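/- Let $k$ be a field of characteristic zero, $\mathfrak g$ a Lie algebra over $k$ (of any dimension), and $\mathcal U=\mathcal U(\mathfrak g)$ its universal enveloping algebra with its usual Hopf algebra structure ($\Delta(x)=x\otimes 1+1\otimes x$, $\varepsilon(x)=0$, $S(x)=-x$ for $x\in\mathfrak g$). Let $C=C(\mathcal U)$ be the Connes–Moscovici cocyclic module with trivial coefficients: $C^n=\mathcal U^{\otimes n}$; $\delta_0$ and $\delta_{n+1}$ insert $1$ on the left and on the right, $\delta_i$ ($1\le i\le n$) applies $\Delta$ to the $i$-th factor; $\sigma_i$ applies $\varepsilon$ to the $(i+1)$-st factor; $\tau_n(h_1\otimes\cdots\otimes h_n)=S(h_1)\cdot(h_2\otimes\cdots\otimes h_n\otimes 1)$ with the diagonal action. Let $b=\sum_i(-1)^i\delta_i$, let $B$ be Connes' operator $N\sigma_{-1}(1-\lambda)$ with $\lambda=(-1)^n\tau_n$, $\sigma_{-1}=\sigma_n\tau_{n+1}$, $N=\sum_i\lambda^i$, and let $HP^*(\mathcal U)$, $*\in\mathbb Z/2$, be the cohomology of the supercomplex $\bigoplus_n \overline C^{\,2n}\rightleftarrows\bigoplus_n\overline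 C^{\,2n+1}$ of normalized cochains (those annihilated by all $\sigma_i$) with differential $b+B$. The tensor product $C\otimes C$, with $(C\otimes C)^n=\bigoplus_{i+j=n}C^i\otimes C^j$ and its normalized cochains $\bigoplus_{i+j=n}\overline C^{\,i}\otimes\overline C^{\,j}$, carries the differential $(b+B)\otimes 1+(-1)^{i}\,1\otimes(b+B)$ on $C^i\otimes C^j$. Let $\cup'=\widetilde{Sh}\circ\Omega\circ\Delta^{\otimes n}$, where $\Omega:(\mathcal U\otimes\mathcal U)^{\otimes n}\to\mathcal U^{\otimes n}\otimes\mathcal U^{\otimes n}$ separates the factors and $\widetilde{Sh}=sh+sh'$ is the sum of the shuffle map and the cyclic shuffle map. With $s_m:=\sigma_{m-1}$ in the products, these have the components $$sh_{i,j}=\sum_{\sigma}\mathrm{sgn}(\sigma)\,s_{\sigma(i+1)}\cdots s_{\sigma(n)}\otimes s_{\sigma(1)}\cdots s_{\sigma(i)}:C^n\otimes C^n\to C^i\otimes C^j\qquad(i+j=n),$$ $$sh'_{i,j}=\sum_{\sigma,p,q}(-1)^{i-1}(-1)^{p(i-1)+q(j-1)}\mathrm{sgn}(\sigma)\,\sigma_{i-p-1}\tau_i^{p+1}s_{\sigma(i+1)}\cdots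 s_{\sigma(n)}\otimes\sigma_{j-q-1}\tau_j^{q+1}s_{\sigma(1)}\cdots s_{\sigma(i)}:C^n\otimes C^n\to C^{i-1}\otimes C^{j-1}$$ ($i+j=n$, $i,j\ge1$), with $\sigma$ running over the $(i,j)$-shuffles and, in $sh'_{i,j}$, over all $0\le p<i$, $0\le q<j$ with $\sigma(p+1)<\sigma(i+q+1)$. Let $H_*(\mathfrak g,k)$ be the homology of $(\Lambda^*\mathfrak g,d)$, $d(g_1\wedge\cdots\wedge g_n)=\sum_{i<j}(-1)^{i+j+1}[g_i,g_j]\wedge g_1\wedge\cdots\widehat{g_i}\cdots\widehat{g_j}\cdots\wedge g_n$; let $\cup_{Lie}:\Lambda^n\mathfrak g\to\bigoplus_{p+q=n}\Lambda^p\mathfrak g\otimes\Lambda^q\mathfrak g$ be the sum over all $(p,q)$-shuffles $\sigma$ of $\mathrm{sgn}(\sigma)(g_{\sigma(1)}\wedge\cdots\wedge g_{\sigma(p)})\otimes(g_{\sigma(p+1)}\wedge\cdots\wedge g_{\sigma(n)})$, and let $A(g_1\wedge\cdots\wedge g_n)=\frac1{n!}\sum_{\sigma\in S_n}\mathrm{sgn}(\sigma)\,g_{\sigma(1)}\otimes\cdots\otimes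 g_{\sigma(n)}\in\mathcal U^{\otimes n}$ and $\mathbb A=A\otimes A$. Then: 1. The Künneth maps $\bigoplus_{i+j=n}HP^i(\mathcal U)\otimes HP^j(\mathcal U)\to HP^n(C\otimes C)$ ($n\in\mathbb Z/2$) and $\bigoplus_{p+q=n}H_p(\mathfrak g,k)\otimes H_q(\mathfrak g,k)\to H_n(\Lambda^*\mathfrak g\otimes\Lambda^*\mathfrak g)$ ($n\ge 0$), $[x]\otimes[y]\mapsto[x\otimes y]$, are isomorphisms. The map $\cup'$ induces a map in periodic cyclic cohomology, and hence a coproduct $\sqcup:HP^n(\mathcal U)\to\bigoplus_{i+j=n}HP^i(\mathcal U)\otimes HP^j(\mathcal U)$; the map $\cup_{Lie}$ induces a coproduct $\sqcup_{Lie}:H_n(\mathfrak g,k)\to\bigoplus_{p+q=n}H_p(\mathfrak g,k)\otimes H_q(\mathfrak g,k)$. 2. Antisymmetrization $A$ induces an isomorphism $\alpha:\bigoplus_{m\ge0}H_{2m+*}(\mathfrak g,k)\cong HP^*(\mathcal U)$, $*=0,1$, and under it the two coproducts coincide: $\sqcup\circ\alpha=(\alpha\otimes\alpha)\circ\sqcup_{Lie}$.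 3. On the level of complexes, for every $n$ and every $x\in\Lambda^n\mathfrak g$ the element $\cup'(A x)-\mathbb A(\cup_{Lie}x)$ is the boundary of a normalized cochain of $C\otimes C$ of parity $n+1$. -/

import Mathlib

open scoped TensorProduct DirectSum

noncomputable section

/-! ### The Hopf algebra structure of a universal enveloping algebra -/

namespace UniversalEnvelopingAlgebra

attribute [local instance] LieRing.ofAssociativeRing

variable (k : Type*) (g : Type*) [CommRing k] [LieRing g] [LieAlgebra k g]

/-- The coproduct of `U(g)`: the algebra map with `x ↦ x ⊗ 1 + 1 ⊗ x` for `x` in `g`. -/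
def comulAlgHom : UniversalEnvelopingAlgebra k g →ₐ[k]
    UniversalEnvelopingAlgebra k g ⊗[k] UniversalEnvelopingAlgebra k g :=
  lift k
    { toLinearMap :=
        ((TensorProduct.mk k _ _).flip 1 + TensorProduct.mk k _ _ 1) ∘ₗ (ι k : g →ₗ⁅k⁆ _).toLinearMap
      map_lie' := by
        intro x y
        simp [LieRing.of_associative_ring_bracket, add_mul, mul_add,
          TensorProduct.tmul_sub, -ι_apply]
        abel }

/-- The counit of `U(g)`: the algebra map with `x ↦ 0` for `x` in `g`. -/
def counitAlgHom : UniversalEnvelopingAlgebra k g →ₐ[k] k := lift k 0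

/-- The algebra map `U(g) → U(g)ᵒᵖ` with `x ↦ -x` for `x` in `g`. -/
def antipodeAlgHom : UniversalEnvelopingAlgebra k g →ₐ[k] (UniversalEnvelopingAlgebra k g)ᵐᵒᵖ :=
  lift k
    { toLinearMap :=
        -((MulOpposite.opLinearEquiv k).toLinearMap ∘ₗ (ι k : g →ₗ⁅k⁆ _).toLinearMap)
      map_lie' := by
        intro x y
        simp [LieRing.of_associative_ring_bracket] }

/-- The antipode of `U(g)`: the algebra antihomomorphism with `x ↦ -x` for `x` in `g`. -/
def antipodeLin : UniversalEnvelopingAlgebra k g →ₗ[k] UniversalEnvelopingAlgebra k g :=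
  (MulOpposite.opLinearEquiv k).symm.toLinearMap ∘ₗ (antipodeAlgHom k g).toLinearMap

variable {k g}

theorem comulAlgHom_ι (x : g) : comulAlgHom k g (ι k x) = ι k x ⊗ₜ[k] 1 + 1 ⊗ₜ[k] ι k x := by
  rw [comulAlgHom, lift_ι_apply]; rfl

theorem counitAlgHom_ι (x : g) : counitAlgHom k g (ι k x) = 0 := by
  rw [counitAlgHom, lift_ι_apply]; simp

theorem antipodeLin_ι (x : g) : antipodeLin k g (ι k x) = -ι k x := by
  have : antipodeAlgHom k g (ι k x) = -MulOpposite.op (ι k x) := by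
    rw [antipodeAlgHom, lift_ι_apply]; rfl
  simp [antipodeLin, this, -ι_apply]

theorem antipodeLin_one : antipodeLin k g 1 = 1 := by simp [antipodeLin]

theorem antipodeLin_mul (u v : UniversalEnvelopingAlgebra k g) :
    antipodeLin k g (u * v) = antipodeLin k g v * antipodeLin k g u := by simp [antipodeLin]

theorem induction_on {P : UniversalEnvelopingAlgebra k g → Prop}
    (hc : ∀ c : k, P (algebraMap k _ c)) (hι : ∀ x : g, P (ι k x))
    (hm : ∀ u v, P u → P v → P (u * v)) (ha : ∀ u v, P u → P v → P (u + v))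
    (u : UniversalEnvelopingAlgebra k g) : P u := by
  obtain ⟨t, rfl⟩ : ∃ t, mkAlgHom k g t = u := by
    obtain ⟨t, ht⟩ := Quotient.exists_rep u
    exact ⟨t, ht⟩
  induction t using TensorAlgebra.induction with
  | algebraMap r => simpa using hc r
  | ι x => exact hι x
  | mul a b h1 h2 => simpa using hm _ _ h1 h2
  | add a b h1 h2 => simpa using ha _ _ h1 h2

theorem algHom_ext_ι {A : Type*} [Ring A] [Algebra k A]
    {f f' : UniversalEnvelopingAlgebra k g →ₐ[k] A} (h : ∀ x : g, f (ι k x) = f' (ι k x)) :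
    f = f' :=
  hom_ext k (LieHom.ext h)

instance instBialgebra : Bialgebra k (UniversalEnvelopingAlgebra k g) :=
  Bialgebra.ofAlgHom (comulAlgHom k g) (counitAlgHom k g)
    (by
      ext x
      simp [comulAlgHom_ι, TensorProduct.add_tmul, TensorProduct.tmul_add,
        Algebra.TensorProduct.one_def, add_assoc, -ι_apply])
    (by
      refine algHom_ext_ι fun x => ?_
      simp [comulAlgHom_ι, counitAlgHom_ι, -ι_apply])
    (by
      refine algHom_ext_ι fun x => ?_
      simp [comulAlgHom_ι, counitAlgHom_ι, -ι_apply])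

theorem comul_eq (u : UniversalEnvelopingAlgebra k g) :
    Coalgebra.comul (R := k) u = comulAlgHom k g u := rfl

theorem counit_eq (u : UniversalEnvelopingAlgebra k g) :
    Coalgebra.counit (R := k) u = counitAlgHom k g u := rfl

theorem antipode_left_mul (w t : UniversalEnvelopingAlgebra k g ⊗[k] UniversalEnvelopingAlgebra k g)
    (c : k) (h : LinearMap.mul' k _ ((antipodeLin k g).rTensor _ w) = algebraMap k _ c) :
    LinearMap.mul' k _ ((antipodeLin k g).rTensor _ (w * t)) =
      algebraMap k _ c * LinearMap.mul' k _ ((antipodeLin k g).rTensor _ t) := by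
  induction t using TensorProduct.induction_on with
  | zero => simp
  | add a b ha hb => simp [mul_add, ha, hb]
  | tmul a b =>
    have key : LinearMap.mul' k _ ((antipodeLin k g).rTensor _ (w * a ⊗ₜ[k] b)) =
        antipodeLin k g a * LinearMap.mul' k _ ((antipodeLin k g).rTensor _ w) * b := by
      clear h
      induction w using TensorProduct.induction_on with
      | zero => simp
      | add p q hp hq => simp [mul_add, add_mul, hp, hq]
      | tmul p q => simp [antipodeLin_mul, mul_assoc]
    rw [key, h, ← Algebra.commutes]
    simp [mul_assoc]

theorem antipode_right_mul (t w : UniversalEnvelopingAlgebra k g ⊗[k] UniversalEnvelopingAlgebra k g)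
    (c : k) (h : LinearMap.mul' k _ ((antipodeLin k g).lTensor _ w) = algebraMap k _ c) :
    LinearMap.mul' k _ ((antipodeLin k g).lTensor _ (t * w)) =
      algebraMap k _ c * LinearMap.mul' k _ ((antipodeLin k g).lTensor _ t) := by
  induction t using TensorProduct.induction_on with
  | zero => simp
  | add a b ha hb => simp [mul_add, add_mul, ha, hb]
  | tmul a b =>
    have key : LinearMap.mul' k _ ((antipodeLin k g).lTensor _ (a ⊗ₜ[k] b * w)) =
        a * LinearMap.mul' k _ ((antipodeLin k g).lTensor _ w) * antipodeLin k g b := by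
      clear h
      induction w using TensorProduct.induction_on with
      | zero => simp
      | add p q hp hq => simp [mul_add, add_mul, hp, hq]
      | tmul p q => simp [antipodeLin_mul, mul_assoc]
    rw [key, h, ← Algebra.commutes]
    simp [mul_assoc]

instance instHopfAlgebra : HopfAlgebra k (UniversalEnvelopingAlgebra k g) where
  antipode := antipodeLin k g
  mul_antipode_rTensor_comul := by
    refine LinearMap.ext fun u => ?_
    change LinearMap.mul' k _ ((antipodeLin k g).rTensor _ (comulAlgHom k g u)) =
      algebraMap k _ (counitAlgHom k g u)
    induction u using induction_on with
    | hc c => simp [Algebra.TensorProduct.one_def, antipodeLin_one, Algebra.algebraMap_eq_smul_one]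
    | hι x => simp [comulAlgHom_ι, counitAlgHom_ι, antipodeLin_ι, antipodeLin_one, -ι_apply]
    | hm u v hu hv => rw [map_mul, antipode_left_mul _ _ _ hu, hv, map_mul, map_mul]
    | ha u v hu hv => simp [hu, hv]
  mul_antipode_lTensor_comul := by
    refine LinearMap.ext fun u => ?_
    change LinearMap.mul' k _ ((antipodeLin k g).lTensor _ (comulAlgHom k g u)) =
      algebraMap k _ (counitAlgHom k g u)
    induction u using induction_on with
    | hc c => simp [Algebra.TensorProduct.one_def, antipodeLin_one, Algebra.algebraMap_eq_smul_one]
    | hι x => simp [comulAlgHom_ι, counitAlgHom_ι, antipodeLin_ι, antipodeLin_one, -ι_apply]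
    | hm u v hu hv =>
      rw [map_mul, antipode_right_mul _ _ _ hv, hu, map_mul, map_mul, Algebra.commutes]
    | ha u v hu hv => simp [hu, hv]

end UniversalEnvelopingAlgebra

namespace HopfCyclic

universe u v w

/-! ### Graded complexes, their homology, tensor products and the Künneth map -/

/-- A module `V` with an endomorphism `d` and a family of submodules `part i`, the elements of
degree `i`.  The index type is `ℕ` for chain complexes (`d` lowers the degree by one) and `ZMod 2`
for supercomplexes.  In both cases the boundaries of degree `i` are the images of the elements of
degree `i + 1`.  Elements of `V` outside of the parts `part i` play no role, so that for example
the normalized subcomplex of a complex is given by smaller parts of the same `V`. -/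
structure GradedComplex (k : Type u) [CommRing k] (ι : Type v) where
  V : Type w
  [addCommGroup : AddCommGroup V]
  [module : Module k V]
  d : V →ₗ[k] V
  part : ι → Submodule k V

attribute [instance] GradedComplex.addCommGroup GradedComplex.module

/-- A graded complex with its grading operator, which is `± 1` in each degree. -/
structure SignedComplex (k : Type u) [CommRing k] (ι : Type v) extends
    GradedComplex.{u, v, w} k ι where
  ε : V →ₗ[k] V
  sgn : ι → ℤˣ
  ε_apply : ∀ i, ∀ x ∈ part i, ε x = sgn i • x

section complexes

variable {k : Type u} [CommRing k] {ι : Type v}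

namespace GradedComplex

variable (X : GradedComplex.{u, v, w} k ι)

/-- The cycles of degree `i`. -/
def cycles (i : ι) : Submodule k X.V := X.part i ⊓ LinearMap.ker X.d

/-- The homology in degree `i`: cycles of degree `i` modulo images of elements of
degree `i + 1`. -/
abbrev H [Add ι] [One ι] (i : ι) : Type w :=
  X.cycles i ⧸ ((X.part (i + 1)).map X.d).submoduleOf (X.cycles i)

/-- The homology class of a cycle. -/
abbrev cls [Add ι] [One ι] (i : ι) : X.cycles i →ₗ[k] X.H i := Submodule.mkQ _

/-- The identification of the homology groups of equal degrees. -/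
def congrH [Add ι] [One ι] {i j : ι} (h : i = j) : X.H i ≃ₗ[k] X.H j :=
  h ▸ LinearEquiv.refl k (X.H i)

variable {X} in
/-- The linear map `φ` on homology is induced by the linear map `f` of complexes: `f` maps every
cycle `z` to a cycle and `φ [z] = [f z]`. -/
def Induces {κ : Type*} [Add ι] [One ι] [Add κ] [One κ] {Y : GradedComplex k κ}
    (f : X.V →ₗ[k] Y.V) {i : ι} {j : κ} (φ : X.H i →ₗ[k] Y.H j) : Prop :=
  ∀ z : X.cycles i, ∃ h : f z ∈ Y.cycles j, φ (X.cls i z) = Y.cls j ⟨f z, h⟩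

end GradedComplex

namespace SignedComplex

variable (X : SignedComplex.{u, v, w} k ι) (Y : GradedComplex.{u, v, w} k ι)

/-- The tensor product of complexes, with `d (x ⊗ y) = d x ⊗ y + (-1)^{|x|} x ⊗ d y`, and with
the sum of all `X_i ⊗ Y_j`, `i + j = n`, in degree `n`. -/
abbrev tensor [Add ι] : GradedComplex.{u, v, w} k ι where
  V := X.V ⊗[k] Y.V
  d := TensorProduct.map X.d LinearMap.id + TensorProduct.map X.ε Y.d
  part n := ⨆ (ij : ι × ι) (_ : ij.1 + ij.2 = n),
    LinearMap.range (TensorProduct.mapIncl (X.part ij.1) (Y.part ij.2))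

/-- The direct sum of all `H_i(X) ⊗ H_j(Y)` with `i + j = n`. -/
abbrev HTensor [Add ι] [One ι] (n : ι) : Type (max v w) :=
  ⨁ ij : {ij : ι × ι // ij.1 + ij.2 = n}, X.H ij.1.1 ⊗[k] Y.H ij.1.2

variable {X Y}

theorem tmul_mem_part [Add ι] {i j n : ι} (h : i + j = n) {x : X.V} {y : Y.V}
    (hx : x ∈ X.part i) (hy : y ∈ Y.part j) : x ⊗ₜ[k] y ∈ (X.tensor Y).part n :=
  Submodule.mem_iSup_of_mem (i, j) (Submodule.mem_iSup_of_mem h ⟨⟨x, hx⟩ ⊗ₜ ⟨y, hy⟩, rfl⟩)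

theorem tensor_d_tmul [Add ι] {i : ι} {x : X.V} (hx : x ∈ X.part i) (y : Y.V) :
    (X.tensor Y).d (x ⊗ₜ[k] y) = X.d x ⊗ₜ[k] y + (X.sgn i • x) ⊗ₜ[k] Y.d y := by
  change X.d x ⊗ₜ[k] y + X.ε x ⊗ₜ[k] Y.d y = _
  rw [X.ε_apply i x hx]

theorem tmul_mem_cycles [Add ι] {i j n : ι} (h : i + j = n) {x : X.V} {y : Y.V}
    (hx : x ∈ X.cycles i) (hy : y ∈ Y.cycles j) : x ⊗ₜ[k] y ∈ (X.tensor Y).cycles n := by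
  refine ⟨tmul_mem_part h hx.1 hy.1, ?_⟩
  have h1 : X.d x = 0 := hx.2
  have h2 : Y.d y = 0 := hy.2
  change (X.tensor Y).d (x ⊗ₜ[k] y) = 0
  rw [tensor_d_tmul hx.1, h1, h2, TensorProduct.zero_tmul,
    TensorProduct.tmul_zero, add_zero]

/-- The class of a product of cycles, as a bilinear map. -/
def clsTmul [Add ι] [One ι] {i j n : ι} (h : i + j = n) :
    X.cycles i →ₗ[k] Y.cycles j →ₗ[k] (X.tensor Y).H n :=
  LinearMap.mk₂ k (fun x y => (X.tensor Y).cls n ⟨x.1 ⊗ₜ y.1, tmul_mem_cycles h x.2 y.2⟩)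
    (fun x x' y => by
      rw [← map_add]; exact congrArg _ (Subtype.ext (TensorProduct.add_tmul _ _ _)))
    (fun c x y => by
      rw [← map_smul]; exact congrArg _ (Subtype.ext (TensorProduct.smul_tmul' _ _ _)))
    (fun x y y' => by
      rw [← map_add]; exact congrArg _ (Subtype.ext (TensorProduct.tmul_add _ _ _)))
    (fun c x y => by
      rw [← map_smul]; exact congrArg _ (Subtype.ext (TensorProduct.tmul_smul _ _ _)))

theorem clsTmul_boundary_right [AddCommMonoid ι] [One ι] {i j n : ι} (h : i + j = n)
    (x : X.cycles i) {y : Y.V} (hy : y ∈ Y.part (j + 1)) (hd : Y.d y ∈ Y.cycles j) :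
    clsTmul h x ⟨Y.d y, hd⟩ = (0 : (X.tensor Y).H n) := by
  have hs : X.sgn i • x.1 ∈ X.part i := (X.part i).smul_of_tower_mem (X.sgn i) x.2.1
  refine (Submodule.Quotient.mk_eq_zero _).2 ⟨(X.sgn i • x.1) ⊗ₜ[k] y, ?_, ?_⟩
  · exact tmul_mem_part (by rw [← add_assoc, h]) hs hy
  · have h1 : X.d x = 0 := x.2.2
    have h2 : X.d (X.sgn i • x.1) = 0 := by
      rcases Int.units_eq_one_or (X.sgn i) with hs | hs <;> simp [hs, h1]
    rw [tensor_d_tmul hs, h2, smul_smul, Int.units_mul_self, one_smul, TensorProduct.zero_tmul,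
      zero_add]
    rfl

theorem clsTmul_boundary_left [AddCommMonoid ι] [One ι] {i j n : ι} (h : i + j = n)
    {x : X.V} (hx : x ∈ X.part (i + 1)) (hd : X.d x ∈ X.cycles i) (y : Y.cycles j) :
    clsTmul h ⟨X.d x, hd⟩ y = (0 : (X.tensor Y).H n) := by
  refine (Submodule.Quotient.mk_eq_zero _).2 ⟨x ⊗ₜ[k] y.1, ?_, ?_⟩
  · exact tmul_mem_part (by rw [add_right_comm, h]) hx y.2.1
  · have h1 : Y.d y = 0 := y.2.2
    rw [tensor_d_tmul hx, h1, TensorProduct.tmul_zero, add_zero]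
    rfl

/-- The bilinear map `(x, [y]) ↦ [x ⊗ y]`. -/
def crossRight [AddCommMonoid ι] [One ι] {i j n : ι} (h : i + j = n) :
    X.cycles i →ₗ[k] Y.H j →ₗ[k] (X.tensor Y).H n :=
  LinearMap.flip (Submodule.liftQ _ (clsTmul h).flip (by
    rintro ⟨_, hd⟩ ⟨y, hy, rfl⟩
    exact LinearMap.ext fun x => clsTmul_boundary_right h x hy hd))

variable (X Y)

/-- The bilinear map `([x], [y]) ↦ [x ⊗ y]`. -/
def cross [AddCommMonoid ι] [One ι] {i j n : ι} (h : i + j = n) :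
    X.H i →ₗ[k] Y.H j →ₗ[k] (X.tensor Y).H n :=
  Submodule.liftQ _ (crossRight h) (by
    rintro ⟨_, hd⟩ ⟨x, hx, rfl⟩
    refine LinearMap.ext fun y => ?_
    obtain ⟨y, rfl⟩ := Submodule.mkQ_surjective _ y
    exact clsTmul_boundary_left h hx hd y)

/-- The Künneth map `⨁_{i + j = n} H_i(X) ⊗ H_j(Y) → H_n(X ⊗ Y)`, `[x] ⊗ [y] ↦ [x ⊗ y]`. -/
def kunneth [AddCommMonoid ι] [One ι] [DecidableEq ι] (n : ι) : X.HTensor Y n →ₗ[k] (X.tensor Y).H n :=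
  DirectSum.toModule k _ _ fun ij => TensorProduct.lift (X.cross Y ij.2)

end SignedComplex

end complexes

/-! ### The periodic complex of a cocyclic module -/

/-- The sign operator `(-1)^n` on degree `n` of a direct sum. -/
def gradeSign (k : Type u) [CommRing k] (X : ℕ → Type w) [∀ n, AddCommGroup (X n)]
    [∀ n, Module k (X n)] : (⨁ n, X n) →ₗ[k] ⨁ n, X n :=
  DirectSum.toModule k ℕ _ fun n => (-1 : k) ^ n • DirectSum.lof k ℕ X n

theorem gradeSign_lof (k : Type u) [CommRing k] (X : ℕ → Type w) [∀ n, AddCommGroup (X n)]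
    [∀ n, Module k (X n)] (n : ℕ) (x : X n) :
    gradeSign k X (DirectSum.lof k ℕ X n x) = ((-1 : ℤˣ) ^ n) • DirectSum.lof k ℕ X n x := by
  rw [gradeSign, DirectSum.toModule_lof]
  rcases Nat.even_or_odd n with h | h <;> simp [h.neg_one_pow]

/-- The modules and operators of a cocyclic module: cofaces `δ_i : X^n → X^{n+1}`,
`0 ≤ i ≤ n + 1`, codegeneracies `σ_i : X^{n+1} → X^n`, `0 ≤ i ≤ n`, and cyclic operators `τ_n`. -/
structure CocyclicOperators (k : Type u) [CommRing k] where
  X : ℕ → Type w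
  [addCommGroup : ∀ n, AddCommGroup (X n)]
  [module : ∀ n, Module k (X n)]
  δ : ∀ n, Fin (n + 2) → X n →ₗ[k] X (n + 1)
  σ : ∀ n, Fin (n + 1) → X (n + 1) →ₗ[k] X n
  τ : ∀ n, X n →ₗ[k] X n

attribute [instance] CocyclicOperators.addCommGroup CocyclicOperators.module

namespace CocyclicOperators

variable {k : Type u} [CommRing k] (C C' : CocyclicOperators.{u, w} k)

/-- The diagonal `C × C'`, with `(C × C')^n = C^n ⊗ C'^n`. -/
abbrev diagonal : CocyclicOperators.{u, w} k where
  X n := C.X n ⊗[k] C'.X n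
  δ n i := TensorProduct.map (C.δ n i) (C'.δ n i)
  σ n i := TensorProduct.map (C.σ n i) (C'.σ n i)
  τ n := TensorProduct.map (C.τ n) (C'.τ n)

/-- The direct sum of all `C^n`. -/
abbrev Tot : Type w := ⨁ n, C.X n

/-- The Hochschild differential `b = ∑ (-1)^i δ_i`. -/
def b (n : ℕ) : C.X n →ₗ[k] C.X (n + 1) := ∑ i : Fin (n + 2), (-1 : k) ^ (i : ℕ) • C.δ n i

/-- The signed cyclic operator `λ_n = (-1)^n τ_n`. -/
def lam (n : ℕ) : C.X n →ₗ[k] C.X n := (-1 : k) ^ n • C.τ n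

/-- Connes' differential `B = N σ_{-1} (1 - λ) : C^{n+1} → C^n`, where `σ_{-1} = σ_n τ_{n+1}` is
the extra codegeneracy and `N = ∑_{i=0}^n λ_n^i`. -/
def B (n : ℕ) : C.X (n + 1) →ₗ[k] C.X n :=
  (∑ i ∈ Finset.range (n + 1), C.lam n ^ i) ∘ₗ
    (C.σ n (Fin.last n) ∘ₗ C.τ (n + 1)) ∘ₗ (LinearMap.id - C.lam (n + 1))

/-- The normalized cochains: those annihilated by all codegeneracies. -/
def normalized : ∀ n, Submodule k (C.X n)
  | 0 => ⊤
  | n + 1 => ⨅ i, LinearMap.ker (C.σ n i)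

/-- The differential `b + B` on the direct sum of all `C^n`. -/
def dTot : C.Tot →ₗ[k] C.Tot :=
  DirectSum.toModule k ℕ _ fun n =>
    DirectSum.lof k ℕ C.X (n + 1) ∘ₗ C.b n +
      match n with
      | 0 => 0
      | m + 1 => DirectSum.lof k ℕ C.X m ∘ₗ C.B m

/-- The periodic complex of `C`: the supercomplex of normalized cochains
`⨁ C^{2n} ⇄ ⨁ C^{2n+1}` with differential `b + B`. -/
def periodic : SignedComplex.{u, 0, w} k (ZMod 2) where
  V := C.Tot
  d := C.dTot
  part i := ⨆ (n : ℕ) (_ : (n : ZMod 2) = i), (C.normalized n).map (DirectSum.lof k ℕ C.X n)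
  ε := gradeSign k C.X
  sgn i := (-1) ^ i.val
  ε_apply i x hx := by
    induction hx using Submodule.iSup_induction' with
    | zero => simp
    | add x y _ _ hx hy => rw [map_add, hx, hy, smul_add]
    | mem n x hx =>
      by_cases h : (n : ZMod 2) = i
      · rw [iSup_pos h] at hx
        obtain ⟨y, -, rfl⟩ := hx
        rw [gradeSign_lof, ← h, ZMod.val_natCast, Int.units_pow_eq_pow_mod_two]
      · rw [iSup_neg h] at hx
        simp [(Submodule.mem_bot k).1 hx]

/-- Periodic cyclic cohomology `HP^i`, `i = 0, 1`. -/
abbrev HP (i : ZMod 2) : Type w := C.periodic.H i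

/-- The codegeneracies `s_i` as operators on the direct sum of all `C^n`. -/
def sTot (i : ℕ) : Module.End k C.Tot :=
  DirectSum.toModule k ℕ _ fun n =>
    match n with
    | 0 => 0
    | m + 1 => if h : i < m + 1 then DirectSum.lof k ℕ C.X m ∘ₗ C.σ m ⟨i, h⟩ else 0

/-- The cyclic operators `τ` as an operator on the direct sum of all `C^n`. -/
def τTot : Module.End k C.Tot :=
  DirectSum.toModule k ℕ _ fun n => DirectSum.lof k ℕ C.X n ∘ₗ C.τ n

end CocyclicOperators

/-! ### The shuffle map and the cyclic shuffle map -/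

/-- The `(i, n - i)`-shuffles: permutations `σ` with `σ(1) < ⋯ < σ(i)` and `σ(i+1) < ⋯ < σ(n)`.
(Everything is numbered from zero here.) -/
def shuffles (n i : ℕ) : Finset (Equiv.Perm (Fin n)) :=
  Finset.univ.filter fun σ =>
    (∀ a b : Fin n, a < b → (b : ℕ) < i → σ a < σ b) ∧
      ∀ a b : Fin n, a < b → i ≤ (a : ℕ) → σ a < σ b

namespace CocyclicOperators

variable {k : Type u} [CommRing k] (C C' : CocyclicOperators.{u, w} k)

/-- The operator `s_{σ(i+1)} ⋯ s_{σ(n)}`. -/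
def sLast {n : ℕ} (i : ℕ) (σ : Equiv.Perm (Fin n)) : Module.End k C.Tot :=
  (((List.finRange n).drop i).map fun a => C.sTot (σ a)).prod

/-- The operator `s_{σ(1)} ⋯ s_{σ(i)}`. -/
def sFirst {n : ℕ} (i : ℕ) (σ : Equiv.Perm (Fin n)) : Module.End k C.Tot :=
  (((List.finRange n).take i).map fun a => C.sTot (σ a)).prod

/-- The shuffle map `sh` on `(C × C')^n`, with components in all `C^i ⊗ C'^{n-i}`. -/
def sh (n : ℕ) : (C.diagonal C').X n →ₗ[k] C.Tot ⊗[k] C'.Tot :=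
  (∑ i ∈ Finset.range (n + 1), ∑ σ ∈ shuffles n i,
    (Equiv.Perm.sign σ : ℤ) • TensorProduct.map (C.sLast i σ) (C'.sFirst i σ)) ∘ₗ
  TensorProduct.map (DirectSum.lof k ℕ C.X n) (DirectSum.lof k ℕ C'.X n)

/-- The cyclic shuffle map `sh'` on `(C × C')^n`, with components in all `C^{i-1} ⊗ C'^{j-1}` with
`i + j = n` and `i, j ≥ 1`.  An `(i, j)`-cyclic shuffle is a `p`-fold cyclic permutation of the
first `i` and a `q`-fold cyclic permutation of the last `j` letters, `0 ≤ p < i`, `0 ≤ q < j`,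
followed by an `(i, j)`-shuffle `σ`, such that the letter `1`, which ends up in position
`σ(p + 1)`, is before the letter `i + 1`, which ends up in position `σ(i + q + 1)`.
The sign of such a cyclic shuffle is `(-1)^{p(i-1) + q(j-1)} sgn(σ)`; the further sign `(-1)^{i-1}`
is the Koszul sign with which `[B, sh] + [b, sh'] = 0` holds. -/
def sh' (n : ℕ) : (C.diagonal C').X n →ₗ[k] C.Tot ⊗[k] C'.Tot :=
  (∑ i ∈ Finset.Ioo 0 n, ∑ σ ∈ shuffles n i, ∑ p : Fin n, ∑ r : Fin n,
    if (p : ℕ) < i ∧ i ≤ (r : ℕ) ∧ σ p < σ r then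
      ((-1) ^ (i - 1) * (-1) ^ ((p : ℕ) * (i - 1) + ((r : ℕ) - i) * (n - i - 1)) *
          (Equiv.Perm.sign σ : ℤ)) •
        TensorProduct.map
          (C.sTot (i - p - 1) * C.τTot ^ ((p : ℕ) + 1) * C.sLast i σ)
          (C'.sTot ((n - i) - ((r : ℕ) - i) - 1) * C'.τTot ^ ((r : ℕ) - i + 1) * C'.sFirst i σ)
    else 0) ∘ₗ
  TensorProduct.map (DirectSum.lof k ℕ C.X n) (DirectSum.lof k ℕ C'.X n)

/-- The map `sh + sh'` of periodic complexes from `C × C'` to `C ⊗ C'`. -/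
def shTilde : (C.diagonal C').Tot →ₗ[k] C.Tot ⊗[k] C'.Tot :=
  DirectSum.toModule k ℕ _ fun n => C.sh C' n + C.sh' C' n

end CocyclicOperators

/-! ### The Connes–Moscovici cocyclic module of a Hopf algebra -/

section Hopf

open PiTensorProduct Coalgebra

variable (k : Type u) (A : Type w) [CommRing k] [Ring A] [HopfAlgebra k A]

/-- The tensor power `A^{⊗ n}`. -/
abbrev Pow (n : ℕ) : Type (max u w) := ⨂[k] _ : Fin n, A

/-- Insertion of a tensor factor in position `i`: the bilinear map
`(a, h_1 ⊗ ⋯ ⊗ h_n) ↦ h_1 ⊗ ⋯ ⊗ h_i ⊗ a ⊗ h_{i+1} ⊗ ⋯ ⊗ h_n`. -/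
def insertFactor (n : ℕ) (i : Fin (n + 1)) : A →ₗ[k] Pow k A n →ₗ[k] Pow k A (n + 1) :=
  (PiTensorProduct.lift (R := k) (s := fun _ : Fin n => A) (E := Pow k A (n + 1))).toLinearMap ∘ₗ
    (PiTensorProduct.tprod k (s := fun _ : Fin (n + 1) => A)).curryMid i

/-- Separation of the tensor factor in position `i`: the inverse of `insertFactor`. -/
def splitFactor (n : ℕ) (i : Fin (n + 1)) : Pow k A (n + 1) →ₗ[k] A ⊗[k] Pow k A n :=
  PiTensorProduct.lift (LinearMap.uncurryMid (M := fun _ : Fin (n + 1) => A) i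
    { toFun := fun a => (TensorProduct.mk k A (Pow k A n) a).compMultilinearMap (PiTensorProduct.tprod k)
      map_add' := fun a b => by ext; simp
      map_smul' := fun c a => by ext; simp [TensorProduct.smul_tmul'] })

/-- The iterated coproduct `h ↦ h^(1) ⊗ ⋯ ⊗ h^(n)`, which is the counit for `n = 0`. -/
def iterComul : ∀ n, A →ₗ[k] Pow k A n
  | 0 => (counit (R := k) (A := A)).smulRight 1
  | n + 1 =>
      TensorProduct.lift (insertFactor k A n 0) ∘ₗ
        TensorProduct.map LinearMap.id (iterComul n) ∘ₗ comul

/-- The map `h_1 ⊗ ⋯ ⊗ h_n ↦ h_1 ⊗ ⋯ ⊗ Δ(h_j) ⊗ ⋯ ⊗ h_n`. -/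
def comulFactor : ∀ n, Fin n → Pow k A n →ₗ[k] Pow k A (n + 1)
  | 0, j => j.elim0
  | n + 1, j =>
      TensorProduct.lift (insertFactor k A (n + 1) j.castSucc) ∘ₗ
      TensorProduct.map LinearMap.id (TensorProduct.lift (insertFactor k A n j)) ∘ₗ
      (TensorProduct.assoc k A A (Pow k A n)).toLinearMap ∘ₗ
      TensorProduct.map comul LinearMap.id ∘ₗ splitFactor k A n j

/-- The cofaces: `δ_0 (h_1 ⊗ ⋯ ⊗ h_n) = 1 ⊗ h_1 ⊗ ⋯ ⊗ h_n`, `δ_i` applies the coproduct to `h_i`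
for `1 ≤ i ≤ n`, and `δ_{n+1} (h_1 ⊗ ⋯ ⊗ h_n) = h_1 ⊗ ⋯ ⊗ h_n ⊗ 1`. -/
def coface (n : ℕ) (i : Fin (n + 2)) : Pow k A n →ₗ[k] Pow k A (n + 1) :=
  Fin.cases (insertFactor k A n 0 1)
    (Fin.lastCases (insertFactor k A n (Fin.last n) 1) (comulFactor k A n)) i

/-- The codegeneracies: `σ_i (h_1 ⊗ ⋯ ⊗ h_{n+1}) = ε(h_{i+1}) h_1 ⊗ ⋯ ⊗ ĥ_{i+1} ⊗ ⋯ ⊗ h_{n+1}`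
for `0 ≤ i ≤ n`. -/
def codegeneracy (n : ℕ) (i : Fin (n + 1)) : Pow k A (n + 1) →ₗ[k] Pow k A n :=
  (TensorProduct.lid k (Pow k A n)).toLinearMap ∘ₗ
    TensorProduct.map counit LinearMap.id ∘ₗ splitFactor k A n i

/-- The cyclic operators `τ_n (h_1 ⊗ ⋯ ⊗ h_n) = S(h_1) · (h_2 ⊗ ⋯ ⊗ h_n ⊗ 1)`, where `·` is the
diagonal action, that is multiplication by the iterated coproduct; `τ_0` is the identity. -/
def cyclicOp : ∀ n, Pow k A n →ₗ[k] Pow k A n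
  | 0 => LinearMap.id
  | n + 1 =>
      LinearMap.mul' k (Pow k A (n + 1)) ∘ₗ
        TensorProduct.map (iterComul k A (n + 1) ∘ₗ HopfAlgebra.antipode k)
          (insertFactor k A n (Fin.last n) 1) ∘ₗ
        splitFactor k A n 0

/-- The Connes–Moscovici cocyclic module of a Hopf algebra with trivial coefficients, that is for
the modular pair `(ε, 1)`, with `A^{⊗ n}` in degree `n`. -/
abbrev connesMoscovici : CocyclicOperators.{u, max u w} k where
  X n := Pow k A n
  δ := coface k A
  σ := codegeneracy k A
  τ := cyclicOp k A

/-- The map `Ω : (A ⊗ A)^{⊗ n} → A^{⊗ n} ⊗ A^{⊗ n}`,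
`(h_1 ⊗ k_1) ⊗ ⋯ ⊗ (h_n ⊗ k_n) ↦ (h_1 ⊗ ⋯ ⊗ h_n) ⊗ (k_1 ⊗ ⋯ ⊗ k_n)`, written as the product of the
elements `(1 ⊗ ⋯ ⊗ h_i ⊗ ⋯ ⊗ 1) ⊗ (1 ⊗ ⋯ ⊗ k_i ⊗ ⋯ ⊗ 1)`. -/
def omega (n : ℕ) : Pow k (A ⊗[k] A) n →ₗ[k] Pow k A n ⊗[k] Pow k A n :=
  PiTensorProduct.lift ((MultilinearMap.mkPiAlgebraFin k n (Pow k A n ⊗[k] Pow k A n)).compLinearMap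
    fun i => TensorProduct.map (singleAlgHom (R := k) (A := fun _ : Fin n => A) i).toLinearMap
      (singleAlgHom (R := k) (A := fun _ : Fin n => A) i).toLinearMap)

/-- The map `Ω ∘ Δ^{⊗ n}` from `A^{⊗ n}` to the diagonal. -/
def rho (n : ℕ) : Pow k A n →ₗ[k] Pow k A n ⊗[k] Pow k A n :=
  omega k A n ∘ₗ PiTensorProduct.map fun _ => comul

/-- The map of periodic complexes given by all `Ω ∘ Δ^{⊗ n}`. -/
def rhoTot : (connesMoscovici k A).Tot →ₗ[k]
    ((connesMoscovici k A).diagonal (connesMoscovici k A)).Tot :=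
  DirectSum.toModule k ℕ _ fun n =>
    DirectSum.lof k ℕ (fun n => Pow k A n ⊗[k] Pow k A n) n ∘ₗ rho k A n

/-- The cochain level coproduct `(sh + sh') ∘ Ω ∘ Δ^{⊗ n}`. -/
def cup' : (connesMoscovici k A).Tot →ₗ[k]
    (connesMoscovici k A).Tot ⊗[k] (connesMoscovici k A).Tot :=
  (connesMoscovici k A).shTilde (connesMoscovici k A) ∘ₗ rhoTot k A

end Hopf

/-! ### Lie algebra homology with trivial coefficients -/

section Lie

variable (k : Type u) (g : Type w) [CommRing k] [LieRing g] [LieAlgebra k g]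

/-- The wedge product `x ⊗ ω ↦ x ∧ ω`. -/
def wedge (n : ℕ) : g ⊗[k] ⋀[k]^n g →ₗ[k] ⋀[k]^(n + 1) g :=
  TensorProduct.lift (exteriorPower.alternatingMapLinearEquiv.toLinearMap ∘ₗ
    (exteriorPower.ιMulti k (n + 1)).curryLeft)

/-- The Lie bracket as an alternating map of two variables. -/
def bracketAlt : g [⋀^Fin 2]→ₗ[k] g where
  toFun v := ⁅v 0, v 1⁆
  map_update_add' v i x y := by
    fin_cases i <;> simp
  map_update_smul' v i c x := by
    fin_cases i <;> simp
  map_eq_zero_of_eq' v i j h hij := by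
    fin_cases i <;> fin_cases j <;> simp_all

/-- The Chevalley–Eilenberg differential
`d(g_1 ∧ ⋯ ∧ g_n) = ∑_{i<j} (-1)^{i+j+1} [g_i, g_j] ∧ g_1 ∧ ⋯ ĝ_i ⋯ ĝ_j ⋯ ∧ g_n`.
For `n = m + 2`, this is the sum of all `sgn(σ) [g_{σ(1)}, g_{σ(2)}] ∧ g_{σ(3)} ∧ ⋯ ∧ g_{σ(n)}` over
the `(2, m)`-shuffles `σ`. -/
def lieD : ∀ n, ⋀[k]^(n + 1) g →ₗ[k] ⋀[k]^n g
  | 0 => 0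
  | m + 1 => exteriorPower.alternatingMapLinearEquiv
      ((wedge k g m).compAlternatingMap
        (((bracketAlt k g).domCoprod (exteriorPower.ιMulti k m)).domDomCongr
          (finSumFinEquiv.trans (finCongr (add_comm 2 m)))))

/-- The direct sum of all exterior powers of `g`. -/
abbrev LieTot : Type (max u w) := ⨁ n, ⋀[k]^n g

/-- The Chevalley–Eilenberg differential on the direct sum of all exterior powers. -/
def lieDTot : LieTot k g →ₗ[k] LieTot k g :=
  DirectSum.toModule k ℕ _ fun n =>
    match n with
    | 0 => 0
    | m + 1 => DirectSum.lof k ℕ (fun n => ⋀[k]^n g) m ∘ₗ lieD k g m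

/-- The Chevalley–Eilenberg complex of `g` with trivial coefficients. -/
def lieComplex : SignedComplex.{u, 0, max u w} k ℕ where
  V := LieTot k g
  d := lieDTot k g
  part n := LinearMap.range (DirectSum.lof k ℕ (fun n => ⋀[k]^n g) n)
  ε := gradeSign k (fun n => ⋀[k]^n g)
  sgn n := (-1) ^ n
  ε_apply n x hx := by
    obtain ⟨y, rfl⟩ := hx
    exact gradeSign_lof k (fun n => ⋀[k]^n g) n y

/-- Lie algebra homology `H_n(g, k)` with trivial coefficients. -/
abbrev LieH (n : ℕ) : Type (max u w) := (lieComplex k g).H n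

/-- The component in `⋀^p g ⊗ ⋀^q g` of the coproduct of the Chevalley–Eilenberg complex, for
`p + q = n`: the sum over all `(p, q)`-shuffles `σ` of
`sgn(σ) (g_{σ(1)} ∧ ⋯ ∧ g_{σ(p)}) ⊗ (g_{σ(p+1)} ∧ ⋯ ∧ g_{σ(n)})`. -/
def cupLieComponent {n p q : ℕ} (h : p + q = n) : ⋀[k]^n g →ₗ[k] ⋀[k]^p g ⊗[k] ⋀[k]^q g :=
  exteriorPower.alternatingMapLinearEquiv (R := k) (M := g) (N := ⋀[k]^p g ⊗[k] ⋀[k]^q g)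
    (((exteriorPower.ιMulti k p).domCoprod (exteriorPower.ιMulti k q)).domDomCongr
      (finSumFinEquiv.trans (finCongr h)))

/-- The coproduct of the Chevalley–Eilenberg complex. -/
def cupLie : LieTot k g →ₗ[k] LieTot k g ⊗[k] LieTot k g :=
  DirectSum.toModule k ℕ _ fun n =>
    ∑ pq ∈ (Finset.HasAntidiagonal.antidiagonal n).attach,
      TensorProduct.map (DirectSum.lof k ℕ (fun n => ⋀[k]^n g) pq.1.1)
          (DirectSum.lof k ℕ (fun n => ⋀[k]^n g) pq.1.2) ∘ₗ
        cupLieComponent k g (Finset.HasAntidiagonal.mem_antidiagonal.1 pq.2)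

end Lie

/-! ### Antisymmetrization -/

section Antisymmetrization

variable (k : Type u) (g : Type w) [Field k] [LieRing g] [LieAlgebra k g]

attribute [local instance] LieRing.ofAssociativeRing

/-- The cocyclic module of `U(g)` with trivial coefficients. -/
abbrev CU : CocyclicOperators.{u, max u w} k := connesMoscovici k (UniversalEnvelopingAlgebra k g)

/-- The antisymmetrization map `A_n : ⋀^n g → U(g)^{⊗ n}`,
`g_1 ∧ ⋯ ∧ g_n ↦ (1 / n!) ∑_σ sgn(σ) g_{σ(1)} ⊗ ⋯ ⊗ g_{σ(n)}`. -/
def antisym (n : ℕ) : ⋀[k]^n g →ₗ[k] Pow k (UniversalEnvelopingAlgebra k g) n :=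
  exteriorPower.alternatingMapLinearEquiv ((n.factorial : k)⁻¹ •
    MultilinearMap.alternatization ((PiTensorProduct.tprod k).compLinearMap
      fun _ : Fin n => (UniversalEnvelopingAlgebra.ι k : g →ₗ⁅k⁆ _).toLinearMap))

/-- The antisymmetrization map on the direct sum of all exterior powers. -/
def antisymTot : LieTot k g →ₗ[k] (CU k g).Tot :=
  DirectSum.toModule k ℕ _ fun n =>
    DirectSum.lof k ℕ (fun n => Pow k (UniversalEnvelopingAlgebra k g) n) n ∘ₗ antisym k g n

variable {k g}

/-- The map `⨁_{n ≡ i} H_n(g, k) → HP^i` with components `α_n`. -/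
def sumMap (α : ∀ n : ℕ, LieH k g n →ₗ[k] (CU k g).HP (n : ZMod 2)) (i : ZMod 2) :
    (⨁ n : {n : ℕ // (n : ZMod 2) = i}, LieH k g n) →ₗ[k] (CU k g).HP i :=
  DirectSum.toModule k _ _ fun n => ((CU k g).periodic.congrH n.2).toLinearMap ∘ₗ α n

/-- The map `⨁_{p+q=n} H_p(g, k) ⊗ H_q(g, k) → ⨁_{i+j≡n} HP^i ⊗ HP^j` with components
`α_p ⊗ α_q`. -/
def tensorMap (α : ∀ n : ℕ, LieH k g n →ₗ[k] (CU k g).HP (n : ZMod 2)) (n : ℕ) :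
    (lieComplex k g).HTensor (lieComplex k g).toGradedComplex n →ₗ[k]
      (CU k g).periodic.HTensor (CU k g).periodic.toGradedComplex (n : ZMod 2) :=
  DirectSum.toModule k _ _ fun pq =>
    DirectSum.lof k _ (fun ij : {ij : ZMod 2 × ZMod 2 // ij.1 + ij.2 = (n : ZMod 2)} =>
        (CU k g).HP ij.1.1 ⊗[k] (CU k g).HP ij.1.2)
      ⟨((pq.1.1 : ZMod 2), (pq.1.2 : ZMod 2)), by rw [← Nat.cast_add, pq.2]⟩ ∘ₗ
    TensorProduct.map (α pq.1.1) (α pq.1.2)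

end Antisymmetrization

end HopfCyclic

end

open HopfCyclic

noncomputable section

set_option linter.unusedSimpArgs false
set_option linter.unusedSectionVars false
set_option linter.unnecessarySeqFocus false

open LinearMap (comp_apply)
open DirectSum (lof)
open TensorProduct (map_tmul tmul_zero add_tmul zero_tmul tmul_add)

/-- The cocyclic module of a Hopf algebra. -/
local notation "CM" => connesMoscovici

namespace Word

variable {L M : Type*} [AddCommGroup M]

/-- Sum over the marked letters `w = w₁ c w₂` of a word. -/
def mark : List L → (List L → L → List L → M) → M
  | [], _ => 0
  | c :: w, F => F [] c w + mark w fun u => F (c :: u)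

/-- Signed sum over all ways to distribute the letters of a word into two subwords. -/
def unsh : List L → (List L → List L → M) → M
  | [], F => F [] []
  | c :: w, F => unsh w (fun l r => F (c :: l) r) +
      unsh w (fun l r => (-1 : ℤ) ^ l.length • F l (c :: r))

/-- `unsh` with a marked letter in the right subword. -/
def unshR : List L → (List L → List L → L → List L → M) → M
  | [], _ => 0
  | c :: w, F => unshR w (fun l r b r' => F (c :: l) r b r') +
      unshR w (fun l r b r' => (-1 : ℤ) ^ l.length • F l (c :: r) b r') +
      unsh w (fun l r => (-1 : ℤ) ^ l.length • F l [] c r)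

/-- `unsh` with a marked letter in the left subword. -/
def unshL : List L → (List L → L → List L → List L → M) → M
  | [], _ => 0
  | c :: w, F => unshL w (fun l a l' r => F (c :: l) a l' r) +
      unshL w (fun l a l' r => (-1 : ℤ) • (-1 : ℤ) ^ l.length • (-1 : ℤ) ^ l'.length • F l a l' (c :: r)) +
      unsh w (fun l r => F [] c l r)

/-- `unsh` with a marked letter in the left subword and a later one in the right subword. -/
def unshLR : List L → (List L → L → List L → List L → L → List L → M) → M
  | [], _ => 0
  | c :: w, F => unshLR w (fun l a l' r b r' => F (c :: l) a l' r b r') +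
      unshLR w (fun l a l' r b r' =>
        (-1 : ℤ) • (-1 : ℤ) ^ l.length • (-1 : ℤ) ^ l'.length • F l a l' (c :: r) b r') +
      unshR w (fun l r b r' => F [] c l r b r')

section linearity

theorem mark_add (w : List L) (F G : List L → L → List L → M) :
    mark w (fun u c v => F u c v + G u c v) = mark w F + mark w G := by
  induction w generalizing F G with
  | nil => simp [mark]
  | cons c w ih => simp only [mark, ih]; abel

theorem mark_smul (w : List L) (n : ℤ) (F : List L → L → List L → M) :
    mark w (fun u c v => n • F u c v) = n • mark w F := by
  induction w generalizing F with
  | nil => simp [mark]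
  | cons c w ih => simp only [mark, ih, smul_add]

theorem unsh_add (w : List L) (F G : List L → List L → M) :
    unsh w (fun l r => F l r + G l r) = unsh w F + unsh w G := by
  induction w generalizing F G with
  | nil => simp [unsh]
  | cons c w ih => simp only [unsh, ih, smul_add]; abel

theorem unsh_smul (w : List L) (n : ℤ) (F : List L → List L → M) :
    unsh w (fun l r => n • F l r) = n • unsh w F := by
  induction w generalizing F with
  | nil => simp [unsh]
  | cons c w ih => simp only [unsh, ih, smul_add, smul_comm _ n]

theorem unshR_add (w : List L) (F G : List L → List L → L → List L → M) :
    unshR w (fun l r b r' => F l r b r' + G l r b r') = unshR w F + unshR w G := by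
  induction w generalizing F G with
  | nil => simp [unshR]
  | cons c w ih => simp only [unshR, ih, smul_add, unsh_add]; abel

theorem unshR_smul (w : List L) (n : ℤ) (F : List L → List L → L → List L → M) :
    unshR w (fun l r b r' => n • F l r b r') = n • unshR w F := by
  induction w generalizing F with
  | nil => simp [unshR]
  | cons c w ih => simp only [unshR, ih, smul_add, smul_comm _ n, unsh_smul]

theorem unshL_smul (w : List L) (n : ℤ) (F : List L → L → List L → List L → M) :
    unshL w (fun l r b r' => n • F l r b r') = n • unshL w F := by
  induction w generalizing F with
  | nil => simp [unshL]
  | cons c w ih => simp only [unshL, ih, smul_add, smul_comm _ n, unsh_smul]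

theorem unshLR_add (w : List L) (F G : List L → L → List L → List L → L → List L → M) :
    unshLR w (fun l a l' r b r' => F l a l' r b r' + G l a l' r b r') =
      unshLR w F + unshLR w G := by
  induction w generalizing F G with
  | nil => simp [unshLR]
  | cons c w ih => simp only [unshLR, ih, smul_add, unshR_add]; abel

theorem unshLR_smul (w : List L) (n : ℤ) (F : List L → L → List L → List L → L → List L → M) :
    unshLR w (fun l a l' r b r' => n • F l a l' r b r') = n • unshLR w F := by
  induction w generalizing F with
  | nil => simp [unshLR]
  | cons c w ih => simp only [unshLR, ih, smul_add, smul_comm _ n, unshR_smul]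

theorem mark_zero (w : List L) : mark w (fun _ _ _ => (0 : M)) = 0 := by
  simpa using mark_smul w 0 fun _ _ _ => (0 : M)

theorem unsh_zero (w : List L) : unsh w (fun _ _ => (0 : M)) = 0 := by
  simpa using unsh_smul w 0 fun _ _ => (0 : M)

theorem unshR_zero (w : List L) : unshR w (fun _ _ _ _ => (0 : M)) = 0 := by
  simpa using unshR_smul w 0 fun _ _ _ _ => (0 : M)

theorem unshLR_zero (w : List L) : unshLR w (fun _ _ _ _ _ _ => (0 : M)) = 0 := by
  simpa using unshLR_smul w 0 fun _ _ _ _ _ _ => (0 : M)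

end linearity

section duplication

variable (dup : L → List (L × L))

/-- The sum over the duplications of a letter. -/
def dsum (c : L) (F : L → L → M) : M := ((dup c).map fun q => F q.1 q.2).sum

/-- The signed sum over the duplications of a letter of a word. -/
def del : List L → (List L → M) → M
  | [], _ => 0
  | c :: w, F => dsum dup c (fun x y => F (x :: y :: w)) + (-1 : ℤ) • del w fun v => F (c :: v)

theorem dsum_add (c : L) (F G : L → L → M) :
    dsum dup c (fun x y => F x y + G x y) = dsum dup c F + dsum dup c G := by
  simp [dsum, List.sum_map_add]

theorem dsum_smul (c : L) (n : ℤ) (F : L → L → M) :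
    dsum dup c (fun x y => n • F x y) = n • dsum dup c F := by
  simp only [dsum, List.smul_sum, List.map_map]; rfl

/-- An additive operator commutes with sums over duplications. -/
theorem map_dsum {α : Type*} (op : (α → M) → M) (hadd : ∀ F G, op (fun a => F a + G a) = op F + op G)
    (c : L) (F : L → L → α → M) :
    dsum dup c (fun x y => op (F x y)) = op (fun a => dsum dup c (fun x y => F x y a)) := by
  have h0 : op (fun _ => 0) = 0 := by simpa using hadd (fun _ => 0) (fun _ => 0)
  unfold dsum
  induction dup c with
  | nil => simp [h0]
  | cons q s ih => simp [ih, hadd]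

theorem del_add (w : List L) (F G : List L → M) :
    del dup w (fun v => F v + G v) = del dup w F + del dup w G := by
  induction w generalizing F G with
  | nil => simp [del]
  | cons c w ih => simp only [del, ih, dsum_add]; abel

theorem del_smul (w : List L) (n : ℤ) (F : List L → M) :
    del dup w (fun v => n • F v) = n • del dup w F := by
  induction w generalizing F with
  | nil => simp [del]
  | cons c w ih => simp only [del, ih, dsum_smul, smul_add, smul_comm _ n]

theorem del_sign (w : List L) (F : List L → M) :
    del dup w (fun v => (-1 : ℤ) ^ v.length • F v) =
      (-1 : ℤ) • (-1 : ℤ) ^ w.length • del dup w F := by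
  induction w generalizing F with
  | nil => simp [del]
  | cons c w ih =>
    simp only [del, List.length_cons, pow_succ, dsum_smul, mul_smul, ih, del_smul]
    module

theorem dsum_unsh (c : L) (w : List L) (F : L → L → List L → List L → M) :
    dsum dup c (fun x y => unsh w (F x y)) = unsh w fun l r => dsum dup c fun x y => F x y l r :=
  map_dsum dup (fun G : List L × List L → M => unsh w fun l r => G (l, r))
    (fun _ _ => unsh_add w _ _) c (fun x y q => F x y q.1 q.2)

theorem dsum_mark (c : L) (w : List L) (F : L → L → List L → L → List L → M) :
    dsum dup c (fun x y => mark w (F x y)) = mark w fun l a r => dsum dup c fun x y => F x y l a r :=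
  map_dsum dup (fun G : List L × L × List L → M => mark w fun l a r => G (l, a, r))
    (fun _ _ => mark_add w _ _) c (fun x y q => F x y q.1 q.2.1 q.2.2)

theorem dsum_unshR (c : L) (w : List L) (F : L → L → List L → List L → L → List L → M) :
    dsum dup c (fun x y => unshR w (F x y)) =
      unshR w fun l r b r' => dsum dup c fun x y => F x y l r b r' :=
  map_dsum dup (fun G : List L × List L × L × List L → M => unshR w fun l r b r' => G (l, r, b, r'))
    (fun _ _ => unshR_add w _ _) c (fun x y q => F x y q.1 q.2.1 q.2.2.1 q.2.2.2)

theorem dsum_unshLR (c : L) (w : List L)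
    (F : L → L → List L → L → List L → List L → L → List L → M) :
    dsum dup c (fun x y => unshLR w (F x y)) =
      unshLR w fun l a l' r b r' => dsum dup c fun x y => F x y l a l' r b r' :=
  map_dsum dup (fun G : List L × L × List L × List L × L × List L → M =>
      unshLR w fun l a l' r b r' => G (l, a, l', r, b, r'))
    (fun _ _ => unshLR_add w _ _) c
    (fun x y q => F x y q.1 q.2.1 q.2.2.1 q.2.2.2.1 q.2.2.2.2.1 q.2.2.2.2.2)

variable {dup}

theorem dsum_swap (hdup : ∀ c, ((dup c).map Prod.swap).Perm (dup c)) (c : L) (F : L → L → M) :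
    dsum dup c (fun x y => F y x) = dsum dup c F := by
  have := ((hdup c).map fun q => F q.1 q.2).sum_eq
  simpa [dsum, Function.comp_def] using this

end duplication

variable {dup : L → List (L × L)}

theorem sign_comm (m n : ℕ) (x : M) :
    (-1 : ℤ) ^ m • (-1 : ℤ) ^ n • x = (-1 : ℤ) ^ n • (-1 : ℤ) ^ m • x := smul_comm _ _ _

theorem sign_neg (m : ℕ) (x : M) :
    (-1 : ℤ) ^ m • (-1 : ℤ) • x = (-1 : ℤ) • (-1 : ℤ) ^ m • x := smul_comm _ _ _

theorem sign_sq (m : ℕ) (x : M) : (-1 : ℤ) ^ m • (-1 : ℤ) ^ m • x = x := by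
  rw [smul_smul, ← mul_pow]; simp

theorem neg_sq (x : M) : (-1 : ℤ) • (-1 : ℤ) • x = x := by simp

theorem unsh_del (hdup : ∀ c, ((dup c).map Prod.swap).Perm (dup c)) (w : List L)
    (F : List L → List L → M) :
    del dup w (fun v => unsh v F) = unsh w fun l r =>
      del dup l (fun l' => F l' r) + (-1 : ℤ) ^ l.length • del dup r (fun r' => F l r') := by
  induction w generalizing F with
  | nil => simp [del, unsh]
  | cons c w ih =>
    have h (l r : List L) := dsum_swap hdup c fun x y => F (x :: l) (y :: r)
    simp only [del, unsh, del_add, ih, dsum_add, dsum_unsh, dsum_smul, h,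
      del_sign, del_smul, List.length_cons, pow_succ', mul_smul, smul_add,
      unsh_add, unsh_smul, sign_neg, sign_sq, neg_sq]
    module

theorem mark_del (w : List L) (F : List L → L → List L → M) :
    del dup w (fun v => mark v F) = mark w fun l c r =>
      del dup l (fun l' => F l' c r) + (-1 : ℤ) ^ l.length •
        (dsum dup c (fun x y => F l x (y :: r) + F (l ++ [x]) y r) +
          (-1 : ℤ) • del dup r (fun r' => F l c r')) := by
  induction w generalizing F with
  | nil => simp [del, mark]
  | cons c w ih =>
    simp only [del, mark, del_add, ih, dsum_add, dsum_mark, smul_add]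
    simp only [List.length_nil, pow_zero, one_smul, List.nil_append, List.length_cons, 
      List.cons_append, pow_succ', mul_smul, sign_neg, mark_add, mark_smul]
    module

theorem unshR_del (hdup : ∀ c, ((dup c).map Prod.swap).Perm (dup c)) (w : List L)
    (F : List L → List L → L → List L → M) :
    del dup w (fun v => unshR v F) = unshR w fun l r b r' =>
      del dup l (fun v => F v r b r') + (-1 : ℤ) ^ l.length • (del dup r (fun v => F l v b r') +
        (-1 : ℤ) ^ r.length • (dsum dup b (fun x y => F l r x (y :: r') + F l (r ++ [x]) y r') +
          (-1 : ℤ) • del dup r' (fun v => F l r b v))) := by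
  induction w generalizing F with
  | nil => simp [del, unshR]
  | cons c w ih =>
    have h1 (l r : List L) := dsum_swap hdup c fun x y => F (x :: l) [] y r
    have h2 (l r b r') := dsum_swap hdup c fun x y => F (x :: l) (y :: r) b r'
    simp only [del, unshR, unsh, del_add, ih, unsh_del hdup, dsum_add, dsum_unshR, dsum_unsh,
      dsum_smul, h1, h2, List.length_nil, pow_zero, one_smul, List.nil_append, List.cons_append,
      del_sign, del_smul, List.length_cons, pow_succ', mul_smul, smul_add,
      unsh_add, unsh_smul, unshR_add, unshR_smul, sign_neg, sign_sq, neg_sq]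
    simp only [sign_comm, sign_sq, smul_zero, add_zero, unsh_zero]
    module

/-- The contribution of the letters which are duplicated with one copy on each side. -/
def unshD (dup : L → List (L × L)) (w : List L)
    (F : List L → L → List L → List L → L → List L → M) : M :=
  mark w fun u c v => (-1 : ℤ) ^ u.length • unsh u fun l r => unsh v fun l' r' =>
    (-1 : ℤ) ^ (l'.length * r.length) • (-1 : ℤ) ^ l'.length • (-1 : ℤ) ^ r.length •
      dsum dup c fun x y => F l x l' r y r'

theorem unshD_cons (c : L) (w : List L) (F : List L → L → List L → List L → L → List L → M) :
    unshD dup (c :: w) F =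
      unsh w (fun l r => (-1 : ℤ) ^ l.length • dsum dup c fun x y => F [] x l [] y r) +
      (-1 : ℤ) • unshD dup w (fun l a l' r b r' => F (c :: l) a l' r b r') +
      unshD dup w (fun l a l' r b r' =>
        (-1 : ℤ) ^ l.length • (-1 : ℤ) ^ l'.length • F l a l' (c :: r) b r') := by
  simp only [unshD, mark, unsh, List.length_nil, mul_zero, pow_zero, one_smul, List.length_cons,
    pow_succ', mul_smul, mul_add, mul_one, pow_add, sign_neg, smul_add, mark_add, mark_smul,
    unsh_smul, unsh_add, dsum_smul, sign_sq, neg_sq]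
  rw [add_assoc]
  congr 3
  funext u c v
  congr 2
  funext l r
  rw [← unsh_smul]
  congr 1
  funext l' r'
  rw [sign_comm, sign_comm l.length r.length, sign_comm l'.length r.length, sign_comm l'.length l.length,
    sign_sq]

theorem unshLR_del (hdup : ∀ c, ((dup c).map Prod.swap).Perm (dup c)) (w : List L)
    (F : List L → L → List L → List L → L → List L → M) :
    del dup w (fun v => unshLR v F) = unshLR w (fun l a l' r b r' =>
      del dup l (fun v => F v a l' r b r') + (-1 : ℤ) ^ l.length • (
        dsum dup a (fun x y => F l x (y :: l') r b r' + F (l ++ [x]) y l' r b r') +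
        (-1 : ℤ) • (del dup l' (fun v => F l a v r b r') +
        (-1 : ℤ) ^ l'.length • (del dup r (fun v => F l a l' v b r') +
        (-1 : ℤ) ^ r.length • (dsum dup b (fun x y => F l a l' r x (y :: r') +
            F l a l' (r ++ [x]) y r') +
          (-1 : ℤ) • del dup r' (fun v => F l a l' r b v)))))) + unshD dup w F := by
  induction w generalizing F with
  | nil => simp [del, unshLR, unshD, mark]
  | cons c w ih =>
    have h1 (l r b r') := dsum_swap hdup c fun x y => F [] x l (y :: r) b r'
    have h2 (l a l' r b r') := dsum_swap hdup c fun x y => F (x :: l) a l' (y :: r) b r'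
    simp only [del, unshLR, unshR, del_add, ih, unshR_del hdup, dsum_add, dsum_unshR,
      dsum_unshLR, dsum_unsh, unshD_cons, List.length_append, List.length_nil, pow_zero, one_smul,
      dsum_smul, h1, h2, List.nil_append, List.cons_append, List.length_singleton,
      del_sign, del_smul, List.length_cons, pow_succ', mul_smul, smul_add, unsh_add, unsh_smul,
      unshR_add, unshR_smul, unshLR_add, unshLR_smul, sign_neg, sign_sq, neg_sq]
    simp only [sign_comm, sign_sq, smul_zero, add_zero, unshR_zero]
    module
end Word

namespace Word
variable {L M : Type*} [AddCommGroup M] {dup : L → List (L × L)}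

theorem del_length (w : List L) (g : ℕ → ℤ) (F : List L → M) :
    del dup w (fun v => g v.length • F v) = g (w.length + 1) • del dup w F := by
  induction w generalizing F g with
  | nil => simp [del]
  | cons c w ih =>
    simp only [del, List.length_cons, dsum_smul, ih (fun n => g (n + 1))]
    module

theorem del_append (w w' : List L) (F : List L → M) :
    del dup (w ++ w') F = del dup w (fun v => F (v ++ w')) +
      (-1 : ℤ) ^ w.length • del dup w' (fun v => F (w ++ v)) := by
  induction w generalizing F with
  | nil => simp [del]
  | cons c w ih => simp only [List.cons_append, del, ih, List.length_cons, pow_succ']; module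

theorem mark_append (w w' : List L) (F : List L → L → List L → M) :
    mark (w ++ w') F = mark w (fun u c v => F u c (v ++ w')) +
      mark w' (fun u c v => F (w ++ u) c v) := by
  induction w generalizing F with
  | nil => simp [mark]
  | cons c w ih => simp only [List.cons_append, mark, ih]; abel

theorem unsh_append_singleton (w : List L) (c : L) (F : List L → List L → M) :
    unsh (w ++ [c]) F = unsh w (fun l r => (-1 : ℤ) ^ r.length • F (l ++ [c]) r) +
      unsh w (fun l r => F l (r ++ [c])) := by
  induction w generalizing F with
  | nil => simp [unsh]
  | cons a w ih =>
    simp only [List.cons_append, unsh, ih, List.length_cons, List.length_append, List.length_nil,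
      zero_add, pow_succ', mul_smul, sign_neg, unsh_smul]
    simp only [sign_comm]
    module

theorem unsh_append (w w' : List L) (F : List L → List L → M) :
    unsh (w ++ w') F = unsh w fun l r => unsh w' fun l' r' =>
      (-1 : ℤ) ^ (r.length * l'.length) • F (l ++ l') (r ++ r') := by
  induction w generalizing F with
  | nil => simp [unsh]
  | cons a w ih =>
    simp only [List.cons_append, unsh, ih, List.length_cons, List.length_append, pow_add, 
      mul_smul, sign_neg, unsh_smul, add_mul, one_mul]
    congr 2
    funext l r
    rw [← unsh_smul]
    congr 1
    funext l' r'
    rw [sign_comm _ l.length]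

theorem unshR_append_singleton (w : List L) (c : L) (F : List L → List L → L → List L → M) :
    unshR (w ++ [c]) F = unshR w (fun l r b r' => (-1 : ℤ) • (-1 : ℤ) ^ r.length •
        (-1 : ℤ) ^ r'.length • F (l ++ [c]) r b r') +
      unshR w (fun l r b r' => F l r b (r' ++ [c])) + unsh w (fun l r => F l r c []) := by
  induction w generalizing F with
  | nil => simp [unshR, unsh]
  | cons a w ih =>
    simp only [List.cons_append, unshR, unsh, ih, List.length_cons, List.length_append, 
      List.length_nil, unsh_append_singleton,
      zero_add, pow_succ', mul_smul, sign_neg, unsh_smul, unshR_smul, sign_comm]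
    simp only [unsh_smul, pow_zero, one_smul, sign_comm, unshR_smul, sign_neg, neg_sq]
    module

theorem unshLR_append_singleton (w : List L) (c : L)
    (F : List L → L → List L → List L → L → List L → M) :
    unshLR (w ++ [c]) F = unshLR w (fun l a l' r b r' => (-1 : ℤ) • (-1 : ℤ) ^ r.length •
        (-1 : ℤ) ^ r'.length • F l a (l' ++ [c]) r b r') +
      unshLR w (fun l a l' r b r' => F l a l' r b (r' ++ [c])) +
      unshL w (fun l a l' r => F l a l' r c []) := by
  induction w generalizing F with
  | nil => simp [unshR, unshL, unsh, unshLR]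
  | cons a w ih =>
    simp only [List.cons_append, unshR, unsh, ih, List.length_cons, List.length_append, unshL,
      List.length_nil, unshR_append_singleton, unshLR,
      zero_add, pow_succ', mul_smul, sign_neg, unsh_smul, unshR_smul, unshLR_smul, unshL_smul]
    simp only [unsh_smul, pow_zero, one_smul, sign_comm, unshR_smul, unshLR_smul, sign_neg, neg_sq]
    module

theorem sign_mark (w : List L) (G : List L → L → List L → M) :
    (-1 : ℤ) ^ w.length • mark w G = mark w fun u b v => (-1 : ℤ) • (-1 : ℤ) ^ u.length •
      (-1 : ℤ) ^ v.length • G u b v := by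
  induction w generalizing G with
  | nil => simp [mark]
  | cons b l ih =>
    simp only [mark, smul_add, List.length_cons, pow_succ', mul_smul, ih, List.length_nil,
      pow_zero, one_smul, sign_neg, mark_smul, neg_sq]

theorem unsh_mark_left (w : List L) (F : List L → L → List L → List L → M) :
    unsh w (fun l r => mark l fun u a v => F u a v r) = unshL w F := by
  induction w generalizing F with
  | nil => simp [unshL, unsh, mark]
  | cons a w ih =>
    have key : ∀ l r, ((-1 : ℤ) ^ l.length • mark l fun u a_1 v => F u a_1 v (a :: r)) =
      mark l fun u b v => (-1 : ℤ) • (-1 : ℤ) ^ u.length • (-1 : ℤ) ^ v.length •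
        F u b v (a :: r) := by
      intro l r; rw [sign_mark]
    simp only [unsh, unshL, mark, unsh_add, key, ih]
    abel

theorem unsh_mark_right (w : List L) (F : List L → List L → L → List L → M) :
    unsh w (fun l r => mark r fun u a v => F l u a v) = unshR w F := by
  induction w generalizing F with
  | nil => simp [unshR, unsh, mark]
  | cons a w ih =>
    have key : ∀ l r, ((-1 : ℤ) ^ l.length • mark r fun u c v => F l (a :: u) c v) =
      mark r fun u c v => (-1 : ℤ) ^ l.length • F l (a :: u) c v := by
      intro l r; rw [mark_smul]
    simp only [unsh, unshR, mark, unsh_add, smul_add, key, ih]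
    abel

theorem sign_unsh (w : List L) (F : List L → List L → M) :
    (-1 : ℤ) ^ w.length • unsh w F = unsh w fun l r => (-1 : ℤ) ^ l.length •
      (-1 : ℤ) ^ r.length • F l r := by
  induction w generalizing F with
  | nil => simp [unsh]
  | cons b l ih =>
    simp only [unsh, smul_add, List.length_cons, pow_succ', mul_smul, ih, List.length_nil,
      pow_zero, one_smul, sign_neg, unsh_smul]
    simp only [sign_comm]

theorem sign_unshL (w : List L) (F : List L → L → List L → List L → M) :
    (-1 : ℤ) ^ w.length • unshL w F = unshL w fun l a l' r => (-1 : ℤ) • (-1 : ℤ) ^ l.length •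
      (-1 : ℤ) ^ l'.length • (-1 : ℤ) ^ r.length • F l a l' r := by
  rw [← unsh_mark_left, ← unsh_mark_left, sign_unsh]
  congr 1; funext l r
  rw [sign_comm, sign_mark, ← mark_smul]
  congr 1; funext u a v
  simp only [sign_neg, sign_comm]

theorem sign_unshR (w : List L) (F : List L → List L → L → List L → M) :
    (-1 : ℤ) ^ w.length • unshR w F = unshR w fun l r b r' => (-1 : ℤ) • (-1 : ℤ) ^ l.length •
      (-1 : ℤ) ^ r.length • (-1 : ℤ) ^ r'.length • F l r b r' := by
  rw [← unsh_mark_right, ← unsh_mark_right, sign_unsh]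
  congr 1; funext l r
  rw [sign_mark, ← mark_smul]
  congr 1; funext u a v
  simp only [sign_neg, sign_comm]

theorem sign_unshLR (w : List L) (F : List L → L → List L → List L → L → List L → M) :
    (-1 : ℤ) ^ w.length • unshLR w F = unshLR w fun l a l' r b r' => (-1 : ℤ) ^ l.length •
      (-1 : ℤ) ^ l'.length • (-1 : ℤ) ^ r.length • (-1 : ℤ) ^ r'.length • F l a l' r b r' := by
  induction w generalizing F with
  | nil => simp [unshLR]
  | cons b l ih =>
    simp only [unshLR, smul_add, List.length_cons, pow_succ', mul_smul, ih, List.length_nil,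
      pow_zero, one_smul, sign_neg, sign_unshR, unshR_smul, unshLR_smul, neg_sq]
    simp only [sign_comm]


/-- The signed sum over all cyclic rotations of a word. -/
def cyc (w : List L) (H : List L → M) : M :=
  mark w fun u c v => (-1 : ℤ) ^ (u.length * v.length) • (-1 : ℤ) ^ u.length • H (c :: v ++ u)

/-- The signed sum over the duplications of a letter of a cyclic word. -/
def delc (dup : L → List (L × L)) : List L → (List L → M) → M
  | [], _ => 0
  | c :: w, H => dsum dup c (fun x y => H (x :: y :: w) +
      (-1 : ℤ) • (-1 : ℤ) ^ w.length • H (x :: w ++ [y])) + (-1 : ℤ) • del dup w fun v => H (c :: v)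

/-- The Hochschild coboundary of a word. -/
def bsum (dup : L → List (L × L)) (e : L) (w : List L) (F : List L → M) : M :=
  F (e :: w) + (-1 : ℤ) • (-1 : ℤ) ^ w.length • F (w ++ [e]) + (-1 : ℤ) • del dup w F

theorem mark_congr (w : List L) {F G : List L → L → List L → M} (h : ∀ u c v, F u c v = G u c v) :
    mark w F = mark w G := by
  congr 1; funext u c v; exact h u c v

theorem cyc_del (hdup : ∀ c, ((dup c).map Prod.swap).Perm (dup c)) (w : List L) (H : List L → M) :
    del dup w (fun v => cyc v H) = cyc w fun v => delc dup v H := by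
  unfold cyc
  rw [mark_del]
  refine mark_congr w fun u c v => ?_
  have h1 := del_length (dup := dup) u (fun n => (-1) ^ (n * v.length))
    fun u => (-1 : ℤ) ^ u.length • H (c :: v ++ u)
  have h2 := del_length (dup := dup) v (fun n => (-1) ^ (u.length * n))
    fun v => (-1 : ℤ) ^ u.length • H (c :: v ++ u)
  have h3 := dsum_swap hdup c fun x y => H (x :: (v ++ (u ++ [y])))
  rw [h1, h2]
  simp only [h3, del_sign, del_smul, delc, List.cons_append, del_append, dsum_add, dsum_smul,
    List.length_append, List.length_cons, pow_add, mul_smul, List.length_nil, add_mul, mul_add,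
    List.append_assoc, List.nil_append]
  simp only [pow_mul, zero_mul, pow_zero, pow_one, one_smul, mul_one, one_mul]
  rcases neg_one_pow_eq_or ℤ u.length with hu | hu <;>
  rcases neg_one_pow_eq_or ℤ v.length with hv | hv <;>
  simp only [hu, hv, one_pow] <;> module

theorem cyc_bsum (hdup : ∀ c, ((dup c).map Prod.swap).Perm (dup c)) (e : L) (w : List L) (H : List L → M) :
    bsum dup e w (fun v => cyc v H) = (-1 : ℤ) • cyc w fun v => delc dup v H := by
  rw [bsum, cyc_del hdup]
  unfold cyc
  rw [mark_append, mark, smul_add, smul_add, sign_mark]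
  simp only [mark, mul_zero, List.length_nil, pow_zero, one_smul, List.append_nil, add_zero,
    zero_mul, sign_sq, ← mark_smul]
  simp only [List.cons_append, List.nil_append, List.append_assoc]
  have key : ∀ a b c d : M, b + d = 0 → a + b + (d + -1 • a) + c = c := by
    intro a b c d h
    rw [show a + b + (d + -1 • a) + c = (b + d) + c by module, h, zero_add]
  refine key _ _ _ _ ?_
  rw [← mark_add, ← mark_zero w]
  refine mark_congr w fun u c v => ?_
  simp only [List.length_append, List.length_cons, pow_add, mul_smul, List.length_nil, add_mul,
    mul_add, zero_add, one_mul, mul_one, pow_succ', sign_neg, sign_sq, neg_sq]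
  module

/-- The signed sum over all pairs of rotations of two complementary subwords such that the first
letter of the left one comes before the first letter of the right one. -/
def cycLR (w : List L) (H : List L → List L → M) : M :=
  unshLR w fun l a l' r b r' => (-1 : ℤ) ^ (l.length * l'.length) • (-1 : ℤ) ^ l'.length •
    (-1 : ℤ) ^ (r.length * r'.length) • (-1 : ℤ) ^ r.length • H (a :: l' ++ l) (b :: r' ++ r)

/-- The sum over the duplications of the letter at the origin of a cyclic word, distributed to the
origins of the two subwords. -/
def unshC (dup : L → List (L × L)) : List L → (List L → List L → M) → M
  | [], _ => 0
  | c :: v, H => unsh v fun l r => dsum dup c fun x y => H (x :: l) (y :: r)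

theorem unsh_congr (w : List L) {F G : List L → List L → M}
    (h : ∀ l r, (l ++ r).Perm w → F l r = G l r) : unsh w F = unsh w G := by
  induction w generalizing F G with
  | nil => simpa [unsh] using h [] [] (List.Perm.refl _)
  | cons c w ih =>
    simp only [unsh]
    congr 1
    · exact ih fun l r hlr => h _ _ (hlr.cons c)
    · exact ih fun l r hlr => congrArg _ (h _ _ (List.perm_middle.trans (hlr.cons c)))

theorem unshR_congr (w : List L) {F G : List L → List L → L → List L → M}
    (h : ∀ l r b r', F l r b r' = G l r b r') : unshR w F = unshR w G := by
  congr 1; funext l r b r'; exact h _ _ _ _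

theorem unshL_congr (w : List L) {F G : List L → L → List L → List L → M}
    (h : ∀ l a l' r, F l a l' r = G l a l' r) : unshL w F = unshL w G := by
  congr 1; funext l a l' r; exact h _ _ _ _

theorem unsh_unsh_comm (w w' : List L) (F : List L → List L → List L → List L → M) :
    unsh w (fun l r => unsh w' fun l' r' => F l r l' r') =
      unsh w' fun l' r' => unsh w fun l r => F l r l' r' := by
  induction w generalizing F with
  | nil => simp [unsh]
  | cons c w ih => simp only [unsh, ih, ← unsh_smul, unsh_add]

theorem unshLR_congr (w : List L) {F G : List L → L → List L → List L → L → List L → M}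
    (h : ∀ l a l' r b r', F l a l' r b r' = G l a l' r b r') : unshLR w F = unshLR w G := by
  congr 1; funext l a l' r b r'; exact h _ _ _ _ _ _

theorem cycLR_del (hdup : ∀ c, ((dup c).map Prod.swap).Perm (dup c)) (w : List L)
    (H : List L → List L → M) :
    del dup w (fun v => cycLR v H) =
      (-1 : ℤ) • cycLR w (fun l r => delc dup l (fun l' => H l' r) +
        (-1 : ℤ) • (-1 : ℤ) ^ l.length • delc dup r (fun r' => H l r')) +
      cyc w fun v => unshC dup v H := by
  unfold cycLR
  rw [unshLR_del hdup]
  congr 1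
  · rw [← unshLR_smul]
    refine unshLR_congr w fun l a l' r b r' => ?_
    have h1 := del_length (dup := dup) l (fun n => (-1) ^ (n * l'.length)) fun v =>
      (-1 : ℤ) ^ l'.length • (-1 : ℤ) ^ (r.length * r'.length) • (-1 : ℤ) ^ r.length •
        H (a :: l' ++ v) (b :: r' ++ r)
    have h2 := del_length (dup := dup) l' (fun n => (-1) ^ (l.length * n)) fun v =>
      (-1 : ℤ) ^ v.length • (-1 : ℤ) ^ (r.length * r'.length) • (-1 : ℤ) ^ r.length •
        H (a :: v ++ l) (b :: r' ++ r)
    have h3 := del_length (dup := dup) r (fun n => (-1) ^ (n * r'.length)) fun v =>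
      (-1 : ℤ) ^ v.length • H (a :: l' ++ l) (b :: r' ++ v)
    have h4 := del_length (dup := dup) r' (fun n => (-1) ^ (r.length * n)) fun v =>
      (-1 : ℤ) ^ r.length • H (a :: l' ++ l) (b :: v ++ r)
    have h5 := dsum_swap hdup a fun x y => H (x :: (l' ++ (l ++ [y]))) (b :: (r' ++ r))
    have h6 := dsum_swap hdup b fun x y => H (a :: (l' ++ l)) (x :: (r' ++ (r ++ [y])))
    simp only [h1, h2, h3, h4, del_sign, del_smul]
    simp only [delc, List.cons_append, del_append, dsum_add, dsum_smul,
      List.length_append, List.length_cons, pow_add, mul_smul, List.length_nil, add_mul, mul_add,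
      List.append_assoc, List.nil_append, h5, h6]
    simp only [pow_mul, zero_mul, pow_zero, pow_one, one_smul, mul_one, one_mul]
    generalize (dsum dup a fun x y => H (x :: y :: (l' ++ l)) (b :: (r' ++ r))) = x1
    generalize (dsum dup a fun x y => H (x :: (l' ++ (l ++ [y]))) (b :: (r' ++ r))) = x2
    generalize (dsum dup b fun x y => H (a :: (l' ++ l)) (x :: (r' ++ (r ++ [y])))) = x3
    generalize (dsum dup b fun x y => H (a :: (l' ++ l)) (x :: y :: (r' ++ r))) = x4
    rcases neg_one_pow_eq_or ℤ l.length with ha | ha <;>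
    rcases neg_one_pow_eq_or ℤ l'.length with hb | hb <;>
    simp only [ha, hb, one_pow] <;>
    rcases neg_one_pow_eq_or ℤ r.length with hc | hc <;>
    rcases neg_one_pow_eq_or ℤ r'.length with hd | hd <;>
    simp only [ha, hb, hc, hd, one_pow] <;> module
  · unfold unshD cyc
    refine mark_congr w fun u c v => ?_
    simp only [List.cons_append, unshC]
    rw [unsh_append, unsh_unsh_comm]
    simp only [← unsh_smul]
    refine unsh_congr v fun l' r' hv => unsh_congr u fun l r hu => ?_
    have hv := hv.length_eq
    have hu := hu.length_eq
    rw [List.length_append] at hu hv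
    rw [← hu, ← hv]
    simp only [dsum_smul, pow_add, add_mul, mul_add, pow_mul]
    generalize (dsum dup c fun x y => H (x :: (l' ++ l)) (y :: (r' ++ r))) = x
    rcases neg_one_pow_eq_or ℤ l.length with ha | ha <;>
    rcases neg_one_pow_eq_or ℤ l'.length with hb | hb <;>
    simp only [ha, hb, one_pow] <;>
    rcases neg_one_pow_eq_or ℤ r.length with hc | hc <;>
    rcases neg_one_pow_eq_or ℤ r'.length with hd | hd <;>
    simp only [ha, hb, hc, hd, one_pow] <;> module

theorem cycLR_bsum (hdup : ∀ c, ((dup c).map Prod.swap).Perm (dup c)) (e : L) (w : List L)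
    (H : List L → List L → M) :
    bsum dup e w (fun v => cycLR v H) =
      cycLR w (fun l r => delc dup l (fun l' => H l' r) +
        (-1 : ℤ) • (-1 : ℤ) ^ l.length • delc dup r (fun r' => H l r')) +
      unsh w (fun l r => cyc l (fun v => H v (e :: r)) +
        (-1 : ℤ) ^ l.length • cyc r (fun v => H (e :: l) v)) +
      (-1 : ℤ) • cyc w fun v => unshC dup v H := by
  have hL : unsh w (fun l r => cyc l (fun v => H v (e :: r))) = unshL w fun u c v r =>
      (-1 : ℤ) ^ (u.length * v.length) • (-1 : ℤ) ^ u.length • H (c :: v ++ u) (e :: r) :=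
    unsh_mark_left w fun u c v r =>
      (-1 : ℤ) ^ (u.length * v.length) • (-1 : ℤ) ^ u.length • H (c :: v ++ u) (e :: r)
  have hR : unsh w (fun l r => (-1 : ℤ) ^ l.length • cyc r (fun v => H (e :: l) v)) =
      unshR w fun l u c v => (-1 : ℤ) ^ l.length •
        (-1 : ℤ) ^ (u.length * v.length) • (-1 : ℤ) ^ u.length • H (e :: l) (c :: v ++ u) := by
    rw [← unsh_mark_right]
    exact unsh_congr w fun l r _ => (mark_smul _ _ _).symm
  rw [bsum, cycLR_del hdup, unsh_add, hL, hR]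
  have h1 : cycLR (e :: w) H + (-1 : ℤ) • (-1 : ℤ) ^ w.length • cycLR (w ++ [e]) H = 
      unshL w (fun u c v r =>
        (-1 : ℤ) ^ (u.length * v.length) • (-1 : ℤ) ^ u.length • H (c :: v ++ u) (e :: r)) +
      unshR w fun l u c v => (-1 : ℤ) ^ l.length •
        (-1 : ℤ) ^ (u.length * v.length) • (-1 : ℤ) ^ u.length • H (e :: l) (c :: v ++ u) := by
    unfold cycLR
    rw [unshLR_append_singleton, unshLR]
    simp only [smul_add, sign_unshLR, sign_unshL]
    simp only [ ← unshLR_smul, ← unshL_smul]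
    have key : ∀ a b c p q r c' r' : M, a + p = 0 → b + q = 0 → c = c' → r = r' →
        a + b + c + (p + q + r) = r' + c' := by
      rintro a b c p q r c' r' h1 h2 rfl rfl
      rw [show a + b + c + (p + q + r) = (a + p) + (b + q) + (r + c) by abel, h1, h2]; simp
    refine key _ _ _ _ _ _ _ _ ?_ ?_ ?_ ?_
    · rw [← unshLR_add, ← unshLR_zero w]
      refine unshLR_congr w fun l a l' r b r' => ?_
      simp only [List.length_append, List.length_cons, pow_add, mul_smul, List.length_nil, 
        List.append_assoc, List.cons_append, List.nil_append,
        add_mul, mul_add, zero_add, one_mul, mul_one, pow_succ', sign_neg, sign_sq, neg_sq]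
      simp only [sign_comm, sign_sq]
      module
    · rw [← unshLR_add, ← unshLR_zero w]
      refine unshLR_congr w fun l a l' r b r' => ?_
      simp only [List.length_append, List.length_cons, pow_add, mul_smul, List.length_nil, 
        List.append_assoc, List.cons_append, List.nil_append,
        add_mul, mul_add, zero_add, one_mul, mul_one, pow_succ', sign_neg, sign_sq, neg_sq]
      module
    · refine unshR_congr w fun l r b r' => ?_
      simp
    · refine unshL_congr w fun l a l' r => ?_
      simp only [List.length_nil, pow_zero, one_smul, mul_zero, List.nil_append, neg_sq,
        List.cons_append, sign_comm, sign_sq]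
  unfold cycLR at h1 ⊢
  rw [h1]; module
end Word

namespace Word
variable {L M : Type*} [AddCommGroup M]

/-- The permutation of `Fin (n + 1)` which sends `i` to `0` and is given by `σ` on the other
letters. -/
def insPerm {n : ℕ} (i : Fin (n + 1)) (σ : Equiv.Perm (Fin n)) : Equiv.Perm (Fin (n + 1)) :=
  Equiv.Perm.decomposeFin.symm (0, σ) * i.cycleRange

theorem insPerm_self {n : ℕ} (i : Fin (n + 1)) (σ : Equiv.Perm (Fin n)) : insPerm i σ i = 0 := by
  simp [insPerm]

theorem insPerm_succAbove {n : ℕ} (i : Fin (n + 1)) (σ : Equiv.Perm (Fin n)) (j : Fin n) :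
    insPerm i σ (i.succAbove j) = (σ j).succ := by
  simp [insPerm]

theorem sign_insPerm {n : ℕ} (i : Fin (n + 1)) (σ : Equiv.Perm (Fin n)) :
    ((insPerm i σ).sign : ℤ) = (-1) ^ (i : ℕ) * (σ.sign : ℤ) := by
  simp [insPerm, mul_comm]

theorem insPerm_inj {n : ℕ} (i : Fin (n + 1)) : Function.Injective (insPerm i) := by
  intro σ σ' h
  ext j
  have := congrArg (fun τ => τ (i.succAbove j)) h
  simp only [insPerm_succAbove] at this
  exact congrArg Fin.val (Fin.succ_injective _ this)

theorem exists_insPerm {n : ℕ} (i : Fin (n + 1)) (τ : Equiv.Perm (Fin (n + 1))) (h : τ i = 0) :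
    ∃ σ, insPerm i σ = τ := by
  obtain ⟨⟨p, σ⟩, hp⟩ := Equiv.Perm.decomposeFin.symm.surjective (τ * i.cycleRange⁻¹)
  have h0 := congrArg (fun τ => τ 0) hp
  have h1 : i.cycleRange⁻¹ 0 = i := Fin.cycleRange_symm_zero i
  simp only [Equiv.Perm.decomposeFin_symm_apply_zero, Equiv.Perm.mul_apply, h1, h] at h0
  subst h0
  exact ⟨σ, by rw [insPerm, hp]; simp⟩

theorem mem_shuffles {n i : ℕ} {σ : Equiv.Perm (Fin n)} : σ ∈ shuffles n i ↔
    (∀ a b : Fin n, a < b → (b : ℕ) < i → σ a < σ b) ∧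
      ∀ a b : Fin n, a < b → i ≤ (a : ℕ) → σ a < σ b := by
  simp [shuffles]

theorem insPerm_zero_mem {n i : ℕ} (σ : Equiv.Perm (Fin n)) :
    insPerm 0 σ ∈ shuffles (n + 1) (i + 1) ↔ σ ∈ shuffles n i := by
  have hs (j : Fin n) : insPerm 0 σ j.succ = (σ j).succ := by
    simpa using insPerm_succAbove 0 σ j
  rw [mem_shuffles, mem_shuffles]
  refine and_congr ⟨fun h a b hab hb => ?_, fun h a b hab hb => ?_⟩
    ⟨fun h a b hab hb => ?_, fun h a b hab hb => ?_⟩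
  · simpa [hs] using h a.succ b.succ (by simpa using hab) (by simpa using hb)
  · induction b using Fin.cases with
    | zero => simp at hab
    | succ b =>
      induction a using Fin.cases with
      | zero => rw [insPerm_self, hs]; exact Fin.succ_pos _
      | succ a => simpa [hs] using h a b (by simpa using hab) (by simpa using hb)
  · simpa [hs] using h a.succ b.succ (by simpa using hab) (by simpa using hb)
  · induction b using Fin.cases with
    | zero => simp at hab
    | succ b =>
      induction a using Fin.cases with
      | zero => simp at hb
      | succ a => simpa [hs] using h a b (by simpa using hab) (by simpa using hb)

theorem succAbove_val_lt {n : ℕ} (i : Fin (n + 1)) (b : Fin n) :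
    ((i.succAbove b : Fin (n + 1)) : ℕ) < i ↔ (b : ℕ) < i := by
  simp only [Fin.succAbove, Fin.lt_def]
  split_ifs with h <;> simp at * <;> omega

theorem insPerm_mem {n : ℕ} (i : Fin (n + 1)) (σ : Equiv.Perm (Fin n)) :
    insPerm i σ ∈ shuffles (n + 1) i ↔ σ ∈ shuffles n i := by
  rw [mem_shuffles, mem_shuffles]
  refine and_congr ⟨fun h a b hab hb => ?_, fun h a b hab hb => ?_⟩
    ⟨fun h a b hab hb => ?_, fun h a b hab hb => ?_⟩
  · simpa [insPerm_succAbove] using h (i.succAbove a) (i.succAbove b) (by simpa using hab)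
      ((succAbove_val_lt i b).2 hb)
  · induction b using Fin.succAboveCases i with
    | x => simp at hb
    | p b =>
      induction a using Fin.succAboveCases i with
      | x => exact absurd (Fin.lt_def.1 hab) (by omega)
      | p a => simpa [insPerm_succAbove] using h a b (by simpa using hab)
                ((succAbove_val_lt i b).1 hb)
  · simpa [insPerm_succAbove] using h (i.succAbove a) (i.succAbove b) (by simpa using hab)
      (not_lt.1 fun h => (not_lt.2 hb) ((succAbove_val_lt i a).1 h))
  · induction b using Fin.succAboveCases i with
    | x => exact absurd (Fin.lt_def.1 hab) (by omega)
    | p b =>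
      induction a using Fin.succAboveCases i with
      | x => rw [insPerm_self, insPerm_succAbove]; exact Fin.succ_pos _
      | p a => simpa [insPerm_succAbove] using h a b (by simpa using hab)
                (not_lt.1 fun h => (not_lt.2 hb) ((succAbove_val_lt i a).2 h))

theorem shuffle_zero {n m : ℕ} {σ : Equiv.Perm (Fin (n + 1))} (hσ : σ ∈ shuffles (n + 1) m)
    (hm : m ≤ n + 1) (h : ∀ i : Fin (n + 1), (i : ℕ) = m → σ i ≠ 0) : σ 0 = 0 ∧ 0 < m := by
  rw [mem_shuffles] at hσ
  obtain ⟨j, hj⟩ := σ.surjective 0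
  rcases lt_trichotomy (j : ℕ) m with h1 | h1 | h1
  · have : j = 0 := by
      by_contra hne
      have := hσ.1 0 j (Fin.pos_of_ne_zero hne) h1
      rw [hj] at this
      exact absurd this (by simp)
    subst this
    exact ⟨hj, by simpa using h1⟩
  · exact absurd hj (h j h1)
  · have := hσ.2 ⟨m, by omega⟩ j h1 le_rfl
    rw [hj] at this
    exact absurd this (by simp)

theorem sum_shuffles_succ {n : ℕ} (g : ℕ → Equiv.Perm (Fin (n + 1)) → M) :
    ∑ m ∈ Finset.range (n + 2), ∑ σ ∈ shuffles (n + 1) m, g m σ =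
      ∑ m ∈ Finset.range (n + 1), ∑ σ ∈ shuffles n m, g (m + 1) (insPerm 0 σ) +
      ∑ m : Fin (n + 1), ∑ σ ∈ shuffles n m, g m (insPerm m σ) := by
  have key (m : ℕ) (hm : m ∈ Finset.range (n + 2)) : ∑ σ ∈ shuffles (n + 1) m, g m σ =
      ∑ σ ∈ (shuffles (n + 1) m).filter (fun σ => ∃ i : Fin (n + 1), (i : ℕ) = m ∧ σ i = 0), g m σ +
      ∑ σ ∈ (shuffles (n + 1) m).filter (fun σ => ¬ ∃ i : Fin (n + 1), (i : ℕ) = m ∧ σ i = 0),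
        g m σ := (Finset.sum_filter_add_sum_filter_not _ _ _).symm
  rw [Finset.sum_congr rfl key, Finset.sum_add_distrib, add_comm]
  congr 1
  · rw [Finset.sum_range_succ', Finset.filter_false_of_mem, Finset.sum_empty, add_zero]
    · refine Finset.sum_congr rfl fun m hm => ?_
      symm
      refine Finset.sum_bij (fun σ _ => insPerm 0 σ) (fun σ hσ => ?_) (fun σ _ σ' _ h =>
        insPerm_inj _ h) (fun τ hτ => ?_) (fun _ _ => rfl)
      · refine Finset.mem_filter.2 ⟨(insPerm_zero_mem σ).2 hσ, ?_⟩
        rintro ⟨i, hi, hi0⟩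
        have := (insPerm 0 σ).injective (hi0.trans (insPerm_self 0 σ).symm)
        subst this
        simp at hi
      · rw [Finset.mem_filter] at hτ
        have h0 := shuffle_zero hτ.1 (by simp at hm; omega) fun i hi h => hτ.2 ⟨i, hi, h⟩
        obtain ⟨σ, rfl⟩ := exists_insPerm 0 τ h0.1
        exact ⟨σ, (insPerm_zero_mem σ).1 hτ.1, rfl⟩
    · intro σ hσ h
      push Not at h
      exact absurd (shuffle_zero hσ (by omega) h).2 (by simp)
  · rw [Finset.sum_range_succ, Finset.filter_false_of_mem, Finset.sum_empty, add_zero,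
      ← Fin.sum_univ_eq_sum_range (fun m => ∑ σ ∈ (shuffles (n + 1) m).filter
        (fun σ => ∃ i : Fin (n + 1), (i : ℕ) = m ∧ σ i = 0), g m σ)]
    · refine Finset.sum_congr rfl fun m _ => ?_
      symm
      refine Finset.sum_bij (fun σ _ => insPerm m σ) (fun σ hσ => ?_) (fun σ _ σ' _ h =>
        insPerm_inj _ h) (fun τ hτ => ?_) (fun _ _ => rfl)
      · exact Finset.mem_filter.2 ⟨(insPerm_mem m σ).2 hσ, m, rfl, insPerm_self m σ⟩
      · rw [Finset.mem_filter] at hτ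
        obtain ⟨hτ, i, hi, hi0⟩ := hτ
        have := Fin.ext hi
        subst this
        obtain ⟨σ, rfl⟩ := exists_insPerm i τ hi0
        exact ⟨σ, (insPerm_mem i σ).1 hτ, rfl⟩
    · rintro σ - ⟨i, hi, -⟩
      have := i.2
      omega

theorem sum_shuffles {n : ℕ} (h : Fin n → L) (F : List L → List L → M) :
    ∑ m ∈ Finset.range (n + 1), ∑ σ ∈ shuffles n m, (Equiv.Perm.sign σ : ℤ) •
      F (((List.finRange n).take m).map fun j => h (σ j))
        (((List.finRange n).drop m).map fun j => h (σ j)) =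
    unsh ((List.finRange n).map h) F := by
  induction n generalizing F with
  | zero => 
    have : shuffles 0 0 = {1} := by ext σ; simp [mem_shuffles]; exact Subsingleton.elim _ _
    simp [unsh, this]
  | succ n ih =>
    have h0 (σ : Equiv.Perm (Fin n)) (j : Fin n) : insPerm 0 σ j.succ = (σ j).succ := by
      simpa using insPerm_succAbove 0 σ j
    rw [sum_shuffles_succ fun m σ => (Equiv.Perm.sign σ : ℤ) •
      F (((List.finRange (n + 1)).take m).map fun j => h (σ j))
        (((List.finRange (n + 1)).drop m).map fun j => h (σ j))]
    have hf : (List.finRange (n + 1)).map h = h 0 :: (List.finRange n).map (h ∘ Fin.succ) := by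
      rw [List.finRange_succ, List.map_cons, List.map_map]
    rw [hf, unsh]
    rw [← ih (h ∘ Fin.succ) (fun l r => F (h 0 :: l) r),
      ← ih (h ∘ Fin.succ) (fun l r => (-1 : ℤ) ^ l.length • F l (h 0 :: r))]
    congr 1
    · refine Finset.sum_congr rfl fun m _ => Finset.sum_congr rfl fun σ _ => ?_
      rw [sign_insPerm]
      simp [List.finRange_succ, insPerm_self, ← List.map_take, ← List.map_drop, Function.comp_def, h0]
    · rw [← Fin.sum_univ_eq_sum_range (fun m => ∑ σ ∈ shuffles n m, (Equiv.Perm.sign σ : ℤ) • (-1 : ℤ) ^ (((List.finRange n).take m).map fun j => (h ∘ Fin.succ) (σ j)).length •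
      F (((List.finRange n).take m).map fun j => (h ∘ Fin.succ) (σ j))
        (h 0 :: ((List.finRange n).drop m).map fun j => (h ∘ Fin.succ) (σ j)))]
      refine Finset.sum_congr rfl fun m _ => Finset.sum_congr rfl fun σ _ => ?_
      have hm := m.2
      rw [sign_insPerm, mul_comm, mul_smul, List.length_map, List.length_take, List.length_finRange,
        min_eq_left (by omega)]
      congr 3
      · refine List.ext_getElem (by simp; omega) fun j h1 h2 => ?_
        simp only [List.length_map, List.length_take, List.length_finRange, lt_min_iff] at h1 h2
        have hj : j < n := by omega
        have hs : m.succAbove ⟨j, hj⟩ = ⟨j, by omega⟩ := by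
          rw [Fin.succAbove_of_castSucc_lt _ _ (Fin.lt_def.2 (by simpa using h1.1))]; rfl
        have := insPerm_succAbove m σ ⟨j, hj⟩
        rw [hs] at this
        simp [this]
      · refine List.ext_getElem (by simp; omega) fun j h1 h2 => ?_
        simp only [List.length_map, List.length_drop, List.length_finRange] at h1
        cases j with
        | zero => simp [insPerm_self]
        | succ j =>
          have hs : m.succAbove ⟨m + j, by omega⟩ = ⟨m + (j + 1), by omega⟩ := by
            rw [Fin.succAbove_of_le_castSucc _ _ (Fin.le_def.2 (by simp))]; rfl
          have := insPerm_succAbove m σ ⟨m + j, by omega⟩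
          rw [hs] at this
          simp [this]

theorem unsh_map {L' : Type*} (h : L' → L) (w : List L') (F : List L → List L → M) :
    unsh (w.map h) F = unsh w fun l r => F (l.map h) (r.map h) := by
  induction w generalizing F with
  | nil => simp [unsh]
  | cons c w ih => simp [unsh, ih]

theorem unshR_map {L' : Type*} (h : L' → L) (w : List L') (F : List L → List L → L → List L → M) :
    unshR (w.map h) F = unshR w fun l r b r' => F (l.map h) (r.map h) (h b) (r'.map h) := by
  induction w generalizing F with
  | nil => simp [unshR]
  | cons c w ih => simp [unshR, ih, unsh_map]

theorem unshLR_map {L' : Type*} (h : L' → L) (w : List L')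
    (F : List L → L → List L → List L → L → List L → M) :
    unshLR (w.map h) F = unshLR w fun l a l' r b r' =>
      F (l.map h) (h a) (l'.map h) (r.map h) (h b) (r'.map h) := by
  induction w generalizing F with
  | nil => simp [unshLR]
  | cons c w ih => simp [unshLR, ih, unshR_map]

theorem mark_congr_mem (w : List L) {F G : List L → L → List L → M}
    (h : ∀ u c v, u ++ c :: v = w → F u c v = G u c v) : mark w F = mark w G := by
  induction w generalizing F G with
  | nil => rfl
  | cons c w ih =>
    rw [mark, mark, h [] c w rfl, ih fun u b v e => h (c :: u) b v (by simp [e])]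

/-- A pair of marked letters of the two subwords, the left one being smaller than the right one. -/
theorem unsh_mark_mark [LinearOrder L] (w : List L) (hw : w.Pairwise (· < ·))
    (F : List L → L → List L → List L → L → List L → M) :
    unsh w (fun l r => mark l fun u a v => mark r fun u' b v' =>
      if a < b then F u a v u' b v' else 0) = unshLR w F := by
  induction w generalizing F with
  | nil => simp [unsh, unshLR, mark]
  | cons c w ih =>
    rw [List.pairwise_cons] at hw
    rw [unsh, unshLR, ← ih hw.2, ← ih hw.2, ← unsh_mark_right]
    rw [add_right_comm, ← unsh_add, ← unsh_add, ← unsh_add]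
    refine unsh_congr w fun l r hlr => ?_
    have h1 : (mark r fun u' b v' => if c < b then F [] c l u' b v' else 0) =
        mark r fun u' b v' => F [] c l u' b v' :=
      mark_congr_mem r fun u' b v' e => if_pos (hw.1 b (hlr.mem_iff.1 (by simp [← e])))
    have h2 : ((-1 : ℤ) ^ l.length • mark l fun u a v => mark (c :: r) fun u' b v' =>
        if a < b then F u a v u' b v' else 0) = mark l fun u a v => mark r fun u' b v' =>
          if a < b then (-1 : ℤ) • (-1 : ℤ) ^ u.length • (-1 : ℤ) ^ v.length •
            F u a v (c :: u') b v' else 0 := by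
      rw [sign_mark]
      refine mark_congr_mem l fun u a v e => ?_
      rw [mark, if_neg (not_lt.2 (hw.1 a (hlr.mem_iff.1 (by simp [← e]))).le), zero_add,
        ← mark_smul, ← mark_smul, ← mark_smul]
      refine mark_congr r fun u' b v' => ?_
      split_ifs <;> simp
    rw [h2, mark, h1]
    abel

theorem mark_eq_sum (w : List L) (F : List L → L → List L → M) :
    mark w F = ∑ p : Fin w.length, F (w.take p) w[p] (w.drop (p + 1)) := by
  induction w generalizing F with
  | nil => simp [mark]
  | cons c w ih => 
    rw [mark, ih]
    simp only [List.length_cons]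
    rw [Fin.sum_univ_succ]
    simp
end Word

namespace HopfCyclic

universe u w

section Words

open PiTensorProduct Coalgebra

variable {k : Type u} {A : Type w} [CommRing k] [Ring A] [HopfAlgebra k A]

@[simp] theorem insertFactor_tprod (n : ℕ) (i : Fin (n + 1)) (a : A) (h : Fin n → A) :
    insertFactor k A n i a (tprod k h) = tprod k (i.insertNth a h : Fin (n + 1) → A) := by
  simp [insertFactor]

@[simp] theorem splitFactor_tprod (n : ℕ) (i : Fin (n + 1)) (h : Fin (n + 1) → A) :
    splitFactor k A n i (tprod k h) = h i ⊗ₜ[k] tprod k (i.removeNth h) := by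
  simp [splitFactor]

theorem ofFn_insertNth {α : Type*} {n : ℕ} (i : Fin (n + 1)) (a : α) (h : Fin n → α) :
    List.ofFn (i.insertNth a h : Fin (n + 1) → α) =
      (List.ofFn h).take i ++ a :: (List.ofFn h).drop i := by
  induction n with
  | zero =>
    have : i = 0 := Fin.fin_one_eq_zero i
    subst this
    simp
  | succ n ih =>
    induction i using Fin.cases with
    | zero => simp [List.ofFn_succ]
    | succ i =>
      have : (i.succ.insertNth a h : Fin (n + 2) → α) =
          Fin.cons (h 0) (i.insertNth a (fun j => h j.succ) : Fin (n + 1) → α) := by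
        ext j
        induction j using Fin.succAboveCases i.succ with
        | x => simp
        | p j =>
          rw [Fin.insertNth_apply_succAbove]
          induction j using Fin.cases with
          | zero => simp
          | succ j => simp
      rw [this, List.ofFn_cons, ih, List.ofFn_succ]
      simp

theorem ofFn_removeNth {α : Type*} {n : ℕ} (i : Fin (n + 1)) (h : Fin (n + 1) → α) :
    List.ofFn (i.removeNth h) = (List.ofFn h).take i ++ (List.ofFn h).drop (i + 1) := by
  obtain ⟨a, h, rfl⟩ : ∃ a h', h = (i.insertNth a h' : Fin (n + 1) → α) :=
    ⟨h i, i.removeNth h, by simp⟩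
  rw [ofFn_insertNth, Fin.removeNth_insertNth]
  have : ((List.ofFn h).take i).length = (i : ℕ) := by simp; omega
  have h2 : ((List.ofFn h).take i).drop (i + 1) = [] := List.drop_eq_nil_of_le (by omega)
  simp [List.drop_append, this, h2]

variable (k A)

/-- Prepend a tensor factor. -/
def consT : A →ₗ[k] Module.End k (CM k A).Tot :=
  LinearMap.flip (DirectSum.toModule k ℕ _ fun n =>
    ((insertFactor k A n 0).compr₂ (lof k ℕ (CM k A).X (n + 1))).flip)

/-- Append a tensor factor. -/
def snocT : A →ₗ[k] Module.End k (CM k A).Tot :=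
  LinearMap.flip (DirectSum.toModule k ℕ _ fun n =>
    ((insertFactor k A n (Fin.last n)).compr₂
      (lof k ℕ (CM k A).X (n + 1))).flip)

/-- The diagonal action. -/
def actT : A →ₗ[k] Module.End k (CM k A).Tot :=
  LinearMap.flip (DirectSum.toModule k ℕ _ fun n =>
    ((LinearMap.mul k (Pow k A n) ∘ₗ iterComul k A n).compr₂
      (lof k ℕ (CM k A).X n)).flip)

/-- The operator `h_1 ⊗ ⋯ ⊗ h_n ↦ S(h_1) · (h_2 ⊗ ⋯ ⊗ h_n)`. -/
def fT : Module.End k (CM k A).Tot :=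
  DirectSum.toModule k ℕ _ fun n => match n with
    | 0 => 0
    | m + 1 => lof k ℕ (CM k A).X m ∘ₗ LinearMap.mul' k (Pow k A m) ∘ₗ
        TensorProduct.map (iterComul k A m ∘ₗ HopfAlgebra.antipode k) LinearMap.id ∘ₗ
          splitFactor k A m 0

/-- The Hochschild differential on the direct sum of all `C^n`. -/
def bT : Module.End k (CM k A).Tot :=
  DirectSum.toModule k ℕ _ fun n =>
    lof k ℕ (CM k A).X (n + 1) ∘ₗ (CM k A).b n

/-- Connes' differential on the direct sum of all `C^n`. -/
def BT : Module.End k (CM k A).Tot :=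
  DirectSum.toModule k ℕ _ fun n => match n with
    | 0 => 0
    | m + 1 => lof k ℕ (CM k A).X m ∘ₗ (CM k A).B m

theorem dTot_eq : (CM k A).dTot = bT k A + BT k A := by
  refine DirectSum.linearMap_ext _ fun n => ?_
  refine LinearMap.ext fun x => ?_
  cases n <;> simp [CocyclicOperators.dTot, bT, BT]

/-- The pure tensor of a list. -/
def wd : List A → (CM k A).Tot
  | [] => lof k ℕ (CM k A).X 0 (tprod k ![])
  | a :: l => consT k A a (wd l)

variable {k A}

theorem consT_lof (a : A) (n : ℕ) (x : Pow k A n) :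
    consT k A a (lof k ℕ (CM k A).X n x) =
      lof k ℕ (CM k A).X (n + 1) (insertFactor k A n 0 a x) := by
  simp [consT]

theorem snocT_lof (a : A) (n : ℕ) (x : Pow k A n) :
    snocT k A a (lof k ℕ (CM k A).X n x) =
      lof k ℕ (CM k A).X (n + 1) (insertFactor k A n (Fin.last n) a x) := by
  simp [snocT]

theorem actT_lof (a : A) (n : ℕ) (x : Pow k A n) :
    actT k A a (lof k ℕ (CM k A).X n x) =
      lof k ℕ (CM k A).X n (iterComul k A n a * x) := by
  simp [actT]

theorem lof_tprod (n : ℕ) (h : Fin n → A) :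
    lof k ℕ (CM k A).X n (tprod k h) = wd k A (List.ofFn h) := by
  induction n with
  | zero => 
    rw [List.ofFn_zero, wd]
    congr 2
    exact Subsingleton.elim _ _
  | succ n ih =>
    rw [List.ofFn_succ, wd, ← ih, consT_lof, insertFactor_tprod, Fin.insertNth_zero']
    congr 2
    ext i
    refine Fin.cases ?_ (fun i => ?_) i <;> simp

theorem tot_ext {M : Type*} [AddCommGroup M] [Module k M]
    {f g : (CM k A).Tot →ₗ[k] M} (h : ∀ l, f (wd k A l) = g (wd k A l)) : f = g := by
  refine DirectSum.linearMap_ext _ fun n => PiTensorProduct.ext (MultilinearMap.ext fun v => ?_)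
  have := h (List.ofFn v)
  rw [← lof_tprod] at this
  exact this

theorem exists_lof_wd (l : List A) : ∃ x, wd k A l =
    lof k ℕ (CM k A).X l.length x := by
  induction l with
  | nil => exact ⟨_, rfl⟩
  | cons a l ih =>
    obtain ⟨x, hx⟩ := ih
    exact ⟨_, by rw [wd, hx, consT_lof]; rfl⟩

theorem wd_eq_lof (l : List A) : wd k A l =
    lof k ℕ (CM k A).X l.length (tprod k l.get) := by
  rw [lof_tprod, List.ofFn_get]

theorem snocT_wd (a : A) (l : List A) : snocT k A a (wd k A l) = wd k A (l ++ [a]) := by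
  rw [wd_eq_lof, snocT_lof, insertFactor_tprod, lof_tprod, ofFn_insertNth, List.ofFn_get]
  simp

theorem sTot_wd (i : ℕ) (l l' : List A) (a : A) (h : l.length = i) :
    (CM k A).sTot i (wd k A (l ++ a :: l')) =
      counit (R := k) a • wd k A (l ++ l') := by
  obtain ⟨n, v, hn, hv⟩ : ∃ (n : ℕ) (v : Fin (n + 1) → A), i < n + 1 ∧ l ++ a :: l' = List.ofFn v :=
    ⟨l.length + l'.length, fun j => (l ++ a :: l').get (j.cast (by simp; omega)), by omega, by
      refine List.ext_getElem (by simp; omega) fun j h1 h2 => by simp [-List.ofFn_succ]⟩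
  rw [hv, ← lof_tprod, CocyclicOperators.sTot, DirectSum.toModule_lof]
  simp only [hn, dif_pos, comp_apply, codegeneracy, splitFactor_tprod,
    map_tmul, LinearEquiv.coe_coe, TensorProduct.lid_tmul, map_smul, LinearMap.id_apply]
  rw [lof_tprod, ofFn_removeNth, ← hv]
  have : v ⟨i, hn⟩ = a := by
    have h1 : (List.ofFn v)[i]? = some a := by rw [← hv]; simp [← h]
    simpa [hn, -List.ofFn_succ] using h1
  rw [this]
  simp [← h]

theorem sTot_nil (i : ℕ) : (CM k A).sTot i (wd k A []) = 0 := by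
  rw [wd, CocyclicOperators.sTot, DirectSum.toModule_lof]
  rfl

theorem sTot_lof_of_le (n i : ℕ) (h : n ≤ i) (x : Pow k A n) :
    (CM k A).sTot i (lof k ℕ (CM k A).X n x) = 0 := by
  rw [CocyclicOperators.sTot, DirectSum.toModule_lof]
  cases n with
  | zero => rfl
  | succ n => 
    simp only
    rw [dif_neg (by omega)]
    rfl

theorem sTot_zero_consT (a : A) (X : (CM k A).Tot) :
    (CM k A).sTot 0 (consT k A a X) = counit (R := k) a • X := by
  have : (CM k A).sTot 0 ∘ₗ consT k A a = counit (R := k) a • LinearMap.id :=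
    tot_ext fun l => sTot_wd 0 [] l a rfl
  exact LinearMap.congr_fun this X

theorem sTot_succ_consT (i : ℕ) (a : A) (X : (CM k A).Tot) :
    (CM k A).sTot (i + 1) (consT k A a X) =
      consT k A a ((CM k A).sTot i X) := by
  have : (CM k A).sTot (i + 1) ∘ₗ consT k A a =
      consT k A a ∘ₗ (CM k A).sTot i := tot_ext fun l => by
    rw [comp_apply, comp_apply]
    by_cases h : i < l.length
    · obtain ⟨l1, b, l2, rfl, rfl⟩ : ∃ l1 b l2, l = l1 ++ b :: l2 ∧ l1.length = i :=
        ⟨l.take i, l[i], l.drop (i + 1), by simp, by simp; omega⟩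
      rw [sTot_wd _ _ _ _ rfl, map_smul]
      exact sTot_wd _ (a :: l1) _ _ rfl
    · have h1 := sTot_lof_of_le (k := k) l.length i (by omega) (tprod k l.get)
      have h2 := sTot_lof_of_le (k := k) (a :: l).length (i + 1) (by simp; omega) (tprod k (a :: l).get)
      rw [← wd_eq_lof] at h1 h2
      rw [h1, map_zero]
      exact h2
  exact LinearMap.congr_fun this X

theorem actT_nil (a : A) : actT k A a (wd k A []) = counit (R := k) a • wd k A [] := by
  rw [wd, actT_lof, iterComul]
  simp

theorem tprod_cons_eq (n : ℕ) (a : A) (h : Fin n → A) :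
    tprod k (Fin.cons a h : Fin (n + 1) → A) = insertFactor k A n 0 a (tprod k h) := by
  simp

theorem insertFactor_mul (n : ℕ) (i : Fin (n + 1)) (a b : A) (x y : Pow k A n) :
    insertFactor k A n i a x * insertFactor k A n i b y = insertFactor k A n i (a * b) (x * y) := by
  induction x using PiTensorProduct.induction_on with
  | add x x' hx hx' => simp [add_mul, hx, hx']
  | smul_tprod r v =>
    induction y using PiTensorProduct.induction_on with
    | add y y' hy hy' => simp only [mul_add, map_add, hy, hy']
    | smul_tprod s v' =>
      simp only [map_smul, insertFactor_tprod, smul_mul_smul_comm, tprod_mul_tprod]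
      congr 2
      ext j
      induction j using Fin.succAboveCases i <;> simp

variable (k A) in
/-- The operators `a ⊗ b ↦ (X ↦ (a c) ⊗ (b · X))`. -/
def consActT (c : A) : A ⊗[k] A →ₗ[k] Module.End k (CM k A).Tot :=
  TensorProduct.lift ((LinearMap.mul k (Module.End k (CM k A).Tot)).compl₁₂
    (consT k A ∘ₗ LinearMap.mulRight k c) (actT k A))

theorem actT_consT (a c : A) (X : (CM k A).Tot) :
    actT k A a (consT k A c X) = consActT k A c (comul (R := k) a) X := by
  induction X using DirectSum.induction_on with
  | zero => simp
  | add x y hx hy => simp only [map_add, hx, hy]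
  | of n x =>
    change actT k A a (consT k A c (lof k ℕ (CM k A).X n x)) =
      consActT k A c (comul (R := k) a) (lof k ℕ (CM k A).X n x)
    rw [consT_lof, actT_lof, iterComul, comp_apply, comp_apply]
    induction comul (R := k) a with
    | zero => simp
    | add y z hy hz => simp only [map_add, add_mul, hy, hz, LinearMap.add_apply]
    | tmul y z =>
      have h1 := consT_lof (k := k) (y * c) n (iterComul k A n z * x)
      have h2 := actT_lof (k := k) z n x
      simpa [consActT, insertFactor_mul, h2] using h1.symm

theorem τTot_nil : (CM k A).τTot (wd k A []) = wd k A [] := by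
  rw [wd, CocyclicOperators.τTot, DirectSum.toModule_lof]
  rfl

theorem splitFactor_insertFactor (n : ℕ) (i : Fin (n + 1)) (a : A) (x : Pow k A n) :
    splitFactor k A n i (insertFactor k A n i a x) = a ⊗ₜ[k] x := by
  induction x using PiTensorProduct.induction_on with
  | add x x' hx hx' => simp only [map_add, hx, hx', tmul_add]
  | smul_tprod r v => simp

theorem τTot_consT (c : A) (X : (CM k A).Tot) :
    (CM k A).τTot (consT k A c X) =
      actT k A (HopfAlgebra.antipode k c) (snocT k A 1 X) := by
  induction X using DirectSum.induction_on with
  | zero => simp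
  | add x y hx hy => simp only [map_add, hx, hy]
  | of n x =>
    change (CM k A).τTot (consT k A c (lof k ℕ (CM k A).X n x)) =
      actT k A _ (snocT k A 1 (lof k ℕ (CM k A).X n x))
    rw [consT_lof, snocT_lof, actT_lof, CocyclicOperators.τTot, DirectSum.toModule_lof]
    simp [cyclicOp, splitFactor_insertFactor]

theorem fT_nil : fT k A (wd k A []) = 0 := by
  rw [wd, fT, DirectSum.toModule_lof]
  rfl

theorem fT_consT (c : A) (X : (CM k A).Tot) :
    fT k A (consT k A c X) = actT k A (HopfAlgebra.antipode k c) X := by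
  induction X using DirectSum.induction_on with
  | zero => simp
  | add x y hx hy => simp only [map_add, hx, hy]
  | of n x =>
    change fT k A (consT k A c (lof k ℕ (CM k A).X n x)) =
      actT k A _ (lof k ℕ (CM k A).X n x)
    rw [consT_lof, actT_lof, fT, DirectSum.toModule_lof]
    simp [splitFactor_insertFactor]

end Words
end HopfCyclic

namespace Word
theorem del_eq_mark {L M : Type*} [AddCommGroup M] (dup : L → List (L × L)) (w : List L)
    (F : List L → M) : del dup w F = mark w fun u c v =>
      (-1 : ℤ) ^ u.length • dsum dup c fun x y => F (u ++ x :: y :: v) := by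
  induction w generalizing F with
  | nil => rfl
  | cons c w ih =>
    rw [del, mark, ih, ← mark_smul]
    simp [pow_succ']
end Word
namespace HopfCyclic

universe u w

section Words

open PiTensorProduct Coalgebra Word

variable {k : Type u} {A : Type w} [CommRing k] [Ring A] [HopfAlgebra k A]

theorem neg_one_pow_smul (k : Type*) {M : Type*} [CommRing k] [AddCommGroup M] [Module k M] (m : ℕ)
    (x : M) : (-1 : k) ^ m • x = (-1 : ℤ) ^ m • x := by
  rcases Nat.even_or_odd m with h | h <;> simp [h.neg_one_pow]

theorem dsum_eq_lift {M : Type*} [AddCommGroup M] [Module k M] {dup : A → List (A × A)}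
    (hd : ∀ a, ((dup a).map fun q => q.1 ⊗ₜ[k] q.2).sum = comul a) (a : A)
    (F : A ⊗[k] A →ₗ[k] M) : dsum dup a (fun x y => F (x ⊗ₜ y)) = F (comul a) := by
  rw [← hd, map_list_sum, dsum, List.map_map]
  rfl

theorem lof_comulFactor {dup : A → List (A × A)}
    (hd : ∀ a, ((dup a).map fun q => q.1 ⊗ₜ[k] q.2).sum = comul a) (n : ℕ) (j : Fin n)
    (h : Fin n → A) :
    lof k ℕ (CM k A).X (n + 1) (comulFactor k A n j (tprod k h)) =
      dsum dup (h j) fun x y => wd k A ((List.ofFn h).take j ++ x :: y :: (List.ofFn h).drop (j + 1)) := by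
  cases n with
  | zero => exact j.elim0
  | succ n =>
    let F : A ⊗[k] A →ₗ[k] (CM k A).Tot :=
      lof k ℕ (CM k A).X (n + 2) ∘ₗ
        TensorProduct.lift (insertFactor k A (n + 1) j.castSucc) ∘ₗ
        TensorProduct.map LinearMap.id (TensorProduct.lift (insertFactor k A n j)) ∘ₗ
        (TensorProduct.assoc k A A (Pow k A n)).toLinearMap ∘ₗ
          (TensorProduct.mk k _ _).flip (tprod k (j.removeNth h))
    have hF (x y : A) : F (x ⊗ₜ y) =
        wd k A ((List.ofFn h).take j ++ x :: y :: (List.ofFn h).drop (j + 1)) := by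
      simp only [F, comp_apply, LinearMap.flip_apply, TensorProduct.mk_apply,
        LinearEquiv.coe_coe, TensorProduct.assoc_tmul, map_tmul,
        TensorProduct.lift.tmul, insertFactor_tprod, LinearMap.id_apply]
      rw [lof_tprod, ofFn_insertNth, ofFn_insertNth, ofFn_removeNth]
      have : ((List.ofFn h).take j).length = (j : ℕ) := by simp [-List.ofFn_succ]
      simp [-List.ofFn_succ, List.take_append, List.drop_append, this]
    simp only [← hF]
    rw [dsum_eq_lift hd, comulFactor]
    simp [F]

theorem bT_wd {dup : A → List (A × A)}
    (hd : ∀ a, ((dup a).map fun q => q.1 ⊗ₜ[k] q.2).sum = comul a) (l : List A) :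
    bT k A (wd k A l) = bsum dup 1 l (wd k A) := by
  obtain ⟨n, h, rfl⟩ : ∃ (n : ℕ) (h : Fin n → A), l = List.ofFn h := ⟨_, l.get, by simp⟩
  rw [← lof_tprod, bT, DirectSum.toModule_lof, comp_apply, CocyclicOperators.b,
    Fin.sum_univ_succ, Fin.sum_univ_castSucc]
  have h0 : coface k A n 0 = insertFactor k A n 0 1 := rfl
  have h1 : coface k A n (Fin.last n).succ = insertFactor k A n (Fin.last n) 1 := by
    simp only [coface, Fin.cases_succ, Fin.lastCases_last]
  have h2 (j : Fin n) : coface k A n j.castSucc.succ = comulFactor k A n j := by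
    simp only [coface, Fin.cases_succ, Fin.lastCases_castSucc]
  simp only [h0, h1, h2, LinearMap.add_apply, LinearMap.smul_apply, LinearMap.sum_apply, map_add,
    map_smul, map_sum, lof_comulFactor hd]
  rw [bsum, del_eq_mark, mark_eq_sum, ← snocT_wd]
  have h3 : wd k A (1 :: List.ofFn h) = consT k A 1 (wd k A (List.ofFn h)) := rfl
  rw [h3, ← lof_tprod, consT_lof, snocT_lof]
  have h4 : (∑ p : Fin (List.ofFn h).length, (-1 : ℤ) ^ ((List.ofFn h).take p).length •
      dsum dup ((List.ofFn h)[p]) fun x y =>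
        wd k A ((List.ofFn h).take p ++ x :: y :: (List.ofFn h).drop (p + 1))) =
      ∑ p : Fin n, (-1 : k) ^ (p : ℕ) • dsum dup (h p) fun x y =>
        wd k A ((List.ofFn h).take p ++ x :: y :: (List.ofFn h).drop (p + 1)) := by
    refine Fintype.sum_equiv (finCongr (by simp)) _ _ fun p => ?_
    have hp : ((List.ofFn h).take p).length = p := by
      have := p.2
      simp at this ⊢
      omega
    rw [hp, neg_one_pow_smul k]
    simp only [Fin.getElem_fin, List.getElem_ofFn]
    rfl
  rw [h4]
  simp only [Fin.val_zero, Fin.val_succ, Fin.val_castSucc, Fin.val_last, pow_succ',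
    neg_mul, one_mul, neg_smul, neg_one_pow_smul k, List.length_ofFn, pow_zero, one_smul, neg_smul, Finset.sum_neg_distrib]
  abel

theorem multilinear_ext_tmul {n : ℕ} {V W M : Type*} [AddCommGroup V] [AddCommGroup W]
    [AddCommGroup M] [Module k V] [Module k W] [Module k M]
    {f g : MultilinearMap k (fun _ : Fin n => V ⊗[k] W) M}
    (h : ∀ (v : Fin n → V) (w : Fin n → W), f (fun i => v i ⊗ₜ w i) = g (fun i => v i ⊗ₜ w i)) : f = g := by
  have key (s : Finset (Fin n)) : ∀ z : Fin n → V ⊗[k] W, (∀ i ∉ s, ∃ v w, z i = v ⊗ₜ w) →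
      f z = g z := by
    induction s using Finset.induction_on with
    | empty =>
      intro z hz
      choose v w hvw using fun i => hz i (by simp)
      rw [funext hvw, h]
    | insert a s ha ih =>
      intro z hz
      have hi (x : V ⊗[k] W) : f (Function.update z a x) = g (Function.update z a x) := by
        induction x with
        | zero => rw [f.map_coord_zero a (by simp), g.map_coord_zero a (by simp)]
        | add x y hx hy => rw [f.map_update_add, g.map_update_add, hx, hy]
        | tmul x y =>
          refine ih _ fun i his => ?_
          by_cases hia : i = a
          · subst hia
            exact ⟨x, y, by simp⟩
          · rw [Function.update_of_ne hia]
            exact hz i (by simp [hia, his])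
      simpa using hi (z a)
  exact MultilinearMap.ext fun z => key Finset.univ z (by simp)

theorem prod_mulSingle {n : ℕ} (a : Fin n → A) :
    (List.ofFn fun i => Pi.mulSingle (M := fun _ : Fin n => A) i (a i)).prod = a := by
  ext j
  rw [List.ofFn_eq_map, Pi.list_prod_apply, List.map_map]
  have key (l : List (Fin n)) (hl : l.Nodup) :
      (l.map fun i => (Pi.mulSingle (M := fun _ : Fin n => A) i (a i)) j).prod =
        if j ∈ l then a j else 1 := by
    induction l with
    | nil => simp
    | cons i l ih =>
      rw [List.nodup_cons] at hl
      rw [List.map_cons, List.prod_cons, ih hl.2]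
      by_cases h : j = i
      · subst h
        simp [hl.1]
      · simp [h]
  have := key _ (List.nodup_finRange n)
  rw [if_pos (List.mem_finRange j)] at this
  exact this

theorem list_prod_ofFn_tmul {B : Type*} [Ring B] [Algebra k B] {n : ℕ} (a b : Fin n → B) :
    (List.ofFn fun i => a i ⊗ₜ[k] b i).prod = (List.ofFn a).prod ⊗ₜ (List.ofFn b).prod := by
  induction n with
  | zero => simp [Algebra.TensorProduct.one_def]
  | succ n ih => simp [List.ofFn_succ, ih]

theorem prod_singleAlgHom {n : ℕ} (a : Fin n → A) :
    (List.ofFn fun i => singleAlgHom (R := k) (A := fun _ : Fin n => A) i (a i)).prod =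
      PiTensorProduct.tprod k a := by
  have := congrArg (tprodMonoidHom k) (prod_mulSingle a)
  rw [map_list_prod, List.map_ofFn] at this
  exact this

theorem omega_tmul (n : ℕ) (a b : Fin n → A) :
    omega k A n (PiTensorProduct.tprod k fun i => a i ⊗ₜ b i) =
      PiTensorProduct.tprod k a ⊗ₜ PiTensorProduct.tprod k b := by
  rw [omega, PiTensorProduct.lift.tprod, MultilinearMap.compLinearMap_apply,
    MultilinearMap.mkPiAlgebraFin_apply]
  simp only [map_tmul, AlgHom.toLinearMap_apply]
  rw [list_prod_ofFn_tmul, prod_singleAlgHom (k := k),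
    prod_singleAlgHom (k := k)]

variable (k A) in
/-- The components of `Ω ∘ Δ^{⊗ n}` in the tensor square of the direct sum of all `C^n`. -/
def rhoT : (CM k A).Tot →ₗ[k]
    (CM k A).Tot ⊗[k] (CM k A).Tot :=
  DirectSum.toModule k ℕ _ fun n =>
    TensorProduct.map (lof k ℕ (CM k A).X n)
      (lof k ℕ (CM k A).X n) ∘ₗ rho k A n

variable (k A) in
/-- The operators `X ⊗ Y ↦ (a ⊗ X) ⊗ (b ⊗ Y)`. -/
def consConsT : A ⊗[k] A →ₗ[k]
    Module.End k ((CM k A).Tot ⊗[k] (CM k A).Tot) :=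
  TensorProduct.lift ((TensorProduct.mapBilinear (RingHom.id k) (CM k A).Tot
    (CM k A).Tot (CM k A).Tot (CM k A).Tot).compl₁₂
      (consT k A) (consT k A))

theorem consConsT_tmul (a b : A) : consConsT k A (a ⊗ₜ b) =
    TensorProduct.map (consT k A a) (consT k A b) := rfl

theorem omega_cons (n : ℕ) (z : A ⊗[k] A) (v : Fin n → A ⊗[k] A) :
    TensorProduct.map (lof k ℕ (CM k A).X (n + 1))
      (lof k ℕ (CM k A).X (n + 1))
        (omega k A (n + 1) (tprod k (Fin.cons z v : Fin (n + 1) → A ⊗[k] A))) =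
    consConsT k A z (TensorProduct.map (lof k ℕ (CM k A).X n)
      (lof k ℕ (CM k A).X n) (omega k A n (tprod k v))) := by
  let Lm (n : ℕ) := TensorProduct.map (lof k ℕ (CM k A).X n)
      (lof k ℕ (CM k A).X n)
  let f : MultilinearMap k (fun _ : Fin (n + 1) => A ⊗[k] A)
      ((CM k A).Tot ⊗[k] (CM k A).Tot) :=
    (Lm (n + 1) ∘ₗ omega k A (n + 1)).compMultilinearMap (tprod k)
  change f.curryLeft z v = _
  induction z with
  | zero => simp
  | add y z hy hz => rw [map_add, add_apply, hy, hz, map_add, LinearMap.add_apply]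
  | tmul a b =>
    have key : f.curryLeft (a ⊗ₜ b) =
        (consConsT k A (a ⊗ₜ[k] b) ∘ₗ Lm n ∘ₗ omega k A n).compMultilinearMap (tprod k) := by
      refine multilinear_ext_tmul fun x y => ?_
      have h1 : (Fin.cons (a ⊗ₜ[k] b) (fun i => x i ⊗ₜ[k] y i) : Fin (n + 1) → A ⊗[k] A) =
          fun i => (Fin.cons a x : Fin (n + 1) → A) i ⊗ₜ (Fin.cons b y : Fin (n + 1) → A) i := by
        ext i
        induction i using Fin.cases <;> simp
      change Lm (n + 1) (omega k A (n + 1) (tprod k (Fin.cons (a ⊗ₜ[k] b) fun i => x i ⊗ₜ[k] y i))) =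
        consConsT k A (a ⊗ₜ b) (Lm n (omega k A n (tprod k fun i => x i ⊗ₜ[k] y i)))
      rw [h1, omega_tmul, omega_tmul, tprod_cons_eq, tprod_cons_eq]
      simp only [Lm, map_tmul, consConsT_tmul]
      rw [consT_lof, consT_lof]
    exact congrArg (fun f => f v) key

theorem rhoT_consT (a : A) (l : List A) :
    rhoT k A (wd k A (a :: l)) = consConsT k A (comul (R := k) a) (rhoT k A (wd k A l)) := by
  obtain ⟨n, h, rfl⟩ : ∃ (n : ℕ) (h : Fin n → A), l = List.ofFn h := ⟨_, l.get, by simp⟩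
  rw [← List.ofFn_cons, ← lof_tprod (k := k), ← lof_tprod (k := k), rhoT, DirectSum.toModule_lof,
    DirectSum.toModule_lof, comp_apply, comp_apply, rho, rho,
    comp_apply, comp_apply, PiTensorProduct.map_tprod, PiTensorProduct.map_tprod,
    ← omega_cons]
  congr 3
  ext i
  induction i using Fin.cases <;> simp

theorem rhoT_nil : rhoT k A (wd k A []) = wd k A [] ⊗ₜ wd k A [] := by
  rw [wd, rhoT, DirectSum.toModule_lof, comp_apply, rho, comp_apply,
    PiTensorProduct.map_tprod]
  have := omega_tmul (k := k) (A := A) 0 ![] ![]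
  rw [show (fun i : Fin 0 => ![] i ⊗ₜ[k] ![] i : Fin 0 → A ⊗[k] A) = fun i => comul (![] i) from
    Subsingleton.elim _ _] at this
  rw [this]
  simp

variable (k A) in
/-- The product of the codegeneracies with indices in a list of positions. -/
abbrev sList {n : ℕ} (l : List (Fin n)) : Module.End k (CM k A).Tot :=
  (l.map fun a : Fin n => (CM k A).sTot (a : ℕ)).prod

theorem sList_succ {n : ℕ} (l : List (Fin n)) (a : A) (X : (CM k A).Tot) :
    sList k A (l.map Fin.succ) (consT k A a X) = consT k A a (sList k A l X) := by
  induction l with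
  | nil => rfl
  | cons i l ih =>
    simp only [sList, List.map_cons, List.prod_cons, Module.End.mul_apply] at ih ⊢
    rw [ih, Fin.val_succ, sTot_succ_consT]

theorem sList_zero {n : ℕ} (l : List (Fin n)) (a : A) (X : (CM k A).Tot) :
    sList k A (0 :: l.map Fin.succ) (consT k A a X) = counit (R := k) a • sList k A l X := by
  have := sList_succ l a X
  simp only [sList, List.map_cons, List.prod_cons, Module.End.mul_apply] at this ⊢
  rw [this]
  exact sTot_zero_consT _ _

theorem map_sList_left {n : ℕ} (l r : List (Fin n)) (a : A)
    (Y : (CM k A).Tot ⊗[k] (CM k A).Tot) :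
    TensorProduct.map (sList k A (r.map Fin.succ)) (sList k A (0 :: l.map Fin.succ))
      (consConsT k A (comul (R := k) a) Y) =
      TensorProduct.map (consT k A a) LinearMap.id (TensorProduct.map (sList k A r) (sList k A l) Y) := by
  have key (z : A ⊗[k] A) : TensorProduct.map (sList k A (r.map Fin.succ)) (sList k A (0 :: l.map Fin.succ))
      (consConsT k A z Y) = TensorProduct.map (consT k A (TensorProduct.rid k A
        (LinearMap.lTensor A (counit (R := k)) z))) LinearMap.id
          (TensorProduct.map (sList k A r) (sList k A l) Y) := by
    induction z with
    | zero => simp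
    | add y z hy hz => simp only [map_add, LinearMap.add_apply, hy, hz, TensorProduct.map_add_left]
    | tmul x y =>
      induction Y with
      | zero => simp
      | add Y Z hY hZ => simp only [map_add, hY, hZ]
      | tmul X Y =>
        simp [consConsT_tmul, sList_succ, sList_zero, TensorProduct.smul_tmul]
  rw [key, Coalgebra.lTensor_counit_comul]
  simp

theorem map_sList_right {n : ℕ} (l r : List (Fin n)) (a : A)
    (Y : (CM k A).Tot ⊗[k] (CM k A).Tot) :
    TensorProduct.map (sList k A (0 :: r.map Fin.succ)) (sList k A (l.map Fin.succ))
      (consConsT k A (comul (R := k) a) Y) =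
      TensorProduct.map LinearMap.id (consT k A a) (TensorProduct.map (sList k A r) (sList k A l) Y) := by
  have key (z : A ⊗[k] A) : TensorProduct.map (sList k A (0 :: r.map Fin.succ)) (sList k A (l.map Fin.succ))
      (consConsT k A z Y) = TensorProduct.map LinearMap.id (consT k A (TensorProduct.lid k A
        (LinearMap.rTensor A (counit (R := k)) z))) (TensorProduct.map (sList k A r) (sList k A l) Y) := by
    induction z with
    | zero => simp
    | add y z hy hz => simp only [map_add, LinearMap.add_apply, hy, hz, TensorProduct.map_add_right]
    | tmul x y =>
      induction Y with
      | zero => simp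
      | add Y Z hY hZ => simp only [map_add, hY, hZ]
      | tmul X Y =>
        simp [consConsT_tmul, sList_succ, sList_zero, TensorProduct.smul_tmul]
  rw [key, Coalgebra.rTensor_counit_comul]
  simp

theorem unsh_sList {M : Type*} [AddCommGroup M] [Module k M] {n : ℕ} (h : Fin n → A)
    (G : List (Fin n) → List (Fin n) →
      (CM k A).Tot ⊗[k] (CM k A).Tot →ₗ[k] M) :
    (unsh (List.finRange n) fun l r => G l r (TensorProduct.map (sList k A r) (sList k A l)
      (rhoT k A (wd k A ((List.finRange n).map h))))) =
    unsh (List.finRange n) fun l r => G l r (wd k A (l.map h) ⊗ₜ wd k A (r.map h)) := by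
  induction n with
  | zero => simp [unsh, rhoT_nil]; rfl
  | succ n ih =>
    have hf : (List.finRange (n + 1)).map h = h 0 :: (List.finRange n).map (h ∘ Fin.succ) := by
      rw [List.finRange_succ, List.map_cons, List.map_map]
    rw [hf, rhoT_consT, List.finRange_succ, unsh, unsh, unsh_map, unsh_map, unsh_map, unsh_map]
    simp only [map_sList_left, map_sList_right, List.length_map]
    have h1 := ih (h ∘ Fin.succ) fun l r => G (0 :: l.map Fin.succ) (r.map Fin.succ) ∘ₗ
      TensorProduct.map (consT k A (h 0)) LinearMap.id
    have h2 := ih (h ∘ Fin.succ) fun l r => ((-1 : ℤ) ^ l.length • G (l.map Fin.succ)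
      (0 :: r.map Fin.succ)) ∘ₗ TensorProduct.map LinearMap.id (consT k A (h 0))
    simp only [comp_apply, LinearMap.smul_apply] at h1 h2
    rw [h1, h2]
    simp [wd]

end Words
end HopfCyclic

namespace Word
theorem mark_eq_sum_of_length {L M : Type*} [AddCommGroup M] (w : List L) {m : ℕ} (hm : w.length = m)
    (F : List L → L → List L → M) :
    mark w F = ∑ p : Fin m, F (w.take p) (w[(p : ℕ)]'(by omega)) (w.drop (p + 1)) := by
  subst hm
  exact mark_eq_sum w F

/-- The sign of a pair of rotations of two words. -/
def cycSgn {M : Type*} [AddCommGroup M] (p p' q q' : ℕ) (x : M) : M :=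
  (-1 : ℤ) ^ (p * p') • (-1 : ℤ) ^ p' • (-1 : ℤ) ^ (q * q') • (-1 : ℤ) ^ q • x

theorem cycLR_eq {L M : Type*} [AddCommGroup M] (w : List L) (H : List L → List L → M) :
    cycLR w H = unshLR w fun l a l' r b r' =>
      cycSgn l.length l'.length r.length r'.length (H (a :: l' ++ l) (b :: r' ++ r)) := rfl

theorem cycSgn_eq (k : Type*) {M : Type*} [CommRing k] [AddCommGroup M] [Module k M]
    (p p' q q' : ℕ) (x : M) : cycSgn p p' q q' x =
      ((-1 : k) ^ (p * p') * (-1) ^ p' * (-1) ^ (q * q') * (-1) ^ q) • x := by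
  have h (n : ℕ) (x : M) : (-1 : ℤ) ^ n • x = (-1 : k) ^ n • x := by
    rcases Nat.even_or_odd n with h | h <;> simp [h.neg_one_pow]
  simp only [cycSgn, h, smul_smul, mul_assoc]
end Word
namespace HopfCyclic

universe u w

section Words

open PiTensorProduct Coalgebra Word

variable (k : Type u) (A : Type w) [CommRing k] [Ring A] [HopfAlgebra k A]

/-- The shuffle coproduct of cochains. -/
def DT : (CM k A).Tot →ₗ[k]
    (CM k A).Tot ⊗[k] (CM k A).Tot :=
  DirectSum.toModule k ℕ _ fun n =>
    (CM k A).sh (CM k A) n ∘ₗ rho k A n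

/-- The cyclic shuffle coproduct of cochains. -/
def ET : (CM k A).Tot →ₗ[k]
    (CM k A).Tot ⊗[k] (CM k A).Tot :=
  DirectSum.toModule k ℕ _ fun n =>
    (CM k A).sh' (CM k A) n ∘ₗ rho k A n

theorem cup'_eq : cup' k A = DT k A + ET k A := by
  refine DirectSum.linearMap_ext _ fun n => LinearMap.ext fun x => ?_
  simp only [cup', CocyclicOperators.shTilde, rhoTot, DT, ET, comp_apply,
    DirectSum.toModule_lof, LinearMap.add_apply]

variable {k A}

theorem rhoT_lof (n : ℕ) (x : Pow k A n) :
    TensorProduct.map (lof k ℕ (CM k A).X n)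
      (lof k ℕ (CM k A).X n) (rho k A n x) =
    rhoT k A (lof k ℕ (CM k A).X n x) := by
  rw [rhoT, DirectSum.toModule_lof]
  rfl

theorem sLast_eq {n : ℕ} (i : ℕ) (σ : Equiv.Perm (Fin n)) :
    (CM k A).sLast i σ = sList k A (((List.finRange n).drop i).map σ) := by
  rw [CocyclicOperators.sLast, sList, List.map_map]
  rfl

theorem sFirst_eq {n : ℕ} (i : ℕ) (σ : Equiv.Perm (Fin n)) :
    (CM k A).sFirst i σ = sList k A (((List.finRange n).take i).map σ) := by
  rw [CocyclicOperators.sFirst, sList, List.map_map]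
  rfl

theorem DT_wd (w : List A) : DT k A (wd k A w) = unsh w fun l r => wd k A l ⊗ₜ wd k A r := by
  obtain ⟨n, h, rfl⟩ : ∃ (n : ℕ) (h : Fin n → A), w = (List.finRange n).map h :=
    ⟨_, w.get, by simp [← List.ofFn_eq_map]⟩
  have := unsh_sList h fun l r => LinearMap.id (R := k)
  simp only [LinearMap.id_apply] at this
  rw [unsh_map, ← this, ← List.ofFn_eq_map, ← lof_tprod, DT, DirectSum.toModule_lof,
    comp_apply, CocyclicOperators.sh, comp_apply, rhoT_lof]
  simp only [LinearMap.sum_apply, LinearMap.smul_apply, sLast_eq, sFirst_eq]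
  have h2 := sum_shuffles (fun i : Fin n => i) fun l r => TensorProduct.map (sList k A r) (sList k A l)
    (rhoT k A (lof k ℕ (CM k A).X n (PiTensorProduct.tprod k h)))
  rw [List.map_id'] at h2
  exact h2

theorem sum_mark_mark {M : Type*} [AddCommGroup M] {n i : ℕ} (hi : i ≤ n) (σ : Equiv.Perm (Fin n))
    (F : ℕ → ℕ → ℕ → ℕ → M) :
    (∑ p : Fin n, ∑ r : Fin n, if (p : ℕ) < i ∧ i ≤ (r : ℕ) ∧ σ p < σ r then
      F p (i - p - 1) (r - i) ((n - i) - (r - i) - 1) else 0) =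
    mark (((List.finRange n).take i).map σ) fun u a v =>
      mark (((List.finRange n).drop i).map σ) fun u' b v' =>
        if a < b then F u.length v.length u'.length v'.length else 0 := by
  obtain ⟨j, rfl⟩ := Nat.exists_eq_add_of_le hi
  rw [mark_eq_sum_of_length _ (m := i) (by simp)]
  simp only [mark_eq_sum_of_length (((List.finRange (i + j)).drop i).map σ) (m := j) (by simp),
    Fin.sum_univ_add]
  simp only [Fin.val_castAdd, Fin.val_natAdd]
  have h1 (p : Fin i) : min (p : ℕ) (min i (i + j)) = p := by omega
  have h2 (p : Fin j) : min (p : ℕ) j = p := by omega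
  have h3 (q : Fin i) : ¬ (i ≤ (q : ℕ)) := by omega
  simp [h1, h2, h3, List.getElem_take, Nat.sub_sub, Nat.add_sub_add_left]
  rfl

theorem ET_wd (w : List A) : ET k A (wd k A w) = unshLR w fun l a l' r b r' =>
    cycSgn l.length l'.length r.length r'.length
      ((CM k A).sTot l'.length
          (((CM k A).τTot ^ (l.length + 1)) (wd k A (l ++ a :: l'))) ⊗ₜ[k]
        (CM k A).sTot r'.length
          (((CM k A).τTot ^ (r.length + 1)) (wd k A (r ++ b :: r')))) := by
  obtain ⟨n, h, rfl⟩ : ∃ (n : ℕ) (h : Fin n → A), w = (List.finRange n).map h :=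
    ⟨_, w.get, by simp [← List.ofFn_eq_map]⟩
  let Φ (p p' q q' : ℕ) : (CM k A).Tot ⊗[k] (CM k A).Tot →ₗ[k]
      (CM k A).Tot ⊗[k] (CM k A).Tot :=
    ((-1 : k) ^ (p * p') * (-1) ^ p' * (-1) ^ (q * q') * (-1) ^ q) •
      TensorProduct.map ((CM k A).sTot p' * (CM k A).τTot ^ (p + 1))
        ((CM k A).sTot q' * (CM k A).τTot ^ (q + 1))
  let X := wd k A ((List.finRange n).map h)
  let G (l r : List (Fin n)) : (CM k A).Tot ⊗[k] (CM k A).Tot →ₗ[k]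
      (CM k A).Tot ⊗[k] (CM k A).Tot :=
    mark l fun u a v => mark r fun u' b v' => if a < b then
      Φ u.length v.length u'.length v'.length else 0
  have hmark (l : List (Fin n)) (F : List (Fin n) → Fin n → List (Fin n) →
      (CM k A).Tot ⊗[k] (CM k A).Tot →ₗ[k]
      (CM k A).Tot ⊗[k] (CM k A).Tot) (Y) :
      mark l F Y = mark l fun u a v => F u a v Y := by
    induction l generalizing F with
    | nil => rfl
    | cons a l ih => simp only [mark, LinearMap.add_apply, ih]
  have hG (l r : List (Fin n)) (Y) : G l r Y = mark l fun u a v => mark r fun u' b v' => if a < b then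
      Φ u.length v.length u'.length v'.length Y else 0 := by
    simp only [G, hmark]
    refine mark_congr l fun u a v => mark_congr r fun u' b v' => ?_
    split_ifs <;> rfl
  have key : (unsh (List.finRange n) fun l r => G l r (TensorProduct.map (sList k A r) (sList k A l)
      (rhoT k A X))) = unshLR (List.finRange n) fun l a l' r b r' =>
      Φ l.length l'.length r.length r'.length
        (wd k A ((l ++ a :: l').map h) ⊗ₜ wd k A ((r ++ b :: r').map h)) := by
    rw [unsh_sList, ← unsh_mark_mark _ (List.pairwise_lt_finRange n)]
    refine unsh_congr _ fun l r _ => ?_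
    rw [hG]
    refine mark_congr_mem l fun u a v e => mark_congr_mem r fun u' b v' e' => ?_
    rw [e, e']
  rw [unshLR_map]
  have h3 : ET k A X = unsh (List.finRange n) fun l r =>
      G l r (TensorProduct.map (sList k A r) (sList k A l) (rhoT k A X)) := by
    have h2 := sum_shuffles (fun i : Fin n => i) fun l r => 
      G l r (TensorProduct.map (sList k A r) (sList k A l) (rhoT k A X))
    rw [List.map_id'] at h2
    rw [← h2]
    have hX : X = lof k ℕ (CM k A).X n (PiTensorProduct.tprod k h) := by
      rw [lof_tprod, List.ofFn_eq_map]
    rw [hX, ET, DirectSum.toModule_lof, comp_apply, CocyclicOperators.sh',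
      comp_apply, rhoT_lof, ← hX]
    simp only [LinearMap.sum_apply, hG]
    rw [← Finset.sum_subset (s₁ := Finset.Ioo 0 n) (s₂ := Finset.range (n + 1))]
    · refine Finset.sum_congr rfl fun i hi => Finset.sum_congr rfl fun σ hσ => ?_
      rw [Finset.mem_Ioo] at hi
      rw [← sum_mark_mark (by omega) σ fun p p' q q' => Φ p p' q q' (TensorProduct.map
        (sList k A (((List.finRange n).drop i).map σ)) (sList k A (((List.finRange n).take i).map σ))
          (rhoT k A X))]
      simp only [Finset.smul_sum]
      refine Finset.sum_congr rfl fun p _ => Finset.sum_congr rfl fun r _ => ?_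
      split_ifs with hc
      · rw [LinearMap.smul_apply, sLast_eq, sFirst_eq, TensorProduct.map_mul, mul_comm (_ * _), mul_smul]
        congr 1
        simp only [Φ, LinearMap.smul_apply]
        refine (Int.cast_smul_eq_zsmul k _ _).symm.trans ?_
        congr 1
        push_cast
        obtain ⟨a, rfl⟩ : ∃ a, i = p + a + 1 := ⟨i - p - 1, by omega⟩
        obtain ⟨q, hq⟩ : ∃ q, (r : ℕ) = p + a + 1 + q := ⟨r - (p + a + 1), by omega⟩
        obtain ⟨c, hc⟩ : ∃ c, n = p + a + 1 + q + c + 1 := ⟨n - (p + a + 1 + q) - 1, by omega⟩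
        have e1 : p + a + 1 - (p : ℕ) - 1 = a := by omega
        have e2 : (r : ℕ) - (p + a + 1) = q := by omega
        have e3 : n - (p + a + 1) - q - 1 = c := by omega
        have e4 : n - (p + a + 1) - 1 = q + c := by omega
        have e5 : (p : ℕ) + a + 1 - 1 = p + a := by omega
        rw [e1, e2, e3, e4, e5]
        have h1 (m : ℕ) : (-1 : k) ^ (m * m) = (-1) ^ m := by
          rw [pow_mul]
          rcases Nat.even_or_odd m with h | h <;> simp [h.neg_one_pow]
        simp only [mul_add, pow_add, h1]
        have h2 : (-1 : k) ^ (p : ℕ) * (-1) ^ (p : ℕ) = 1 := by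
          rw [← mul_pow]; simp
        linear_combination ((-1 : k) ^ a * (-1) ^ (p * a : ℕ) * ((-1) ^ q * (-1) ^ (q * c))) * h2
      · simp
    · intro i hi
      simp at hi ⊢
      omega
    · intro i hi hi'
      refine Finset.sum_eq_zero fun σ _ => ?_
      simp at hi hi'
      rcases Nat.eq_zero_or_pos i with h0 | h0
      · subst h0; simp [mark]
      · have : i = n := by omega
        subst this
        have : (List.finRange i).drop i = [] := by simp
        simp [this, mark, mark_zero]
  rw [h3, key]
  refine unshLR_congr _ fun l a l' r b r' => ?_
  rw [cycSgn_eq k]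
  simp [Φ]

end Words
end HopfCyclic

namespace HopfCyclic

universe u w

section Action

open PiTensorProduct Coalgebra Word

variable {k : Type u} {A : Type w} [CommRing k] [Ring A] [HopfAlgebra k A]

theorem consActT_tmul (c x y : A) (X : (CM k A).Tot) :
    consActT k A c (x ⊗ₜ y) X = consT k A (x * c) (actT k A y X) := rfl

theorem actT_one (X : (CM k A).Tot) : actT k A 1 X = X := by
  suffices h : actT k A 1 = LinearMap.id from LinearMap.congr_fun h X
  refine tot_ext fun l => ?_
  induction l with
  | nil => simp [actT_nil]
  | cons c l ih =>
    rw [wd, actT_consT, Bialgebra.comul_one, Algebra.TensorProduct.one_def, consActT_tmul, ih]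
    simp

theorem actT_mul (a b : A) (X : (CM k A).Tot) :
    actT k A (a * b) X = actT k A a (actT k A b X) := by
  suffices h : ∀ l a b, actT k A (a * b) (wd k A l) = actT k A a (actT k A b (wd k A l)) from
    LinearMap.congr_fun (tot_ext (g := actT k A a ∘ₗ actT k A b) fun l => h l a b) X
  intro l
  induction l with
  | nil => simp [actT_nil, smul_smul, mul_comm]
  | cons c l ih =>
    intro a b
    rw [wd, actT_consT, actT_consT, Bialgebra.comul_mul]
    induction comul (R := k) b with
    | zero => simp
    | add y z hy hz => simp only [mul_add, map_add, LinearMap.add_apply, hy, hz]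
    | tmul p q =>
      rw [consActT_tmul, actT_consT]
      induction comul (R := k) a with
      | zero => simp
      | add y z hy hz => simp only [add_mul, map_add, LinearMap.add_apply, hy, hz]
      | tmul r s =>
        rw [Algebra.TensorProduct.tmul_mul_tmul, consActT_tmul, consActT_tmul, ih, mul_assoc]

theorem snocT_consT (a c : A) (X : (CM k A).Tot) :
    snocT k A a (consT k A c X) = consT k A c (snocT k A a X) := by
  suffices h : snocT k A a ∘ₗ consT k A c = consT k A c ∘ₗ snocT k A a from LinearMap.congr_fun h X
  refine tot_ext fun l => ?_
  have := snocT_wd (k := k) a (c :: l)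
  rw [comp_apply, comp_apply, snocT_wd]
  exact this

theorem snocT_nil (a : A) : snocT k A a (wd k A []) = consT k A a (wd k A []) := snocT_wd a []

/-- Induction on cochains by first letters. -/
theorem tot_induction {P : (CM k A).Tot → Prop} (X : (CM k A).Tot)
    (hnil : P (wd k A [])) (hcons : ∀ c X, P X → P (consT k A c X))
    (hadd : ∀ X Y, P X → P Y → P (X + Y)) (hsmul : ∀ (r : k) X, P X → P (r • X)) : P X := by
  have h1 (l : List A) : P (wd k A l) := by
    induction l with
    | nil => exact hnil
    | cons c l ih => exact hcons c _ ih
  induction X using DirectSum.induction_on with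
  | zero => simpa using hsmul 0 _ hnil
  | add X Y hX hY => exact hadd X Y hX hY
  | of n x =>
    change P (lof k ℕ (CM k A).X n x)
    induction x using PiTensorProduct.induction_on with
    | smul_tprod r v => rw [map_smul, lof_tprod]; exact hsmul _ _ (h1 _)
    | add x y hx hy => rw [map_add]; exact hadd _ _ hx hy

variable (k A) in
/-- The operators `a ⊗ b ↦ (X ↦ a ⊗ b ⊗ X)`. -/
def cons₂T : A ⊗[k] A →ₗ[k] Module.End k (CM k A).Tot :=
  TensorProduct.lift ((LinearMap.mul k (Module.End k (CM k A).Tot)).compl₁₂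
    (consT k A) (consT k A))

theorem cons₂T_tmul (x y : A) (X : (CM k A).Tot) :
    cons₂T k A (x ⊗ₜ y) X = consT k A x (consT k A y X) := rfl

variable (k A) in
/-- The operators `a ⊗ b ↦ (X ↦ S(a) · ((b c) ⊗ X))`. -/
def antConsT (c : A) : A ⊗[k] A →ₗ[k] Module.End k (CM k A).Tot :=
  TensorProduct.lift ((LinearMap.mul k (Module.End k (CM k A).Tot)).compl₁₂
    (actT k A ∘ₗ HopfAlgebra.antipode k) (consT k A ∘ₗ LinearMap.mulRight k c))

theorem antConsT_tmul (c x y : A) (X : (CM k A).Tot) :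
    antConsT k A c (x ⊗ₜ y) X = actT k A (HopfAlgebra.antipode k x) (consT k A (y * c) X) := rfl

variable (k A) in
/-- The operators `a ⊗ b ↦ (X ↦ S(a) · (X ⊗ (b c)))`. -/
def antSnocT (c : A) : A ⊗[k] A →ₗ[k] Module.End k (CM k A).Tot :=
  TensorProduct.lift ((LinearMap.mul k (Module.End k (CM k A).Tot)).compl₁₂
    (actT k A ∘ₗ HopfAlgebra.antipode k) (snocT k A ∘ₗ LinearMap.mulRight k c))

theorem antSnocT_tmul (c x y : A) (X : (CM k A).Tot) :
    antSnocT k A c (x ⊗ₜ y) X = actT k A (HopfAlgebra.antipode k x) (snocT k A (y * c) X) := rfl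

variable (k A) in
/-- The operators `a ⊗ b ↦ (X ↦ S(a) · ((b · X) ⊗ c))`. -/
def antSnocActT (c : A) : A ⊗[k] A →ₗ[k] Module.End k (CM k A).Tot :=
  TensorProduct.lift ((LinearMap.mul k (Module.End k (CM k A).Tot)).compl₁₂
    (actT k A ∘ₗ HopfAlgebra.antipode k) (LinearMap.mulLeft k (snocT k A c) ∘ₗ actT k A))

theorem antSnocActT_tmul (c x y : A) (X : (CM k A).Tot) :
    antSnocActT k A c (x ⊗ₜ y) X =
      actT k A (HopfAlgebra.antipode k x) (snocT k A c (actT k A y X)) := rfl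

variable (k A) in
/-- The grading operator `(-1)^n`. -/
abbrev sgnT : Module.End k (CM k A).Tot := gradeSign k (CM k A).X

theorem sgnT_lof (n : ℕ) (x : Pow k A n) :
    sgnT k A (lof k ℕ (CM k A).X n x) =
      (-1 : ℤ) ^ n • lof k ℕ (CM k A).X n x := by
  rw [sgnT, gradeSign, DirectSum.toModule_lof, LinearMap.smul_apply, neg_one_pow_smul]

theorem sgnT_wd (l : List A) : sgnT k A (wd k A l) = (-1 : ℤ) ^ l.length • wd k A l := by
  obtain ⟨x, hx⟩ := exists_lof_wd (k := k) l
  rw [hx, sgnT_lof]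

theorem sgnT_consT (c : A) (X : (CM k A).Tot) :
    sgnT k A (consT k A c X) = -consT k A c (sgnT k A X) := by
  suffices h : sgnT k A ∘ₗ consT k A c = -(consT k A c ∘ₗ sgnT k A) from LinearMap.congr_fun h X
  refine tot_ext fun l => ?_
  have := sgnT_wd (k := k) (c :: l)
  rw [comp_apply, LinearMap.neg_apply, comp_apply, sgnT_wd]
  refine this.trans ?_
  simp [pow_succ', wd]

theorem sgnT_snocT (c : A) (X : (CM k A).Tot) :
    sgnT k A (snocT k A c X) = -snocT k A c (sgnT k A X) := by
  suffices h : sgnT k A ∘ₗ snocT k A c = -(snocT k A c ∘ₗ sgnT k A) from LinearMap.congr_fun h X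
  refine tot_ext fun l => ?_
  rw [comp_apply, LinearMap.neg_apply, comp_apply, sgnT_wd, map_zsmul, snocT_wd,
    sgnT_wd]
  simp [pow_succ']

theorem sgnT_actT (c : A) (X : (CM k A).Tot) :
    sgnT k A (actT k A c X) = actT k A c (sgnT k A X) := by
  suffices h : sgnT k A ∘ₗ actT k A c = actT k A c ∘ₗ sgnT k A from LinearMap.congr_fun h X
  refine DirectSum.linearMap_ext _ fun n => LinearMap.ext fun x => ?_
  simp only [comp_apply]
  rw [actT_lof, sgnT_lof, sgnT_lof, map_zsmul, actT_lof]

theorem sgnT_sgnT (X : (CM k A).Tot) : sgnT k A (sgnT k A X) = X := by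
  suffices h : sgnT k A ∘ₗ sgnT k A = LinearMap.id from LinearMap.congr_fun h X
  refine DirectSum.linearMap_ext _ fun n => LinearMap.ext fun x => ?_
  simp only [comp_apply]
  rw [sgnT_lof, map_zsmul, sgnT_lof, sign_sq]
  rfl

variable (k A) in
/-- The signed sum of the inner cofaces. -/
def delT : Module.End k (CM k A).Tot :=
  consT k A 1 - snocT k A 1 ∘ₗ sgnT k A - bT k A

theorem bT_eq (X : (CM k A).Tot) :
    bT k A X = consT k A 1 X - snocT k A 1 (sgnT k A X) - delT k A X := by
  simp [delT]

theorem delT_wd {dup : A → List (A × A)}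
    (hd : ∀ a, ((dup a).map fun q => q.1 ⊗ₜ[k] q.2).sum = comul a) (l : List A) :
    delT k A (wd k A l) = del dup l (wd k A) := by
  simp only [delT, LinearMap.sub_apply, comp_apply, bT_wd hd, bsum, sgnT_wd, map_zsmul,
    snocT_wd, wd]
  abel

variable (k A) in
theorem exists_dup : ∃ dup : A → List (A × A),
    ∀ a, ((dup a).map fun q => q.1 ⊗ₜ[k] q.2).sum = comul a := by
  have key (z : A ⊗[k] A) : ∃ l : List (A × A), (l.map fun q => q.1 ⊗ₜ[k] q.2).sum = z := by
    induction z with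
    | zero => exact ⟨[], rfl⟩
    | tmul x y => exact ⟨[(x, y)], by simp⟩
    | add y z hy hz =>
      obtain ⟨l, rfl⟩ := hy
      obtain ⟨l', rfl⟩ := hz
      exact ⟨l ++ l', by simp⟩
  choose dup hd using fun a : A => key (comul a)
  exact ⟨dup, hd⟩

theorem delT_nil : delT k A (wd k A []) = 0 := by
  obtain ⟨dup, hd⟩ := exists_dup k A
  rw [delT_wd hd]
  rfl

theorem delT_consT (c : A) (X : (CM k A).Tot) :
    delT k A (consT k A c X) = cons₂T k A (comul (R := k) c) X - consT k A c (delT k A X) := by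
  obtain ⟨dup, hd⟩ := exists_dup k A
  suffices h : delT k A ∘ₗ consT k A c = cons₂T k A (comul (R := k) c) - consT k A c ∘ₗ delT k A from
    LinearMap.congr_fun h X
  refine tot_ext fun l => ?_
  rw [comp_apply, LinearMap.sub_apply, comp_apply]
  have h1 := delT_wd hd (c :: l)
  rw [wd] at h1
  have h3 : cons₂T k A (comul (R := k) c) (wd k A l) = dsum dup c fun x y => wd k A (x :: y :: l) :=
    (dsum_eq_lift hd c ((cons₂T k A).flip (wd k A l))).symm
  rw [h1, del, h3, delT_wd hd]
  have h2 : consT k A c (del dup l (wd k A)) = del dup l fun v => consT k A c (wd k A v) := by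
    have (l : List A) (F : List A → (CM k A).Tot) (T : Module.End k (CM k A).Tot) :
        T (del dup l F) = del dup l fun v => T (F v) := by
      induction l generalizing F with
      | nil => simp [del]
      | cons a l ih => simp [del, ih, dsum, map_list_sum, Function.comp_def]
    exact this l _ _
  rw [h2, neg_one_smul, sub_eq_add_neg]
  rfl

theorem delT_snocT (c : A) (hc : comul (R := k) c = c ⊗ₜ c) (X : (CM k A).Tot) :
    delT k A (snocT k A c X) =
      snocT k A c (delT k A X) + sgnT k A (snocT k A c (snocT k A c X)) := by
  induction X using tot_induction with
  | hadd X Y hX hY => simp only [map_add, hX, hY]; abel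
  | hsmul r X hX => simp only [map_smul, hX, smul_add]
  | hnil =>
    rw [snocT_nil, delT_consT, delT_nil, hc, cons₂T_tmul, snocT_consT, snocT_nil, sgnT_consT,
      sgnT_consT, sgnT_wd]
    simp
  | hcons d X hX =>
    have h (z : A ⊗[k] A) : cons₂T k A z (snocT k A c X) = snocT k A c (cons₂T k A z X) := by
      induction z with
      | zero => simp
      | add y z hy hz => simp only [map_add, LinearMap.add_apply, hy, hz]
      | tmul x y => rw [cons₂T_tmul, cons₂T_tmul, snocT_consT, snocT_consT]
    rw [snocT_consT, snocT_consT, delT_consT, delT_consT, hX, h, map_sub, snocT_consT, sgnT_consT,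
      map_add]
    abel

variable (k A) in
/-- The operators `a ⊗ b ⊗ c ↦ (X ↦ a ⊗ b ⊗ c ⊗ X)`. -/
def cons₃T : A ⊗[k] (A ⊗[k] A) →ₗ[k] Module.End k (CM k A).Tot :=
  TensorProduct.lift ((LinearMap.mul k (Module.End k (CM k A).Tot)).compl₁₂
    (consT k A) (cons₂T k A))

theorem cons₃T_tmul (x : A) (z : A ⊗[k] A) (X : (CM k A).Tot) :
    cons₃T k A (x ⊗ₜ z) X = consT k A x (cons₂T k A z X) := rfl

theorem cons₃T_assoc (z : A ⊗[k] A) (y : A) (X : (CM k A).Tot) :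
    cons₃T k A (TensorProduct.assoc k A A A (z ⊗ₜ y)) X = cons₂T k A z (consT k A y X) := by
  induction z with
  | zero => simp
  | add y z hy hz => simp only [add_tmul, map_add, LinearMap.add_apply, hy, hz]
  | tmul x z => rfl

theorem delT_cons₂T (z : A ⊗[k] A) (X : (CM k A).Tot) :
    delT k A (cons₂T k A z X) =
      cons₃T k A (TensorProduct.assoc k A A A (comul.rTensor A z)) X -
        cons₃T k A (comul.lTensor A z) X + cons₂T k A z (delT k A X) := by
  induction z with
  | zero => simp
  | add y z hy hz => simp only [map_add, LinearMap.add_apply, hy, hz]; abel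
  | tmul x y =>
    rw [cons₂T_tmul, delT_consT, delT_consT, LinearMap.rTensor_tmul, LinearMap.lTensor_tmul,
      cons₃T_assoc, cons₃T_tmul, cons₂T_tmul, map_sub]
    abel

theorem delT_delT (X : (CM k A).Tot) : delT k A (delT k A X) = 0 := by
  induction X using tot_induction with
  | hadd X Y hX hY => simp only [map_add, hX, hY, add_zero]
  | hsmul r X hX => simp only [map_smul, hX, smul_zero]
  | hnil => simp [delT_nil]
  | hcons c X hX =>
    rw [delT_consT, map_sub, delT_consT, delT_cons₂T, hX, map_zero, sub_zero,
      Coalgebra.coassoc_apply]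
    abel

theorem sgnT_bT (X : (CM k A).Tot) : sgnT k A (bT k A X) = -bT k A (sgnT k A X) := by
  suffices h : sgnT k A ∘ₗ bT k A = -(bT k A ∘ₗ sgnT k A) from LinearMap.congr_fun h X
  refine DirectSum.linearMap_ext _ fun n => LinearMap.ext fun x => ?_
  simp only [comp_apply, LinearMap.neg_apply]
  rw [sgnT_lof, map_zsmul, bT, DirectSum.toModule_lof, comp_apply, sgnT_lof, pow_succ']
  simp

theorem sgnT_delT (X : (CM k A).Tot) :
    sgnT k A (delT k A X) = -delT k A (sgnT k A X) := by
  have h := sgnT_bT (k := k) X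
  rw [bT_eq, bT_eq, map_sub, map_sub, sgnT_consT, sgnT_snocT] at h
  simp only [neg_sub, sub_neg_eq_add] at h
  rw [eq_neg_iff_add_eq_zero]
  have h2 := sub_eq_zero.2 h
  rw [← neg_eq_zero, ← h2]
  abel

theorem bT_bT (X : (CM k A).Tot) : bT k A (bT k A X) = 0 := by
  have h1 : comul (R := k) (1 : A) = 1 ⊗ₜ 1 := Bialgebra.comul_one
  rw [bT_eq, bT_eq X]
  simp only [map_sub]
  rw [sgnT_consT, sgnT_snocT, sgnT_sgnT, sgnT_delT, delT_consT, delT_snocT _ h1, delT_delT, h1,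
    cons₂T_tmul, sgnT_snocT, sgnT_snocT, sgnT_sgnT]
  simp only [map_neg, snocT_consT]
  abel

end Action

section Primitive

open PiTensorProduct Coalgebra Word

/-- A Hopf algebra is primitively generated if a property of its elements holds in general as soon
as it holds for `1` and the primitive elements and is stable under sums, multiples and products. -/
class PrimitivelyGenerated (k : Type u) (A : Type w) [CommRing k] [Ring A] [HopfAlgebra k A] :
    Prop where
  induction : ∀ {P : A → Prop} (u : A) (_ : P 1)
    (_ : ∀ x : A, comul (R := k) x = x ⊗ₜ 1 + 1 ⊗ₜ x → P x)
    (_ : ∀ (c : k) u, P u → P (c • u)) (_ : ∀ u v, P u → P v → P (u * v))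
    (_ : ∀ u v, P u → P v → P (u + v)), P u

variable {k : Type u} {A : Type w} [CommRing k] [Ring A] [HopfAlgebra k A]

local notation "𝒯" => CocyclicOperators.Tot (CM k A)

theorem counit_prim {x : A} (hx : comul (R := k) x = x ⊗ₜ 1 + 1 ⊗ₜ x) : counit (R := k) x = 0 := by
  have h := Coalgebra.rTensor_counit_comul (R := k) x
  rw [hx, map_add, LinearMap.rTensor_tmul, LinearMap.rTensor_tmul, Bialgebra.counit_one,
    add_eq_right] at h
  have := congrArg (fun z => counit (R := k) (TensorProduct.lid k A z)) h
  simpa using this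

theorem antipode_prim {x : A} (hx : comul (R := k) x = x ⊗ₜ 1 + 1 ⊗ₜ x) :
    HopfAlgebra.antipode k x = -x := by
  have h := HopfAlgebra.mul_antipode_rTensor_comul_apply (R := k) x
  rw [hx, counit_prim hx] at h
  simpa [eq_neg_iff_add_eq_zero] using h

theorem actT_prim_consT {x : A} (hx : comul (R := k) x = x ⊗ₜ 1 + 1 ⊗ₜ x) (c : A) (X : 𝒯) :
    actT k A x (consT k A c X) = consT k A (x * c) X + consT k A c (actT k A x X) := by
  rw [actT_consT, hx, map_add, LinearMap.add_apply, consActT_tmul, consActT_tmul, actT_one,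
    one_mul]

theorem actT_prim_nil {x : A} (hx : comul (R := k) x = x ⊗ₜ 1 + 1 ⊗ₜ x) :
    actT k A x (wd k A []) = 0 := by
  rw [actT_nil, counit_prim hx, zero_smul]

theorem actT_prim_snocT {x : A} (hx : comul (R := k) x = x ⊗ₜ 1 + 1 ⊗ₜ x) (c : A) (X : 𝒯) :
    actT k A x (snocT k A c X) = snocT k A (x * c) X + snocT k A c (actT k A x X) := by
  induction X using tot_induction with
  | hadd X Y hX hY => simp only [map_add, hX, hY]; abel
  | hsmul r X hX => simp only [map_smul, hX, smul_add]
  | hnil =>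
    rw [snocT_nil, actT_prim_consT hx, actT_prim_nil hx, snocT_nil, map_zero, map_zero]
  | hcons d X hX =>
    rw [snocT_consT, actT_prim_consT hx, snocT_consT, actT_prim_consT hx, map_add, snocT_consT, snocT_consT, hX,
      map_add]
    abel

variable [PrimitivelyGenerated k A]

variable (k) in
theorem prim_induction {P : A → Prop} (u : A) (h1 : P 1)
    (hx : ∀ x : A, comul (R := k) x = x ⊗ₜ 1 + 1 ⊗ₜ x → P x)
    (hs : ∀ (c : k) u, P u → P (c • u)) (hm : ∀ u v, P u → P v → P (u * v))
    (ha : ∀ u v, P u → P v → P (u + v)) : P u :=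
  PrimitivelyGenerated.induction (k := k) u h1 hx hs hm ha

theorem antipode_antipode (u : A) : HopfAlgebra.antipode k (HopfAlgebra.antipode k u) = u := by
  induction u using prim_induction (k := k) (A := A) with
  | h1 => simp
  | hx x hx => simp [antipode_prim hx]
  | hs c u hu => simp [hu]
  | hm u v hu hv => simp [HopfAlgebra.antipode_mul_antidistrib, hu, hv]
  | ha u v hu hv => simp [hu, hv]

theorem sTot_actT (j : ℕ) (u : A) (X : 𝒯) :
    (CM k A).sTot j (actT k A u X) = actT k A u ((CM k A).sTot j X) := by
  induction u using prim_induction (k := k) (A := A) generalizing X with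
  | h1 => rw [actT_one, actT_one]
  | hs c u hu => simp only [map_smul, LinearMap.smul_apply, hu]
  | ha u v hu hv => simp only [map_add, LinearMap.add_apply, hu, hv]
  | hm u v hu hv => rw [actT_mul, actT_mul, hu, hv]
  | hx x hx =>
    induction X using tot_induction generalizing j with
    | hadd X Y hX hY => simp only [map_add, hX, hY]
    | hsmul r X hX => simp only [map_smul, hX]
    | hnil => rw [actT_prim_nil hx, sTot_nil, map_zero, map_zero]
    | hcons d X hX =>
      rw [actT_prim_consT hx, map_add]
      cases j with
      | zero =>
        rw [sTot_zero_consT, sTot_zero_consT, sTot_zero_consT, Bialgebra.counit_mul, counit_prim hx, map_smul]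
        simp
      | succ j => rw [sTot_succ_consT, sTot_succ_consT, sTot_succ_consT, hX, actT_prim_consT hx]

theorem fT_actT (u : A) (X : 𝒯) : fT k A (actT k A u X) = counit (R := k) u • fT k A X := by
  induction u using prim_induction (k := k) (A := A) generalizing X with
  | h1 => rw [actT_one, Bialgebra.counit_one, one_smul]
  | hs c u hu => simp only [map_smul, LinearMap.smul_apply, hu, smul_assoc]
  | ha u v hu hv => simp only [map_add, LinearMap.add_apply, hu, hv, add_smul]
  | hm u v hu hv => rw [actT_mul, hu, hv, Bialgebra.counit_mul, smul_smul]
  | hx x hx =>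
    rw [counit_prim hx, zero_smul]
    induction X using tot_induction with
    | hadd X Y hX hY => simp only [map_add, hX, hY, add_zero]
    | hsmul r X hX => simp only [map_smul, hX, smul_zero]
    | hnil => rw [actT_prim_nil hx, map_zero]
    | hcons d X hX =>
      rw [actT_prim_consT hx, map_add, fT_consT, fT_consT, HopfAlgebra.antipode_mul_antidistrib, actT_mul, antipode_prim hx, map_neg,
        LinearMap.neg_apply, map_neg, neg_add_cancel]

theorem fT_fT_consT (c : A) (X : 𝒯) :
    fT k A (fT k A (consT k A c X)) = counit (R := k) c • fT k A X := by
  rw [fT_consT, fT_actT, HopfAlgebra.counit_antipode]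

theorem antConsT_comul (u c : A) (X : 𝒯) : antConsT k A c (comul (R := k) u) X =
    consT k A c (actT k A (HopfAlgebra.antipode k u) X) := by
  induction u using prim_induction (k := k) (A := A) generalizing X c with
  | h1 => 
    rw [Bialgebra.comul_one, Algebra.TensorProduct.one_def, antConsT_tmul, HopfAlgebra.antipode_one,
      actT_one, actT_one, one_mul]
  | hs r u hu => simp only [map_smul, LinearMap.smul_apply, hu]
  | ha u v hu hv => simp only [map_add, LinearMap.add_apply, hu, hv]
  | hm u v hu hv =>
    have (w z : A ⊗[k] A) (h : ∀ c X, antConsT k A c w X =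
        consT k A c (actT k A (HopfAlgebra.antipode k u) X)) :
        antConsT k A c (w * z) X = antConsT k A c z (actT k A (HopfAlgebra.antipode k u) X) := by
      induction z with
      | zero => simp
      | add y z hy hz => simp only [mul_add, map_add, LinearMap.add_apply, hy, hz]
      | tmul p q =>
        rw [antConsT_tmul, ← h]
        clear h
        induction w with
        | zero => simp
        | add y z hy hz => simp only [add_mul, map_add, LinearMap.add_apply, hy, hz]
        | tmul r s =>
          rw [Algebra.TensorProduct.tmul_mul_tmul, antConsT_tmul, antConsT_tmul, HopfAlgebra.antipode_mul_antidistrib,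
            actT_mul, mul_assoc]
    rw [Bialgebra.comul_mul, this _ _ fun c X => hu c X, hv, HopfAlgebra.antipode_mul_antidistrib, actT_mul]
  | hx x hx =>
    rw [hx, map_add, LinearMap.add_apply, antConsT_tmul, antConsT_tmul, antipode_prim hx,
      HopfAlgebra.antipode_one, actT_one, map_neg, LinearMap.neg_apply, actT_prim_consT hx, one_mul,
      LinearMap.neg_apply, map_neg]
    abel

theorem antSnocT_comul (u c : A) (X : 𝒯) : antSnocT k A c (comul (R := k) u) X =
    snocT k A c (actT k A (HopfAlgebra.antipode k u) X) := by
  induction u using prim_induction (k := k) (A := A) generalizing X c with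
  | h1 => 
    rw [Bialgebra.comul_one, Algebra.TensorProduct.one_def, antSnocT_tmul, HopfAlgebra.antipode_one,
      actT_one, actT_one, one_mul]
  | hs r u hu => simp only [map_smul, LinearMap.smul_apply, hu]
  | ha u v hu hv => simp only [map_add, LinearMap.add_apply, hu, hv]
  | hm u v hu hv =>
    have (w z : A ⊗[k] A) (h : ∀ c X, antSnocT k A c w X =
        snocT k A c (actT k A (HopfAlgebra.antipode k u) X)) :
        antSnocT k A c (w * z) X = antSnocT k A c z (actT k A (HopfAlgebra.antipode k u) X) := by
      induction z with
      | zero => simp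
      | add y z hy hz => simp only [mul_add, map_add, LinearMap.add_apply, hy, hz]
      | tmul p q =>
        rw [antSnocT_tmul, ← h]
        clear h
        induction w with
        | zero => simp
        | add y z hy hz => simp only [add_mul, map_add, LinearMap.add_apply, hy, hz]
        | tmul r s =>
          rw [Algebra.TensorProduct.tmul_mul_tmul, antSnocT_tmul, antSnocT_tmul, HopfAlgebra.antipode_mul_antidistrib,
            actT_mul, mul_assoc]
    rw [Bialgebra.comul_mul, this _ _ fun c X => hu c X, hv, HopfAlgebra.antipode_mul_antidistrib, actT_mul]
  | hx x hx =>
    rw [hx, map_add, LinearMap.add_apply, antSnocT_tmul, antSnocT_tmul, antipode_prim hx,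
      HopfAlgebra.antipode_one, actT_one, map_neg, LinearMap.neg_apply, actT_prim_snocT hx, one_mul,
      LinearMap.neg_apply, map_neg]
    abel

theorem antSnocActT_comul (u c : A) (X : 𝒯) : antSnocActT k A c (comul (R := k) u) X =
    snocT k A (HopfAlgebra.antipode k u * c) X := by
  induction u using prim_induction (k := k) (A := A) generalizing X c with
  | h1 => 
    rw [Bialgebra.comul_one, Algebra.TensorProduct.one_def, antSnocActT_tmul,
      HopfAlgebra.antipode_one, actT_one, actT_one, one_mul]
  | hs r u hu => simp only [map_smul, LinearMap.smul_apply, hu, smul_mul_assoc]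
  | ha u v hu hv => simp only [map_add, LinearMap.add_apply, hu, hv, add_mul]
  | hm u v hu hv =>
    have (w z : A ⊗[k] A) (h : ∀ c X, antSnocActT k A c w X =
        snocT k A (HopfAlgebra.antipode k u * c) X) :
        antSnocActT k A c (w * z) X = antSnocActT k A (HopfAlgebra.antipode k u * c) z X := by
      induction z with
      | zero => simp
      | add y z hy hz => simp only [mul_add, map_add, LinearMap.add_apply, hy, hz]
      | tmul p q =>
        rw [antSnocActT_tmul, ← h]
        clear h
        induction w with
        | zero => simp
        | add y z hy hz => simp only [add_mul, map_add, LinearMap.add_apply, hy, hz]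
        | tmul r s =>
          rw [Algebra.TensorProduct.tmul_mul_tmul, antSnocActT_tmul, antSnocActT_tmul, HopfAlgebra.antipode_mul_antidistrib,
            actT_mul, actT_mul]
    rw [Bialgebra.comul_mul, this _ _ fun c X => hu c X, hv, HopfAlgebra.antipode_mul_antidistrib, mul_assoc]
  | hx x hx =>
    rw [hx, map_add, LinearMap.add_apply, antSnocActT_tmul, antSnocActT_tmul, antipode_prim hx,
      HopfAlgebra.antipode_one, actT_one, actT_one, map_neg, LinearMap.neg_apply, actT_prim_snocT hx,
      neg_mul, map_neg, LinearMap.neg_apply]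
    abel

theorem τTot_actT_consT (u c : A) (X : 𝒯) :
    (CM k A).τTot (actT k A u (consT k A c X)) =
      actT k A (HopfAlgebra.antipode k c) (snocT k A (HopfAlgebra.antipode k u) X) := by
  rw [actT_consT]
  have := antSnocActT_comul u 1 X
  rw [mul_one] at this
  rw [← this]
  induction comul (R := k) u with
  | zero => simp
  | add y z hy hz => simp only [map_add, LinearMap.add_apply, hy, hz]
  | tmul x y => rw [consActT_tmul, antSnocActT_tmul, τTot_consT, HopfAlgebra.antipode_mul_antidistrib, actT_mul]

theorem fT_wd_cons (c : A) (v : List A) :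
    fT k A (wd k A (c :: v)) = actT k A (HopfAlgebra.antipode k c) (wd k A v) := fT_consT _ _

theorem τTot_fT_wd (c : A) (v : List A) :
    (CM k A).τTot (fT k A (wd k A (c :: v))) = fT k A (wd k A (v ++ [c])) := by
  cases v with
  | nil => rw [fT_wd_cons, actT_nil, map_smul, τTot_nil, List.nil_append, fT_wd_cons, actT_nil]
  | cons d v =>
    rw [wd, wd, fT_consT, τTot_actT_consT, antipode_antipode, List.cons_append, wd, fT_consT, snocT_wd]

theorem τTot_pow_fT_wd (l w : List A) :
    ((CM k A).τTot ^ l.length) (fT k A (wd k A (l ++ w))) =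
      fT k A (wd k A (w ++ l)) := by
  induction l generalizing w with
  | nil => simp
  | cons c l ih =>
    rw [List.length_cons, pow_succ, Module.End.mul_apply, List.cons_append, τTot_fT_wd,
      List.append_assoc, ih]
    simp

theorem τTot_wd (c : A) (v : List A) :
    (CM k A).τTot (wd k A (c :: v)) = fT k A (wd k A (c :: v ++ [1])) := by
  rw [wd, τTot_consT, List.cons_append, wd, fT_consT, snocT_wd]

theorem sTot_τTot_pow_wd (l l' : List A) (a : A) :
    (CM k A).sTot l'.length
      (((CM k A).τTot ^ (l.length + 1)) (wd k A (l ++ a :: l'))) =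
      fT k A (wd k A (a :: l' ++ l)) := by
  have h1 : (CM k A).τTot (wd k A (l ++ a :: l')) =
      fT k A (wd k A (l ++ (a :: l' ++ [1]))) := by
    cases l with
    | nil => exact τTot_wd _ _
    | cons c l => rw [List.cons_append, τTot_wd]; simp
  rw [pow_succ, Module.End.mul_apply, h1, τTot_pow_fT_wd]
  have h2 : a :: l' ++ [1] ++ l = a :: (l' ++ 1 :: l) := by simp
  rw [h2, fT_wd_cons, sTot_actT, sTot_wd _ _ _ _ rfl, Bialgebra.counit_one, one_smul,
    List.cons_append, fT_wd_cons]

theorem ET_wd_eq_cycLR (w : List A) : ET k A (wd k A w) =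
    cycLR w fun l r => fT k A (wd k A l) ⊗ₜ fT k A (wd k A r) := by
  rw [ET_wd, cycLR_eq]
  simp only [sTot_τTot_pow_wd]

end Primitive
end HopfCyclic

namespace Word

variable {L M : Type*} [AddCommGroup M]

/-- The derivation of words which is given by `φ` on letters. -/
def der (φ : L → L) : List L → (List L → M) → M
  | [], _ => 0
  | c :: w, F => F (φ c :: w) + der φ w fun v => F (c :: v)

variable (φ : L → L)

theorem der_add (w : List L) (F G : List L → M) :
    der φ w (fun v => F v + G v) = der φ w F + der φ w G := by
  induction w generalizing F G with
  | nil => simp [der]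
  | cons c w ih => simp only [der, ih]; abel

theorem der_sign (w : List L) (s : ℕ → ℤ) (F : List L → M) :
    der φ w (fun v => s v.length • F v) = s w.length • der φ w F := by
  induction w generalizing F s with
  | nil => simp [der]
  | cons c w ih => simp only [der, smul_add, List.length_cons, ih fun n => s (n + 1)]

theorem der_smul (w : List L) (n : ℤ) (F : List L → M) :
    der φ w (fun v => n • F v) = n • der φ w F := der_sign φ w (fun _ => n) F

theorem der_append (w w' : List L) (F : List L → M) :
    der φ (w ++ w') F = der φ w (fun v => F (v ++ w')) + der φ w' (fun v => F (w ++ v)) := by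
  induction w generalizing F with
  | nil => simp [der]
  | cons c w ih => simp only [List.cons_append, der, ih, add_assoc]

theorem der_unsh (w : List L) (F : List L → List L → M) :
    der φ w (fun v => unsh v F) =
      unsh w fun l r => der φ l (fun l => F l r) + der φ r (fun r => F l r) := by
  induction w generalizing F with
  | nil => simp [der, unsh]
  | cons c w ih =>
    simp only [der, unsh, der_add, ih, smul_add, unsh_add, der_smul]
    simp only [der_sign φ _ (fun n => (-1) ^ n), der_smul, unsh_zero, unshR_zero, zero_add, add_zero,
      smul_zero]
    abel

theorem der_unshR (w : List L) (F : List L → List L → L → List L → M) :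
    der φ w (fun v => unshR v F) =
      unshR w fun l r b r' => der φ l (fun l => F l r b r') + der φ r (fun r => F l r b r') +
        F l r (φ b) r' + der φ r' (fun r' => F l r b r') := by
  induction w generalizing F with
  | nil => simp [der, unshR]
  | cons c w ih =>
    simp only [der, unshR, der_add, ih, smul_add, unshR_add, der_smul, der_unsh, unsh_add]
    simp only [der_sign φ _ (fun n => (-1) ^ n), der_smul, unsh_zero, unshR_zero, zero_add, add_zero,
      smul_zero]
    abel

theorem der_unshLR (w : List L) (F : List L → L → List L → List L → L → List L → M) :
    der φ w (fun v => unshLR v F) =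
      unshLR w fun l a l' r b r' => der φ l (fun l => F l a l' r b r') + F l (φ a) l' r b r' +
        der φ l' (fun l' => F l a l' r b r') + der φ r (fun r => F l a l' r b r') +
        F l a l' r (φ b) r' + der φ r' (fun r' => F l a l' r b r') := by
  induction w generalizing F with
  | nil => simp [der, unshLR]
  | cons c w ih =>
    simp only [der, unshLR, der_add, ih, smul_add, unshLR_add, der_smul, der_unshR, unshR_add]
    simp only [der_sign φ _ (fun n => (-1) ^ n), der_smul, unsh_zero, unshR_zero, zero_add, add_zero,
      smul_zero]
    abel

/-- `cycLR` is compatible with derivations. -/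
theorem der_cycLR (w : List L) (H : List L → List L → M) :
    der φ w (fun v => cycLR v H) =
      cycLR w fun l r => der φ l (fun l => H l r) + der φ r (fun r => H l r) := by
  simp only [cycLR, der_unshLR]
  refine unshLR_congr w fun l a l' r b r' => ?_
  simp only [der_smul, der_sign φ _ (fun n => (-1) ^ n), der_sign φ _ (fun n => (-1) ^ (n * l'.length)),
    der_sign φ _ (fun n => (-1) ^ (l.length * n)), der_sign φ _ (fun n => (-1) ^ (n * r'.length)),
    der_sign φ _ (fun n => (-1) ^ (r.length * n)), der, List.cons_append, der_append, smul_add]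
  abel

theorem map_unsh {N T : Type*} [AddCommGroup N] [FunLike T M N] [AddMonoidHomClass T M N] (f : T)
    (w : List L) (F : List L → List L → M) : f (unsh w F) = unsh w fun l r => f (F l r) := by
  induction w generalizing F with
  | nil => rfl
  | cons c w ih => simp only [unsh, map_add, ih, map_zsmul]

theorem map_unshR {N T : Type*} [AddCommGroup N] [FunLike T M N] [AddMonoidHomClass T M N] (f : T)
    (w : List L) (F : List L → List L → L → List L → M) :
    f (unshR w F) = unshR w fun l r b r' => f (F l r b r') := by
  induction w generalizing F with
  | nil => simp [unshR]
  | cons c w ih => simp only [unshR, map_add, ih, map_zsmul, map_unsh]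

theorem map_unshLR {N T : Type*} [AddCommGroup N] [FunLike T M N] [AddMonoidHomClass T M N] (f : T)
    (w : List L) (F : List L → L → List L → List L → L → List L → M) :
    f (unshLR w F) = unshLR w fun l a l' r b r' => f (F l a l' r b r') := by
  induction w generalizing F with
  | nil => simp [unshLR]
  | cons c w ih => simp only [unshLR, map_add, ih, map_zsmul, map_unshR]

theorem map_cycLR {N T : Type*} [AddCommGroup N] [FunLike T M N] [AddMonoidHomClass T M N] (f : T)
    (w : List L) (H : List L → List L → M) :
    f (cycLR w H) = cycLR w fun l r => f (H l r) := by
  simp only [cycLR, map_unshLR, map_zsmul]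

theorem map_mark {N T : Type*} [AddCommGroup N] [FunLike T M N] [AddMonoidHomClass T M N] (f : T)
    (w : List L) (F : List L → L → List L → M) : f (mark w F) = mark w fun u c v => f (F u c v) := by
  induction w generalizing F with
  | nil => simp [mark]
  | cons c w ih => simp only [mark, map_add, ih]

theorem map_cyc {N T : Type*} [AddCommGroup N] [FunLike T M N] [AddMonoidHomClass T M N] (f : T)
    (w : List L) (H : List L → M) : f (cyc w H) = cyc w fun v => f (H v) := by
  simp only [cyc, map_mark, map_zsmul]

theorem map_dsum' {N T : Type*} [AddCommGroup N] [FunLike T M N] [AddMonoidHomClass T M N] (f : T)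
    (dup : L → List (L × L)) (c : L) (F : L → L → M) :
    f (dsum dup c F) = dsum dup c fun x y => f (F x y) := by
  simp only [dsum, map_list_sum, List.map_map]
  rfl

theorem map_del {N T : Type*} [AddCommGroup N] [FunLike T M N] [AddMonoidHomClass T M N] (f : T)
    (dup : L → List (L × L)) (w : List L) (F : List L → M) :
    f (del dup w F) = del dup w fun v => f (F v) := by
  induction w generalizing F with
  | nil => simp [del]
  | cons c w ih => simp only [del, map_add, ih, map_zsmul, map_dsum']

theorem map_delc {N T : Type*} [AddCommGroup N] [FunLike T M N] [AddMonoidHomClass T M N] (f : T)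
    (dup : L → List (L × L)) (w : List L) (F : List L → M) :
    f (delc dup w F) = delc dup w fun v => f (F v) := by
  cases w with
  | nil => simp [delc]
  | cons c w => simp only [delc, map_add, map_zsmul, map_dsum', map_del]

theorem map_bsum {N T : Type*} [AddCommGroup N] [FunLike T M N] [AddMonoidHomClass T M N] (f : T)
    (dup : L → List (L × L)) (e : L) (w : List L) (F : List L → M) :
    f (bsum dup e w F) = bsum dup e w fun v => f (F v) := by
  simp only [bsum, map_add, map_zsmul, map_del]

end Word

namespace HopfCyclic

universe u w

section Primitive

open PiTensorProduct Coalgebra Word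

variable {k : Type u} {A : Type w} [CommRing k] [Ring A] [HopfAlgebra k A]
  [PrimitivelyGenerated k A]

local notation "𝒯" => CocyclicOperators.Tot (CM k A)

theorem delT_actT (a : A) (X : 𝒯) : delT k A (actT k A a X) = actT k A a (delT k A X) := by
  induction a using prim_induction (k := k) (A := A) generalizing X with
  | h1 => rw [actT_one, actT_one]
  | hs c u hu => simp only [map_smul, LinearMap.smul_apply, hu]
  | ha u v hu hv => simp only [map_add, LinearMap.add_apply, hu, hv]
  | hm u v hu hv => rw [actT_mul, actT_mul, hu, hv]
  | hx x hx =>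
    induction X using tot_induction with
    | hadd X Y hX hY => simp only [map_add, hX, hY]
    | hsmul r X hX => simp only [map_smul, hX]
    | hnil => rw [actT_prim_nil hx, delT_nil, map_zero, map_zero]
    | hcons d X hX =>
      rw [actT_prim_consT hx, map_add, delT_consT, delT_consT, hX, delT_consT, map_sub,
        actT_prim_consT hx, Bialgebra.comul_mul, hx]
      have key (z : A ⊗[k] A) : actT k A x (cons₂T k A z X) =
          cons₂T k A ((x ⊗ₜ 1 + 1 ⊗ₜ x) * z) X + cons₂T k A z (actT k A x X) := by
        induction z with
        | zero => simp
        | add y z hy hz => simp only [map_add, mul_add, LinearMap.add_apply, hy, hz]; abel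
        | tmul y z =>
          rw [add_mul, Algebra.TensorProduct.tmul_mul_tmul, Algebra.TensorProduct.tmul_mul_tmul,
            map_add, LinearMap.add_apply, cons₂T_tmul, cons₂T_tmul, cons₂T_tmul, cons₂T_tmul,
            actT_prim_consT hx, actT_prim_consT hx, map_add, one_mul, one_mul]
          abel
      rw [key]
      abel

/-- The Hochschild differential of a cyclic word. -/
theorem bT_fT_wd {dup : A → List (A × A)}
    (hd : ∀ a, ((dup a).map fun q => q.1 ⊗ₜ[k] q.2).sum = comul a) (w : List A) :
    bT k A (fT k A (wd k A w)) = delc dup w fun v => fT k A (wd k A v) := by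
  cases w with
  | nil => rw [fT_nil, map_zero, delc]
  | cons a v =>
    have h1 := antConsT_comul (k := k) a 1 (wd k A v)
    have h2 := antSnocT_comul (k := k) a 1 (wd k A v)
    have h3 : antConsT k A 1 (comul (R := k) a) (wd k A v) =
        dsum dup a fun x y => antConsT k A 1 (x ⊗ₜ y) (wd k A v) :=
      (dsum_eq_lift hd a ((antConsT k A 1).flip (wd k A v))).symm
    have h4 : antSnocT k A 1 (comul (R := k) a) (wd k A v) =
        dsum dup a fun x y => antSnocT k A 1 (x ⊗ₜ y) (wd k A v) :=
      (dsum_eq_lift hd a ((antSnocT k A 1).flip (wd k A v))).symm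
    rw [fT_wd_cons, bT_eq, ← h1, h3, sgnT_actT, sgnT_wd, map_zsmul, map_zsmul, ← h2, h4, delT_actT,
      delT_wd hd, delc, dsum_add, dsum_smul, dsum_smul, map_del]
    have h5 : (dsum dup a fun x y => antConsT k A 1 (x ⊗ₜ[k] y) (wd k A v)) =
        dsum dup a fun x y => fT k A (wd k A (x :: y :: v)) := by
      congr 1; funext x y
      rw [antConsT_tmul, fT_wd_cons, mul_one, wd]
    have h6 : (dsum dup a fun x y => antSnocT k A 1 (x ⊗ₜ[k] y) (wd k A v)) =
        dsum dup a fun x y => fT k A (wd k A (x :: v ++ [y])) := by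
      congr 1; funext x y
      rw [antSnocT_tmul, List.cons_append, fT_wd_cons, mul_one, snocT_wd]
    have h7 : (del dup v fun v => actT k A (HopfAlgebra.antipode k a) (wd k A v)) =
        del dup v fun v => fT k A (wd k A (a :: v)) := by
      congr 1; funext v
      rw [fT_wd_cons]
    rw [h5, h6, h7]
    simp only [neg_smul, one_smul, sub_eq_add_neg]

theorem actT_prim_wd {x : A} (hx : comul (R := k) x = x ⊗ₜ 1 + 1 ⊗ₜ x) (w : List A) :
    actT k A x (wd k A w) = der (fun c => x * c) w (wd k A) := by
  induction w with
  | nil => rw [actT_prim_nil hx, der]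
  | cons c w ih =>
    have h : consT k A c (der (fun c => x * c) w (wd k A)) =
        der (fun c => x * c) w fun v => wd k A (c :: v) := by
      have (F : List A → 𝒯) : consT k A c (der (fun c => x * c) w F) =
          der (fun c => x * c) w fun v => consT k A c (F v) := by
        clear ih
        induction w generalizing F with
        | nil => simp [der]
        | cons d w ih => simp only [der, map_add, ih]
      exact this _
    rw [wd, actT_prim_consT hx, ih, der, h, wd]

theorem map_der {L M N T : Type*} [AddCommGroup M] [AddCommGroup N] [FunLike T M N]
    [AddMonoidHomClass T M N] (f : T) (φ : L → L) (w : List L) (F : List L → M) :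
    f (der φ w F) = der φ w fun v => f (F v) := by
  induction w generalizing F with
  | nil => simp [der]
  | cons c w ih => simp only [der, map_add, ih]

theorem ET_actT (u : A) (X : 𝒯) : ET k A (actT k A u X) = counit (R := k) u • ET k A X := by
  induction u using prim_induction (k := k) (A := A) generalizing X with
  | h1 => rw [actT_one, Bialgebra.counit_one, one_smul]
  | hs c u hu => simp only [map_smul, LinearMap.smul_apply, hu, smul_assoc]
  | ha u v hu hv => simp only [map_add, LinearMap.add_apply, hu, hv, add_smul]
  | hm u v hu hv => rw [actT_mul, hu, hv, Bialgebra.counit_mul, smul_smul]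
  | hx x hx =>
    rw [counit_prim hx, zero_smul]
    suffices h : ET k A ∘ₗ actT k A x = 0 from LinearMap.congr_fun h X
    refine tot_ext fun w => ?_
    have hf (l : List A) : (der (fun c => x * c) l fun l => fT k A (wd k A l)) = 0 := by
      rw [← map_der, ← actT_prim_wd hx, fT_actT, counit_prim hx, zero_smul]
    have h1 (l : List A) (Y : 𝒯) :
        (der (fun c => x * c) l fun l => fT k A (wd k A l) ⊗ₜ[k] Y) = 0 := by
      have := map_der ((TensorProduct.mk k 𝒯 𝒯).flip Y) (fun c => x * c) l fun l => fT k A (wd k A l)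
      rw [hf, map_zero] at this
      exact this.symm
    have h2 (l : List A) (Y : 𝒯) :
        (der (fun c => x * c) l fun l => Y ⊗ₜ[k] fT k A (wd k A l)) = 0 := by
      have := map_der (TensorProduct.mk k 𝒯 𝒯 Y) (fun c => x * c) l fun l => fT k A (wd k A l)
      rw [hf, map_zero] at this
      exact this.symm
    rw [comp_apply, actT_prim_wd hx, map_der]
    simp only [ET_wd_eq_cycLR, der_cycLR, h1, h2, add_zero]
    simp only [cycLR, smul_zero, unshLR_zero, LinearMap.zero_apply]

end Primitive
end HopfCyclic

namespace Word
variable {L M : Type*} [AddCommGroup M] {dup : L → List (L × L)}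

theorem unsh_bsum (hdup : ∀ c, ((dup c).map Prod.swap).Perm (dup c)) (e : L) (w : List L)
    (H : List L → List L → M) :
    bsum dup e w (fun v => unsh v H) = unsh w fun l r =>
      bsum dup e l (fun l => H l r) + (-1 : ℤ) ^ l.length • bsum dup e r (fun r => H l r) := by
  simp only [bsum, unsh_del hdup, unsh_append_singleton, unsh, sign_unsh, ← unsh_smul, ← unsh_add]
  refine unsh_congr w fun l r h => ?_
  have hw : w.length = l.length + r.length := by rw [← h.length_eq, List.length_append]
  rcases neg_one_pow_eq_or ℤ l.length with hl | hl <;>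
    rcases neg_one_pow_eq_or ℤ r.length with hr | hr <;>
    simp only [hw, pow_add, hl, hr, one_smul, neg_smul, mul_one, one_mul, mul_neg, neg_neg,
      smul_add, smul_neg] <;> abel

end Word

namespace HopfCyclic

universe u w

section Primitive

open PiTensorProduct Coalgebra Word

variable {k : Type u} {A : Type w} [CommRing k] [Ring A] [HopfAlgebra k A]
  [PrimitivelyGenerated k A]

local notation "𝒯" => CocyclicOperators.Tot (CM k A)

theorem comm_comul (a : A) : Algebra.TensorProduct.comm k A A (comul a) = comul a := by
  induction a using prim_induction (k := k) (A := A) with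
  | h1 => rw [Bialgebra.comul_one, map_one]
  | hs c u hu => rw [map_smul, map_smul, hu]
  | ha u v hu hv => rw [map_add, map_add, hu, hv]
  | hm u v hu hv => rw [Bialgebra.comul_mul, map_mul, hu, hv]
  | hx x hx => rw [hx, map_add, Algebra.TensorProduct.comm_tmul, Algebra.TensorProduct.comm_tmul, add_comm]

variable (k A) in
theorem exists_symm_dup [Invertible (2 : k)] : ∃ dup : A → List (A × A),
    (∀ a, ((dup a).map fun q => q.1 ⊗ₜ[k] q.2).sum = comul a) ∧
      ∀ a, ((dup a).map Prod.swap).Perm (dup a) := by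
  obtain ⟨dup, hd⟩ := exists_dup k A
  refine ⟨fun a => (dup a).map (fun q : A × A => (⅟(2 : k) • q.1, q.2)) ++
    (dup a).map (fun q : A × A => (q.2, ⅟(2 : k) • q.1)), fun a => ?_, fun a => ?_⟩
  · rw [List.map_append, List.sum_append, List.map_map, List.map_map]
    have h1 : ((fun q : A × A => q.1 ⊗ₜ[k] q.2) ∘ fun q : A × A => (⅟(2 : k) • q.1, q.2)) =
        (LinearMap.lsmul k (A ⊗[k] A) ⅟(2 : k)) ∘ fun q : A × A => q.1 ⊗ₜ[k] q.2 := by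
      ext q; simp [TensorProduct.smul_tmul']
    have h2 : ((fun q : A × A => q.1 ⊗ₜ[k] q.2) ∘ fun q : A × A => (q.2, ⅟(2 : k) • q.1)) =
        (LinearMap.lsmul k (A ⊗[k] A) ⅟(2 : k) ∘ₗ
          (Algebra.TensorProduct.comm k A A).toLinearMap) ∘ fun q : A × A => q.1 ⊗ₜ[k] q.2 := by
      ext q; simp
    rw [h1, h2, ← List.map_map, ← List.map_map, ← map_list_sum, ← map_list_sum, hd,
      comp_apply, AlgEquiv.toLinearMap_apply, comm_comul, ← map_add]
    simp [← two_smul k]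
  · rw [List.map_append, List.map_map, List.map_map]
    exact List.perm_append_comm

theorem comul_antipode (a : A) : comul (R := k) (HopfAlgebra.antipode k a) =
    TensorProduct.map (HopfAlgebra.antipode k) (HopfAlgebra.antipode k) (comul a) := by
  induction a using prim_induction (k := k) (A := A) with
  | h1 => rw [HopfAlgebra.antipode_one, Bialgebra.comul_one, Algebra.TensorProduct.one_def,
      map_tmul, HopfAlgebra.antipode_one]
  | hs c u hu => simp only [map_smul, hu]
  | ha u v hu hv => simp only [map_add, hu, hv]
  | hx x hx =>
    rw [hx, map_add, map_tmul, map_tmul, HopfAlgebra.antipode_one,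
      antipode_prim hx, map_neg, hx, TensorProduct.neg_tmul, TensorProduct.tmul_neg, neg_add]
  | hm u v hu hv =>
    rw [HopfAlgebra.antipode_mul_antidistrib, Bialgebra.comul_mul, Bialgebra.comul_mul, hu, hv]
    induction comul (R := k) u with
    | zero => simp
    | add y z hy hz => simp only [add_mul, map_add, mul_add, hy, hz]
    | tmul p q =>
      induction comul (R := k) v with
      | zero => simp
      | add y z hy hz => simp only [add_mul, map_add, mul_add, hy, hz]
      | tmul r s =>
        simp [HopfAlgebra.antipode_mul_antidistrib]

variable (k A) in
/-- The action of `A ⊗ A` on the tensor square of the cochains. -/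
def actActT : A ⊗[k] A →ₗ[k] Module.End k (𝒯 ⊗[k] 𝒯) :=
  TensorProduct.lift ((TensorProduct.mapBilinear (RingHom.id k) 𝒯 𝒯 𝒯 𝒯).compl₁₂
    (actT k A) (actT k A))

theorem actActT_tmul (a b : A) : actActT k A (a ⊗ₜ b) =
    TensorProduct.map (actT k A a) (actT k A b) := rfl

theorem actActT_mul (z w : A ⊗[k] A) (Y : 𝒯 ⊗[k] 𝒯) :
    actActT k A (z * w) Y = actActT k A z (actActT k A w Y) := by
  induction z with
  | zero => simp
  | add y z hy hz => simp only [add_mul, map_add, LinearMap.add_apply, hy, hz]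
  | tmul p q =>
    induction w with
    | zero => simp
    | add y z hy hz => simp only [map_add, mul_add, LinearMap.add_apply, hy, hz]
    | tmul r s =>
      rw [Algebra.TensorProduct.tmul_mul_tmul, actActT_tmul, actActT_tmul, actActT_tmul]
      induction Y with
      | zero => simp
      | add y z hy hz => simp only [map_add, hy, hz]
      | tmul X Y =>
        simp only [map_tmul, actT_mul]

theorem sgnT_tmul (l : List A) (Y : 𝒯) :
    (sgnT k A (wd k A l)) ⊗ₜ[k] Y = (-1 : k) ^ l.length • (wd k A l ⊗ₜ[k] Y) := by
  rw [sgnT_wd, ← neg_one_pow_smul k, TensorProduct.smul_tmul']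

theorem DT_consT (c : A) (X : 𝒯) : DT k A (consT k A c X) =
    TensorProduct.map (consT k A c) LinearMap.id (DT k A X) +
      TensorProduct.map (sgnT k A) (consT k A c) (DT k A X) := by
  suffices h : DT k A ∘ₗ consT k A c = TensorProduct.map (consT k A c) LinearMap.id ∘ₗ DT k A +
      TensorProduct.map (sgnT k A) (consT k A c) ∘ₗ DT k A from LinearMap.congr_fun h X
  refine tot_ext fun w => ?_
  have := DT_wd (k := k) (c :: w)
  rw [comp_apply, LinearMap.add_apply, comp_apply, comp_apply, DT_wd,
    map_unsh, map_unsh]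
  refine this.trans ?_
  rw [unsh]
  simp only [← neg_one_pow_smul k, map_tmul, sgnT_tmul, LinearMap.id_apply, wd]

theorem DT_nil : DT k A (wd k A []) = wd k A [] ⊗ₜ wd k A [] := by rw [DT_wd, unsh]

theorem DT_actT (u : A) (X : 𝒯) :
    DT k A (actT k A u X) = actActT k A (comul (R := k) u) (DT k A X) := by
  induction u using prim_induction (k := k) (A := A) generalizing X with
  | h1 =>
    rw [actT_one, Bialgebra.comul_one, Algebra.TensorProduct.one_def, actActT_tmul]
    have : actT k A 1 = LinearMap.id := LinearMap.ext fun X => actT_one X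
    rw [this, TensorProduct.map_id, LinearMap.id_apply]
  | hs c u hu => simp only [map_smul, LinearMap.smul_apply, hu]
  | ha u v hu hv => simp only [map_add, LinearMap.add_apply, hu, hv]
  | hm u v hu hv => rw [actT_mul, hu, hv, Bialgebra.comul_mul, actActT_mul]
  | hx x hx =>
    have h1 : actT k A 1 = LinearMap.id := LinearMap.ext fun X => actT_one X
    rw [hx, map_add, LinearMap.add_apply, actActT_tmul, actActT_tmul, h1]
    induction X using tot_induction with
    | hadd X Y hX hY => simp only [map_add, hX, hY]; abel
    | hsmul r X hX => simp only [map_smul, hX, smul_add]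
    | hnil => rw [actT_prim_nil hx, map_zero, DT_nil]; simp [actT_prim_nil hx]
    | hcons c X hX =>
      rw [actT_prim_consT hx, map_add, DT_consT, DT_consT, DT_consT, hX]
      clear hX
      induction DT k A X with
      | zero => simp
      | add Y Z hY hZ =>
        simp only [map_add] at hY hZ ⊢
        refine Eq.trans ?_ ((congrArg₂ (· + ·) hY hZ).trans ?_) <;> abel
      | tmul Y Z =>
        simp only [map_add, map_tmul, LinearMap.id_apply, actT_prim_consT hx,
          add_tmul, tmul_add, sgnT_actT]
        abel

/-- The shuffle coproduct of a cyclic word. -/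
theorem DT_fT_wd {dup : A → List (A × A)}
    (hd : ∀ a, ((dup a).map fun q => q.1 ⊗ₜ[k] q.2).sum = comul a) (w : List A) :
    DT k A (fT k A (wd k A w)) =
      unshC dup w fun l r => fT k A (wd k A l) ⊗ₜ fT k A (wd k A r) := by
  cases w with
  | nil => rw [fT_nil, map_zero, unshC]
  | cons c v =>
    rw [fT_wd_cons, DT_actT, comul_antipode, DT_wd, map_unsh, unshC]
    refine unsh_congr v fun l r _ => ?_
    have := dsum_eq_lift hd c ((actActT k A).flip (wd k A l ⊗ₜ wd k A r) ∘ₗ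
      TensorProduct.map (HopfAlgebra.antipode k) (HopfAlgebra.antipode k))
    refine this.symm.trans ?_
    congr 1; funext x y
    rw [fT_wd_cons, fT_wd_cons]
    rfl

theorem DT_bT [Invertible (2 : k)] (X : 𝒯) : DT k A (bT k A X) =
    TensorProduct.map (bT k A) LinearMap.id (DT k A X) +
      TensorProduct.map (sgnT k A) (bT k A) (DT k A X) := by
  suffices h : DT k A ∘ₗ bT k A = TensorProduct.map (bT k A) LinearMap.id ∘ₗ DT k A +
      TensorProduct.map (sgnT k A) (bT k A) ∘ₗ DT k A from LinearMap.congr_fun h X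
  obtain ⟨dup, hd, hdup⟩ := exists_symm_dup k A
  refine tot_ext fun w => ?_
  rw [comp_apply, LinearMap.add_apply, comp_apply, comp_apply, DT_wd,
    map_unsh, map_unsh, bT_wd hd, map_bsum]
  simp only [DT_wd, unsh_bsum hdup]
  rw [← unsh_add]
  refine unsh_congr w fun l r _ => ?_
  rw [map_tmul, map_tmul, bT_wd hd, bT_wd hd, sgnT_tmul,
    ← neg_one_pow_smul k, LinearMap.id_apply]
  have h1 := map_bsum ((TensorProduct.mk k 𝒯 𝒯).flip (wd k A r)) dup 1 l (wd k A)
  have h2 := map_bsum (TensorProduct.mk k 𝒯 𝒯 (wd k A l)) dup 1 r (wd k A)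
  exact congrArg₂ (fun x y => x + (-1 : k) ^ l.length • y) h1.symm h2.symm

end Primitive
end HopfCyclic

namespace HopfCyclic

universe u w

section Normalized

open PiTensorProduct Coalgebra Word

variable {k : Type u} {A : Type w} [CommRing k] [Ring A] [HopfAlgebra k A]

local notation "𝒯" => CocyclicOperators.Tot (CM k A)

variable (k) in
/-- All letters are in the augmentation ideal. -/
def IsNorm (l : List A) : Prop := ∀ a ∈ l, counit (R := k) a = 0

theorem isNorm_cons {c : A} {l : List A} :
    IsNorm k (c :: l) ↔ counit (R := k) c = 0 ∧ IsNorm k l := by simp [IsNorm]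

theorem isNorm_append {l l' : List A} : IsNorm k (l ++ l') ↔ IsNorm k l ∧ IsNorm k l' := by
  simp only [IsNorm, List.mem_append]
  exact ⟨fun h => ⟨fun a ha => h a (Or.inl ha), fun a ha => h a (Or.inr ha)⟩,
    fun h a ha => ha.elim (h.1 a) (h.2 a)⟩

theorem sTot_wd_of_isNorm {l : List A} (hl : IsNorm k l) (j : ℕ) :
    (CM k A).sTot j (wd k A l) = 0 := by
  induction l generalizing j with
  | nil => exact sTot_nil j
  | cons c l ih =>
    obtain ⟨hc, hl⟩ := isNorm_cons.1 hl
    cases j with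
    | zero => rw [wd, sTot_zero_consT, hc, zero_smul]
    | succ j => rw [wd, sTot_succ_consT, ih hl, map_zero]

theorem mem_normalized {n : ℕ} {x : Pow k A n} : x ∈ (CM k A).normalized n ↔
    ∀ j, (CM k A).sTot j (lof k ℕ (CM k A).X n x) = 0 := by
  cases n with
  | zero =>
    refine iff_of_true trivial fun j => ?_
    rw [CocyclicOperators.sTot, DirectSum.toModule_lof]
    rfl
  | succ n =>
    change x ∈ ⨅ i, LinearMap.ker _ ↔ _
    rw [Submodule.mem_iInf]
    constructor
    · intro h j
      rw [CocyclicOperators.sTot, DirectSum.toModule_lof]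
      by_cases hj : j < n + 1
      · have : codegeneracy k A n ⟨j, hj⟩ x = 0 := h ⟨j, hj⟩
        simp [hj, this]
      · simp [hj]
    · intro h j
      have := h j
      rw [CocyclicOperators.sTot, DirectSum.toModule_lof] at this
      simp only [j.2, dif_pos, comp_apply] at this
      exact (DirectSum.of_injective (β := (CM k A).X) n)
        (this.trans (map_zero _).symm)

variable (k A) in
/-- The projection onto the augmentation ideal. -/
def augProj : A →ₗ[k] A := LinearMap.id - (counit (R := k) (A := A)).smulRight 1

theorem counit_augProj (a : A) : counit (R := k) (augProj k A a) = 0 := by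
  simp [augProj]

theorem map_update_augProj (n : ℕ) (i : Fin (n + 1)) (x : Pow k A (n + 1)) :
    PiTensorProduct.map (Function.update (fun _ => LinearMap.id) i (augProj k A)) x =
      x - insertFactor k A n i 1 (codegeneracy k A n i x) := by
  suffices h : PiTensorProduct.map (Function.update (fun _ => LinearMap.id) i (augProj k A)) =
      LinearMap.id - insertFactor k A n i 1 ∘ₗ codegeneracy k A n i from LinearMap.congr_fun h x
  refine PiTensorProduct.ext (MultilinearMap.ext fun h => ?_)
  simp only [LinearMap.compMultilinearMap_apply, map_tprod, LinearMap.sub_apply,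
    comp_apply, LinearMap.id_apply, codegeneracy, splitFactor_tprod,
    LinearEquiv.coe_coe, map_tmul, TensorProduct.lid_tmul, map_smul,
    insertFactor_tprod]
  rw [Fin.insertNth_removeNth, ← MultilinearMap.map_update_smul]
  have h1 : (fun j => (Function.update (fun _ => LinearMap.id) i (augProj k A) : Fin (n + 1) → A →ₗ[k] A) j (h j))
      = Function.update h i (augProj k A (h i)) := by
    funext j
    rcases eq_or_ne j i with rfl | hj
    · simp
    · simp [hj]
  rw [h1, augProj, LinearMap.sub_apply, MultilinearMap.map_update_sub, LinearMap.id_apply,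
    Function.update_eq_self]
  rfl

theorem map_augProj {n : ℕ} {x : Pow k A n} (hx : x ∈ (CM k A).normalized n) :
    PiTensorProduct.map (fun _ => augProj k A) x = x := by
  cases n with
  | zero =>
    rw [show (fun _ : Fin 0 => augProj k A) = fun _ => LinearMap.id from funext fun i => i.elim0,
      PiTensorProduct.map_id, LinearMap.id_apply]
  | succ n =>
    have hx' : ∀ i, codegeneracy k A n i x = 0 := by
      have : x ∈ ⨅ i, LinearMap.ker (codegeneracy k A n i) := hx
      rwa [Submodule.mem_iInf] at this
    have key (s : Finset (Fin (n + 1))) : PiTensorProduct.map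
        (fun i => if i ∈ s then augProj k A else LinearMap.id) x = x := by
      induction s using Finset.induction_on with
      | empty => simp
      | insert a s ha ih =>
        have : (fun i => if i ∈ insert a s then augProj k A else LinearMap.id) =
            fun i => (Function.update (fun _ => LinearMap.id) a (augProj k A) :
              Fin (n + 1) → A →ₗ[k] A) i ∘ₗ (if i ∈ s then augProj k A else LinearMap.id) := by
          funext i
          rcases eq_or_ne i a with rfl | hi
          · simp [ha]
          · simp [hi]
        rw [this, PiTensorProduct.map_comp, comp_apply, ih, map_update_augProj, hx',
          map_zero, sub_zero]
    simpa using key Finset.univ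

theorem lof_mem_span_of_mem_normalized {n : ℕ} {x : Pow k A n}
    (hx : x ∈ (CM k A).normalized n) :
    lof k ℕ (CM k A).X n x ∈
      Submodule.span k {X | ∃ l : List A, l.length = n ∧ IsNorm k l ∧ wd k A l = X} := by
  rw [← map_augProj hx]
  have hx2 : x ∈ Submodule.span k (Set.range (tprod k (s := fun _ : Fin n => A))) := by
    rw [PiTensorProduct.span_tprod_eq_top]; trivial
  clear hx
  induction hx2 using Submodule.span_induction with
  | mem x h =>
    obtain ⟨h, rfl⟩ := h
    refine Submodule.subset_span ⟨List.ofFn fun i => augProj k A (h i), by simp, ?_, ?_⟩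
    · intro a ha
      obtain ⟨i, rfl⟩ := List.mem_ofFn.1 ha
      exact counit_augProj _
    · rw [map_tprod, lof_tprod]
  | zero => simp
  | add x y _ _ h1 h2 => rw [map_add, map_add]; exact add_mem h1 h2
  | smul c x _ h1 => rw [map_smul, map_smul]; exact Submodule.smul_mem _ _ h1

theorem wd_mem_part {l : List A} (hl : IsNorm k l) {i : ZMod 2} (hi : (l.length : ZMod 2) = i) :
    wd k A l ∈ (CM k A).periodic.part i := by
  refine Submodule.mem_iSup_of_mem l.length (Submodule.mem_iSup_of_mem hi ?_)
  rw [wd_eq_lof]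
  refine Submodule.mem_map_of_mem (mem_normalized.2 fun j => ?_)
  rw [← wd_eq_lof]
  exact sTot_wd_of_isNorm hl j

theorem part_eq_span (i : ZMod 2) : (CM k A).periodic.part i =
    Submodule.span k {X | ∃ l : List A, (l.length : ZMod 2) = i ∧ IsNorm k l ∧ wd k A l = X} := by
  apply le_antisymm
  · refine iSup_le (α := Submodule k 𝒯) fun n => iSup_le fun hn => ?_
    rintro _ ⟨x, hx, rfl⟩
    refine Submodule.span_mono ?_ (lof_mem_span_of_mem_normalized hx)
    rintro X ⟨l, rfl, h⟩
    exact ⟨l, hn, h⟩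
  · refine (Submodule.span_le (M := 𝒯)).2 ?_
    rintro X ⟨l, hi, hl, rfl⟩
    exact wd_mem_part hl hi

/-- Induction on normalized cochains. -/
theorem part_induction {i : ZMod 2} {P : 𝒯 → Prop}
    (hw : ∀ l : List A, (l.length : ZMod 2) = i → IsNorm k l → P (wd k A l))
    (h0 : P 0) (ha : ∀ X Y, P X → P Y → P (X + Y)) (hs : ∀ (c : k) X, P X → P (c • X)) {X : 𝒯}
    (hX : X ∈ (CM k A).periodic.part i) : P X := by
  rw [part_eq_span] at hX
  induction hX using Submodule.span_induction with
  | mem x h => obtain ⟨l, h1, h2, rfl⟩ := h; exact hw l h1 h2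
  | zero => exact h0
  | add x y _ _ hx hy => exact ha _ _ hx hy
  | smul c x _ hx => exact hs _ _ hx

theorem mem_part_of_sTot {n : ℕ} {i : ZMod 2} (hn : (n : ZMod 2) = i) (x : Pow k A n)
    (h : ∀ j, (CM k A).sTot j (lof k ℕ (CM k A).X n x) = 0) :
    lof k ℕ (CM k A).X n x ∈ (CM k A).periodic.part i :=
  Submodule.mem_iSup_of_mem n (Submodule.mem_iSup_of_mem hn
    (Submodule.mem_map_of_mem (mem_normalized.2 h)))

theorem bT_consT (c : A) (X : 𝒯) : bT k A (consT k A c X) =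
    consT k A 1 (consT k A c X) - cons₂T k A (comul (R := k) c) X + consT k A c (consT k A 1 X) -
      consT k A c (bT k A X) := by
  rw [bT_eq, bT_eq X, sgnT_consT, delT_consT]
  simp only [map_sub, map_neg, snocT_consT]
  abel

theorem bT_nil : bT k A (wd k A []) = 0 := by
  rw [bT_eq, delT_nil, sgnT_wd, List.length_nil, pow_zero, one_smul, snocT_nil, sub_self, sub_zero]

theorem sTot_zero_cons₂T (z : A ⊗[k] A) (X : 𝒯) : (CM k A).sTot 0 (cons₂T k A z X) =
    consT k A (TensorProduct.lid k A (counit.rTensor A z)) X := by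
  induction z with
  | zero => simp
  | add y z hy hz => simp only [map_add, LinearMap.add_apply, hy, hz]
  | tmul x y => rw [cons₂T_tmul, sTot_zero_consT]; simp

theorem sTot_one_cons₂T (z : A ⊗[k] A) (X : 𝒯) : (CM k A).sTot 1 (cons₂T k A z X) =
    consT k A (TensorProduct.rid k A (counit.lTensor A z)) X := by
  induction z with
  | zero => simp
  | add y z hy hz => simp only [map_add, LinearMap.add_apply, hy, hz]
  | tmul x y => rw [cons₂T_tmul, sTot_succ_consT, sTot_zero_consT]; simp

theorem sTot_add_two_cons₂T (j : ℕ) (z : A ⊗[k] A) (X : 𝒯) :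
    (CM k A).sTot (j + 2) (cons₂T k A z X) =
      cons₂T k A z ((CM k A).sTot j X) := by
  induction z with
  | zero => simp
  | add y z hy hz => simp only [map_add, LinearMap.add_apply, hy, hz]
  | tmul x y => rw [cons₂T_tmul, sTot_succ_consT, sTot_succ_consT, cons₂T_tmul]

theorem sTot_bT_wd {l : List A} (hl : IsNorm k l) (j : ℕ) :
    (CM k A).sTot j (bT k A (wd k A l)) = 0 := by
  induction l generalizing j with
  | nil => rw [bT_nil, map_zero]
  | cons c l ih =>
    obtain ⟨hc, hl⟩ := isNorm_cons.1 hl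
    rw [wd, bT_consT]
    simp only [map_add, map_sub]
    match j with
    | 0 =>
      rw [sTot_zero_consT, sTot_zero_consT, sTot_zero_consT, sTot_zero_cons₂T, hc,
        Coalgebra.rTensor_counit_comul]
      simp
    | 1 =>
      rw [sTot_succ_consT, sTot_succ_consT, sTot_succ_consT, sTot_zero_consT, sTot_zero_consT,
        sTot_one_cons₂T, hc, Coalgebra.lTensor_counit_comul, ih hl]
      simp
    | j + 2 =>
      rw [sTot_succ_consT, sTot_succ_consT, sTot_succ_consT, sTot_succ_consT, sTot_succ_consT,
        sTot_add_two_cons₂T, sTot_wd_of_isNorm hl, ih hl]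
      simp

theorem bT_mem_part {i : ZMod 2} {X : 𝒯} (hX : X ∈ (CM k A).periodic.part i) :
    bT k A X ∈ (CM k A).periodic.part (i + 1) := by
  refine part_induction (P := fun X => bT k A X ∈ (CM k A).periodic.part (i + 1))
    (fun l hi hl => ?_) ?_ (fun X Y hX hY => ?_) (fun c X hX => ?_) hX
  · have h := sTot_bT_wd hl
    rw [wd_eq_lof, bT, DirectSum.toModule_lof] at h ⊢
    exact mem_part_of_sTot (by rw [← hi]; push_cast; rfl) _ h
  · rw [map_zero]; exact zero_mem _
  · rw [map_add]; exact add_mem hX hY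
  · rw [map_smul]; exact Submodule.smul_mem _ _ hX

end Normalized

section Connes

open PiTensorProduct Coalgebra Word

variable {k : Type u} {A : Type w} [CommRing k] [Ring A] [HopfAlgebra k A]
  [PrimitivelyGenerated k A]

local notation "𝒯" => CocyclicOperators.Tot (CM k A)

variable (k A) in
/-- The norm operator `∑ λ^i` on the direct sum of all `C^n`. -/
def NT : Module.End k 𝒯 :=
  DirectSum.toModule k ℕ _ fun n => ∑ i ∈ Finset.range (n + 1),
    lof k ℕ (CM k A).X n ∘ₗ (CM k A).lam n ^ i

variable (k A) in
/-- The operator `N f`, which is Connes' operator `B` on normalized cochains. -/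
def FNT : Module.End k 𝒯 := NT k A ∘ₗ fT k A

theorem lof_lam (n : ℕ) (x : Pow k A n) :
    lof k ℕ (CM k A).X n ((CM k A).lam n x) = (-1 : k) ^ n •
      (CM k A).τTot (lof k ℕ (CM k A).X n x) := by
  rw [CocyclicOperators.lam, LinearMap.smul_apply, map_smul, CocyclicOperators.τTot,
    DirectSum.toModule_lof, comp_apply]

theorem lof_lam_pow (n i : ℕ) (x : Pow k A n) :
    lof k ℕ (CM k A).X n (((CM k A).lam n ^ i) x) =
      (-1 : ℤ) ^ (n * i) •
        ((CM k A).τTot ^ i) (lof k ℕ (CM k A).X n x) := by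
  induction i with
  | zero => simp
  | succ i ih =>
    rw [pow_succ', Module.End.mul_apply, lof_lam, neg_one_pow_smul, ih, mul_add, pow_add, mul_smul,
      mul_one, pow_succ', Module.End.mul_apply, map_zsmul, sign_comm]

theorem exists_lof_fT_wd (w : List A) : ∃ x, fT k A (wd k A w) =
    lof k ℕ (CM k A).X (w.length - 1) x := by
  cases w with
  | nil => exact ⟨0, by rw [fT_nil, map_zero]⟩
  | cons c v =>
    rw [wd_eq_lof, fT, DirectSum.toModule_lof]
    exact ⟨_, rfl⟩

theorem FNT_wd (w : List A) : FNT k A (wd k A w) = cyc w fun v => fT k A (wd k A v) := by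
  rw [FNT, comp_apply]
  cases w with
  | nil => rw [fT_nil, map_zero, cyc, mark]
  | cons c v =>
    obtain ⟨x, hx⟩ := exists_lof_fT_wd (k := k) (c :: v)
    have hlen : (c :: v).length - 1 + 1 = (c :: v).length := by simp
    rw [cyc, mark_eq_sum, hx, NT, DirectSum.toModule_lof, LinearMap.sum_apply, hlen,
      Finset.sum_range]
    refine Finset.sum_congr rfl fun i _ => ?_
    rw [comp_apply, lof_lam_pow, ← hx]
    have h := τTot_pow_fT_wd (k := k) ((c :: v).take i) ((c :: v).drop i)
    have hi := i.2
    rw [List.take_append_drop, List.length_take, min_eq_left hi.le,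
      ← List.cons_getElem_drop_succ (h := hi)] at h
    rw [h, smul_smul, ← pow_add, List.length_take, List.length_drop, min_eq_left hi.le]
    congr 1
    obtain ⟨m, hm⟩ := Nat.exists_eq_add_of_lt hi
    have e1 : (c :: v).length - 1 = i + m := by omega
    have e2 : (c :: v).length - (i + 1) = m := by omega
    rw [e1, e2, add_mul, pow_add, pow_add, mul_comm m, mul_comm,]
    congr 1
    rcases Nat.even_or_odd (i : ℕ) with h | h
    · rw [(h.mul_left _).neg_one_pow, h.neg_one_pow]
    · rw [(h.mul h).neg_one_pow, h.neg_one_pow]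

theorem fT_sTot_τTot_lof (n : ℕ) (x : Pow k A (n + 1)) :
    lof k ℕ (CM k A).X n
      (codegeneracy k A n (Fin.last n) (cyclicOp k A (n + 1) x)) =
    fT k A (lof k ℕ (CM k A).X (n + 1) x) := by
  suffices h : lof k ℕ (CM k A).X n ∘ₗ
      codegeneracy k A n (Fin.last n) ∘ₗ cyclicOp k A (n + 1) =
      fT k A ∘ₗ lof k ℕ (CM k A).X (n + 1) from LinearMap.congr_fun h x
  refine PiTensorProduct.ext (MultilinearMap.ext fun h => ?_)
  simp only [LinearMap.compMultilinearMap_apply, comp_apply]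
  have h1 := sTot_τTot_pow_wd (k := k) [] (List.ofFn (Fin.tail h)) (h 0)
  rw [List.nil_append, List.append_nil, List.length_nil, zero_add, pow_one] at h1
  have h2 : h 0 :: List.ofFn (Fin.tail h) = List.ofFn h := by rw [List.ofFn_succ]; rfl
  rw [h2, ← lof_tprod, CocyclicOperators.τTot, DirectSum.toModule_lof, comp_apply,
    CocyclicOperators.sTot, DirectSum.toModule_lof] at h1
  simp only [List.length_ofFn, Nat.lt_succ_self, dif_pos, comp_apply] at h1
  exact h1

theorem BT_eq (X : 𝒯) :
    BT k A X = FNT k A (X - sgnT k A ((CM k A).τTot X)) := by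
  suffices h : BT k A = FNT k A ∘ₗ (LinearMap.id - sgnT k A ∘ₗ (CM k A).τTot) from
    LinearMap.congr_fun h X
  refine DirectSum.linearMap_ext _ fun n => LinearMap.ext fun x => ?_
  simp only [comp_apply]
  have h1 : (LinearMap.id - sgnT k A ∘ₗ (CM k A).τTot : Module.End k 𝒯)
      (lof k ℕ (CM k A).X n x) =
      lof k ℕ (CM k A).X n
        (x - (CM k A).lam n x) := by
    rw [LinearMap.sub_apply, comp_apply, map_sub, lof_lam, neg_one_pow_smul,
      CocyclicOperators.τTot, DirectSum.toModule_lof, comp_apply, sgnT_lof,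
      LinearMap.id_apply]
  rw [h1, BT, DirectSum.toModule_lof, FNT, comp_apply]
  cases n with
  | zero =>
    rw [fT, DirectSum.toModule_lof]
    simp
  | succ n =>
    rw [← fT_sTot_τTot_lof, NT, DirectSum.toModule_lof]
    simp [CocyclicOperators.B]

theorem fT_τTot_wd {w : List A} (hw : IsNorm k w) :
    fT k A ((CM k A).τTot (wd k A w)) = 0 := by
  cases w with
  | nil => rw [τTot_nil, fT_nil]
  | cons c v =>
    rw [τTot_wd, List.cons_append, wd, fT_fT_consT, (isNorm_cons.1 hw).1, zero_smul]

theorem fT_sgnT (X : 𝒯) : fT k A (sgnT k A X) = -sgnT k A (fT k A X) := by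
  induction X using tot_induction with
  | hadd X Y hX hY => simp only [map_add, hX, hY]; abel
  | hsmul r X hX => simp only [map_smul, hX, smul_neg]
  | hnil => rw [sgnT_wd, map_zsmul, fT_nil]; simp
  | hcons c X hX => rw [sgnT_consT, map_neg, fT_consT, fT_consT, sgnT_actT]

theorem dTot_eq_of_mem_part {i : ZMod 2} {X : 𝒯}
    (hX : X ∈ (CM k A).periodic.part i) :
    (CM k A).dTot X = bT k A X + FNT k A X := by
  rw [dTot_eq, LinearMap.add_apply, BT_eq, map_sub]
  congr 1
  refine part_induction (P := fun X => FNT k A X - FNT k A (sgnT k A ((CM k A).τTot X)) = FNT k A X)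
    (fun l hi hl => ?_) ?_ (fun X Y hX hY => ?_) (fun c X hX => ?_) hX
  · rw [FNT, comp_apply, comp_apply, fT_sgnT, fT_τTot_wd hl]
    simp
  · simp
  · simp only [map_add] at hX hY ⊢
    refine Eq.trans ?_ (congrArg₂ (· + ·) hX hY)
    abel
  · simp only [map_smul, ← smul_sub, hX]

theorem FNT_bT (X : 𝒯) [Invertible (2 : k)] : FNT k A (bT k A X) = -bT k A (FNT k A X) := by
  suffices h : FNT k A ∘ₗ bT k A = -(bT k A ∘ₗ FNT k A) from LinearMap.congr_fun h X
  obtain ⟨dup, hd, hdup⟩ := exists_symm_dup k A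
  refine tot_ext fun w => ?_
  rw [comp_apply, LinearMap.neg_apply, comp_apply, bT_wd hd, map_bsum]
  simp only [FNT_wd]
  rw [cyc_bsum hdup, map_cyc]
  simp only [bT_fT_wd hd]
  exact neg_one_smul ℤ _

theorem rotate_perm {L : Type*} (w : List L) (i : Fin w.length) :
    (w[i] :: w.drop (i + 1) ++ w.take i).Perm w := by
  have h : w.drop i = w[i] :: w.drop (i + 1) := List.drop_eq_getElem_cons i.2
  rw [← h]
  exact List.perm_append_comm.trans (by rw [List.take_append_drop])

theorem cyc_congr_perm {L M : Type*} [AddCommGroup M] (w : List L) {F G : List L → M}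
    (h : ∀ v, v.Perm w → F v = G v) : cyc w F = cyc w G := by
  rw [cyc, cyc, mark_eq_sum, mark_eq_sum]
  refine Finset.sum_congr rfl fun i _ => ?_
  rw [h _ (rotate_perm w i)]

theorem IsNorm.perm {v w : List A} (hw : IsNorm k w) (h : v.Perm w) : IsNorm k v :=
  fun a ha => hw a (h.subset ha)

theorem cyc_zero {L M : Type*} [AddCommGroup M] (w : List L) : cyc w (fun _ => (0 : M)) = 0 := by
  simp [cyc, mark_zero]

theorem fT_FNT_wd {w : List A} (hw : IsNorm k w) : fT k A (FNT k A (wd k A w)) = 0 := by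
  rw [FNT_wd, map_cyc, ← cyc_zero w]
  refine cyc_congr_perm w fun v hv => ?_
  cases v with
  | nil => rw [fT_nil, map_zero]
  | cons c v => rw [wd, fT_fT_consT, (isNorm_cons.1 (hw.perm hv)).1, zero_smul]

theorem FNT_FNT {i : ZMod 2} {X : 𝒯} (hX : X ∈ (CM k A).periodic.part i) :
    FNT k A (FNT k A X) = 0 := by
  refine part_induction (P := fun X => FNT k A (FNT k A X) = 0)
    (fun l hi hl => ?_) ?_ (fun X Y hX hY => ?_) (fun c X hX => ?_) hX
  · rw [FNT, comp_apply, ← FNT, fT_FNT_wd hl, map_zero]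
  · simp
  · rw [map_add, map_add, hX, hY, add_zero]
  · rw [map_smul, map_smul, hX, smul_zero]

theorem fT_wd_mem_part {w : List A} (hw : IsNorm k w) {i : ZMod 2}
    (hi : (w.length : ZMod 2) = i + 1) : fT k A (wd k A w) ∈ (CM k A).periodic.part i := by
  cases w with
  | nil => rw [fT_nil]; exact zero_mem _
  | cons c v =>
    have h (j : ℕ) : (CM k A).sTot j (fT k A (wd k A (c :: v))) = 0 := by
      rw [fT_wd_cons, sTot_actT, sTot_wd_of_isNorm (isNorm_cons.1 hw).2, map_zero]
    obtain ⟨x, hx⟩ := exists_lof_fT_wd (k := k) (c :: v)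
    rw [hx] at h ⊢
    refine mem_part_of_sTot ?_ x h
    simpa using hi

theorem cyc_mem {M : Type*} [AddCommGroup M] [Module k M] (S : Submodule k M) {L : Type*}
    (w : List L) {F : List L → M} (h : ∀ v, v.Perm w → F v ∈ S) : cyc w F ∈ S := by
  rw [cyc, mark_eq_sum]
  refine sum_mem fun i _ => zsmul_mem (zsmul_mem (h _ (rotate_perm w i)) _) _

theorem FNT_mem_part {i : ZMod 2} {X : 𝒯} (hX : X ∈ (CM k A).periodic.part (i + 1)) :
    FNT k A X ∈ (CM k A).periodic.part i := by
  refine part_induction (P := fun X => FNT k A X ∈ (CM k A).periodic.part i)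
    (fun l hi hl => ?_) ?_ (fun X Y hX hY => ?_) (fun c X hX => ?_) hX
  · rw [FNT_wd]
    exact cyc_mem _ _ fun v hv => fT_wd_mem_part (hl.perm hv) (by rw [hv.length_eq, hi])
  · rw [map_zero]; exact zero_mem _
  · rw [map_add]; exact add_mem hX hY
  · rw [map_smul]; exact Submodule.smul_mem _ _ hX

theorem dTot_mem_part {i : ZMod 2} {X : 𝒯} (hX : X ∈ (CM k A).periodic.part (i + 1)) :
    (CM k A).dTot X ∈ (CM k A).periodic.part i := by
  rw [dTot_eq_of_mem_part hX]
  have h := bT_mem_part hX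
  have h2 : i + 1 + 1 = i := by
    rw [add_assoc, show (1 : ZMod 2) + 1 = 0 from rfl, add_zero]
  rw [h2] at h
  exact add_mem h (FNT_mem_part hX)

theorem dTot_dTot [Invertible (2 : k)] {i : ZMod 2} {X : 𝒯}
    (hX : X ∈ (CM k A).periodic.part (i + 1)) :
    (CM k A).dTot ((CM k A).dTot X) = 0 := by
  rw [dTot_eq_of_mem_part (dTot_mem_part hX), dTot_eq_of_mem_part hX, map_add, map_add, bT_bT,
    FNT_FNT hX, FNT_bT]
  abel

end Connes
end HopfCyclic

namespace Word

variable {L M : Type*} [AddCommGroup M]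

theorem unsh_mem (S : AddSubgroup M) (w : List L) {F : List L → List L → M}
    (h : ∀ l r, (l ++ r).Perm w → F l r ∈ S) : unsh w F ∈ S := by
  induction w generalizing F with
  | nil => exact h [] [] (List.Perm.refl _)
  | cons c w ih =>
    exact add_mem (ih fun l r hlr => h _ _ (hlr.cons c))
      (ih fun l r hlr => S.zsmul_mem (h _ _ (List.perm_middle.trans (hlr.cons c))) _)

theorem unshR_mem (S : AddSubgroup M) (w : List L) {F : List L → List L → L → List L → M}
    (h : ∀ l r b r', (l ++ (r ++ b :: r')).Perm w → F l r b r' ∈ S) : unshR w F ∈ S := by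
  induction w generalizing F with
  | nil => exact zero_mem _
  | cons c w ih =>
    refine add_mem (add_mem (ih fun l r b r' hp => ?_) (ih fun l r b r' hp => ?_))
      (unsh_mem S w fun l r hp => ?_)
    · exact h _ _ _ _ (hp.cons c)
    · exact S.zsmul_mem (h _ _ _ _ (List.perm_middle.trans (hp.cons c))) _
    · exact S.zsmul_mem (h _ _ _ _ (List.perm_middle.trans (hp.cons c))) _

theorem unshLR_mem (S : AddSubgroup M) (w : List L)
    {F : List L → L → List L → List L → L → List L → M}
    (h : ∀ l a l' r b r', ((l ++ a :: l') ++ (r ++ b :: r')).Perm w → F l a l' r b r' ∈ S) :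
    unshLR w F ∈ S := by
  induction w generalizing F with
  | nil => exact zero_mem _
  | cons c w ih =>
    refine add_mem (add_mem (ih fun l a l' r b r' hp => ?_) (ih fun l a l' r b r' hp => ?_))
      (unshR_mem S w fun l r b r' hp => ?_)
    · exact h _ _ _ _ _ _ (hp.cons c)
    · exact S.zsmul_mem (S.zsmul_mem (S.zsmul_mem
        (h _ _ _ _ _ _ (List.perm_middle.trans (hp.cons c))) _) _) _
    · exact h _ _ _ _ _ _ (hp.cons c)

theorem cycLR_mem (S : AddSubgroup M) (w : List L) {H : List L → List L → M}
    (h : ∀ l r, (l ++ r).Perm w → H l r ∈ S) : cycLR w H ∈ S := by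
  refine unshLR_mem S w fun l a l' r b r' hp => S.zsmul_mem (S.zsmul_mem (S.zsmul_mem (S.zsmul_mem
    (h _ _ (List.Perm.trans ?_ hp)) _) _) _) _
  exact List.perm_append_comm.append List.perm_append_comm

theorem unshLR_congr_funext (w : List L) {F G : List L → List L → M} (h : ∀ l r, F l r = G l r) :
    cycLR w F = cycLR w G := by
  rw [show F = G from funext fun l => funext (h l)]

theorem add_sign_congr {k : Type*} [CommRing k] [Module k M] (n : ℕ) {x x' y y' : M} (hx : x = x')
    (hy : y = y') : x + (-1 : k) ^ n • y = x' + (-1 : k) ^ n • y' := by rw [hx, hy]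

theorem add_sign_congr' {k : Type*} [CommRing k] [Module k M] (n : ℕ) {x x' y y' : M} (hx : x = x')
    (hy : y = y') : x + (-1 : ℤ) • (-1 : k) ^ n • y = x' + -((-1 : k) ^ n • y') := by
  rw [hx, hy, neg_one_smul]

end Word

namespace HopfCyclic

universe u w

section Connes

open PiTensorProduct Coalgebra Word

variable {k : Type u} {A : Type w} [CommRing k] [Ring A] [HopfAlgebra k A]
  [PrimitivelyGenerated k A]

local notation "𝒯" => CocyclicOperators.Tot (CM k A)

variable (k A) in
/-- The normalized cochains of parity `i`, as a submodule of the sum of all cochains. -/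
def normPart (i : ZMod 2) : Submodule k 𝒯 := (CM k A).periodic.part i

variable (k A) in
/-- The normalized cochains of parity `i` of the tensor square. -/
def tensPart (i : ZMod 2) : Submodule k (𝒯 ⊗[k] 𝒯) :=
  ⨆ (ij : ZMod 2 × ZMod 2) (_ : ij.1 + ij.2 = i),
    LinearMap.range (TensorProduct.mapIncl (normPart k A ij.1) (normPart k A ij.2))

theorem tmul_mem_tensPart {i j n : ZMod 2} (h : i + j = n) {X Y : 𝒯} (hX : X ∈ normPart k A i)
    (hY : Y ∈ normPart k A j) : X ⊗ₜ Y ∈ tensPart k A n :=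
  Submodule.mem_iSup_of_mem (i, j) (Submodule.mem_iSup_of_mem h ⟨⟨X, hX⟩ ⊗ₜ ⟨Y, hY⟩, rfl⟩)

/-- The extension of an odd operator to the tensor square. -/
def tensD (D : Module.End k 𝒯) : Module.End k (𝒯 ⊗[k] 𝒯) :=
  TensorProduct.map D LinearMap.id + TensorProduct.map (sgnT k A) D

theorem tensD_wd (D : Module.End k 𝒯) (l : List A) (Y : 𝒯) : tensD D (wd k A l ⊗ₜ Y) =
    D (wd k A l) ⊗ₜ Y + (-1 : k) ^ l.length • (wd k A l ⊗ₜ D Y) := by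
  rw [tensD, LinearMap.add_apply, map_tmul, map_tmul, sgnT_tmul]
  rfl

theorem tensD_fT_wd (D : Module.End k 𝒯) (l : List A) (Y : 𝒯) :
    tensD D (fT k A (wd k A l) ⊗ₜ Y) = D (fT k A (wd k A l)) ⊗ₜ Y +
      -((-1 : k) ^ l.length • (fT k A (wd k A l) ⊗ₜ D Y)) := by
  rw [tensD, LinearMap.add_apply, map_tmul, map_tmul,
    show sgnT k A (fT k A (wd k A l)) = -((-1 : k) ^ l.length • fT k A (wd k A l)) by
      rw [neg_one_pow_smul, ← map_zsmul, ← sgnT_wd, fT_sgnT, neg_neg],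
    TensorProduct.neg_tmul, ← TensorProduct.smul_tmul']
  rfl

theorem tensor_part_induction {i : ZMod 2} {P : 𝒯 ⊗[k] 𝒯 → Prop}
    (hw : ∀ l r : List A, ((l.length : ZMod 2) + (r.length : ZMod 2)) = i → IsNorm k l →
      IsNorm k r → P (wd k A l ⊗ₜ wd k A r))
    (h0 : P 0) (ha : ∀ X Y, P X → P Y → P (X + Y)) (hs : ∀ (c : k) X, P X → P (c • X))
    {Z : 𝒯 ⊗[k] 𝒯} (hZ : Z ∈ tensPart k A i) :
    P Z := by
  induction hZ using Submodule.iSup_induction' with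
  | zero => exact h0
  | add x y _ _ hx hy => exact ha _ _ hx hy
  | mem ij z hz =>
    by_cases h : ij.1 + ij.2 = i
    · rw [iSup_pos h] at hz
      obtain ⟨t, rfl⟩ := hz
      induction t with
      | zero => rw [map_zero]; exact h0
      | add x y hx hy => rw [map_add]; exact ha _ _ hx hy
      | tmul x y =>
        obtain ⟨x, hx⟩ := x
        obtain ⟨y, hy⟩ := y
        change P (x ⊗ₜ y)
        refine part_induction (P := fun X => P (X ⊗ₜ y)) (fun l hi hl => ?_) ?_ (fun X Y hX hY => ?_)
          (fun c X hX => ?_) hx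
        · refine part_induction (P := fun Y => P (wd k A l ⊗ₜ Y)) (fun r hj hr => ?_) ?_
            (fun X Y hX hY => ?_) (fun c X hX => ?_) hy
          · exact hw l r (by rw [hi, hj, h]) hl hr
          · rw [tmul_zero]; exact h0
          · rw [tmul_add]; exact ha _ _ hX hY
          · rw [TensorProduct.tmul_smul]; exact hs _ _ hX
        · rw [zero_tmul]; exact h0
        · rw [add_tmul]; exact ha _ _ hX hY
        · rw [← TensorProduct.smul_tmul']; exact hs _ _ hX
    · rw [iSup_neg h] at hz
      rw [(Submodule.mem_bot k).1 hz]
      exact h0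

theorem tensor_d_eq {i : ZMod 2} {Z : 𝒯 ⊗[k] 𝒯}
    (hZ : Z ∈ tensPart k A i) :
    tensD (CM k A).dTot Z =
      tensD (bT k A) Z + tensD (FNT k A) Z := by
  refine tensor_part_induction (P := fun Z => tensD (CM k A).dTot Z =
    tensD (bT k A) Z + tensD (FNT k A) Z) (fun l r hlr hl hr => ?_) ?_ (fun X Y hX hY => ?_)
      (fun c X hX => ?_) hZ
  · rw [tensD_wd, tensD_wd, tensD_wd, dTot_eq_of_mem_part (wd_mem_part hl rfl),
      dTot_eq_of_mem_part (wd_mem_part hr rfl), add_tmul, tmul_add,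
      smul_add]
    abel
  · simp
  · refine Eq.trans (map_add _ _ _) (Eq.trans (congrArg₂ (· + ·) hX hY) ?_)
    rw [map_add, map_add]
    abel
  · rw [map_smul, map_smul, map_smul, hX, smul_add]

theorem fT_wd_one_cons (l : List A) : fT k A (wd k A (1 :: l)) = wd k A l := by
  rw [fT_wd_cons, HopfAlgebra.antipode_one, actT_one]

theorem delc_tmul (dup : A → List (A × A)) (l : List A) (F : List A → 𝒯) (Y : 𝒯) :
    delc dup l (fun v => F v ⊗ₜ[k] Y) = delc dup l F ⊗ₜ Y :=
  (map_delc ((TensorProduct.mk k 𝒯 𝒯).flip Y) dup l F).symm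

theorem delc_tmul_right (dup : A → List (A × A)) (l : List A) (F : List A → 𝒯) (Y : 𝒯) :
    delc dup l (fun v => Y ⊗ₜ[k] F v) = Y ⊗ₜ delc dup l F :=
  (map_delc (TensorProduct.mk k 𝒯 𝒯 Y) dup l F).symm

theorem cyc_tmul (l : List A) (F : List A → 𝒯) (Y : 𝒯) :
    cyc l (fun v => F v ⊗ₜ[k] Y) = cyc l F ⊗ₜ Y :=
  (map_cyc ((TensorProduct.mk k 𝒯 𝒯).flip Y) l F).symm

theorem cyc_tmul_right (l : List A) (F : List A → 𝒯) (Y : 𝒯) :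
    cyc l (fun v => Y ⊗ₜ[k] F v) = Y ⊗ₜ cyc l F :=
  (map_cyc (TensorProduct.mk k 𝒯 𝒯 Y) l F).symm

theorem ET_bT [Invertible (2 : k)] (X : 𝒯) : ET k A (bT k A X) =
    tensD (bT k A) (ET k A X) + tensD (FNT k A) (DT k A X) - DT k A (FNT k A X) := by
  suffices h : ET k A ∘ₗ bT k A = tensD (bT k A) ∘ₗ ET k A + tensD (FNT k A) ∘ₗ DT k A -
      DT k A ∘ₗ FNT k A from LinearMap.congr_fun h X
  obtain ⟨dup, hd, hdup⟩ := exists_symm_dup k A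
  refine tot_ext fun w => ?_
  rw [comp_apply, LinearMap.sub_apply, LinearMap.add_apply, comp_apply,
    comp_apply, comp_apply, bT_wd hd, map_bsum]
  simp only [ET_wd_eq_cycLR]
  rw [cycLR_bsum hdup, DT_wd, map_unsh, map_cycLR, FNT_wd, map_cyc]
  simp only [DT_fT_wd hd, fT_wd_one_cons]
  rw [neg_one_smul, ← sub_eq_add_neg]
  congr 2
  · refine unshLR_congr_funext w fun l r => ?_
    rw [tensD_fT_wd, bT_fT_wd hd, bT_fT_wd hd, ← neg_one_pow_smul k]
    exact add_sign_congr' _ (delc_tmul dup l _ _) (delc_tmul_right dup r _ _)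
  · refine unsh_congr w fun l r _ => ?_
    rw [tensD_wd, FNT_wd, FNT_wd, ← neg_one_pow_smul k]
    exact add_sign_congr _ (cyc_tmul l _ _) (cyc_tmul_right r _ _)

theorem FNT_fT_wd {l : List A} (hl : IsNorm k l) : FNT k A (fT k A (wd k A l)) = 0 := by
  rw [FNT, comp_apply]
  cases l with
  | nil => rw [fT_nil, map_zero, map_zero]
  | cons c v => rw [wd, fT_fT_consT, (isNorm_cons.1 hl).1, zero_smul, map_zero]

theorem ET_FNT_wd {w : List A} (hw : IsNorm k w) : ET k A (FNT k A (wd k A w)) = 0 := by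
  rw [FNT_wd, map_cyc, ← cyc_zero w]
  refine cyc_congr_perm w fun v hv => ?_
  cases v with
  | nil => rw [fT_nil, map_zero]
  | cons c v =>
    rw [fT_wd_cons, ET_actT, HopfAlgebra.counit_antipode, (isNorm_cons.1 (hw.perm hv)).1, zero_smul]

theorem tensD_FNT_ET_wd {w : List A} (hw : IsNorm k w) :
    tensD (FNT k A) (ET k A (wd k A w)) = 0 := by
  rw [ET_wd_eq_cycLR, map_cycLR]
  refine AddSubgroup.mem_bot.1 (cycLR_mem ⊥ w fun l r h => AddSubgroup.mem_bot.2 ?_)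
  obtain ⟨hl, hr⟩ := isNorm_append.1 (hw.perm h)
  rw [tensD_fT_wd, FNT_fT_wd hl, FNT_fT_wd hr, zero_tmul, tmul_zero,
    smul_zero, neg_zero, zero_add]

theorem cup'_mem_part {i : ZMod 2} {X : 𝒯} (hX : X ∈ normPart k A i) :
    cup' k A X ∈ tensPart k A i := by
  refine part_induction (P := fun X => cup' k A X ∈ tensPart k A i) (fun w hi hw => ?_) ?_
      (fun X Y hX hY => ?_) (fun c X hX => ?_) hX
  · rw [cup'_eq, LinearMap.add_apply, DT_wd, ET_wd_eq_cycLR]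
    refine add_mem ?_ ?_
    · refine unsh_mem (tensPart k A i).toAddSubgroup w fun l r h => ?_
      obtain ⟨hl, hr⟩ := isNorm_append.1 (hw.perm h)
      refine tmul_mem_tensPart ?_ (wd_mem_part hl rfl) (wd_mem_part hr rfl)
      rw [← Nat.cast_add, ← List.length_append, h.length_eq, hi]
    · refine cycLR_mem (tensPart k A i).toAddSubgroup w fun l r h => ?_
      obtain ⟨hl, hr⟩ := isNorm_append.1 (hw.perm h)
      have h2 : (1 : ZMod 2) + 1 = 0 := rfl
      have h3 (n : ℕ) : (n : ZMod 2) = ((n : ZMod 2) + 1) + 1 := by rw [add_assoc, h2, add_zero]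
      refine tmul_mem_tensPart ?_ (fT_wd_mem_part hl (h3 _)) (fT_wd_mem_part hr (h3 _))
      rw [add_add_add_comm, h2, add_zero, ← Nat.cast_add, ← List.length_append, h.length_eq, hi]
  · rw [map_zero]; exact zero_mem _
  · rw [map_add]; exact add_mem hX hY
  · rw [map_smul]; exact Submodule.smul_mem _ _ hX

/-- The coproduct of periodic cochains is a map of complexes. -/
theorem cup'_dTot [Invertible (2 : k)] {i : ZMod 2} {X : 𝒯} (hX : X ∈ normPart k A i) :
    cup' k A ((CM k A).dTot X) =
      tensD (CM k A).dTot (cup' k A X) := by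
  rw [tensor_d_eq (cup'_mem_part hX), dTot_eq_of_mem_part hX]
  have h1 : tensD (FNT k A) (ET k A X) = 0 ∧ ET k A (FNT k A X) = 0 := by
    refine part_induction (P := fun X => tensD (FNT k A) (ET k A X) = 0 ∧ ET k A (FNT k A X) = 0)
      (fun w hi hw => ⟨tensD_FNT_ET_wd hw, ET_FNT_wd hw⟩) (by simp) (fun X Y hX hY => ?_)
      (fun c X hX => ?_) hX
    · simp only [map_add, hX.1, hX.2, hY.1, hY.2, add_zero, and_self]
    · simp only [map_smul, hX.1, hX.2, smul_zero, and_self]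
  have h2 := DT_bT (k := k) X
  rw [← LinearMap.add_apply, ← tensD] at h2
  rw [cup'_eq]
  simp only [LinearMap.add_apply, map_add]
  rw [h1.1, h1.2, h2, ET_bT]
  abel

end Connes
end HopfCyclic

namespace Word

section Alt

variable {L M : Type*} [AddCommGroup M]

/-- The signed sum over all rearrangements of a tuple. -/
def altS {n : ℕ} (v : Fin n → L) (F : (Fin n → L) → M) : M :=
  ∑ σ : Equiv.Perm (Fin n), (Equiv.Perm.sign σ : ℤ) • F (v ∘ σ)

theorem altS_congr {n : ℕ} (v : Fin n → L) {F G : (Fin n → L) → M} (h : ∀ u, F u = G u) :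
    altS v F = altS v G := by rw [funext h]

theorem altS_add {n : ℕ} (v : Fin n → L) (F G : (Fin n → L) → M) :
    altS v (fun u => F u + G u) = altS v F + altS v G := by
  simp [altS, Finset.sum_add_distrib]

theorem altS_neg {n : ℕ} (v : Fin n → L) (F : (Fin n → L) → M) :
    altS v (fun u => -F u) = -altS v F := by
  simp [altS]

theorem altS_sum {n : ℕ} {ι : Type*} (s : Finset ι) (v : Fin n → L) (F : ι → (Fin n → L) → M) :
    altS v (fun u => ∑ i ∈ s, F i u) = ∑ i ∈ s, altS v (F i) := by
  simp only [altS, Finset.smul_sum]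
  exact Finset.sum_comm

theorem altS_smul {n : ℕ} (v : Fin n → L) (c : ℤ) (F : (Fin n → L) → M) :
    altS v (fun u => c • F u) = c • altS v F := by
  simp only [altS, Finset.smul_sum, smul_comm c]

theorem map_altS {N T : Type*} [AddCommGroup N] [FunLike T M N] [AddMonoidHomClass T M N] (f : T)
    {n : ℕ} (v : Fin n → L) (F : (Fin n → L) → M) : f (altS v F) = altS v fun u => f (F u) := by
  simp only [altS, map_sum, map_zsmul]

theorem altS_perm {n : ℕ} (v : Fin n → L) (τ : Equiv.Perm (Fin n)) (F : (Fin n → L) → M) :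
    altS v (fun u => F (u ∘ τ)) = (Equiv.Perm.sign τ : ℤ) • altS v F := by
  rw [altS, altS, Finset.smul_sum]
  refine Fintype.sum_equiv (Equiv.mulRight τ) _ _ fun σ => ?_
  rw [Equiv.coe_mulRight, smul_smul, Equiv.Perm.sign_mul, Units.val_mul, mul_left_comm, ← Units.val_mul,
    Int.units_mul_self, Units.val_one, mul_one]
  rfl

theorem altS_sum_perm {n : ℕ} {ι : Type*} [Fintype ι] (v : Fin n → L) (e : ι → Equiv.Perm (Fin n))
    (F : (Fin n → L) → M) :
    altS v (fun u => ∑ t, (Equiv.Perm.sign (e t) : ℤ) • F (u ∘ e t)) = Fintype.card ι • altS v F := by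
  rw [altS_sum]
  simp only [altS_smul, altS_perm, smul_smul, ← Units.val_mul, Int.units_mul_self, Units.val_one,
    one_smul, Finset.sum_const, Finset.card_univ]

theorem altS_block {p q : ℕ} (v : Fin (p + q) → L) (F : (Fin p → L) → (Fin q → L) → M) :
    altS v (fun u => altS (u ∘ Fin.castAdd q) fun x => altS (u ∘ Fin.natAdd p) fun y => F x y) =
      (p.factorial * q.factorial) • altS v fun u => F (u ∘ Fin.castAdd q) (u ∘ Fin.natAdd p) := by
  have h := altS_sum_perm v
    (fun t : Equiv.Perm (Fin p) × Equiv.Perm (Fin q) =>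
      finSumFinEquiv.permCongr (Equiv.Perm.sumCongr t.1 t.2))
    fun u => F (u ∘ Fin.castAdd q) (u ∘ Fin.natAdd p)
  rw [Fintype.card_prod, Fintype.card_perm, Fintype.card_perm, Fintype.card_fin, Fintype.card_fin] at h
  rw [← h]
  refine altS_congr v fun u => ?_
  rw [Fintype.sum_prod_type]
  simp only [altS, Finset.smul_sum, smul_smul]
  refine Finset.sum_congr rfl fun σ _ => Finset.sum_congr rfl fun τ _ => ?_
  rw [Equiv.Perm.sign_permCongr, Equiv.Perm.sign_sumCongr, Units.val_mul]
  congr 2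
  · funext i; simp [Equiv.permCongr_apply]
  · funext i; simp [Equiv.permCongr_apply]

theorem factorial_smul_domCoprod {k V N₁ N₂ : Type*} [CommRing k] [AddCommGroup V] [Module k V]
    [AddCommGroup N₁] [Module k N₁] [AddCommGroup N₂] [Module k N₂] {p q n : ℕ}
    (a : V [⋀^Fin p]→ₗ[k] N₁) (b : V [⋀^Fin q]→ₗ[k] N₂) (e : Fin p ⊕ Fin q ≃ Fin n)
    (v : Fin n → V) :
    (p.factorial * q.factorial) • (a.domCoprod b).domDomCongr e v =
      altS v fun u => a (u ∘ e ∘ Sum.inl) ⊗ₜ[k] b (u ∘ e ∘ Sum.inr) := by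
  have h := congrArg (fun f => f (v ∘ e)) (MultilinearMap.domCoprod_alternization_eq a b)
  rw [Fintype.card_fin, Fintype.card_fin] at h
  refine h.symm.trans ?_
  simp only [MultilinearMap.alternatization_apply]
  rw [altS]
  refine Fintype.sum_equiv e.permCongr _ _ fun σ => ?_
  rw [Equiv.Perm.sign_permCongr, Units.smul_def]
  rw [MultilinearMap.domDomCongr_apply, MultilinearMap.domCoprod_apply]
  have h1 : (v ∘ ⇑(e.permCongr σ)) ∘ ⇑e ∘ Sum.inl = fun i => (v ∘ e) (σ (Sum.inl i)) := by
    funext i; simp [Equiv.permCongr_apply]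
  have h2 : (v ∘ ⇑(e.permCongr σ)) ∘ ⇑e ∘ Sum.inr = fun i => (v ∘ e) (σ (Sum.inr i)) := by
    funext i; simp [Equiv.permCongr_apply]
  rw [h1, h2]
  rfl

theorem card_shuffles {n m : ℕ} (hm : m ≤ n) : (shuffles n m).card = n.choose m := by
  induction n generalizing m with
  | zero =>
    obtain rfl : m = 0 := by omega
    simp [shuffles]
  | succ n ih =>
    have h := sum_shuffles_succ (n := n) (M := ℤ) fun m' _ => if m' = m then 1 else 0
    simp only [Finset.sum_const, smul_ite, smul_zero] at h
    rw [Finset.sum_ite_eq' , if_pos (by simp; omega),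
      Fin.sum_univ_eq_sum_range (fun m' => if m' = m then (shuffles n m').card • (1 : ℤ) else 0) (n + 1),
      Finset.sum_ite_eq'] at h
    cases m with
    | zero =>
      rw [if_pos (by simp), ih (Nat.zero_le n)] at h
      simp at h
      simpa using h
    | succ m =>
      simp only [add_left_inj] at h
      rw [Finset.sum_ite_eq', if_pos (by simp; omega), ih (by omega)] at h
      rw [Nat.choose_succ_succ]
      by_cases hmn : m + 1 ≤ n
      · rw [if_pos (by simp; omega), ih hmn] at h
        simp at h
        exact_mod_cast h
      · rw [if_neg (by simp; omega)] at h
        rw [Nat.choose_eq_zero_of_lt (by omega : n < m + 1)]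
        simp at h
        exact_mod_cast h

theorem altS_unsh {n : ℕ} (v : Fin n → L) (F : List L → List L → M) :
    altS v (fun u => unsh (List.ofFn u) F) = ∑ m ∈ Finset.range (n + 1), n.choose m •
      altS v fun u => F ((List.ofFn u).take m) ((List.ofFn u).drop m) := by
  simp only [List.ofFn_eq_map]
  simp only [← sum_shuffles]
  rw [altS_sum]
  refine Finset.sum_congr rfl fun m hm => ?_
  rw [altS_sum, ← card_shuffles (by simpa [Nat.lt_succ_iff] using hm), ← Finset.sum_const]
  refine Finset.sum_congr rfl fun σ _ => ?_
  have := altS_perm v σ fun u => F (((List.finRange n).take m).map u) (((List.finRange n).drop m).map u)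
  simp only [← List.map_take, ← List.map_drop]
  rw [altS_smul]
  refine (congrArg _ this).trans ?_
  rw [smul_smul, ← Units.val_mul, Int.units_mul_self, Units.val_one, one_smul]

theorem cycLR_map {L' : Type*} (f : L' → L) (w : List L') (H : List L → List L → M) :
    cycLR (w.map f) H = cycLR w fun l r => H (l.map f) (r.map f) := by
  simp only [cycLR, unshLR_map, List.length_map, List.map_append, List.map_cons]

theorem exists_perm_finRange {n : ℕ} {l : List (Fin n)} (h : l.Perm (List.finRange n)) :
    ∃ τ : Equiv.Perm (Fin n), l = (List.finRange n).map τ := by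
  have hlen : l.length = n := by simpa using h.length_eq
  have hnd : l.Nodup := h.nodup_iff.2 (List.nodup_finRange n)
  have hinj : Function.Injective fun i : Fin n => l.get (i.cast hlen.symm) := fun a b hab => by
    have := List.nodup_iff_injective_get.1 hnd hab
    simpa using this
  refine ⟨Equiv.ofBijective _ (Finite.injective_iff_bijective.1 hinj), ?_⟩
  refine List.ext_getElem (by simpa using hlen) fun i h1 h2 => ?_
  simp

theorem altS_cycLR_mem {n : ℕ} (v : Fin n → L) (H : List L → List L → M) (S : AddSubgroup M)
    (hS : ∀ m ≤ n, altS v (fun u => H ((List.ofFn u).take m) ((List.ofFn u).drop m)) ∈ S) :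
    altS v (fun u => cycLR (List.ofFn u) H) ∈ S := by
  let ev (u : Fin n → L) : ((Fin n → L) → M) →+ M := Pi.evalAddMonoidHom _ u
  let al : ((Fin n → L) → M) →+ M :=
    { toFun := altS v, map_zero' := by simp [altS], map_add' := fun F G => altS_add v F G }
  have h1 : (fun u => cycLR (List.ofFn u) H) =
      cycLR (List.finRange n) fun l r => fun u : Fin n → L => H (l.map u) (r.map u) := by
    funext u
    have := map_cycLR (ev u) (List.finRange n) fun l r => fun u : Fin n → L => H (l.map u) (r.map u)
    rw [List.ofFn_eq_map, cycLR_map]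
    exact this.symm
  have h2 := map_cycLR al (List.finRange n) fun l r => fun u : Fin n → L => H (l.map u) (r.map u)
  rw [h1]
  change al _ ∈ S
  rw [h2]
  refine cycLR_mem S _ fun l r hp => ?_
  obtain ⟨τ, hτ⟩ := exists_perm_finRange hp
  have hl : l = ((List.finRange n).map τ).take l.length := by rw [← hτ, List.take_left]
  have hr : r = ((List.finRange n).map τ).drop l.length := by rw [← hτ, List.drop_left]
  have h3 : (fun u : Fin n → L => H (l.map u) (r.map u)) = fun u =>
      H ((List.ofFn (u ∘ τ)).take l.length) ((List.ofFn (u ∘ τ)).drop l.length) := by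
    funext u
    rw [List.ofFn_eq_map, ← List.map_map, ← List.map_take, ← List.map_drop, ← hl, ← hr]
  rw [h3]
  change altS v (fun u => H ((List.ofFn (u ∘ τ)).take l.length) ((List.ofFn (u ∘ τ)).drop l.length)) ∈ S
  rw [altS_perm v τ fun u => H ((List.ofFn u).take l.length) ((List.ofFn u).drop l.length)]
  refine S.zsmul_mem (hS _ ?_) _
  have := hp.length_eq
  simp at this
  omega

theorem ofFn_rotate {n : ℕ} (h : Fin (n + 1) → L) (i : ℕ) :
    (List.ofFn h).rotate i = List.ofFn (h ∘ ⇑(finRotate (n + 1) ^ i)) := by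
  induction i generalizing h with
  | zero => simp
  | succ i ih =>
    rw [← List.rotate_rotate, ih, pow_succ, List.ofFn_succ, List.rotate_cons_succ, List.rotate_zero]
    have : (h ∘ ⇑(finRotate (n + 1) ^ i * finRotate (n + 1))) =
      Fin.snoc (fun j : Fin n => (h ∘ ⇑(finRotate (n + 1) ^ i)) j.succ) ((h ∘ ⇑(finRotate (n + 1) ^ i)) 0) := by
      funext j
      induction j using Fin.lastCases with
      | last => simp
      | cast j => simp
    rw [this, List.ofFn_succ']
    simp [List.concat_eq_append]

/-- All rotations contribute equally to an alternating sum. -/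
theorem altS_cyc {n : ℕ} (v : Fin (n + 1) → L) (H : List L → M) :
    altS v (fun u => cyc (List.ofFn u) H) = (n + 1) • altS v fun u => H (List.ofFn u) := by
  have h (u : Fin (n + 1) → L) : cyc (List.ofFn u) H = ∑ i : Fin (n + 1),
      (Equiv.Perm.sign (finRotate (n + 1) ^ (i : ℕ)) : ℤ) •
        H (List.ofFn (u ∘ ⇑(finRotate (n + 1) ^ (i : ℕ)))) := by
    rw [cyc, mark_eq_sum_of_length _ (m := n + 1) (by simp)]
    refine Finset.sum_congr rfl fun i _ => ?_
    have hi := i.2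
    rw [← ofFn_rotate, List.rotate_eq_drop_append_take (by simp), smul_smul, ← pow_add,
      List.drop_eq_getElem_cons (i := (i : ℕ)) (l := List.ofFn u) (by simp; omega), map_pow, sign_finRotate]
    congr 1
    rw [List.length_take, List.length_drop, List.length_ofFn, min_eq_left hi.le]
    push_cast
    rw [← pow_mul]
    obtain ⟨m, hm⟩ := Nat.exists_eq_add_of_lt hi
    have e1 : n = i + m := by omega
    have e2 : n - i = m := by omega
    have e3 : n * (i : ℕ) = i * i + i * m := by rw [← mul_add, ← e1, mul_comm]
    rw [e2, e3, pow_add, pow_add, mul_comm]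
    congr 1
    rcases Nat.even_or_odd (i : ℕ) with h | h
    · rw [(h.mul_left _).neg_one_pow, h.neg_one_pow]
    · rw [(h.mul h).neg_one_pow, h.neg_one_pow]
  rw [altS_congr v h, altS_sum_perm v (fun i : Fin (n + 1) => finRotate (n + 1) ^ (i : ℕ)) fun u =>
    H (List.ofFn u), Fintype.card_fin]

theorem der_ofFn {n : ℕ} (φ : L → L) (h : Fin n → L) (F : List L → M) :
    der φ (List.ofFn h) F = ∑ i, F (List.ofFn (Function.update h i (φ (h i)))) := by
  induction n generalizing F with
  | zero => simp [der]
  | succ n ih =>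
    rw [List.ofFn_succ, der, ih, Fin.sum_univ_succ]
    congr 1
    · simp [List.ofFn_succ]
    · refine Finset.sum_congr rfl fun i _ => ?_
      rw [List.ofFn_succ (f := Function.update h i.succ _)]
      congr 2
      congr 1
      funext j
      rcases eq_or_ne j i with rfl | hj
      · simp
      · simp [hj]

end Alt

end Word

namespace HopfCyclic

universe u v w

section Antisymmetrization

open Coalgebra Word

/-- The tuple `([u_0, u_{i+1}])_i`, with all other entries of `u_1, …, u_n` unchanged. -/
def bracketAt {g : Type*} [Bracket g g] {m : ℕ} (i : Fin (m + 1)) (u : Fin (m + 2) → g) :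
    Fin (m + 1) → g :=
  Function.update (Fin.tail u) i ⁅u 0, u i.succ⁆

theorem sum_perm_apply_zero {M : Type*} [AddCommGroup M] {m : ℕ} (c : Fin (m + 1) → M) :
    ∑ τ : Equiv.Perm (Fin (m + 1)), c (τ⁻¹ 0) = m.factorial • ∑ i, c i := by
  rw [← Equiv.sum_comp (Equiv.inv (Equiv.Perm (Fin (m + 1))))]
  simp only [Equiv.inv_apply, inv_inv]
  rw [← Equiv.sum_comp Equiv.Perm.decomposeFin.symm, Fintype.sum_prod_type]
  simp [Finset.smul_sum, Fintype.card_perm]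

theorem altS_altS_bracketAt {g M : Type*} [Bracket g g] [AddCommGroup M] {m : ℕ}
    (v : Fin (m + 2) → g) (G : (Fin (m + 1) → g) → M) :
    altS v (fun u => altS (bracketAt 0 u) G) =
      m.factorial • ∑ i, altS v (fun u => G (bracketAt i u)) := by
  have h (u : Fin (m + 2) → g) (τ : Equiv.Perm (Fin (m + 1))) : bracketAt 0 u ∘ τ =
      bracketAt (τ⁻¹ 0) (u ∘ ⇑(Equiv.Perm.decomposeFin.symm (0, τ))) := by
    funext i
    by_cases hi : i = τ⁻¹ 0
    · subst hi
      simp [bracketAt]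
    · have : τ i ≠ 0 := fun h => hi (by rw [← h]; simp)
      rw [Function.comp_apply, bracketAt, bracketAt, Function.update_of_ne this,
        Function.update_of_ne hi]
      simp [Fin.tail]
  conv_lhs => enter [2, u]; rw [altS]
  rw [altS_sum, ← sum_perm_apply_zero fun i => altS v fun u => G (bracketAt i u)]
  refine Finset.sum_congr rfl fun τ _ => ?_
  simp only [h]
  rw [altS_smul, altS_perm v (Equiv.Perm.decomposeFin.symm (0, τ)) fun u => G (bracketAt (τ⁻¹ 0) u),
    Equiv.Perm.decomposeFin.symm_sign, if_pos rfl, one_mul, smul_smul, ← Units.val_mul,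
    Int.units_mul_self, Units.val_one, one_smul]

variable {k : Type u} {A : Type v} {g : Type w} [Field k] [CharZero k] [Ring A] [HopfAlgebra k A]
  [PrimitivelyGenerated k A] [LieRing g] [LieAlgebra k g] (j : g →ₗ[k] A)

local notation "𝒯" => CocyclicOperators.Tot (CM k A)

/-- The word of the images of a tuple. -/
def jwd {n : ℕ} (u : Fin n → g) : 𝒯 := wd k A (List.ofFn fun i => j (u i))

/-- Antisymmetrization with values in the direct sum of all cochains. -/
def antT (n : ℕ) : ⋀[k]^n g →ₗ[k] 𝒯 :=
  lof k ℕ (CM k A).X n ∘ₗ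
    exteriorPower.alternatingMapLinearEquiv ((n.factorial : k)⁻¹ •
      MultilinearMap.alternatization ((PiTensorProduct.tprod k).compLinearMap fun _ : Fin n => j))

theorem factorial_smul_antT {n : ℕ} (v : Fin n → g) :
    (n.factorial : k) • antT j n (exteriorPower.ιMulti k n v) = altS v (jwd j) := by
  have hn : (n.factorial : k) ≠ 0 := Nat.cast_ne_zero.2 n.factorial_ne_zero
  rw [antT, comp_apply, exteriorPower.alternatingMapLinearEquiv_apply_ιMulti,
    AlternatingMap.smul_apply, map_smul, smul_smul, mul_inv_cancel₀ hn, one_smul,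
    MultilinearMap.alternatization_apply, map_sum, altS]
  refine Finset.sum_congr rfl fun σ _ => ?_
  rw [Units.smul_def, map_zsmul, jwd, ← lof_tprod]
  rfl

theorem exterior_ext {M : Type*} [AddCommGroup M] [Module k M] {n : ℕ} {f f' : ⋀[k]^n g →ₗ[k] M}
    (h : ∀ v : Fin n → g, f (exteriorPower.ιMulti k n v) = f' (exteriorPower.ιMulti k n v)) :
    f = f' := by
  refine exteriorPower.linearMap_ext (AlternatingMap.ext fun v => h v)

theorem two_factorial_smul_lieD {m : ℕ} (v : Fin (m + 2) → g) :
    (2 * m.factorial) • lieD k g (m + 1) (exteriorPower.ιMulti k (m + 2) v) =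
      altS v fun u => exteriorPower.ιMulti k (m + 1) (bracketAt 0 u) := by
  rw [lieD, exteriorPower.alternatingMapLinearEquiv_apply_ιMulti,
    LinearMap.compAlternatingMap_apply, ← map_nsmul]
  have h := factorial_smul_domCoprod (bracketAlt k g) (exteriorPower.ιMulti k m)
    (finSumFinEquiv.trans (finCongr (add_comm 2 m))) v
  rw [Nat.factorial_two] at h
  rw [h, map_altS]
  refine altS_congr v fun u => ?_
  rw [wedge, TensorProduct.lift.tmul, comp_apply, LinearEquiv.coe_coe,
    exteriorPower.alternatingMapLinearEquiv_apply_ιMulti, AlternatingMap.curryLeft_apply_apply]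
  congr 1
  funext i
  induction i using Fin.cases with
  | zero => 
    simp [bracketAt, bracketAlt]
    rfl
  | succ i => 
    simp [bracketAt, bracketAlt, Fin.tail]
    rfl

theorem factorial_smul_cupLieComponent {p q : ℕ} (v : Fin (p + q) → g) :
    (p.factorial * q.factorial) • cupLieComponent k g rfl (exteriorPower.ιMulti k (p + q) v) =
      altS v fun u => exteriorPower.ιMulti k p (u ∘ Fin.castAdd q) ⊗ₜ[k]
        exteriorPower.ιMulti k q (u ∘ Fin.natAdd p) := by
  rw [cupLieComponent, exteriorPower.alternatingMapLinearEquiv_apply_ιMulti,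
    factorial_smul_domCoprod]
  refine altS_congr v fun u => ?_
  congr 2

variable {j}

theorem altS_ksmul {L M : Type*} [AddCommGroup M] [Module k M] {n : ℕ} (v : Fin n → L) (c : k)
    (F : (Fin n → L) → M) : altS v (fun u => c • F u) = c • altS v F :=
  (map_altS (LinearMap.lsmul k M c) v F).symm

theorem mark_map {L L' M : Type*} [AddCommGroup M] (f : L' → L) (w : List L')
    (F : List L → L → List L → M) :
    mark (w.map f) F = mark w fun u c v => F (u.map f) (f c) (v.map f) := by
  induction w generalizing F with
  | nil => rfl
  | cons c w ih => simp only [List.map_cons, mark, ih, List.map_nil]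

theorem cyc_map {L L' M : Type*} [AddCommGroup M] (f : L' → L) (w : List L') (H : List L → M) :
    cyc (w.map f) H = cyc w fun l => H (l.map f) := by
  simp only [cyc, mark_map, List.length_map, List.map_append, List.map_cons]

theorem counit_j (hj : ∀ x, comul (R := k) (j x) = j x ⊗ₜ 1 + 1 ⊗ₜ j x) (x : g) :
    counit (R := k) (j x) = 0 := counit_prim (hj x)

theorem isNorm_ofFn (hj : ∀ x, comul (R := k) (j x) = j x ⊗ₜ 1 + 1 ⊗ₜ j x) {n : ℕ}
    (u : Fin n → g) : IsNorm k (List.ofFn fun i => j (u i)) := by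
  intro a ha
  obtain ⟨i, rfl⟩ := List.mem_ofFn.1 ha
  exact counit_j hj _

theorem bT_wd_prim {l : List A} (hl : ∀ a ∈ l, comul (R := k) a = a ⊗ₜ 1 + 1 ⊗ₜ a) :
    bT k A (wd k A l) = 0 := by
  induction l with
  | nil => exact bT_nil
  | cons c l ih =>
    rw [wd, bT_consT, ih fun a ha => hl a (List.mem_cons_of_mem _ ha), hl c List.mem_cons_self,
      map_add, LinearMap.add_apply, cons₂T_tmul, cons₂T_tmul, map_zero]
    abel

theorem altS_mem {L M : Type*} [AddCommGroup M] (S : AddSubgroup M) {n : ℕ} (v : Fin n → L)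
    {F : (Fin n → L) → M} (h : ∀ u, F u ∈ S) : altS v F ∈ S :=
  sum_mem fun _ _ => S.zsmul_mem (h _) _

theorem antT_ιMulti {n : ℕ} (v : Fin n → g) :
    antT j n (exteriorPower.ιMulti k n v) = (n.factorial : k)⁻¹ • altS v (jwd j) := by
  rw [← factorial_smul_antT, smul_smul,
    inv_mul_cancel₀ (Nat.cast_ne_zero.2 n.factorial_ne_zero : (n.factorial : k) ≠ 0), one_smul]

theorem antT_mem_part (hj : ∀ x, comul (R := k) (j x) = j x ⊗ₜ 1 + 1 ⊗ₜ j x) {n : ℕ}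
    (x : ⋀[k]^n g) : antT j n x ∈ normPart k A n := by
  have h : LinearMap.range (antT j n) ≤ normPart k A n := by
    rw [LinearMap.range_eq_map, ← exteriorPower.ιMulti_span k n, Submodule.map_span,
      Submodule.span_le]
    rintro _ ⟨_, ⟨v, rfl⟩, rfl⟩
    rw [antT_ιMulti]
    refine Submodule.smul_mem _ _ (altS_mem (normPart k A n).toAddSubgroup v fun u => ?_)
    exact wd_mem_part (isNorm_ofFn hj u) (by simp)
  exact h ⟨x, rfl⟩

theorem bT_antT (hj : ∀ x, comul (R := k) (j x) = j x ⊗ₜ 1 + 1 ⊗ₜ j x) {n : ℕ} (x : ⋀[k]^n g) :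
    bT k A (antT j n x) = 0 := by
  suffices h : bT k A ∘ₗ antT j n = 0 from LinearMap.congr_fun h x
  refine exterior_ext fun v => ?_
  rw [comp_apply, antT_ιMulti, map_smul, map_altS]
  have h (u : Fin n → g) : bT k A (jwd j u) = 0 := bT_wd_prim fun a ha => by
    obtain ⟨i, rfl⟩ := List.mem_ofFn.1 ha
    exact hj _
  simp [h, altS]

theorem fT_jwd (hj : ∀ x, comul (R := k) (j x) = j x ⊗ₜ 1 + 1 ⊗ₜ j x) {n : ℕ}
    (u : Fin (n + 1) → g) : fT k A (jwd j u) = -∑ i : Fin n, wd k A (List.ofFn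
      (Function.update (fun i : Fin n => j (u i.succ)) i (j (u 0) * j (u i.succ)))) := by
  rw [jwd, List.ofFn_succ, fT_wd_cons, antipode_prim (hj _), map_neg, LinearMap.neg_apply,
    actT_prim_wd (hj _), der_ofFn]

theorem wd_update_sub {n : ℕ} (h : Fin n → A) (i : Fin n) (a b : A) :
    wd k A (List.ofFn (Function.update h i (a - b))) =
      wd k A (List.ofFn (Function.update h i a)) - wd k A (List.ofFn (Function.update h i b)) := by
  rw [← lof_tprod, ← lof_tprod, ← lof_tprod, MultilinearMap.map_update_sub, map_sub]

theorem two_smul_altS_fT_jwd (hj : ∀ x, comul (R := k) (j x) = j x ⊗ₜ 1 + 1 ⊗ₜ j x)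
    (hbr : ∀ x y, j ⁅x, y⁆ = j x * j y - j y * j x) {m : ℕ} (v : Fin (m + 2) → g) :
    (2 : k) • altS v (fun u => fT k A (jwd j u)) =
      -∑ i, altS v (fun u => jwd j (bracketAt i u)) := by
  simp only [fT_jwd hj]
  rw [altS_neg, altS_sum, smul_neg, Finset.smul_sum]
  congr 1
  refine Finset.sum_congr rfl fun i _ => ?_
  have hs := altS_perm v (Equiv.swap 0 i.succ) fun u => wd k A (List.ofFn
    (Function.update (fun i : Fin (m + 1) => j (u i.succ)) i (j (u 0) * j (u i.succ))))
  rw [Equiv.Perm.sign_swap (Fin.succ_ne_zero i).symm] at hs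
  simp only [Units.val_neg, Units.val_one, neg_smul, one_smul] at hs
  rw [two_smul, ← sub_neg_eq_add, ← hs, sub_eq_add_neg, ← altS_neg, ← altS_add]
  refine altS_congr v fun u => ?_
  have e1 : (fun l => j (bracketAt i u l)) =
      Function.update (fun i : Fin (m + 1) => j (u i.succ)) i (j ⁅u 0, u i.succ⁆) := by
    funext l
    rcases eq_or_ne l i with rfl | hl
    · simp [bracketAt]
    · simp [bracketAt, hl, Fin.tail]
  have e2 : Function.update (fun l : Fin (m + 1) => j ((u ∘ ⇑(Equiv.swap 0 i.succ)) l.succ)) i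
      (j ((u ∘ ⇑(Equiv.swap 0 i.succ)) 0) * j ((u ∘ ⇑(Equiv.swap 0 i.succ)) i.succ)) =
      Function.update (fun l : Fin (m + 1) => j (u l.succ)) i (j (u i.succ) * j (u 0)) := by
    funext l
    rcases eq_or_ne l i with rfl | hl
    · simp
    · have h2 : Equiv.swap 0 i.succ l.succ = l.succ :=
        Equiv.swap_apply_of_ne_of_ne (Fin.succ_ne_zero l) fun h => hl (Fin.succ_injective _ h)
      simp [hl, h2]
  rw [jwd, e1, e2, hbr, wd_update_sub, sub_eq_add_neg]

/-- Connes' operator on antisymmetric cochains is the Chevalley–Eilenberg differential. -/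
theorem FNT_antT (hj : ∀ x, comul (R := k) (j x) = j x ⊗ₜ 1 + 1 ⊗ₜ j x)
    (hbr : ∀ x y, j ⁅x, y⁆ = j x * j y - j y * j x) {n : ℕ} (x : ⋀[k]^(n + 1) g) :
    FNT k A (antT j (n + 1) x) = -antT j n (lieD k g n x) := by
  suffices h : FNT k A ∘ₗ antT j (n + 1) = -(antT j n ∘ₗ lieD k g n) from LinearMap.congr_fun h x
  refine exterior_ext fun v => ?_
  rw [comp_apply, LinearMap.neg_apply, comp_apply, antT_ιMulti, map_smul,
    map_altS]
  have h1 (u : Fin (n + 1) → g) : FNT k A (jwd j u) =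
      cyc (List.ofFn u) fun l => fT k A (wd k A (l.map j)) := by
    have e : (List.ofFn fun i => j (u i)) = (List.ofFn u).map j := by rw [List.map_ofFn]; rfl
    rw [jwd, FNT_wd, e, cyc_map]
  simp only [h1]
  rw [altS_cyc]
  have h2 (u : Fin (n + 1) → g) : fT k A (wd k A ((List.ofFn u).map j)) = fT k A (jwd j u) := by
    rw [jwd, List.map_ofFn]; rfl
  simp only [h2]
  cases n with
  | zero =>
    have h3 (u : Fin (0 + 1) → g) : fT k A (jwd j u) = 0 := by rw [fT_jwd hj]; simp
    simp [h3, altS, lieD]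
  | succ m =>
    have h3 := two_smul_altS_fT_jwd hj hbr v
    have h4 := congrArg (antT j (m + 1)) (two_factorial_smul_lieD (k := k) v)
    rw [map_nsmul, map_altS] at h4
    simp only [antT_ιMulti, altS_ksmul, altS_altS_bracketAt] at h4
    rw [← neg_eq_iff_eq_neg] at h3
    rw [← h3, ← Nat.cast_smul_eq_nsmul k, ← Nat.cast_smul_eq_nsmul k] at h4
    have h5 : ((2 * m.factorial : ℕ) : k) ≠ 0 :=
      Nat.cast_ne_zero.2 (mul_ne_zero two_ne_zero m.factorial_ne_zero)
    rw [← eq_inv_smul_iff₀ h5] at h4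
    have h7 : (m.factorial : k) ≠ 0 := Nat.cast_ne_zero.2 (Nat.factorial_ne_zero _)
    have h8 : ((m : k) + 1 + 1) ≠ 0 := by exact_mod_cast Nat.succ_ne_zero (m + 1)
    have h9 : ((m : k) + 1) ≠ 0 := by exact_mod_cast Nat.succ_ne_zero m
    rw [h4, ← Nat.cast_smul_eq_nsmul k, smul_smul, smul_smul, smul_smul, ← smul_neg, neg_neg, smul_smul]
    congr 1
    push_cast [Nat.factorial_succ]
    field_simp

theorem FNT_antT_zero (x : ⋀[k]^0 g) : FNT k A (antT j 0 x) = 0 := by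
  suffices h : FNT k A ∘ₗ antT j 0 = 0 from LinearMap.congr_fun h x
  refine exterior_ext fun v => ?_
  rw [comp_apply, antT_ιMulti, map_smul, map_altS]
  have h (u : Fin 0 → g) : FNT k A (jwd j u) = 0 := by
    rw [jwd, List.ofFn_zero, FNT, comp_apply, fT_nil, map_zero]
  simp [h, altS]

variable (j) in
/-- Antisymmetrization on the direct sum of all exterior powers. -/
def antTot : LieTot k g →ₗ[k] 𝒯 := DirectSum.toModule k ℕ _ fun n => antT j n

theorem antTot_lof (n : ℕ) (x : ⋀[k]^n g) :
    antTot j (lof k ℕ (fun n => ⋀[k]^n g) n x) = antT j n x := by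
  rw [antTot, DirectSum.toModule_lof]

theorem lieTot_ext {M : Type*} [AddCommGroup M] [Module k M] {f f' : LieTot k g →ₗ[k] M}
    (h : ∀ (n : ℕ) (v : Fin n → g),
      f (lof k ℕ (fun n => ⋀[k]^n g) n (exteriorPower.ιMulti k n v)) =
        f' (lof k ℕ (fun n => ⋀[k]^n g) n (exteriorPower.ιMulti k n v))) : f = f' :=
  DirectSum.linearMap_ext _ fun n => exterior_ext (h n)

theorem bT_antTot (hj : ∀ x, comul (R := k) (j x) = j x ⊗ₜ 1 + 1 ⊗ₜ j x) (x : LieTot k g) :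
    bT k A (antTot j x) = 0 := by
  suffices h : bT k A ∘ₗ antTot j = 0 from LinearMap.congr_fun h x
  refine lieTot_ext fun n v => ?_
  rw [comp_apply, antTot_lof, bT_antT hj, LinearMap.zero_apply]

theorem FNT_antTot (hj : ∀ x, comul (R := k) (j x) = j x ⊗ₜ 1 + 1 ⊗ₜ j x)
    (hbr : ∀ x y, j ⁅x, y⁆ = j x * j y - j y * j x) (x : LieTot k g) :
    FNT k A (antTot j x) = -antTot j (lieDTot k g x) := by
  suffices h : FNT k A ∘ₗ antTot j = -(antTot j ∘ₗ lieDTot k g) from LinearMap.congr_fun h x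
  refine lieTot_ext fun n v => ?_
  rw [comp_apply, antTot_lof, LinearMap.neg_apply, comp_apply, lieDTot,
    DirectSum.toModule_lof]
  cases n with
  | zero => rw [FNT_antT_zero]; simp
  | succ n => rw [FNT_antT hj hbr, comp_apply, antTot_lof]

theorem dTot_antTot (hj : ∀ x, comul (R := k) (j x) = j x ⊗ₜ 1 + 1 ⊗ₜ j x)
    (hbr : ∀ x y, j ⁅x, y⁆ = j x * j y - j y * j x) (x : LieTot k g) :
    (CM k A).dTot (antTot j x) = -antTot j (lieDTot k g x) := by
  suffices h : (CM k A).dTot ∘ₗ antTot j = -(antTot j ∘ₗ lieDTot k g) from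
    LinearMap.congr_fun h x
  refine lieTot_ext fun n v => ?_
  rw [comp_apply, LinearMap.neg_apply, comp_apply, ← FNT_antTot hj hbr,
    dTot_eq_of_mem_part (i := n) (by rw [antTot_lof]; exact antT_mem_part hj _), bT_antTot hj, zero_add]

theorem take_drop_jwd {p q : ℕ} (u : Fin (p + q) → g) :
    (List.ofFn fun i => j (u i)).take p = (List.ofFn fun i => j ((u ∘ Fin.castAdd q) i)) ∧
    (List.ofFn fun i => j (u i)).drop p = (List.ofFn fun i => j ((u ∘ Fin.natAdd p) i)) := by
  have h : (List.ofFn fun i => j (u i)) = (List.ofFn fun i => j ((u ∘ Fin.castAdd q) i)) ++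
      (List.ofFn fun i => j ((u ∘ Fin.natAdd p) i)) := List.ofFn_add
  have hl : (List.ofFn fun i => j ((u ∘ Fin.castAdd q) i)).length = p := by simp
  constructor
  · rw [h, List.take_left' hl]
  · rw [h, List.drop_left' hl]

theorem altS_tmul_altS {L M N : Type*} [AddCommGroup M] [Module k M] [AddCommGroup N] [Module k N]
    {p q : ℕ} (x : Fin p → L) (y : Fin q → L) (F : (Fin p → L) → M) (G : (Fin q → L) → N) :
    altS x F ⊗ₜ[k] altS y G = altS x fun x => altS y fun y => F x ⊗ₜ[k] G y := by
  refine (map_altS ((TensorProduct.mk k M N).flip (altS y G)) x F).trans (altS_congr x fun x => ?_)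
  exact map_altS (TensorProduct.mk k M N (F x)) y G

theorem map_antT_cupLieComponent {p q n : ℕ} (h : p + q = n) (v : Fin n → g) :
    TensorProduct.map (antT j p) (antT j q) (cupLieComponent k g h (exteriorPower.ιMulti k n v)) =
      ((p.factorial * q.factorial : ℕ) : k)⁻¹ • altS v fun u =>
        wd k A ((List.ofFn fun i => j (u i)).take p) ⊗ₜ wd k A ((List.ofFn fun i => j (u i)).drop p) := by
  subst h
  have hp : ((p.factorial * q.factorial : ℕ) : k) ≠ 0 :=
    Nat.cast_ne_zero.2 (mul_ne_zero p.factorial_ne_zero q.factorial_ne_zero)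
  have h1 := congrArg (TensorProduct.map (antT j p) (antT j q))
    (factorial_smul_cupLieComponent (k := k) v)
  rw [map_nsmul, map_altS, ← Nat.cast_smul_eq_nsmul k, ← eq_inv_smul_iff₀ hp] at h1
  rw [h1]
  congr 1
  have h2 (u : Fin (p + q) → g) : TensorProduct.map (antT j p) (antT j q)
      (exteriorPower.ιMulti k p (u ∘ Fin.castAdd q) ⊗ₜ[k] exteriorPower.ιMulti k q (u ∘ Fin.natAdd p)) =
      ((p.factorial * q.factorial : ℕ) : k)⁻¹ • altS (u ∘ Fin.castAdd q) fun x =>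
        altS (u ∘ Fin.natAdd p) fun y => jwd j x ⊗ₜ[k] jwd j y := by
    rw [map_tmul, antT_ιMulti, antT_ιMulti, TensorProduct.smul_tmul_smul, altS_tmul_altS]
    push_cast
    rw [mul_inv]
  simp only [h2]
  rw [altS_ksmul, altS_block, ← Nat.cast_smul_eq_nsmul k, smul_smul, inv_mul_cancel₀ hp, one_smul]
  refine altS_congr v fun u => ?_
  rw [(take_drop_jwd u).1, (take_drop_jwd u).2]
  rfl

theorem DT_antTot (x : LieTot k g) :
    DT k A (antTot j x) = TensorProduct.map (antTot j) (antTot j) (cupLie k g x) := by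
  suffices h : DT k A ∘ₗ antTot j = TensorProduct.map (antTot j) (antTot j) ∘ₗ cupLie k g from
    LinearMap.congr_fun h x
  refine lieTot_ext fun n v => ?_
  rw [comp_apply, comp_apply, antTot_lof, antT_ιMulti, map_smul, map_altS, cupLie,
    DirectSum.toModule_lof, LinearMap.sum_apply, map_sum]
  have h1 (u : Fin n → g) : DT k A (jwd j u) = unsh (List.ofFn u) fun l r =>
      wd k A (l.map j) ⊗ₜ wd k A (r.map j) := by
    have e : (List.ofFn fun i => j (u i)) = (List.ofFn u).map j := by rw [List.map_ofFn]; rfl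
    rw [jwd, DT_wd, e, unsh_map]
  simp only [h1]
  rw [altS_unsh]
  have h2 (pq : {pq // pq ∈ Finset.HasAntidiagonal.antidiagonal n}) :
      TensorProduct.map (antTot j) (antTot j) ((TensorProduct.map
        (lof k ℕ (fun n => ⋀[k]^n g) pq.1.1) (lof k ℕ (fun n => ⋀[k]^n g) pq.1.2) ∘ₗ
          cupLieComponent k g (Finset.HasAntidiagonal.mem_antidiagonal.1 pq.2))
            (exteriorPower.ιMulti k n v)) =
      ((pq.1.1.factorial * pq.1.2.factorial : ℕ) : k)⁻¹ • altS v fun u =>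
        wd k A ((List.ofFn fun i => j (u i)).take pq.1.1) ⊗ₜ
          wd k A ((List.ofFn fun i => j (u i)).drop pq.1.1) := by
    rw [← map_antT_cupLieComponent (Finset.HasAntidiagonal.mem_antidiagonal.1 pq.2), comp_apply,
      ← comp_apply, ← TensorProduct.map_comp]
    congr 2 <;> exact LinearMap.ext fun x => antTot_lof _ _
  rw [Finset.sum_congr rfl fun pq _ => h2 pq, Finset.sum_attach _ fun pq : ℕ × ℕ =>
    ((pq.1.factorial * pq.2.factorial : ℕ) : k)⁻¹ • altS v fun u =>
        wd k A ((List.ofFn fun i => j (u i)).take pq.1) ⊗ₜ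
          wd k A ((List.ofFn fun i => j (u i)).drop pq.1),
    Finset.Nat.sum_antidiagonal_eq_sum_range_succ_mk, Finset.smul_sum]
  refine Finset.sum_congr rfl fun m hm => ?_
  have hm : m ≤ n := by simpa [Nat.lt_succ_iff] using hm
  rw [← Nat.cast_smul_eq_nsmul k, smul_smul]
  congr 1
  · rw [Nat.cast_choose k hm]
    have hn : (n.factorial : k) ≠ 0 := Nat.cast_ne_zero.2 n.factorial_ne_zero
    push_cast
    field_simp
  · refine altS_congr v fun u => ?_
    have e : (List.ofFn fun i => j (u i)) = (List.ofFn u).map j := by rw [List.map_ofFn]; rfl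
    rw [e, List.map_take, List.map_drop]

/-- The tensors of antisymmetrizations of boundaries. -/
def antBoundary (j : g →ₗ[k] A) (n : ℕ) : Submodule k (𝒯 ⊗[k] 𝒯) :=
  Submodule.span k {Z | ∃ (p q : ℕ) (a : ⋀[k]^p g) (b : ⋀[k]^q g), p + q = n ∧
    antTot j (lieDTot k g (lof k ℕ (fun n => ⋀[k]^n g) p a)) ⊗ₜ[k]
      antTot j (lieDTot k g (lof k ℕ (fun n => ⋀[k]^n g) q b)) = Z}

theorem exists_altS_fT_jwd (hj : ∀ x, comul (R := k) (j x) = j x ⊗ₜ 1 + 1 ⊗ₜ j x)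
    (hbr : ∀ x y, j ⁅x, y⁆ = j x * j y - j y * j x) {n : ℕ} (v : Fin n → g) :
    ∃ a : ⋀[k]^n g, altS v (fun u => fT k A (jwd j u)) =
      antTot j (lieDTot k g (lof k ℕ (fun n => ⋀[k]^n g) n a)) := by
  cases n with
  | zero =>
    refine ⟨0, ?_⟩
    have h (u : Fin 0 → g) : fT k A (jwd j u) = 0 := by rw [jwd, List.ofFn_zero, fT_nil]
    simp [h, altS]
  | succ n =>
    refine ⟨-(((n + 1 : ℕ) : k)⁻¹ * ((n + 1).factorial : k)) • exteriorPower.ιMulti k (n + 1) v, ?_⟩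
    have h1 := FNT_antTot hj hbr (lof k ℕ (fun n => ⋀[k]^n g) (n + 1)
      (exteriorPower.ιMulti k (n + 1) v))
    rw [antTot_lof, antT_ιMulti, map_smul, map_altS] at h1
    have e (u : Fin (n + 1) → g) : FNT k A (jwd j u) =
        cyc (List.ofFn u) fun l => fT k A (wd k A (l.map j)) := by
      have e : (List.ofFn fun i => j (u i)) = (List.ofFn u).map j := by rw [List.map_ofFn]; rfl
      rw [jwd, FNT_wd, e, cyc_map]
    have e2 (u : Fin (n + 1) → g) : fT k A (wd k A ((List.ofFn u).map j)) = fT k A (jwd j u) := by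
      rw [jwd, List.map_ofFn]; rfl
    simp only [e] at h1
    rw [altS_cyc] at h1
    simp only [e2] at h1
    have hn : ((n + 1 : ℕ) : k) ≠ 0 := Nat.cast_ne_zero.2 n.succ_ne_zero
    have hf : ((n + 1).factorial : k) ≠ 0 := Nat.cast_ne_zero.2 (Nat.factorial_ne_zero _)
    rw [← Nat.cast_smul_eq_nsmul k] at h1
    rw [map_smul, map_smul, map_smul, neg_smul, ← smul_neg, ← h1, smul_smul, smul_smul]
    rw [show ((n + 1 : ℕ) : k)⁻¹ * ((n + 1).factorial : k) * ((n + 1).factorial : k)⁻¹ * ((n + 1 : ℕ) : k)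
      = 1 by field_simp, one_smul]

theorem ET_antTot (hj : ∀ x, comul (R := k) (j x) = j x ⊗ₜ 1 + 1 ⊗ₜ j x)
    (hbr : ∀ x y, j ⁅x, y⁆ = j x * j y - j y * j x) {n : ℕ} (x : ⋀[k]^n g) :
    ET k A (antTot j (lof k ℕ (fun n => ⋀[k]^n g) n x)) ∈ antBoundary j n := by
  rw [antTot_lof]
  have h : LinearMap.range (ET k A ∘ₗ antT j n) ≤ antBoundary j n := by
    rw [LinearMap.range_eq_map, ← exteriorPower.ιMulti_span k n, Submodule.map_span,
      Submodule.span_le]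
    rintro _ ⟨_, ⟨v, rfl⟩, rfl⟩
    rw [comp_apply, antT_ιMulti, map_smul, map_altS]
    refine Submodule.smul_mem _ _ ?_
    have h1 (u : Fin n → g) : ET k A (jwd j u) = cycLR (List.ofFn u) fun l r =>
        fT k A (wd k A (l.map j)) ⊗ₜ[k] fT k A (wd k A (r.map j)) := by
      have e : (List.ofFn fun i => j (u i)) = (List.ofFn u).map j := by rw [List.map_ofFn]; rfl
      rw [jwd, ET_wd_eq_cycLR, e, cycLR_map]
    simp only [h1]
    refine altS_cycLR_mem v (fun l r => fT k A (wd k A (l.map j)) ⊗ₜ[k] fT k A (wd k A (r.map j)))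
      (antBoundary j n).toAddSubgroup fun p hp => ?_
    obtain ⟨q, rfl⟩ := Nat.exists_eq_add_of_le hp
    have h2 (u : Fin (p + q) → g) : fT k A (wd k A (((List.ofFn u).take p).map j)) ⊗ₜ[k]
        fT k A (wd k A (((List.ofFn u).drop p).map j)) =
        fT k A (jwd j (u ∘ Fin.castAdd q)) ⊗ₜ[k] fT k A (jwd j (u ∘ Fin.natAdd p)) := by
      have e : (List.ofFn u).map j = (List.ofFn fun i => j (u i)) := by rw [List.map_ofFn]; rfl
      rw [List.map_take, List.map_drop, e, (take_drop_jwd u).1, (take_drop_jwd u).2]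
      rfl
    simp only [h2]
    have hpq : ((p.factorial * q.factorial : ℕ) : k) ≠ 0 :=
      Nat.cast_ne_zero.2 (mul_ne_zero p.factorial_ne_zero q.factorial_ne_zero)
    have h3 := altS_block v fun x y => fT k A (jwd j x) ⊗ₜ[k] fT k A (jwd j y)
    rw [← Nat.cast_smul_eq_nsmul k, eq_comm, ← eq_inv_smul_iff₀ hpq] at h3
    rw [h3]
    refine Submodule.smul_mem _ _ (altS_mem (antBoundary j (p + q)).toAddSubgroup v fun u => ?_)
    rw [← altS_tmul_altS]
    obtain ⟨a, ha⟩ := exists_altS_fT_jwd hj hbr (u ∘ Fin.castAdd q)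
    obtain ⟨b, hb⟩ := exists_altS_fT_jwd hj hbr (u ∘ Fin.natAdd p)
    rw [ha, hb]
    exact Submodule.subset_span ⟨p, q, a, b, rfl, rfl⟩
  exact h ⟨x, rfl⟩

end Antisymmetrization
end HopfCyclic

namespace HopfCyclic

universe u v w

section LieConsequences

open Coalgebra Word

variable {k : Type u} {A : Type v} {g : Type w} [Field k] [CharZero k] [Ring A] [HopfAlgebra k A]
  [PrimitivelyGenerated k A] [LieRing g] [LieAlgebra k g] {j : g →ₗ[k] A}

local notation "𝒯" => CocyclicOperators.Tot (CM k A)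

instance invertibleTwo : Invertible (2 : k) := invertibleOfNonzero two_ne_zero

theorem lieTot_induction {P : LieTot k g → Prop}
    (h : ∀ (n : ℕ) (v : Fin n → g),
      P (lof k ℕ (fun n => ⋀[k]^n g) n (exteriorPower.ιMulti k n v)))
    (hadd : ∀ x y, P x → P y → P (x + y)) (hsmul : ∀ (c : k) x, P x → P (c • x)) (x : LieTot k g) :
    P x := by
  have h0 : P 0 := by
    rw [← zero_smul k (0 : LieTot k g),
      ← map_zero (lof k ℕ (fun n => ⋀[k]^n g) 0)]
    have := hsmul 0 _ (h 0 Fin.elim0)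
    simpa using this
  induction x using DirectSum.induction_on with
  | zero => exact h0
  | add x y hx hy => exact hadd x y hx hy
  | of n y =>
    change P (lof k ℕ (fun n => ⋀[k]^n g) n y)
    have hy : y ∈ Submodule.span k (Set.range (exteriorPower.ιMulti k n (M := g))) := by
      rw [exteriorPower.ιMulti_span]; trivial
    induction hy using Submodule.span_induction with
    | zero => rw [map_zero]; exact h0
    | add x y _ _ hx hy => rw [map_add]; exact hadd _ _ hx hy
    | smul c x _ hx => rw [map_smul]; exact hsmul c _ hx
    | mem x hx =>
      obtain ⟨v, rfl⟩ := hx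
      exact h n v

/-- The projection of cochains to exterior powers which is induced by a map `p`. -/
def extProj (p : A →ₗ[k] g) : 𝒯 →ₗ[k] LieTot k g :=
  DirectSum.toModule k ℕ _ fun n => lof k ℕ (fun n => ⋀[k]^n g) n ∘ₗ
    PiTensorProduct.lift ((exteriorPower.ιMulti k n).toMultilinearMap.compLinearMap fun _ => p)

theorem extProj_jwd {p : A →ₗ[k] g} (hp : ∀ x, p (j x) = x) {n : ℕ} (v : Fin n → g) :
    extProj p (jwd j v) = lof k ℕ (fun n => ⋀[k]^n g) n (exteriorPower.ιMulti k n v) := by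
  rw [jwd, ← lof_tprod, extProj, DirectSum.toModule_lof, comp_apply,
    PiTensorProduct.lift.tprod, MultilinearMap.compLinearMap_apply]
  simp [hp]

theorem extProj_antTot {p : A →ₗ[k] g} (hp : ∀ x, p (j x) = x) (x : LieTot k g) :
    extProj p (antTot j x) = x := by
  suffices h : extProj p ∘ₗ antTot j = LinearMap.id from LinearMap.congr_fun h x
  refine lieTot_ext (M := LieTot k g) fun n v => ?_
  rw [comp_apply, antTot_lof, antT_ιMulti, map_smul, map_altS]
  simp only [extProj_jwd hp]
  have hn : (n.factorial : k) ≠ 0 := Nat.cast_ne_zero.2 n.factorial_ne_zero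
  have h (σ : Equiv.Perm (Fin n)) : (Equiv.Perm.sign σ : ℤ) •
      lof k ℕ (fun n => ⋀[k]^n g) n (exteriorPower.ιMulti k n (v ∘ σ)) =
      lof k ℕ (fun n => ⋀[k]^n g) n (exteriorPower.ιMulti k n v) := by
    rw [AlternatingMap.map_perm, Units.smul_def, map_zsmul, smul_smul, ← Units.val_mul,
      Int.units_mul_self, Units.val_one, one_smul]
  rw [altS, Finset.sum_congr rfl fun σ _ => h σ, Finset.sum_const, Finset.card_univ,
    Fintype.card_perm, Fintype.card_fin, ← Nat.cast_smul_eq_nsmul k, smul_smul, inv_mul_cancel₀ hn,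
    one_smul, LinearMap.id_apply]

variable (k g) in
/-- The differential of the tensor square of the Chevalley–Eilenberg complex. -/
def lieTensD : LieTot k g ⊗[k] LieTot k g →ₗ[k] LieTot k g ⊗[k] LieTot k g :=
  TensorProduct.map (lieDTot k g) LinearMap.id +
    TensorProduct.map (gradeSign k fun n => ⋀[k]^n g) (lieDTot k g)

theorem sgnT_antTot (x : LieTot k g) :
    sgnT k A (antTot j x) = antTot j (gradeSign k (fun n => ⋀[k]^n g) x) := by
  suffices h : sgnT k A ∘ₗ antTot j = antTot j ∘ₗ gradeSign k (fun n => ⋀[k]^n g) from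
    LinearMap.congr_fun h x
  refine DirectSum.linearMap_ext _ fun n => LinearMap.ext fun y => ?_
  have h1 : sgnT k A (antT j n y) = (-1 : ℤ) ^ n • antT j n y := sgnT_lof _ _
  have h2 : gradeSign k (fun n => ⋀[k]^n g) (lof k ℕ (fun n => ⋀[k]^n g) n y) =
      (-1 : k) ^ n • lof k ℕ (fun n => ⋀[k]^n g) n y := by
    rw [gradeSign, DirectSum.toModule_lof]; rfl
  simp only [comp_apply]
  rw [antTot_lof, h1, h2, map_smul, antTot_lof, neg_one_pow_smul k]

theorem tensD_map_antTot {D : Module.End k 𝒯} {D' : LieTot k g →ₗ[k] LieTot k g}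
    (h : ∀ x, D (antTot j x) = -antTot j (D' x)) (z : LieTot k g ⊗[k] LieTot k g) :
    tensD D (TensorProduct.map (antTot j) (antTot j) z) =
      -TensorProduct.map (antTot j) (antTot j) (TensorProduct.map D' LinearMap.id z +
        TensorProduct.map (gradeSign k fun n => ⋀[k]^n g) D' z) := by
  induction z with
  | zero => simp
  | add x y hx hy =>
    rw [map_add, map_add, hx, hy]
    simp only [map_add]
    abel
  | tmul x y =>
    rw [tensD, LinearMap.add_apply]
    simp only [map_tmul, LinearMap.id_apply, map_add, h, sgnT_antTot,
      TensorProduct.neg_tmul, TensorProduct.tmul_neg]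
    abel

theorem tensD_bT_antBoundary (hj : ∀ x, comul (R := k) (j x) = j x ⊗ₜ 1 + 1 ⊗ₜ j x) {n : ℕ}
    {Z : 𝒯 ⊗[k] 𝒯} (hZ : Z ∈ antBoundary j n) : tensD (bT k A) Z = 0 := by
  rw [antBoundary] at hZ
  induction hZ using Submodule.span_induction with
  | zero => rw [map_zero]
  | add x y _ _ hx hy => rw [map_add, hx, hy, add_zero]
  | smul c x _ hx => rw [map_smul, hx, smul_zero]
  | mem x hx =>
    obtain ⟨p, q, a, b, -, rfl⟩ := hx
    rw [tensD, LinearMap.add_apply, map_tmul, map_tmul, bT_antTot hj,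
      bT_antTot hj, zero_tmul, tmul_zero, zero_add]

section

variable (hj : ∀ x, comul (R := k) (j x) = j x ⊗ₜ 1 + 1 ⊗ₜ j x)
  (hbr : ∀ x y, j ⁅x, y⁆ = j x * j y - j y * j x) {p : A →ₗ[k] g} (hp : ∀ x, p (j x) = x)

include hj hbr hp

theorem lieDTot_lieDTot (x : LieTot k g) : lieDTot k g (lieDTot k g x) = 0 := by
  suffices h : lieDTot k g ∘ₗ lieDTot k g = 0 from LinearMap.congr_fun h x
  refine lieTot_ext (M := LieTot k g) fun n v => ?_
  rw [comp_apply, LinearMap.zero_apply]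
  have h := FNT_FNT (i := (n : ZMod 2)) (X := antTot j (lof k ℕ (fun n => ⋀[k]^n g) n
    (exteriorPower.ιMulti k n v))) (by rw [antTot_lof]; exact antT_mem_part hj _)
  rw [FNT_antTot hj hbr, map_neg, FNT_antTot hj hbr, neg_neg] at h
  rw [← extProj_antTot hp (lieDTot k g _), h, map_zero]

theorem cupLie_lieDTot (x : LieTot k g) :
    cupLie k g (lieDTot k g x) = lieTensD k g (cupLie k g x) := by
  refine lieTot_induction (P := fun x => cupLie k g (lieDTot k g x) = lieTensD k g (cupLie k g x))
    (fun n v => ?_) (fun x y hx hy => ?_) (fun c x hx => ?_) x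
  rotate_left
  · simp only [map_add, hx, hy]
  · simp only [map_smul, hx]
  have h := ET_bT (antTot j (lof k ℕ (fun n => ⋀[k]^n g) n (exteriorPower.ιMulti k n v)))
  rw [bT_antTot hj, map_zero, tensD_bT_antBoundary hj (ET_antTot hj hbr _), zero_add,
    FNT_antTot hj hbr, map_neg, sub_neg_eq_add, DT_antTot, DT_antTot,
    tensD_map_antTot (FNT_antTot hj hbr), eq_comm, neg_add_eq_zero] at h
  have h2 := congrArg (TensorProduct.map (extProj p) (extProj p)) h
  have h3 (z : LieTot k g ⊗[k] LieTot k g) : TensorProduct.map (extProj p) (extProj p)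
      (TensorProduct.map (antTot j) (antTot j) z) = z := by
    rw [← comp_apply, ← TensorProduct.map_comp,
      show extProj p ∘ₗ antTot j = LinearMap.id from LinearMap.ext (extProj_antTot hp),
      TensorProduct.map_id, LinearMap.id_apply]
  rw [h3, h3] at h2
  exact h2.symm

theorem exists_tensD_eq_of_mem_antBoundary {n : ℕ} {Z : 𝒯 ⊗[k] 𝒯} (hZ : Z ∈ antBoundary j n) :
    ∃ y ∈ tensPart k A ((n : ZMod 2) + 1), Z = tensD (CM k A).dTot y := by
  rw [antBoundary] at hZ
  induction hZ using Submodule.span_induction with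
  | zero => exact ⟨0, zero_mem _, (map_zero _).symm⟩
  | add x y _ _ hx hy =>
    obtain ⟨x', hx', rfl⟩ := hx
    obtain ⟨y', hy', rfl⟩ := hy
    exact ⟨x' + y', add_mem hx' hy', (map_add _ _ _).symm⟩
  | smul c x _ hx =>
    obtain ⟨x', hx', rfl⟩ := hx
    exact ⟨c • x', Submodule.smul_mem _ _ hx', (map_smul _ _ _).symm⟩
  | mem x hx =>
    obtain ⟨p, q, a, b, rfl, rfl⟩ := hx
    have ha : antTot j (lof k ℕ (fun n => ⋀[k]^n g) p a) ∈ normPart k A p := by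
      rw [antTot_lof]; exact antT_mem_part hj _
    have hb : antTot j (lof k ℕ (fun n => ⋀[k]^n g) q b) ∈ normPart k A q := by
      rw [antTot_lof]; exact antT_mem_part hj _
    have hdb : antTot j (lieDTot k g (lof k ℕ (fun n => ⋀[k]^n g) q b)) ∈
        normPart k A ((q : ZMod 2) + 1) := by
      have h2 : (q : ZMod 2) = (q : ZMod 2) + 1 + 1 := by
        rw [add_assoc, show (1 : ZMod 2) + 1 = 0 from rfl, add_zero]
      have h := dTot_mem_part (k := k) (A := A) (i := (q : ZMod 2) + 1)
        (X := antTot j (lof k ℕ (fun n => ⋀[k]^n g) q b)) (by rw [← h2]; exact hb)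
      rw [dTot_antTot hj hbr] at h
      exact (Submodule.neg_mem_iff _).1 h
    refine ⟨-(antTot j (lof k ℕ (fun n => ⋀[k]^n g) p a) ⊗ₜ[k]
      antTot j (lieDTot k g (lof k ℕ (fun n => ⋀[k]^n g) q b))),
      neg_mem (tmul_mem_tensPart (by rw [← add_assoc, Nat.cast_add]) ha hdb), ?_⟩
    rw [map_neg, tensD, LinearMap.add_apply, map_tmul, map_tmul,
      dTot_antTot hj hbr, dTot_antTot hj hbr, lieDTot_lieDTot hj hbr hp, map_zero, neg_zero,
      tmul_zero, add_zero, TensorProduct.neg_tmul, neg_neg]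
    rfl

/-- The coproducts agree up to boundaries under antisymmetrization. -/
theorem cup'_antTot_sub (n : ℕ) (x : ⋀[k]^n g) :
    ∃ y ∈ tensPart k A ((n : ZMod 2) + 1),
      cup' k A (antTot j (lof k ℕ (fun n => ⋀[k]^n g) n x)) -
        TensorProduct.map (antTot j) (antTot j)
          (cupLie k g (lof k ℕ (fun n => ⋀[k]^n g) n x)) =
      tensD (CM k A).dTot y := by
  rw [cup'_eq, LinearMap.add_apply, DT_antTot, add_sub_cancel_left]
  exact exists_tensD_eq_of_mem_antBoundary hj hbr hp (ET_antTot hj hbr x)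

end

end LieConsequences
end HopfCyclic

namespace HopfCyclic

universe u v w

section Kunneth

variable {k : Type u} [Field k] {ι : Type v} [AddCommMonoid ι] [One ι]

/-- A graded complex in which the differential has degree `-1` and square zero, and in which
families of linear maps on the homogeneous parts have common extensions. -/
structure GradedComplex.IsComplex (X : GradedComplex.{u, v, w} k ι) : Prop where
  glue : ∀ {W : Type w} [AddCommGroup W] [Module k W] (f : ∀ i, X.part i →ₗ[k] W),
    ∃ F : X.V →ₗ[k] W, ∀ i (x : X.part i), F x = f i x
  d_mem : ∀ {i x}, x ∈ X.part (i + 1) → X.d x ∈ X.part i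
  d_d : ∀ {i x}, x ∈ X.part i → X.d (X.d x) = 0
  eq_succ_or : ∀ i, (∃ j, i = j + 1) ∨ ∀ x ∈ X.part i, X.d x = 0

namespace GradedComplex.IsComplex

variable {X : GradedComplex.{u, v, w} k ι} (hX : X.IsComplex)
include hX

theorem d_mem_cycles {i : ι} {x : X.V} (hx : x ∈ X.part (i + 1)) : X.d x ∈ X.cycles i :=
  ⟨hX.d_mem hx, hX.d_d hx⟩

/-- A linear extension of the projection from cycles of degree `i` to homology, which vanishes on
boundaries and on other degrees. -/
theorem exists_extension_cls [IsRightCancelAdd ι] (i : ι) : ∃ q : X.V →ₗ[k] X.H i,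
    (∀ z : X.cycles i, q z = X.cls i z) ∧ (∀ j, j ≠ i → ∀ x ∈ X.part j, q x = 0) ∧
      ∀ j, ∀ x ∈ X.part j, q (X.d x) = 0 := by
  classical
  obtain ⟨e, he⟩ := LinearMap.exists_extend (p := (X.cycles i).submoduleOf (X.part i))
    ((X.cls i) ∘ₗ (Submodule.submoduleOfEquivOfLe inf_le_left).toLinearMap)
  obtain ⟨q, hq⟩ := hX.glue (W := X.H i) fun j => if h : j = i then h ▸ e else 0
  have h1 : ∀ z : X.cycles i, q z = X.cls i z := by
    intro z
    rw [show (z : X.V) = ((⟨z, z.2.1⟩ : X.part i) : X.V) from rfl, hq, dif_pos rfl]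
    exact LinearMap.congr_fun he ⟨⟨z, z.2.1⟩, z.2⟩
  have h2 : ∀ j, j ≠ i → ∀ x ∈ X.part j, q x = 0 := by
    intro j hj x hx
    rw [show x = ((⟨x, hx⟩ : X.part j) : X.V) from rfl, hq, dif_neg hj, LinearMap.zero_apply]
  refine ⟨q, h1, h2, fun j x hx => ?_⟩
  rcases hX.eq_succ_or j with ⟨j', rfl⟩ | h
  · rcases eq_or_ne j' i with rfl | h
    · exact (h1 ⟨_, hX.d_mem_cycles hx⟩).trans
        ((Submodule.Quotient.mk_eq_zero _).2 ⟨x, hx, rfl⟩)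
    · exact h2 j' h _ (hX.d_mem hx)
  · rw [h x hx, map_zero]

/-- A map of degree one such that `d h d = d`. -/
theorem exists_contraction : ∃ h : X.V →ₗ[k] X.V,
    (∀ i, ∀ x ∈ X.part i, h x ∈ X.part (i + 1)) ∧
      ∀ i, ∀ x ∈ X.part i, X.d (h (X.d x)) = X.d x := by
  have hk (i : ι) : ∃ s : X.part i →ₗ[k] X.part (i + 1),
      ∀ x : X.part (i + 1), X.d (s ⟨X.d x, hX.d_mem x.2⟩) = X.d x := by
    set D : X.part (i + 1) →ₗ[k] X.part i := X.d.restrict fun x hx => hX.d_mem hx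
    obtain ⟨t, ht⟩ := D.rangeRestrict.exists_rightInverse_of_surjective D.range_rangeRestrict
    obtain ⟨s, hs⟩ := LinearMap.exists_extend t
    refine ⟨s, fun x => ?_⟩
    have h1 : s ⟨X.d x, hX.d_mem x.2⟩ = t (D.rangeRestrict x) :=
      LinearMap.congr_fun hs (D.rangeRestrict x)
    rw [h1]
    exact congrArg (fun y : LinearMap.range D => ((y : X.part i) : X.V))
      (LinearMap.congr_fun ht (D.rangeRestrict x))
  choose s hs using hk
  obtain ⟨h, hh⟩ := hX.glue fun i => (X.part (i + 1)).subtype ∘ₗ s i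
  refine ⟨h, fun i x hx => ?_, fun i x hx => ?_⟩
  · rw [show x = ((⟨x, hx⟩ : X.part i) : X.V) from rfl, hh]
    exact (s i ⟨x, hx⟩).2
  · rcases hX.eq_succ_or i with ⟨j, rfl⟩ | h0
    · rw [show X.d x = ((⟨X.d x, hX.d_mem hx⟩ : X.part j) : X.V) from rfl, hh]
      exact hs j ⟨x, hx⟩
    · rw [h0 x hx, map_zero, map_zero]

end GradedComplex.IsComplex

namespace SignedComplex

variable {X : SignedComplex.{u, v, w} k ι} {Y : GradedComplex.{u, v, w} k ι}

omit [One ι] in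
theorem tensor_part_le {n : ι} {N : Submodule k (X.V ⊗[k] Y.V)}
    (h : ∀ i j, i + j = n → ∀ x ∈ X.part i, ∀ y ∈ Y.part j, x ⊗ₜ[k] y ∈ N) :
    (X.tensor Y).part n ≤ N := by
  refine iSup_le fun ij => iSup_le fun hij => ?_
  rintro _ ⟨t, rfl⟩
  induction t with
  | zero => rw [map_zero]; exact zero_mem _
  | add a b ha hb => rw [map_add]; exact add_mem ha hb
  | tmul a b => exact h _ _ hij a a.2 b b.2

omit [One ι] in
theorem tensor_map_apply {n : ι} {W : Type*} [AddCommGroup W] [Module k W]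
    {f f' : X.V ⊗[k] Y.V →ₗ[k] W}
    (h : ∀ i j, i + j = n → ∀ x ∈ X.part i, ∀ y ∈ Y.part j, f (x ⊗ₜ y) = f' (x ⊗ₜ y))
    {z : X.V ⊗[k] Y.V} (hz : z ∈ (X.tensor Y).part n) : f z = f' z :=
  tensor_part_le (N := LinearMap.eqLocus f f') h hz

variable [DecidableEq ι]

theorem kunneth_lof {n : ι} (ij : {ij : ι × ι // ij.1 + ij.2 = n}) (x : X.cycles ij.1.1)
    (y : Y.cycles ij.1.2) :
    X.kunneth Y n (lof k _ (fun ij : {ij : ι × ι // ij.1 + ij.2 = n} =>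
      X.H ij.1.1 ⊗[k] Y.H ij.1.2) ij (X.cls _ x ⊗ₜ Y.cls _ y)) =
    (X.tensor Y).cls n ⟨x.1 ⊗ₜ y.1, tmul_mem_cycles ij.2 x.2 y.2⟩ := by
  rw [kunneth, DirectSum.toModule_lof, TensorProduct.lift.tmul]
  rfl

theorem kunneth_injective [IsRightCancelAdd ι] (hX : X.IsComplex) (hY : Y.IsComplex) (n : ι) :
    Function.Injective (X.kunneth Y n) := by
  choose q hq1 hq2 hq3 using hX.exists_extension_cls
  choose r hr1 hr2 hr3 using hY.exists_extension_cls
  have hL (ij : {ij : ι × ι // ij.1 + ij.2 = n}) : ∃ L : (X.tensor Y).H n →ₗ[k]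
      X.H ij.1.1 ⊗[k] Y.H ij.1.2, ∀ z : (X.tensor Y).cycles n,
        L ((X.tensor Y).cls n z) = TensorProduct.map (q ij.1.1) (r ij.1.2) z.1 := by
    refine ⟨Submodule.liftQ _ (TensorProduct.map (q ij.1.1) (r ij.1.2) ∘ₗ
      ((X.tensor Y).cycles n).subtype) ?_, fun z => rfl⟩
    rintro ⟨_, hd⟩ ⟨z, hz, rfl⟩
    change TensorProduct.map (q ij.1.1) (r ij.1.2) ((X.tensor Y).d z) = 0
    refine tensor_map_apply (f := TensorProduct.map (q ij.1.1) (r ij.1.2) ∘ₗ (X.tensor Y).d)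
      (f' := 0) (fun a b _ x hx y hy => ?_) hz
    rw [comp_apply, tensor_d_tmul hx, map_add, map_tmul,
      map_tmul, hq3 _ _ _ hx, hr3 _ _ _ hy, zero_tmul,
      tmul_zero, add_zero, LinearMap.zero_apply]
  choose L hL using hL
  have hcomp (ij : {ij : ι × ι // ij.1 + ij.2 = n}) :
      L ij ∘ₗ X.kunneth Y n = DirectSum.component k _ _ ij := by
    refine DirectSum.linearMap_ext _ fun ij' => TensorProduct.ext' fun x y => ?_
    obtain ⟨x, rfl⟩ := Submodule.mkQ_surjective _ x
    obtain ⟨y, rfl⟩ := Submodule.mkQ_surjective _ y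
    rw [comp_apply, comp_apply, comp_apply, kunneth_lof, hL,
      map_tmul]
    rcases eq_or_ne ij' ij with rfl | hne
    · rw [DirectSum.component.lof_self, hq1, hr1]
    · rw [DirectSum.component.of, dif_neg hne]
      by_cases h1 : ij'.1.1 = ij.1.1
      · have h2 : ij'.1.2 ≠ ij.1.2 := fun h2 => hne (Subtype.ext (Prod.ext h1 h2))
        rw [hr2 _ _ h2 _ y.2.1, tmul_zero]
      · rw [hq2 _ _ h1 _ x.2.1, zero_tmul]
  intro a b hab
  refine DirectSum.ext_component k fun ij => ?_
  rw [← hcomp ij, comp_apply, hab, comp_apply]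

theorem kunneth_surjective (hX : X.IsComplex) (hY : Y.IsComplex)
    (hs : ∀ i, X.sgn (i + 1) = -X.sgn i) (n : ι) : Function.Surjective (X.kunneth Y n) := by
  obtain ⟨h, hh, hd⟩ := hX.exists_contraction
  obtain ⟨h', hh', hd'⟩ := hY.exists_contraction
  set P : X.V →ₗ[k] X.V := LinearMap.id - X.d ∘ₗ h - h ∘ₗ X.d with hP
  set P' : Y.V →ₗ[k] Y.V := LinearMap.id - Y.d ∘ₗ h' - h' ∘ₗ Y.d with hP'
  have hPx (x : X.V) : P x = x - X.d (h x) - h (X.d x) := rfl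
  have hPx' (x : Y.V) : P' x = x - Y.d (h' x) - h' (Y.d x) := rfl
  have hPc {i : ι} {x : X.V} (hx : x ∈ X.part i) : P x ∈ X.cycles i := by
    refine ⟨?_, ?_⟩
    · rw [hPx]
      refine sub_mem (sub_mem hx (hX.d_mem (hh _ _ hx))) ?_
      rcases hX.eq_succ_or i with ⟨j, rfl⟩ | h0
      · exact hh _ _ (hX.d_mem hx)
      · rw [h0 x hx, map_zero]; exact zero_mem _
    · change X.d (P x) = 0
      rw [hPx, map_sub, map_sub, hX.d_d (hh _ _ hx), hd _ _ hx, sub_zero, sub_self]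
  have hPc' {i : ι} {x : Y.V} (hx : x ∈ Y.part i) : P' x ∈ Y.cycles i := by
    refine ⟨?_, ?_⟩
    · rw [hPx']
      refine sub_mem (sub_mem hx (hY.d_mem (hh' _ _ hx))) ?_
      rcases hY.eq_succ_or i with ⟨j, rfl⟩ | h0
      · exact hh' _ _ (hY.d_mem hx)
      · rw [h0 x hx, map_zero]; exact zero_mem _
    · change Y.d (P' x) = 0
      rw [hPx', map_sub, map_sub, hY.d_d (hh' _ _ hx), hd' _ _ hx, sub_zero, sub_self]
  have hPd {i : ι} {x : X.V} (hx : x ∈ X.part i) : P (X.d x) = 0 := by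
    rw [hPx, hd _ _ hx, hX.d_d hx, map_zero, sub_self, sub_self]
  set K : X.V ⊗[k] Y.V →ₗ[k] X.V ⊗[k] Y.V :=
    TensorProduct.map h LinearMap.id + TensorProduct.map (X.ε ∘ₗ P) h'
  have hK (x : X.V) (y : Y.V) : K (x ⊗ₜ y) = h x ⊗ₜ y + X.ε (P x) ⊗ₜ h' y := rfl
  have hKpart {z : X.V ⊗[k] Y.V} (hz : z ∈ (X.tensor Y).part n) :
      K z ∈ (X.tensor Y).part (n + 1) := by
    refine tensor_part_le (N := ((X.tensor Y).part (n + 1)).comap K)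
      (fun i j hij x hx y hy => ?_) hz
    rw [Submodule.mem_comap, hK, X.ε_apply _ _ (hPc hx).1]
    exact add_mem (tmul_mem_part (by rw [add_right_comm, hij]) (hh _ _ hx) hy)
      (tmul_mem_part (by rw [← add_assoc, hij])
        ((X.part i).smul_of_tower_mem _ (hPc hx).1) (hh' _ _ hy))
  have hDK {z : X.V ⊗[k] Y.V} (hz : z ∈ (X.tensor Y).part n) :
      ((X.tensor Y).d ∘ₗ K + K ∘ₗ (X.tensor Y).d) z =
        ((LinearMap.id : X.V ⊗[k] Y.V →ₗ[k] X.V ⊗[k] Y.V) - TensorProduct.map P P') z := by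
    refine tensor_map_apply (fun i j hij x hx y hy => ?_) hz
    have e1 : X.d (P x) = 0 := (hPc hx).2
    have e2 : x ⊗ₜ[k] y - P x ⊗ₜ[k] P' y = (X.d (h x) + h (X.d x)) ⊗ₜ[k] y +
        P x ⊗ₜ[k] (Y.d (h' y) + h' (Y.d y)) := by
      have a1 : X.d (h x) + h (X.d x) = x - P x := by rw [hPx]; abel
      have a2 : Y.d (h' y) + h' (Y.d y) = y - P' y := by rw [hPx']; abel
      rw [a1, a2, TensorProduct.sub_tmul, TensorProduct.tmul_sub]
      abel
    rw [LinearMap.sub_apply, map_tmul, LinearMap.id_apply, e2, LinearMap.add_apply,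
      comp_apply, comp_apply, tensor_d_tmul hx, hK, map_add, map_add,
      tensor_d_tmul (hh _ _ hx), hK, X.ε_apply _ _ (hPc hx).1, hPd hx, map_zero,
      zero_tmul, hs]
    rcases Int.units_eq_one_or (X.sgn i) with hi | hi
    · rw [hi]
      simp only [one_smul, Units.neg_smul, hK, tensor_d_tmul (hPc hx).1, e1, hi,
        X.ε_apply _ _ (hPc hx).1, zero_tmul, add_tmul,
        tmul_add, TensorProduct.neg_tmul]
      abel
    · rw [hi]
      simp only [one_smul, Units.neg_smul, neg_neg, map_neg, hK, tensor_d_tmul (hPc hx).1, e1, hi,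
        X.ε_apply _ _ (hPc hx).1, zero_tmul, add_tmul,
        tmul_add, TensorProduct.neg_tmul]
      abel
  intro t
  obtain ⟨z, rfl⟩ := Submodule.mkQ_surjective _ t
  have hzd : (X.tensor Y).d z.1 = 0 := z.2.2
  have hPz : (X.tensor Y).part n ≤ Submodule.comap (TensorProduct.map P P')
      (Submodule.map ((X.tensor Y).cycles n).subtype
        (Submodule.comap ((X.tensor Y).cls n) (LinearMap.range (X.kunneth Y n)))) := by
    refine tensor_part_le fun i j hij x hx y hy => ?_
    rw [Submodule.mem_comap, map_tmul]
    exact ⟨⟨P x ⊗ₜ P' y, tmul_mem_cycles hij (hPc hx) (hPc' hy)⟩,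
      ⟨_, kunneth_lof ⟨(i, j), hij⟩ ⟨P x, hPc hx⟩ ⟨P' y, hPc' hy⟩⟩, rfl⟩
  obtain ⟨y, ⟨t, ht⟩, hy⟩ := hPz z.2.1
  refine ⟨t, ht.trans (eq_comm.1 ((Submodule.Quotient.eq _).2 ⟨K z.1, hKpart z.2.1, ?_⟩))⟩
  have h1 := hDK z.2.1
  rw [LinearMap.add_apply, comp_apply, comp_apply, hzd, map_zero, add_zero,
    LinearMap.sub_apply, LinearMap.id_apply] at h1
  rw [h1, ← hy]
  rfl

theorem kunneth_bijective [IsRightCancelAdd ι] (hX : X.IsComplex) (hY : Y.IsComplex)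
    (hs : ∀ i, X.sgn (i + 1) = -X.sgn i) (n : ι) : Function.Bijective (X.kunneth Y n) :=
  ⟨kunneth_injective hX hY n, kunneth_surjective hX hY hs n⟩

end SignedComplex

end Kunneth

end HopfCyclic

namespace HopfCyclic

universe u v w

/-- A Lie algebra of primitive elements which generates a Hopf algebra, with a projection to it. -/
structure LieFrame (k : Type u) (g : Type w) (A : Type v) [Field k] [LieRing g] [LieAlgebra k g]
    [Ring A] [HopfAlgebra k A] where
  j : g →ₗ[k] A
  p : A →ₗ[k] g
  comul_j : ∀ x, Coalgebra.comul (R := k) (j x) = j x ⊗ₜ 1 + 1 ⊗ₜ j x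
  j_lie : ∀ x y, j ⁅x, y⁆ = j x * j y - j y * j x
  p_j : ∀ x, p (j x) = x
  p_one : p 1 = 0
  adjoin : Algebra.adjoin k (Set.range j) = ⊤

namespace LieFrame

section Koszul

open Coalgebra

variable {k : Type u} {A : Type v} {g : Type w} [Field k] [Ring A] [HopfAlgebra k A]
  [LieRing g] [LieAlgebra k g] (J : LieFrame k g A)

local notation "𝓔" => ExteriorAlgebra k g
local notation "𝓚" => A ⊗[k] ExteriorAlgebra k g

theorem counit_j (x : g) : counit (R := k) (J.j x) = 0 := by
  have h := rTensor_counit_comul (R := k) (J.j x)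
  rw [J.comul_j, map_add, LinearMap.rTensor_tmul, LinearMap.rTensor_tmul,
    Bialgebra.counit_one] at h
  have h2 := congrArg (fun t => (TensorProduct.lid k A t)) h
  simp only [map_add, TensorProduct.lid_tmul, one_smul] at h2
  have h3 := congrArg (counit (R := k)) (add_eq_right.1 h2)
  rw [map_smul, Bialgebra.counit_one, map_zero, smul_eq_mul, mul_one] at h3
  exact h3

/-- Right multiplication by an element of the Lie algebra. -/
def opR (x : g) : 𝓚 →ₗ[k] 𝓚 := (LinearMap.mulRight k (J.j x)).rTensor 𝓔

variable (k A) in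
/-- Left exterior multiplication by an element of the Lie algebra. -/
def opW (x : g) : 𝓚 →ₗ[k] 𝓚 := (LinearMap.mulLeft k (ExteriorAlgebra.ι k x)).lTensor A

variable (k) in
theorem ι_mul_ι_mul (x y : g) (l : 𝓔) : ExteriorAlgebra.ι k x * (ExteriorAlgebra.ι k y * l) =
    -(ExteriorAlgebra.ι k y * (ExteriorAlgebra.ι k x * l)) := by
  rw [← mul_assoc, ← mul_assoc, ← neg_mul, eq_neg_of_add_eq_zero_left (ExteriorAlgebra.ι_add_mul_swap x y)]

variable (k) in
/-- The adjoint action on the exterior algebra. -/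
def adE (x : g) : 𝓔 →ₗ[k] 𝓔 :=
  CliffordAlgebra.foldr' 0
    ((LinearMap.mul k 𝓔 ∘ₗ ExteriorAlgebra.ι k ∘ₗ (LieAlgebra.ad k g x)).compl₂
        (LinearMap.fst k 𝓔 𝓔) +
      (LinearMap.mul k 𝓔 ∘ₗ ExteriorAlgebra.ι k).compl₂ (LinearMap.snd k 𝓔 𝓔))
    (fun y l l' => by
      have h : ExteriorAlgebra.ι k y * (ExteriorAlgebra.ι k y * l') = 0 := by
        rw [← mul_assoc, ExteriorAlgebra.ι_sq_zero, zero_mul]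
      change ExteriorAlgebra.ι k ⁅x, y⁆ * (ExteriorAlgebra.ι k y * l) + ExteriorAlgebra.ι k y *
        (ExteriorAlgebra.ι k ⁅x, y⁆ * l + ExteriorAlgebra.ι k y * l') = (0 : k) • l'
      rw [mul_add, h, ι_mul_ι_mul k ⁅x, y⁆, add_zero, neg_add_cancel, zero_smul]) 0

theorem adE_one (x : g) : adE k x (1 : 𝓔) = 0 := by
  have := CliffordAlgebra.foldr'_algebraMap (R := k) (M := g) (0 : QuadraticForm k g) (N := 𝓔)
  rw [adE, ← map_one (algebraMap k 𝓔)]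
  exact (this _ _ 0 1).trans (smul_zero _)

theorem adE_mul (x y : g) (l : 𝓔) : adE k x (ExteriorAlgebra.ι k y * l) =
    ExteriorAlgebra.ι k ⁅x, y⁆ * l + ExteriorAlgebra.ι k y * adE k x l :=
  CliffordAlgebra.foldr'_ι_mul _ _ _ _ _ _

theorem exterior_induction {P : 𝓔 → Prop} (h1 : P 1) (hm : ∀ x l, P l → P (ExteriorAlgebra.ι k x * l))
    (ha : ∀ l l', P l → P l' → P (l + l')) (hs : ∀ (c : k) l, P l → P (c • l)) (l : 𝓔) : P l := by
  induction l using CliffordAlgebra.left_induction with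
  | algebraMap r => rw [Algebra.algebraMap_eq_smul_one]; exact hs r _ h1
  | add x y hx hy => exact ha x y hx hy
  | ι_mul x m hx => exact hm m x hx

theorem adE_lie (x y : g) (l : 𝓔) : adE k x (adE k y l) - adE k y (adE k x l) = adE k ⁅x, y⁆ l := by
  induction l using exterior_induction with
  | h1 => simp [adE_one]
  | ha a b h1 h2 =>
    rw [map_add, map_add, map_add, map_add, map_add, ← h1, ← h2]; abel
  | hs c a h => simp only [map_smul, ← smul_sub, h]
  | hm z l h =>
    rw [adE_mul, adE_mul, adE_mul, map_add, map_add, adE_mul, adE_mul, adE_mul, adE_mul, ← h,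
      lie_lie, map_sub, mul_sub, sub_mul]
    abel

variable (k A) in
/-- The adjoint action on the exterior algebra. -/
def opTheta (x : g) : 𝓚 →ₗ[k] 𝓚 := (adE k x).lTensor A

theorem koszul_ext {M : Type*} [AddCommGroup M] [Module k M] {f f' : 𝓚 →ₗ[k] M}
    (h1 : ∀ u : A, f (u ⊗ₜ 1) = f' (u ⊗ₜ 1))
    (h : ∀ x z, f z = f' z → f (opW k A x z) = f' (opW k A x z)) : f = f' := by
  refine TensorProduct.ext' fun u l => ?_
  induction l using exterior_induction with
  | h1 => exact h1 u
  | hm x l hl => exact h x _ hl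
  | ha l l' h1 h2 => rw [tmul_add, map_add, map_add, h1, h2]
  | hs c l hl => rw [TensorProduct.tmul_smul, map_smul, map_smul, hl]

theorem opR_tmul (x : g) (u : A) (l : 𝓔) : J.opR x (u ⊗ₜ l) = (u * J.j x) ⊗ₜ l := rfl

theorem opW_tmul (x : g) (u : A) (l : 𝓔) :
    opW k A x (u ⊗ₜ l) = u ⊗ₜ (ExteriorAlgebra.ι k x * l) := rfl

theorem opTheta_tmul (x : g) (u : A) (l : 𝓔) : opTheta k A x (u ⊗ₜ l) = u ⊗ₜ adE k x l := rfl

theorem opR_opW (x y : g) (z : 𝓚) : J.opR x (opW k A y z) = opW k A y (J.opR x z) := by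
  induction z with
  | zero => simp only [map_zero]
  | add a b ha hb => simp only [map_add, ha, hb]
  | tmul u l => rfl

theorem opR_opTheta (x y : g) (z : 𝓚) : J.opR x (opTheta k A y z) = opTheta k A y (J.opR x z) := by
  induction z with
  | zero => simp only [map_zero]
  | add a b ha hb => simp only [map_add, ha, hb]
  | tmul u l => rfl

theorem opTheta_opW (x y : g) (z : 𝓚) : opTheta k A x (opW k A y z) =
    opW k A y (opTheta k A x z) + opW k A ⁅x, y⁆ z := by
  induction z with
  | zero => simp only [map_zero, add_zero]
  | add a b ha hb => simp only [map_add, ha, hb]; abel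
  | tmul u l =>
    rw [opW_tmul, opW_tmul, opTheta_tmul, opTheta_tmul, opW_tmul, adE_mul, tmul_add,
      add_comm]

theorem opTheta_lie (x y : g) (z : 𝓚) : opTheta k A x (opTheta k A y z) -
    opTheta k A y (opTheta k A x z) = opTheta k A ⁅x, y⁆ z := by
  induction z with
  | zero => simp only [map_zero, sub_zero]
  | add a b ha hb => simp only [map_add, ← ha, ← hb]; abel
  | tmul u l => simp only [opTheta_tmul, ← TensorProduct.tmul_sub, adE_lie]

theorem opR_lie (x y : g) (z : 𝓚) : J.opR x (J.opR y z) - J.opR y (J.opR x z) =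
    -J.opR ⁅x, y⁆ z := by
  induction z with
  | zero => simp only [map_zero, sub_zero, neg_zero]
  | add a b ha hb => rw [map_add, map_add, map_add, map_add, map_add, neg_add, ← ha, ← hb]; abel
  | tmul u l =>
    simp only [opR_tmul, ← TensorProduct.sub_tmul, ← TensorProduct.neg_tmul, J.j_lie, mul_assoc,
      mul_sub, neg_sub]

/-- The restriction of the Chevalley–Eilenberg differential to the exterior algebra. -/
def ceE : 𝓔 →ₗ[k] 𝓚 :=
  CliffordAlgebra.foldr' 0
    ((TensorProduct.mk k A 𝓔 ∘ₗ J.j).compl₂ (LinearMap.fst k 𝓔 𝓚) -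
      LinearMap.mk₂ k (fun (x : g) (z : 𝓔 × 𝓚) => opW k A x z.2 + (1 : A) ⊗ₜ adE k x z.1)
        (fun x y z => by
          have h (l : 𝓔) : adE k (x + y) l = adE k x l + adE k y l := by
            induction l using exterior_induction with
            | h1 => simp [adE_one]
            | ha a b h1 h2 => rw [map_add, map_add, map_add, h1, h2]; abel
            | hs c a h => simp only [map_smul, ← smul_add, h]
            | hm z l h => rw [adE_mul, adE_mul, adE_mul, h, add_lie, map_add, add_mul, mul_add]; abel
          have h2 (z : 𝓚) : opW k A (x + y) z = opW k A x z + opW k A y z := by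
            induction z with
            | zero => simp only [map_zero, add_zero]
            | add a b ha hb => simp only [map_add, ha, hb]; abel
            | tmul u l => simp only [opW_tmul, map_add, add_mul, tmul_add]
          simp only [h, h2, tmul_add]
          abel)
        (fun c x z => by
          have h (l : 𝓔) : adE k (c • x) l = c • adE k x l := by
            induction l using exterior_induction with
            | h1 => simp [adE_one]
            | ha a b h1 h2 => rw [map_add, map_add, h1, h2, smul_add]
            | hs d a h => simp only [map_smul, h, smul_comm c d]
            | hm z l h =>
              rw [adE_mul, adE_mul, h, smul_lie, map_smul, smul_mul_assoc, mul_smul_comm, smul_add]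
          have h2 (z : 𝓚) : opW k A (c • x) z = c • opW k A x z := by
            induction z with
            | zero => simp only [map_zero, smul_zero]
            | add a b ha hb => simp only [map_add, ha, hb, smul_add]
            | tmul u l => simp only [opW_tmul, map_smul, smul_mul_assoc, TensorProduct.tmul_smul]
          simp only [h, h2, TensorProduct.tmul_smul, smul_add])
        (fun x z z' => by
          simp only [Prod.fst_add, Prod.snd_add, map_add, tmul_add]; abel)
        (fun c x z => by
          simp only [Prod.smul_fst, Prod.smul_snd, map_smul, TensorProduct.tmul_smul, smul_add]))
    (fun x l z => by
      have h1 : opW k A x (opW k A x z) = 0 := by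
        induction z with
        | zero => simp only [map_zero]
        | add a b ha hb => simp only [map_add, ha, hb, add_zero]
        | tmul u l =>
          rw [opW_tmul, opW_tmul, ← mul_assoc, ExteriorAlgebra.ι_sq_zero, zero_mul,
            tmul_zero]
      change J.j x ⊗ₜ (ExteriorAlgebra.ι k x * l) - (opW k A x (J.j x ⊗ₜ l -
        (opW k A x z + (1 : A) ⊗ₜ adE k x l)) + (1 : A) ⊗ₜ adE k x (ExteriorAlgebra.ι k x * l)) =
          (0 : k) • z
      rw [map_sub, map_add, h1, opW_tmul, opW_tmul, adE_mul, lie_self, map_zero, zero_mul, zero_add,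
        zero_add, sub_add_cancel, sub_self, zero_smul]) 0

theorem ceE_one : J.ceE 1 = 0 := by
  have := CliffordAlgebra.foldr'_algebraMap (R := k) (M := g) (0 : QuadraticForm k g) (N := 𝓚)
  rw [ceE, ← map_one (algebraMap k 𝓔)]
  exact (this _ _ 0 1).trans (smul_zero _)

theorem ceE_mul (x : g) (l : 𝓔) : J.ceE (ExteriorAlgebra.ι k x * l) =
    J.j x ⊗ₜ l - (opW k A x (J.ceE l) + (1 : A) ⊗ₜ adE k x l) :=
  CliffordAlgebra.foldr'_ι_mul _ _ _ _ _ _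

/-- The differential of the Chevalley–Eilenberg resolution. -/
def ceD : 𝓚 →ₗ[k] 𝓚 :=
  TensorProduct.lift ((LinearMap.lcomp k 𝓚 J.ceE) ∘ₗ (LinearMap.rTensorHom 𝓔 ∘ₗ LinearMap.mul k A))

theorem ceD_tmul (u : A) (l : 𝓔) :
    J.ceD (u ⊗ₜ l) = (LinearMap.mulLeft k u).rTensor 𝓔 (J.ceE l) := rfl

theorem ceD_tmul_one (u : A) : J.ceD (u ⊗ₜ 1) = 0 := by
  rw [ceD_tmul, ceE_one, map_zero]

theorem rTensor_opW (f : A →ₗ[k] A) (x : g) (z : 𝓚) :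
    f.rTensor 𝓔 (opW k A x z) = opW k A x (f.rTensor 𝓔 z) := by
  induction z with
  | zero => simp only [map_zero]
  | add a b ha hb => simp only [map_add, ha, hb]
  | tmul u l => rfl

theorem ceD_opW (x : g) (z : 𝓚) :
    J.ceD (opW k A x z) = -opW k A x (J.ceD z) + J.opR x z - opTheta k A x z := by
  induction z with
  | zero => simp only [map_zero, add_zero, sub_zero, neg_zero]
  | add a b ha hb => simp only [map_add, ha, hb]; abel
  | tmul u l =>
    rw [opW_tmul, ceD_tmul, ceE_mul, ceD_tmul, map_sub, map_add, rTensor_opW, opR_tmul,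
      opTheta_tmul, LinearMap.rTensor_tmul, LinearMap.rTensor_tmul, LinearMap.mulLeft_apply,
      LinearMap.mulLeft_apply, mul_one]
    abel

theorem ceD_opR (x : g) (z : 𝓚) : J.ceD (J.opR x z) =
    J.opR x (J.ceD z) + J.ceD (opTheta k A x z) - opTheta k A x (J.ceD z) := by
  suffices h : J.ceD ∘ₗ J.opR x = J.opR x ∘ₗ J.ceD + J.ceD ∘ₗ opTheta k A x -
      opTheta k A x ∘ₗ J.ceD from LinearMap.congr_fun h z
  refine koszul_ext (fun u => ?_) fun y z hz => ?_
  · simp only [LinearMap.sub_apply, LinearMap.add_apply, comp_apply, opR_tmul,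
      ceD_tmul_one, opTheta_tmul, adE_one, tmul_zero, map_zero, add_zero, sub_zero]
  · simp only [LinearMap.sub_apply, LinearMap.add_apply, comp_apply] at hz ⊢
    have h1 := J.opR_lie x y z
    have h2 := opTheta_lie (k := k) (A := A) x y z
    simp only [opR_opW, ceD_opW, opTheta_opW, map_add, map_sub, map_neg, hz, opR_opTheta]
    have e1 := sub_eq_iff_eq_add.1 h1
    have e2 := sub_eq_iff_eq_add.1 h2
    rw [e1, e2]
    abel

theorem ceD_ceD (z : 𝓚) : J.ceD (J.ceD z) = 0 := by
  suffices h : J.ceD ∘ₗ J.ceD = 0 from LinearMap.congr_fun h z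
  refine koszul_ext (fun u => ?_) fun x z hz => ?_
  · rw [comp_apply, ceD_tmul_one, map_zero, LinearMap.zero_apply]
  · rw [comp_apply, LinearMap.zero_apply] at hz ⊢
    rw [ceD_opW, map_sub, map_add, map_neg, ceD_opW, hz, map_zero, ceD_opR]
    abel

end Koszul

end LieFrame

end HopfCyclic

namespace HopfCyclic

universe u v w

namespace LieFrame

section Filtration

open Coalgebra

variable {k : Type u} {A : Type v} {g : Type w} [Field k] [Ring A] [HopfAlgebra k A]
  [LieRing g] [LieAlgebra k g] (J : LieFrame k g A)

local notation "𝓔" => ExteriorAlgebra k g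
local notation "𝓚" => A ⊗[k] ExteriorAlgebra k g

/-- The map `(a ⊗ b) ⊗ l ↦ b ⊗ (φ(a) ∧ l)`. -/
def coM (φ : A →ₗ[k] g) : (A ⊗[k] A) ⊗[k] 𝓔 →ₗ[k] 𝓚 :=
  (LinearMap.mul' k 𝓔 ∘ₗ (ExteriorAlgebra.ι k ∘ₗ φ).rTensor 𝓔).lTensor A ∘ₗ
    (TensorProduct.assoc k A A 𝓔).toLinearMap ∘ₗ (TensorProduct.comm k A A).toLinearMap.rTensor 𝓔

theorem coM_tmul (φ : A →ₗ[k] g) (a b : A) (l : 𝓔) :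
    coM φ ((a ⊗ₜ b) ⊗ₜ l) = b ⊗ₜ (ExteriorAlgebra.ι k (φ a) * l) := rfl

/-- The map `u ⊗ l ↦ u'' ⊗ (φ(u') ∧ l)`. -/
def coD (φ : A →ₗ[k] g) : 𝓚 →ₗ[k] 𝓚 := coM φ ∘ₗ (comul (R := k)).rTensor 𝓔

theorem coD_tmul (φ : A →ₗ[k] g) (u : A) (l : 𝓔) :
    coD φ (u ⊗ₜ l) = coM φ (comul (R := k) u ⊗ₜ l) := rfl

theorem coD_one {φ : A →ₗ[k] g} (hφ : φ 1 = 0) (l : 𝓔) : coD φ ((1 : A) ⊗ₜ l) = 0 := by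
  rw [coD_tmul, Bialgebra.comul_one, Algebra.TensorProduct.one_def, coM_tmul, hφ, map_zero,
    zero_mul, tmul_zero]

theorem coD_opW (φ : A →ₗ[k] g) (x : g) (z : 𝓚) : coD φ (opW k A x z) = -opW k A x (coD φ z) := by
  induction z with
  | zero => simp only [map_zero, neg_zero]
  | add a b ha hb => simp only [map_add, ha, hb]; abel
  | tmul u l =>
    rw [opW_tmul, coD_tmul, coD_tmul]
    induction comul (R := k) u with
    | zero => simp only [zero_tmul, map_zero, neg_zero]
    | add a b ha hb => simp only [add_tmul, map_add, ha, hb]; abel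
    | tmul a b => rw [coM_tmul, coM_tmul, opW_tmul, ι_mul_ι_mul, TensorProduct.tmul_neg]

theorem coD_opR (φ : A →ₗ[k] g) (x : g) (z : 𝓚) : coD φ (J.opR x z) =
    J.opR x (coD φ z) + coD (φ ∘ₗ LinearMap.mulRight k (J.j x)) z := by
  induction z with
  | zero => simp only [map_zero, add_zero]
  | add a b ha hb => simp only [map_add, ha, hb]; abel
  | tmul u l =>
    rw [opR_tmul, coD_tmul, coD_tmul, coD_tmul, Bialgebra.comul_mul, J.comul_j]
    induction comul (R := k) u with
    | zero => simp only [zero_mul, zero_tmul, map_zero, add_zero]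
    | add a b ha hb => simp only [add_mul, add_tmul, map_add] at ha hb ⊢; rw [ha, hb]; abel
    | tmul a b =>
      rw [mul_add, Algebra.TensorProduct.tmul_mul_tmul, Algebra.TensorProduct.tmul_mul_tmul, mul_one,
        mul_one, add_tmul, map_add, coM_tmul, coM_tmul, coM_tmul, coM_tmul, opR_tmul,
        add_comm]
      rfl

theorem coD_eq (φ : A →ₗ[k] g) (z : 𝓚) :
    coD φ z = coD (φ - (counit (R := k)).smulRight (φ 1)) z + opW k A (φ 1) z := by
  induction z with
  | zero => simp only [map_zero, add_zero]
  | add a b ha hb => rw [map_add, ha, hb, map_add, map_add]; abel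
  | tmul u l =>
    have h : opW k A (φ 1) (u ⊗ₜ l) = coM ((counit (R := k)).smulRight (φ 1))
        (comul (R := k) u ⊗ₜ l) := by
      have h1 := congrArg (fun t => opW k A (φ 1) ((TensorProduct.lid k A t) ⊗ₜ l))
        (rTensor_counit_comul (R := k) u)
      simp only [TensorProduct.lid_tmul, one_smul] at h1
      rw [← h1]
      induction comul (R := k) u with
      | zero => simp only [zero_tmul, map_zero]
      | add a b ha hb => simp only [map_add, add_tmul] at ha hb ⊢; rw [ha, hb]
      | tmul a b =>
        rw [LinearMap.rTensor_tmul, TensorProduct.lid_tmul, coM_tmul, LinearMap.smulRight_apply,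
          opW_tmul, map_smul, smul_mul_assoc, TensorProduct.smul_tmul]
    rw [h, coD_tmul, coD_tmul]
    induction comul (R := k) u with
    | zero => simp only [zero_tmul, map_zero, add_zero]
    | add a b ha hb => rw [add_tmul, map_add, ha, hb, map_add, map_add]; abel
    | tmul a b =>
      rw [coM_tmul, coM_tmul, coM_tmul, LinearMap.sub_apply, map_sub, sub_mul, TensorProduct.tmul_sub,
        sub_add_cancel]

/-- The filtration by the total number of factors from the Lie algebra. -/
def filt : ℕ → Submodule k 𝓚
  | 0 => Submodule.span k {1}
  | n + 1 => filt n ⊔ ((⨆ x, (filt n).map (J.opR x)) ⊔ ⨆ x, (filt n).map (opW k A x))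

theorem one_mem_filt : (1 : 𝓚) ∈ J.filt 0 := Submodule.mem_span_singleton_self _

theorem filt_le_succ (n : ℕ) : J.filt n ≤ J.filt (n + 1) := le_sup_left

theorem filt_mono : Monotone J.filt := monotone_nat_of_le_succ J.filt_le_succ

theorem opR_mem_filt (x : g) {n : ℕ} {z : 𝓚} (hz : z ∈ J.filt n) : J.opR x z ∈ J.filt (n + 1) :=
  Submodule.mem_sup_right (Submodule.mem_sup_left
    (Submodule.mem_iSup_of_mem x (Submodule.mem_map_of_mem hz)))

theorem opW_mem_filt (x : g) {n : ℕ} {z : 𝓚} (hz : z ∈ J.filt n) : opW k A x z ∈ J.filt (n + 1) :=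
  Submodule.mem_sup_right (Submodule.mem_sup_right
    (Submodule.mem_iSup_of_mem x (Submodule.mem_map_of_mem hz)))

theorem filt_le {n : ℕ} {N : Submodule k 𝓚} (h0 : J.filt n ≤ N)
    (hR : ∀ x, ∀ z ∈ J.filt n, J.opR x z ∈ N) (hW : ∀ x, ∀ z ∈ J.filt n, opW k A x z ∈ N) :
    J.filt (n + 1) ≤ N :=
  sup_le h0 (sup_le (iSup_le fun x => Submodule.map_le_iff_le_comap.2 (hR x))
    (iSup_le fun x => Submodule.map_le_iff_le_comap.2 (hW x)))

theorem filt_zero_le {N : Submodule k 𝓚} (h : (1 : 𝓚) ∈ N) : J.filt 0 ≤ N :=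
  Submodule.span_le.2 (Set.singleton_subset_iff.2 h)

theorem exists_mem_filt (z : 𝓚) : ∃ n, z ∈ J.filt n := by
  set N : Submodule k 𝓚 := ⨆ n, J.filt n with hN
  have hdir : Directed (· ≤ ·) J.filt := J.filt_mono.directed_le
  have hmem {z : 𝓚} : z ∈ N ↔ ∃ n, z ∈ J.filt n := Submodule.mem_iSup_of_directed _ hdir
  have hR (u : A) : ∀ z ∈ N, (LinearMap.mulRight k u).rTensor 𝓔 z ∈ N := by
    have hu : u ∈ Algebra.adjoin k (Set.range J.j) := by rw [J.adjoin]; trivial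
    induction hu using Algebra.adjoin_induction with
    | mem u hu =>
      obtain ⟨x, rfl⟩ := hu
      intro z hz
      obtain ⟨n, hn⟩ := hmem.1 hz
      exact hmem.2 ⟨n + 1, J.opR_mem_filt x hn⟩
    | algebraMap c =>
      intro z hz
      have h : LinearMap.mulRight k (algebraMap k A c) = c • LinearMap.id := by
        ext a; simp [Algebra.algebraMap_eq_smul_one]
      rw [h, LinearMap.rTensor_smul, LinearMap.rTensor_id]
      exact N.smul_mem c hz
    | add a b _ _ ha hb =>
      intro z hz
      have h : LinearMap.mulRight k (a + b) = LinearMap.mulRight k a + LinearMap.mulRight k b := by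
        ext c; simp [mul_add]
      rw [h, LinearMap.rTensor_add]
      exact add_mem (ha z hz) (hb z hz)
    | mul a b _ _ ha hb =>
      intro z hz
      have h : LinearMap.mulRight k (a * b) = LinearMap.mulRight k b ∘ₗ LinearMap.mulRight k a := by
        ext c; simp [mul_assoc]
      rw [h, LinearMap.rTensor_comp]
      exact hb _ (ha z hz)
  refine hmem.1 ?_
  induction z with
  | zero => exact zero_mem _
  | add a b ha hb => exact add_mem ha hb
  | tmul u l =>
    induction l using exterior_induction with
    | h1 =>
      have h := hR u 1 (hmem.2 ⟨0, J.one_mem_filt⟩)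
      rwa [Algebra.TensorProduct.one_def, LinearMap.rTensor_tmul, LinearMap.mulRight_apply,
        one_mul] at h
    | hm x l hl =>
      obtain ⟨n, hn⟩ := hmem.1 hl
      exact hmem.2 ⟨n + 1, J.opW_mem_filt x hn⟩
    | ha l l' h1 h2 => rw [tmul_add]; exact add_mem h1 h2
    | hs c l hl => rw [TensorProduct.tmul_smul]; exact N.smul_mem c hl

theorem opTheta_mem_filt (x : g) {n : ℕ} : ∀ z ∈ J.filt n, opTheta k A x z ∈ J.filt n := by
  induction n with
  | zero =>
    refine J.filt_zero_le (N := (J.filt 0).comap (opTheta k A x)) ?_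
    rw [Submodule.mem_comap, Algebra.TensorProduct.one_def, opTheta_tmul, adE_one,
      tmul_zero]
    exact zero_mem _
  | succ n ih =>
    refine J.filt_le (N := (J.filt (n + 1)).comap (opTheta k A x))
      (fun z hz => J.filt_le_succ n (ih z hz)) (fun y z hz => ?_) fun y z hz => ?_
    · rw [Submodule.mem_comap, ← opR_opTheta]
      exact J.opR_mem_filt y (ih z hz)
    · rw [Submodule.mem_comap, opTheta_opW]
      exact add_mem (J.opW_mem_filt _ (ih z hz)) (J.opW_mem_filt _ hz)

theorem ceD_mem_filt {n : ℕ} : ∀ z ∈ J.filt n, J.ceD z ∈ J.filt n := by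
  induction n with
  | zero =>
    refine J.filt_zero_le (N := (J.filt 0).comap J.ceD) ?_
    rw [Submodule.mem_comap, Algebra.TensorProduct.one_def, ceD_tmul_one]
    exact zero_mem _
  | succ n ih =>
    refine J.filt_le (N := (J.filt (n + 1)).comap J.ceD)
      (fun z hz => J.filt_le_succ n (ih z hz)) (fun y z hz => ?_) fun y z hz => ?_
    · rw [Submodule.mem_comap, ceD_opR]
      exact sub_mem (add_mem (J.opR_mem_filt y (ih z hz))
        (J.filt_le_succ n (ih _ (J.opTheta_mem_filt y z hz))))
        (J.filt_le_succ n (J.opTheta_mem_filt y _ (ih z hz)))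
    · rw [Submodule.mem_comap, ceD_opW]
      exact sub_mem (add_mem (neg_mem (J.opW_mem_filt y (ih z hz))) (J.opR_mem_filt y hz))
        (J.filt_le_succ n (J.opTheta_mem_filt y z hz))

theorem sub_smulRight_apply_one (φ : A →ₗ[k] g) :
    (φ - (counit (R := k) (A := A)).smulRight (φ 1) : A →ₗ[k] g) 1 = 0 := by
  rw [LinearMap.sub_apply, LinearMap.smulRight_apply, Bialgebra.counit_one, one_smul, sub_self]

theorem coD_mem_filt {n : ℕ} : ∀ {φ : A →ₗ[k] g}, φ 1 = 0 → ∀ z ∈ J.filt n,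
    coD φ z ∈ J.filt n := by
  induction n with
  | zero =>
    intro φ hφ
    refine J.filt_zero_le (N := (J.filt 0).comap (coD φ)) ?_
    rw [Submodule.mem_comap, Algebra.TensorProduct.one_def, coD_one hφ]
    exact zero_mem _
  | succ n ih =>
    intro φ hφ
    refine J.filt_le (N := (J.filt (n + 1)).comap (coD φ))
      (fun z hz => J.filt_le_succ n (ih hφ z hz)) (fun y z hz => ?_) fun y z hz => ?_
    · rw [Submodule.mem_comap, coD_opR, coD_eq (φ ∘ₗ _)]
      exact add_mem (J.opR_mem_filt y (ih hφ z hz))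
        (add_mem (J.filt_le_succ n (ih (sub_smulRight_apply_one _) z hz)) (J.opW_mem_filt _ hz))
    · rw [Submodule.mem_comap, coD_opW]
      exact neg_mem (J.opW_mem_filt y (ih hφ z hz))

/-- The remainder in the commutator of the Koszul differential with right multiplication. -/
def remainder (x : g) : A →ₗ[k] g :=
  J.p ∘ₗ LinearMap.mulRight k (J.j x) - (counit (R := k)).smulRight x

theorem remainder_one (x : g) : J.remainder x 1 = 0 := by
  rw [remainder, LinearMap.sub_apply, LinearMap.smulRight_apply, Bialgebra.counit_one, one_smul,
    comp_apply, LinearMap.mulRight_apply, one_mul, J.p_j, sub_self]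

theorem coD_p_opR (x : g) (z : 𝓚) : coD J.p (J.opR x z) =
    J.opR x (coD J.p z) + opW k A x z + coD (J.remainder x) z := by
  have h : (J.p ∘ₗ LinearMap.mulRight k (J.j x)) 1 = x := by
    rw [comp_apply, LinearMap.mulRight_apply, one_mul, J.p_j]
  rw [coD_opR, coD_eq (J.p ∘ₗ _), h, remainder]
  abel

/-- The Laplacian of the Koszul and the Chevalley–Eilenberg differential. -/
def laplacian : 𝓚 →ₗ[k] 𝓚 := coD J.p ∘ₗ J.ceD + J.ceD ∘ₗ coD J.p

theorem laplacian_opW (x : g) (z : 𝓚) : J.laplacian (opW k A x z) =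
    opW k A x (J.laplacian z) + opW k A x z + (coD (J.remainder x) z -
      (coD J.p (opTheta k A x z) - opTheta k A x (coD J.p z))) := by
  simp only [laplacian, LinearMap.add_apply, comp_apply, ceD_opW, map_sub, map_add,
    map_neg, coD_opW, coD_p_opR]
  abel

theorem laplacian_opR (x : g) (z : 𝓚) : J.laplacian (J.opR x z) =
    J.opR x (J.laplacian z) + J.opR x z +
      (coD (J.remainder x) (J.ceD z) + J.ceD (coD (J.remainder x) z) +
        (coD J.p (J.ceD (opTheta k A x z)) - coD J.p (opTheta k A x (J.ceD z))) +
        (J.ceD (opTheta k A x (coD J.p z)) - opTheta k A x (J.ceD (coD J.p z))) -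
          opTheta k A x z) := by
  simp only [laplacian, LinearMap.add_apply, comp_apply, ceD_opR, ceD_opW, map_sub, map_add,
    coD_p_opR]
  abel

/-- The preceding step of the filtration. -/
def filtPred : ℕ → Submodule k 𝓚
  | 0 => ⊥
  | n + 1 => J.filt n

theorem laplacian_sub_mem {n : ℕ} : ∀ z ∈ J.filt n, J.laplacian z - (n : k) • z ∈ J.filtPred n := by
  induction n with
  | zero =>
    refine J.filt_zero_le (N := (J.filtPred 0).comap (J.laplacian - ((0 : ℕ) : k) • LinearMap.id)) ?_
    rw [Submodule.mem_comap, LinearMap.sub_apply, LinearMap.smul_apply, Nat.cast_zero, zero_smul,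
      sub_zero, laplacian, LinearMap.add_apply, comp_apply, comp_apply,
      Algebra.TensorProduct.one_def, ceD_tmul_one, coD_one J.p_one, map_zero, map_zero, add_zero]
    exact zero_mem _
  | succ n ih =>
    have hpred {z : 𝓚} (hz : z ∈ J.filtPred n) : z ∈ J.filt n := by
      cases n with
      | zero => rw [(Submodule.mem_bot k).1 hz]; exact zero_mem _
      | succ n => exact J.filt_le_succ n hz
    have hR (x : g) {z : 𝓚} (hz : z ∈ J.filtPred n) : J.opR x z ∈ J.filt n := by
      cases n with
      | zero => rw [(Submodule.mem_bot k).1 hz, map_zero]; exact zero_mem _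
      | succ n => exact J.opR_mem_filt x hz
    have hW (x : g) {z : 𝓚} (hz : z ∈ J.filtPred n) : opW k A x z ∈ J.filt n := by
      cases n with
      | zero => rw [(Submodule.mem_bot k).1 hz, map_zero]; exact zero_mem _
      | succ n => exact J.opW_mem_filt x hz
    have hd {z : 𝓚} := J.coD_mem_filt (n := n) J.p_one z
    have hr (x : g) {z : 𝓚} := J.coD_mem_filt (n := n) (J.remainder_one x) z
    have ht (x : g) {z : 𝓚} := J.opTheta_mem_filt (n := n) x z
    have hc {z : 𝓚} := J.ceD_mem_filt (n := n) z
    have e (a b c d : 𝓚) : a + b + d - (c + b) = a - c + d := by abel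
    refine J.filt_le (N := (J.filt n).comap (J.laplacian - ((n + 1 : ℕ) : k) • LinearMap.id))
      (fun z hz => ?_) (fun x z hz => ?_) fun x z hz => ?_
    · exact sub_mem (add_mem (hd (hc hz)) (hc (hd hz))) ((J.filt n).smul_mem _ hz)
    · rw [Submodule.mem_comap, LinearMap.sub_apply, LinearMap.smul_apply, LinearMap.id_apply,
        laplacian_opR, Nat.cast_succ, add_smul, one_smul, e, ← map_smul, ← map_sub]
      exact add_mem (hR x (ih z hz)) (sub_mem (add_mem (add_mem (add_mem (hr x (hc hz))
        (hc (hr x hz))) (sub_mem (hd (hc (ht x hz))) (hd (ht x (hc hz)))))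
        (sub_mem (hc (ht x (hd hz))) (ht x (hc (hd hz))))) (ht x hz))
    · rw [Submodule.mem_comap, LinearMap.sub_apply, LinearMap.smul_apply, LinearMap.id_apply,
        laplacian_opW, Nat.cast_succ, add_smul, one_smul, e, ← map_smul, ← map_sub]
      exact add_mem (hW x (ih z hz)) (sub_mem (hr x hz) (sub_mem (hd (ht x hz)) (ht x (hd hz))))

section CharZero

variable [CharZero k]

/-- A linear form vanishes on the cycles of the Chevalley–Eilenberg resolution if it vanishes on
boundaries and on the unit. -/
theorem apply_eq_zero_of_ceD_eq_zero {f : 𝓚 →ₗ[k] k} (h1 : f 1 = 0) (hf : ∀ z, f (J.ceD z) = 0)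
    {z : 𝓚} (hz : J.ceD z = 0) : f z = 0 := by
  obtain ⟨n, hn⟩ := J.exists_mem_filt z
  have h0 : ∀ z ∈ J.filt 0, f z = 0 := J.filt_zero_le (N := LinearMap.ker f) h1
  induction n generalizing z with
  | zero => exact h0 z hn
  | succ n ih =>
    have h := J.laplacian_sub_mem z hn
    have hL : J.laplacian z = J.ceD (coD J.p z) := by
      rw [laplacian, LinearMap.add_apply, comp_apply, hz, map_zero, zero_add,
        comp_apply]
    have h2 := ih (z := J.laplacian z - ((n + 1 : ℕ) : k) • z)
      (by rw [hL, map_sub, ceD_ceD, map_smul, hz, smul_zero, sub_zero]) h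
    rw [map_sub, hL, hf, map_smul, zero_sub, neg_eq_zero, smul_eq_mul, mul_eq_zero] at h2
    exact h2.resolve_left (Nat.cast_ne_zero.2 n.succ_ne_zero)

theorem exists_coD_of_coD_eq_zero (hdd : ∀ z : 𝓚, coD J.p (coD J.p z) = 0) {z : 𝓚}
    (hz : coD J.p z = 0) : ∃ (y : 𝓚) (c : k), z = coD J.p y + c • 1 := by
  obtain ⟨n, hn⟩ := J.exists_mem_filt z
  induction n generalizing z with
  | zero =>
    obtain ⟨c, rfl⟩ := Submodule.mem_span_singleton.1 hn
    exact ⟨0, c, by rw [map_zero, zero_add]⟩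
  | succ n ih =>
    have h := J.laplacian_sub_mem z hn
    have hL : J.laplacian z = coD J.p (J.ceD z) := by
      rw [laplacian, LinearMap.add_apply, comp_apply, comp_apply, hz, map_zero,
        add_zero]
    obtain ⟨y, c, hy⟩ := ih (z := J.laplacian z - ((n + 1 : ℕ) : k) • z)
      (by rw [hL, map_sub, hdd, map_smul, hz, smul_zero, sub_zero]) h
    have hn0 : ((n + 1 : ℕ) : k) ≠ 0 := Nat.cast_ne_zero.2 n.succ_ne_zero
    refine ⟨((n + 1 : ℕ) : k)⁻¹ • (J.ceD z - y), -(((n + 1 : ℕ) : k)⁻¹ * c), ?_⟩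
    rw [map_smul, map_sub, ← hL, neg_smul, mul_smul, ← sub_eq_add_neg, ← smul_sub, sub_sub, ← hy,
      sub_sub_cancel, inv_smul_smul₀ hn0]

end CharZero

/-- The projection to the ground field. -/
def proj0 : 𝓚 →ₗ[k] k :=
  LinearMap.mul' k k ∘ₗ TensorProduct.map (counit (R := k))
    (ExteriorAlgebra.algebraMapInv (R := k) (M := g)).toLinearMap

variable (g) in
theorem proj0_tmul (u : A) (l : 𝓔) : proj0 (u ⊗ₜ l) =
    counit (R := k) u * ExteriorAlgebra.algebraMapInv l := rfl

theorem algebraMapInv_ι_mul (x : g) (l : 𝓔) :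
    ExteriorAlgebra.algebraMapInv (ExteriorAlgebra.ι k x * l) = 0 := by
  rw [map_mul, ExteriorAlgebra.algebraMapInv, ExteriorAlgebra.lift_ι_apply, LinearMap.zero_apply,
    zero_mul]

theorem proj0_one : proj0 (1 : 𝓚) = 1 := by
  rw [Algebra.TensorProduct.one_def, proj0_tmul, Bialgebra.counit_one, map_one, mul_one]

theorem proj0_coD (φ : A →ₗ[k] g) (z : 𝓚) : proj0 (coD φ z) = 0 := by
  induction z with
  | zero => simp only [map_zero]
  | add a b ha hb => simp only [map_add, ha, hb, add_zero]
  | tmul u l =>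
    rw [coD_tmul]
    induction comul (R := k) u with
    | zero => simp only [zero_tmul, map_zero]
    | add a b ha hb => simp only [add_tmul, map_add, ha, hb, add_zero]
    | tmul a b => rw [coM_tmul, proj0_tmul, algebraMapInv_ι_mul, mul_zero]

section Square

variable [PrimitivelyGenerated k A] [CharZero k]

theorem coD_coD (φ : A →ₗ[k] g) (z : 𝓚) : coD φ (coD φ z) = 0 := by
  suffices h : coD φ ∘ₗ coD φ = (0 : 𝓚 →ₗ[k] 𝓚) from LinearMap.congr_fun h z
  refine koszul_ext (fun u => ?_) fun x z hz => ?_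
  · let f : A →ₗ[k] 𝓔 := ExteriorAlgebra.ι k ∘ₗ φ
    let T : (A ⊗[k] A) ⊗[k] A →ₗ[k] 𝓚 := (LinearMap.mul' k 𝓔 ∘ₗ TensorProduct.map f f).lTensor A ∘ₗ
      (TensorProduct.comm k (A ⊗[k] A) A).toLinearMap
    have hT (a b c : A) : T ((a ⊗ₜ b) ⊗ₜ c) = c ⊗ₜ (f a * f b) := rfl
    have hswap (X : A ⊗[k] A) (c : A) : T (TensorProduct.comm k A A X ⊗ₜ c) = -T (X ⊗ₜ c) := by
      induction X with
      | zero => simp only [map_zero, zero_tmul, neg_zero]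
      | add a b ha hb => simp only [map_add, add_tmul, ha, hb]; abel
      | tmul a b =>
        rw [TensorProduct.comm_tmul, hT, hT, ← TensorProduct.tmul_neg]
        exact congrArg _ (eq_neg_of_add_eq_zero_left (ExteriorAlgebra.ι_add_mul_swap _ _))
    have h1 (X : A ⊗[k] A) : coD φ (coM φ (X ⊗ₜ (1 : 𝓔))) =
        -T ((TensorProduct.assoc k A A A).symm ((comul (R := k)).lTensor A X)) := by
      induction X with
      | zero => simp only [map_zero, zero_tmul, neg_zero]
      | add a b ha hb => simp only [map_add, add_tmul, ha, hb]; abel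
      | tmul a b =>
        rw [coM_tmul, coD_tmul, LinearMap.lTensor_tmul]
        induction comul (R := k) b with
        | zero => simp only [map_zero, zero_tmul, tmul_zero, neg_zero]
        | add c d hc hd =>
          simp only [map_add, add_tmul, tmul_add, hc, hd]; abel
        | tmul c d =>
          rw [coM_tmul, TensorProduct.assoc_symm_tmul, hT, ← TensorProduct.tmul_neg, mul_one]
          exact congrArg _ (eq_neg_of_add_eq_zero_left (ExteriorAlgebra.ι_add_mul_swap _ _))
    have h2 (X : A ⊗[k] A) : T ((comul (R := k)).rTensor A X) =
        -T ((comul (R := k)).rTensor A X) := by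
      induction X with
      | zero => simp only [map_zero, neg_zero]
      | add a b ha hb => rw [map_add, map_add, neg_add, ← ha, ← hb]
      | tmul a b =>
        rw [LinearMap.rTensor_tmul, ← hswap]
        exact congrArg (fun t => T (t ⊗ₜ b)) (comm_comul a).symm
    rw [comp_apply, LinearMap.zero_apply, coD_tmul, h1, coassoc_symm_apply, neg_eq_zero]
    have h3 := h2 (comul (R := k) u)
    rw [eq_neg_iff_add_eq_zero, ← two_smul k] at h3
    exact (smul_eq_zero.1 h3).resolve_left two_ne_zero
  · rw [comp_apply, LinearMap.zero_apply] at hz ⊢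
    rw [coD_opW, map_neg, coD_opW, hz, map_zero, neg_zero, neg_zero]

/-- The Koszul complex is contractible onto the ground field. -/
theorem exists_contraction_coD : ∃ h : 𝓚 →ₗ[k] 𝓚,
    ∀ z, coD J.p (h z) + h (coD J.p z) = z - proj0 z • 1 := by
  set d : 𝓚 →ₗ[k] 𝓚 := coD J.p
  have hd1 : d 1 = 0 := by rw [Algebra.TensorProduct.one_def]; exact coD_one J.p_one _
  obtain ⟨t, ht⟩ := d.rangeRestrict.exists_rightInverse_of_surjective d.range_rangeRestrict
  obtain ⟨s, hs⟩ := LinearMap.exists_extend t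
  have hds (z : 𝓚) : d (s (d z)) = d z := by
    have h1 : s (d z) = t (d.rangeRestrict z) := LinearMap.congr_fun hs (d.rangeRestrict z)
    rw [h1]
    exact congrArg Subtype.val (LinearMap.congr_fun ht (d.rangeRestrict z))
  let η : 𝓚 →ₗ[k] 𝓚 := proj0.smulRight 1
  have hη (z : 𝓚) : η z = proj0 z • 1 := rfl
  have hηd (z : 𝓚) : η (d z) = 0 := by rw [hη, proj0_coD, zero_smul]
  have hdη (z : 𝓚) : d (η z) = 0 := by rw [hη, map_smul, hd1, smul_zero]
  let y : 𝓚 →ₗ[k] 𝓚 := LinearMap.id - η - (s ∘ₗ d - η ∘ₗ s ∘ₗ d)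
  have hy (z : 𝓚) : y z = z - η z - (s (d z) - η (s (d z))) := rfl
  have hdy (z : 𝓚) : d (s (y z)) = y z := by
    have h1 : d (y z) = 0 := by
      rw [hy, map_sub, map_sub, map_sub, hdη, hdη, hds, sub_zero, sub_self]
    obtain ⟨x, c, hx⟩ := J.exists_coD_of_coD_eq_zero (coD_coD J.p) h1
    have hη2 (z : 𝓚) : η (η z) = η z := by rw [hη z, map_smul, hη 1, proj0_one, one_smul]
    have h2 : η (y z) = 0 := by
      rw [hy, map_sub, map_sub, map_sub, hη2, hη2, sub_self, sub_self, sub_self]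
    have h3 : c • (1 : 𝓚) = 0 := by
      have h4 := congrArg η hx
      rw [h2, map_add, hηd, zero_add, map_smul, hη 1, proj0_one, one_smul] at h4
      exact h4.symm
    rw [hx, h3, add_zero]
    exact hds x
  refine ⟨(LinearMap.id - η) ∘ₗ s ∘ₗ y, fun z => ?_⟩
  have h1 : y (d z) = d z := by
    rw [hy, hηd, show d (d z) = 0 from coD_coD J.p z, map_zero, map_zero, sub_zero, sub_zero, sub_zero]
  have h2 (x : 𝓚) : ((LinearMap.id - η) ∘ₗ s ∘ₗ y) x = s (y x) - η (s (y x)) := rfl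
  rw [h2, h2, h1, map_sub, hdη, sub_zero, hdy, hy, ← hη]
  abel

end Square

end Filtration

end LieFrame

end HopfCyclic

namespace HopfCyclic

universe u v w x

namespace LieFrame

section Cocycle

open Coalgebra

variable {k : Type u} {A : Type v} {g : Type w} [Field k] [Ring A] [HopfAlgebra k A]
  [LieRing g] [LieAlgebra k g] (J : LieFrame k g A)

local notation "𝓔" => ExteriorAlgebra k g
local notation "𝓚" => A ⊗[k] ExteriorAlgebra k g

variable (k g) in
/-- The projection of the exterior algebra to degree one. -/
def extDegreeOne : 𝓔 →ₗ[k] g :=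
  CliffordAlgebra.foldr' 0
    (LinearMap.smulRightₗ ((ExteriorAlgebra.algebraMapInv (R := k) (M := g)).toLinearMap ∘ₗ
      LinearMap.fst k 𝓔 g))
    (fun x l y => by
      change ExteriorAlgebra.algebraMapInv (ExteriorAlgebra.ι k x * l) • x = (0 : k) • y
      rw [algebraMapInv_ι_mul, zero_smul, zero_smul]) 0

theorem extDegreeOne_one : extDegreeOne k g 1 = 0 := by
  have := CliffordAlgebra.foldr'_algebraMap (R := k) (M := g) (0 : QuadraticForm k g) (N := g)
  rw [extDegreeOne, ← map_one (algebraMap k 𝓔)]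
  exact (this _ _ 0 1).trans (smul_zero _)

theorem extDegreeOne_mul (x : g) (l : 𝓔) : extDegreeOne k g (ExteriorAlgebra.ι k x * l) =
    ExteriorAlgebra.algebraMapInv l • x :=
  CliffordAlgebra.foldr'_ι_mul _ _ _ _ _ _

/-- The linear form on the exterior algebra which is given by an alternating form in degree two. -/
def extDegreeTwo {c : g →ₗ[k] g →ₗ[k] k} (hc : ∀ x, c x x = 0) : 𝓔 →ₗ[k] k :=
  CliffordAlgebra.foldr' 0 (c.compl₂ (extDegreeOne k g ∘ₗ LinearMap.fst k 𝓔 k))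
    (fun x l y => by
      change c x (extDegreeOne k g (ExteriorAlgebra.ι k x * l)) = (0 : k) • y
      rw [extDegreeOne_mul, map_smul, hc, smul_zero, zero_smul]) 0

theorem extDegreeTwo_one {c : g →ₗ[k] g →ₗ[k] k} (hc : ∀ x, c x x = 0) : extDegreeTwo hc 1 = 0 := by
  have := CliffordAlgebra.foldr'_algebraMap (R := k) (M := g) (0 : QuadraticForm k g) (N := k)
  rw [extDegreeTwo, ← map_one (algebraMap k 𝓔)]
  exact (this _ _ 0 1).trans (smul_zero _)

theorem extDegreeTwo_mul {c : g →ₗ[k] g →ₗ[k] k} (hc : ∀ x, c x x = 0) (x : g) (l : 𝓔) :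
    extDegreeTwo hc (ExteriorAlgebra.ι k x * l) = c x (extDegreeOne k g l) :=
  CliffordAlgebra.foldr'_ι_mul _ _ _ _ _ _

/-- A linear map on the exterior algebra, extended by the counit. -/
def counitExt {M : Type*} [AddCommGroup M] [Module k M] (f : 𝓔 →ₗ[k] M) : 𝓚 →ₗ[k] M :=
  (TensorProduct.lid k M).toLinearMap ∘ₗ TensorProduct.map (counit (R := k)) f

theorem counitExt_tmul {M : Type*} [AddCommGroup M] [Module k M] (f : 𝓔 →ₗ[k] M) (u : A) (l : 𝓔) :
    counitExt f (u ⊗ₜ l) = counit (R := k) u • f l := rfl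

theorem counitExt_opR {M : Type*} [AddCommGroup M] [Module k M] (f : 𝓔 →ₗ[k] M) (x : g) (z : 𝓚) :
    counitExt f (J.opR x z) = 0 := by
  induction z with
  | zero => simp only [map_zero]
  | add a b ha hb => simp only [map_add, ha, hb, add_zero]
  | tmul u l => rw [opR_tmul, counitExt_tmul, Bialgebra.counit_mul, J.counit_j, mul_zero, zero_smul]

theorem proj0_opR (x : g) (z : 𝓚) : proj0 (J.opR x z) = 0 := by
  induction z with
  | zero => simp only [map_zero]
  | add a b ha hb => simp only [map_add, ha, hb, add_zero]
  | tmul u l => rw [opR_tmul, proj0_tmul, Bialgebra.counit_mul, J.counit_j, mul_zero, zero_mul]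

theorem proj0_opW (x : g) (z : 𝓚) : proj0 (opW k A x z) = 0 := by
  induction z with
  | zero => simp only [map_zero]
  | add a b ha hb => simp only [map_add, ha, hb, add_zero]
  | tmul u l => rw [opW_tmul, proj0_tmul, algebraMapInv_ι_mul, mul_zero]

theorem proj0_opTheta (x : g) (z : 𝓚) : proj0 (opTheta k A x z) = 0 := by
  suffices h : proj0 ∘ₗ opTheta k A x = 0 from LinearMap.congr_fun h z
  refine koszul_ext (fun u => ?_) fun y z hz => ?_
  · rw [comp_apply, opTheta_tmul, adE_one, tmul_zero, map_zero,
      LinearMap.zero_apply]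
  · rw [comp_apply, opTheta_opW, map_add, proj0_opW, proj0_opW, add_zero,
      LinearMap.zero_apply]

theorem proj0_ceD (z : 𝓚) : proj0 (J.ceD z) = 0 := by
  suffices h : proj0 ∘ₗ J.ceD = 0 from LinearMap.congr_fun h z
  refine koszul_ext (fun u => ?_) fun y z hz => ?_
  · rw [comp_apply, ceD_tmul_one, map_zero, LinearMap.zero_apply]
  · rw [comp_apply, ceD_opW, map_sub, map_add, map_neg, proj0_opW, proj0_opR, proj0_opTheta,
      neg_zero, add_zero, sub_zero, LinearMap.zero_apply]

theorem degreeOne_opW (x : g) (z : 𝓚) :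
    counitExt (extDegreeOne k g) (opW k A x z) = proj0 z • x := by
  induction z with
  | zero => simp only [map_zero, zero_smul]
  | add a b ha hb => simp only [map_add, ha, hb, add_smul]
  | tmul u l => rw [opW_tmul, counitExt_tmul, extDegreeOne_mul, smul_smul, proj0_tmul]

theorem degreeTwo_opW {c : g →ₗ[k] g →ₗ[k] k} (hc : ∀ x, c x x = 0) (x : g) (z : 𝓚) :
    counitExt (extDegreeTwo hc) (opW k A x z) = c x (counitExt (extDegreeOne k g) z) := by
  induction z with
  | zero => simp only [map_zero]
  | add a b ha hb => simp only [map_add, ha, hb]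
  | tmul u l => rw [opW_tmul, counitExt_tmul, counitExt_tmul, extDegreeTwo_mul, map_smul]

theorem degreeOne_opTheta (x : g) (z : 𝓚) : counitExt (extDegreeOne k g) (opTheta k A x z) =
    ⁅x, counitExt (extDegreeOne k g) z⁆ := by
  suffices h : counitExt (extDegreeOne k g) ∘ₗ opTheta k A x =
      (LieAlgebra.ad k g x).comp (counitExt (extDegreeOne k g)) from LinearMap.congr_fun h z
  refine koszul_ext (fun u => ?_) fun y z hz => ?_
  · rw [comp_apply, comp_apply, opTheta_tmul, adE_one, tmul_zero,
      map_zero, counitExt_tmul, extDegreeOne_one, smul_zero, map_zero]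
  · rw [comp_apply, comp_apply, opTheta_opW, map_add, degreeOne_opW,
      degreeOne_opW, proj0_opTheta, zero_smul, zero_add, degreeOne_opW, map_smul, LieAlgebra.ad_apply]

theorem degreeTwo_ceD {c : g →ₗ[k] g →ₗ[k] k} (hc : ∀ x, c x x = 0)
    (hcoc : ∀ x y z, c x ⁅y, z⁆ = c y ⁅x, z⁆ + c ⁅x, y⁆ z) (z : 𝓚) :
    counitExt (extDegreeTwo hc) (J.ceD z) = 0 := by
  suffices h : counitExt (extDegreeTwo hc) ∘ₗ J.ceD = 0 from LinearMap.congr_fun h z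
  refine koszul_ext (fun u => ?_) fun x z _ => ?_
  · rw [comp_apply, ceD_tmul_one, map_zero, LinearMap.zero_apply]
  suffices h : counitExt (extDegreeTwo hc) ∘ₗ J.ceD ∘ₗ opW k A x = 0 from LinearMap.congr_fun h z
  refine koszul_ext (fun u => ?_) fun y z _ => ?_
  · rw [comp_apply, comp_apply, ceD_opW, ceD_tmul_one, map_zero, neg_zero, zero_add,
      opTheta_tmul, adE_one, tmul_zero, sub_zero, counitExt_opR, LinearMap.zero_apply]
  · rw [comp_apply, comp_apply, ceD_opW, map_sub, map_add, map_neg, counitExt_opR,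
      degreeTwo_opW, ceD_opW, map_sub, map_add, map_neg, degreeOne_opW, proj0_ceD, zero_smul,
      counitExt_opR, degreeOne_opTheta, opTheta_opW, map_add, degreeTwo_opW, degreeTwo_opW,
      degreeOne_opTheta, neg_zero, zero_add, zero_sub, map_neg, neg_neg, add_zero, hcoc,
      sub_self, LinearMap.zero_apply]

/-- Two-cocycles become coboundaries in linear forms on the Hopf algebra. -/
theorem exists_coboundary [CharZero k] {c : g →ₗ[k] g →ₗ[k] k} (hc : ∀ x, c x x = 0)
    (hcoc : ∀ x y z, c x ⁅y, z⁆ = c y ⁅x, z⁆ + c ⁅x, y⁆ z) : ∃ φ : g →ₗ[k] A →ₗ[k] k,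
      ∀ x y u, φ y (u * J.j x) - φ x (u * J.j y) - φ ⁅x, y⁆ u = counit (R := k) u * c x y := by
  set f : 𝓚 →ₗ[k] k := counitExt (extDegreeTwo hc) with hf
  have hker : LinearMap.ker J.ceD ≤ LinearMap.ker f := fun z hz =>
    J.apply_eq_zero_of_ceD_eq_zero
      (by rw [Algebra.TensorProduct.one_def, counitExt_tmul, extDegreeTwo_one, smul_zero])
      (J.degreeTwo_ceD hc hcoc) hz
  obtain ⟨F, hF⟩ := LinearMap.exists_extend
    ((LinearMap.ker J.ceD).liftQ f hker ∘ₗ J.ceD.quotKerEquivRange.symm.toLinearMap)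
  have hF2 (z : 𝓚) : F (J.ceD z) = f z := by
    have h := LinearMap.congr_fun hF (J.ceD.quotKerEquivRange (Submodule.Quotient.mk z))
    rw [comp_apply, comp_apply, LinearEquiv.coe_coe,
      LinearEquiv.symm_apply_apply] at h
    exact h
  refine ⟨((TensorProduct.mk k A 𝓔).flip.compr₂ F) ∘ₗ ExteriorAlgebra.ι k, fun x y u => ?_⟩
  have h := hF2 (opW k A x (opW k A y (u ⊗ₜ 1)))
  rw [hf, degreeTwo_opW, degreeOne_opW, ceD_opW, ceD_opW, ceD_tmul_one, map_zero, neg_zero, zero_add,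
    opTheta_tmul, adE_one, tmul_zero, sub_zero, opTheta_opW, opTheta_tmul, adE_one,
    tmul_zero, map_zero, zero_add, opR_opW, opR_tmul, opR_tmul, opW_tmul, opW_tmul,
    opW_tmul, mul_one, mul_one, mul_one, proj0_tmul, map_one, mul_one, map_smul, smul_eq_mul, map_sub,
    map_add, map_neg] at h
  rw [← h]
  change F ((u * J.j x) ⊗ₜ ExteriorAlgebra.ι k y) - F ((u * J.j y) ⊗ₜ ExteriorAlgebra.ι k x) -
    F (u ⊗ₜ ExteriorAlgebra.ι k ⁅x, y⁆) = _
  abel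

end Cocycle

section CentralExtension

open Coalgebra

variable {k : Type u} {A : Type v} {h : Type w} [Field k] [CharZero k] [Ring A] [HopfAlgebra k A]
  [LieRing h] [LieAlgebra k h] {g : Type x} [LieRing g] [LieAlgebra k g]

/-- Central extensions have representations which are faithful on the kernel. -/
theorem exists_rep_of_central (J : LieFrame k h A) (f : g →ₗ⁅k⁆ h) (hf : Function.Surjective f)
    (hcen : ∀ z : g, f z = 0 → ∀ y : g, ⁅z, y⁆ = 0) {z : g} (hz : f z = 0) (hz0 : z ≠ 0) :
    ∃ ρ : g →ₗ[k] Module.End k ((A →ₗ[k] k) × k),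
      (∀ x y, ρ ⁅x, y⁆ = ρ x * ρ y - ρ y * ρ x) ∧ ρ z ≠ 0 := by
  obtain ⟨s, hs⟩ := (f : g →ₗ[k] h).exists_rightInverse_of_surjective (LinearMap.range_eq_top.2 hf)
  have hfs (x : h) : f (s x) = x := LinearMap.congr_fun hs x
  obtain ⟨l, hl⟩ : ∃ l : Module.Dual k g, l z ≠ 0 := by
    by_contra! hl
    exact hz0 ((Module.forall_dual_apply_eq_zero_iff k z).1 hl)
  have hcen2 (x y x' y' : g) (hx : f x = f x') (hy : f y = f y') : ⁅x, y⁆ = ⁅x', y'⁆ := by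
    have h1 := hcen (x - x') (by rw [map_sub, hx, sub_self]) y
    have h2 := hcen (y - y') (by rw [map_sub, hy, sub_self]) x'
    rw [sub_lie, sub_eq_zero] at h1 h2
    rw [h1, ← lie_skew, h2, lie_skew]
  let c : h →ₗ[k] h →ₗ[k] k := LinearMap.mk₂ k (fun x y => l (⁅s x, s y⁆ - s ⁅x, y⁆))
    (fun x x' y => by simp only [map_add, add_lie, map_sub]; ring)
    (fun a x y => by simp only [map_smul, smul_lie, map_sub, smul_sub])
    (fun x y y' => by simp only [map_add, lie_add, map_sub]; ring)
    (fun a x y => by simp only [map_smul, lie_smul, map_sub, smul_sub])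
  have hc_apply (x y : h) : c x y = l (⁅s x, s y⁆ - s ⁅x, y⁆) := rfl
  have hlie (x y : h) : f (s ⁅x, y⁆) = f ⁅s x, s y⁆ := by rw [hfs, LieHom.map_lie, hfs, hfs]
  obtain ⟨φ, hφ⟩ := J.exists_coboundary (c := c)
    (fun x => by rw [hc_apply, lie_self, lie_self, map_zero, sub_zero, map_zero]) fun x y w => by
      rw [hc_apply, hc_apply, hc_apply, hcen2 (s x) _ (s x) _ rfl (hlie y w),
        hcen2 (s y) _ (s y) _ rfl (hlie x w), hcen2 _ (s w) _ (s w) (hlie x y) rfl, ← map_add,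
        leibniz_lie (s x), leibniz_lie x, map_add]
      congr 1
      abel
  let ψ : g →ₗ[k] A →ₗ[k] k := φ ∘ₗ (f : g →ₗ[k] h) +
    (l ∘ₗ (LinearMap.id - s ∘ₗ (f : g →ₗ[k] h))).smulRight (counit (R := k) (A := A))
  have hψ (x : g) (u : A) : ψ x u = φ (f x) u + l (x - s (f x)) * counit (R := k) u := rfl
  have hψ_lie (x y : g) (u : A) :
      ψ ⁅x, y⁆ u = ψ y (u * J.j (f x)) - ψ x (u * J.j (f y)) := by
    have h1 := hφ (f x) (f y) u
    rw [hψ, hψ, hψ, Bialgebra.counit_mul, Bialgebra.counit_mul, J.counit_j, J.counit_j, LieHom.map_lie]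
    rw [hc_apply, hcen2 (s (f x)) (s (f y)) x y (hfs _) (hfs _)] at h1
    linear_combination -h1
  let ρ : g →ₗ[k] Module.End k ((A →ₗ[k] k) × k) :=
    { toFun := fun x => ((LinearMap.lcomp k k (LinearMap.mulRight k (J.j (f x)))) ∘ₗ
        LinearMap.fst k (A →ₗ[k] k) k + (LinearMap.snd k (A →ₗ[k] k) k).smulRight (ψ x)).prod 0
      map_add' := fun x y => by
        refine LinearMap.ext fun m => Prod.ext (LinearMap.ext fun u => ?_) ?_
        · change m.1 (u * J.j (f (x + y))) + m.2 * ψ (x + y) u =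
            (m.1 (u * J.j (f x)) + m.2 * ψ x u) + (m.1 (u * J.j (f y)) + m.2 * ψ y u)
          rw [map_add, map_add, map_add, mul_add, map_add, LinearMap.add_apply]
          ring
        · exact (add_zero _).symm
      map_smul' := fun a x => by
        refine LinearMap.ext fun m => Prod.ext (LinearMap.ext fun u => ?_) ?_
        · change m.1 (u * J.j (f (a • x))) + m.2 * ψ (a • x) u =
            a * (m.1 (u * J.j (f x)) + m.2 * ψ x u)
          rw [map_smul, map_smul, map_smul, mul_smul_comm, map_smul, LinearMap.smul_apply,
            smul_eq_mul, smul_eq_mul]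
          ring
        · exact (smul_zero _).symm }
  have hρ (x : g) (m : (A →ₗ[k] k) × k) (u : A) :
      (ρ x m).1 u = m.1 (u * J.j (f x)) + m.2 * ψ x u := rfl
  have hρ2 (x : g) (m : (A →ₗ[k] k) × k) : (ρ x m).2 = 0 := rfl
  refine ⟨ρ, fun x y => ?_, fun h0 => hl ?_⟩
  · refine LinearMap.ext fun m => Prod.ext (LinearMap.ext fun u => ?_) ?_
    · change (ρ ⁅x, y⁆ m).1 u = (ρ x (ρ y m)).1 u - (ρ y (ρ x m)).1 u
      rw [hρ, hρ, hρ, hρ, hρ, hρ2, hρ2, hψ_lie, LieHom.map_lie, J.j_lie, mul_sub, map_sub, mul_assoc,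
        mul_assoc]
      ring
    · change (0 : k) = 0 - 0
      rw [sub_zero]
  · have h1 := hρ z (0, 1) 1
    rw [h0, hψ, hz, map_zero, map_zero, Bialgebra.counit_one] at h1
    simpa using h1.symm

end CentralExtension

end LieFrame

end HopfCyclic

namespace HopfCyclic

universe u v w x

section PBW

attribute [local instance] LieRing.ofAssociativeRing

variable (k : Type u) (g : Type w) [Field k] [LieRing g] [LieAlgebra k g]

theorem adjoin_range_ι : Algebra.adjoin k (Set.range
    (UniversalEnvelopingAlgebra.ι k : g →ₗ⁅k⁆ UniversalEnvelopingAlgebra k g)) = ⊤ := by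
  refine eq_top_iff.2 fun u _ => ?_
  induction u using UniversalEnvelopingAlgebra.induction_on with
  | hc c => exact Subalgebra.algebraMap_mem _ c
  | hι x => exact Algebra.subset_adjoin ⟨x, rfl⟩
  | hm u v hu hv => exact mul_mem (hu trivial) (hv trivial)
  | ha u v hu hv => exact add_mem (hu trivial) (hv trivial)

theorem comul_ι (x : g) : Coalgebra.comul (R := k) (UniversalEnvelopingAlgebra.ι k x) =
    UniversalEnvelopingAlgebra.ι k x ⊗ₜ[k] 1 + 1 ⊗ₜ[k] UniversalEnvelopingAlgebra.ι k x :=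
  UniversalEnvelopingAlgebra.comulAlgHom_ι x

instance primitivelyGenerated : PrimitivelyGenerated k (UniversalEnvelopingAlgebra k g) where
  induction {P} u h1 hx hs hm ha := by
    induction u using UniversalEnvelopingAlgebra.induction_on with
    | hc c => rw [Algebra.algebraMap_eq_smul_one]; exact hs c 1 h1
    | hι x => exact hx _ (comul_ι k g x)
    | hm u v hu hv => exact hm u v hu hv
    | ha u v hu hv => exact ha u v hu hv

variable {k g}

/-- The generators of an enveloping algebra, if they form a copy of the Lie algebra. -/
def lieFrameOfInjective (h : Function.Injective
    (UniversalEnvelopingAlgebra.ι k : g →ₗ⁅k⁆ UniversalEnvelopingAlgebra k g)) :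
    LieFrame k g (UniversalEnvelopingAlgebra k g) :=
  let q := ((UniversalEnvelopingAlgebra.ι k : g →ₗ⁅k⁆ _).toLinearMap.exists_leftInverse_of_injective
    (LinearMap.ker_eq_bot.2 h)).choose
  have hq (x : g) : q (UniversalEnvelopingAlgebra.ι k x) = x := LinearMap.congr_fun
    ((UniversalEnvelopingAlgebra.ι k : g →ₗ⁅k⁆ _).toLinearMap.exists_leftInverse_of_injective
      (LinearMap.ker_eq_bot.2 h)).choose_spec x
  { j := (UniversalEnvelopingAlgebra.ι k : g →ₗ⁅k⁆ _).toLinearMap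
    p := q - (Coalgebra.counit (R := k)).smulRight (q 1)
    comul_j := comul_ι k g
    j_lie := fun x y => LieHom.map_lie _ x y
    p_j := fun x => by
      have h0 : Coalgebra.counit (R := k) (UniversalEnvelopingAlgebra.ι k x) = 0 :=
        UniversalEnvelopingAlgebra.counitAlgHom_ι x
      rw [LinearMap.sub_apply, LinearMap.smulRight_apply]
      exact (congrArg₂ (fun a b => a - b • q 1) (hq x) h0).trans (by rw [zero_smul, sub_zero])
    p_one := by
      rw [LinearMap.sub_apply, LinearMap.smulRight_apply, Bialgebra.counit_one, one_smul, sub_self]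
    adjoin := adjoin_range_ι k g }

theorem apply_eq_zero_of_ι_eq_zero {M : Type x} [Ring M] [Algebra k M] (f : g →ₗ⁅k⁆ M) {z : g}
    (hz : (UniversalEnvelopingAlgebra.ι k : g →ₗ⁅k⁆ UniversalEnvelopingAlgebra k g) z = 0) :
    f z = 0 := by
  rw [← UniversalEnvelopingAlgebra.lift_ι_apply k f, hz, map_zero]

/-- A Lie algebra over a field of characteristic zero embeds in its enveloping algebra. -/
theorem ι_injective [CharZero k] : Function.Injective
    (UniversalEnvelopingAlgebra.ι k : g →ₗ⁅k⁆ UniversalEnvelopingAlgebra k g) := by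
  set 𝔥 : LieSubalgebra k (UniversalEnvelopingAlgebra k g) :=
    (UniversalEnvelopingAlgebra.ι k : g →ₗ⁅k⁆ UniversalEnvelopingAlgebra k g).range
  have hinj : Function.Injective
      (UniversalEnvelopingAlgebra.ι k : 𝔥 →ₗ⁅k⁆ UniversalEnvelopingAlgebra k 𝔥) := by
    intro x y hxy
    have h := congrArg (UniversalEnvelopingAlgebra.lift k 𝔥.incl) hxy
    rw [UniversalEnvelopingAlgebra.lift_ι_apply, UniversalEnvelopingAlgebra.lift_ι_apply] at h
    exact Subtype.ext h
  refine (injective_iff_map_eq_zero _).2 fun z hz => ?_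
  by_contra hz0
  set f := (UniversalEnvelopingAlgebra.ι k : g →ₗ⁅k⁆ UniversalEnvelopingAlgebra k g).rangeRestrict
  have hf (x : g) (hx : f x = 0) :
      (UniversalEnvelopingAlgebra.ι k : g →ₗ⁅k⁆ UniversalEnvelopingAlgebra k g) x = 0 :=
    congrArg Subtype.val hx
  obtain ⟨ρ, hρ, hρz⟩ := LieFrame.exists_rep_of_central (lieFrameOfInjective hinj) f
    (LieHom.surjective_rangeRestrict _)
    (fun x hx y => LinearMap.congr_fun (apply_eq_zero_of_ι_eq_zero (LieAlgebra.ad k g) (hf x hx)) y)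
    (Subtype.ext hz) hz0
  exact hρz (apply_eq_zero_of_ι_eq_zero
    { ρ with map_lie' := fun {x y} => hρ x y } hz)

variable (k g) in
/-- The generators of the enveloping algebra. -/
def lieFrame [CharZero k] : LieFrame k g (UniversalEnvelopingAlgebra k g) :=
  lieFrameOfInjective ι_injective

end PBW

end HopfCyclic

namespace HopfCyclic

universe u v w

namespace LieFrame

section Double

open Coalgebra

variable {k : Type u} {A : Type v} {g : Type w} [Field k] [CharZero k] [Ring A] [HopfAlgebra k A]
  [PrimitivelyGenerated k A] [LieRing g] [LieAlgebra k g] (J : LieFrame k g A)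

local notation "𝓔" => ExteriorAlgebra k g
local notation "𝓚" => A ⊗[k] ExteriorAlgebra k g
local notation "𝒯" => CocyclicOperators.Tot (CM k A)
local notation "𝓩" => (A ⊗[k] ExteriorAlgebra k g) ⊗[k] CocyclicOperators.Tot (CM k A)

variable (k A) in
/-- The part of the Hochschild differential which does not insert a unit in front. -/
def redB : Module.End k 𝒯 := bT k A - consT k A 1

theorem redB_apply (X : 𝒯) : redB k A X = bT k A X - consT k A 1 X := rfl

theorem redB_consT (c : A) (X : 𝒯) : redB k A (consT k A c X) =
    -cons₂T k A (comul (R := k) c) X - consT k A c (redB k A X) := by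
  rw [redB_apply, redB_apply, bT_consT, map_sub]
  abel

theorem redB_nil : redB k A (wd k A []) = -consT k A 1 (wd k A []) := by
  rw [redB_apply, bT_nil, zero_sub]

theorem coassoc_lift {M : Type*} [AddCommGroup M] [Module k M] (T : (A ⊗[k] A) ⊗[k] A →ₗ[k] M)
    (u : A) : T ((TensorProduct.assoc k A A A).symm ((comul (R := k)).lTensor A (comul u))) =
      T ((comul (R := k)).rTensor A (comul u)) := by
  rw [coassoc_symm_apply]

theorem redB_redB (X : 𝒯) : redB k A (redB k A X) = 0 := by
  induction X using tot_induction with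
  | hnil =>
    rw [redB_nil, map_neg, redB_consT, Bialgebra.comul_one, Algebra.TensorProduct.one_def, cons₂T_tmul,
      redB_nil, map_neg]
    abel
  | hadd X Y hX hY => rw [map_add, map_add, hX, hY, add_zero]
  | hsmul r X hX => rw [map_smul, map_smul, hX, smul_zero]
  | hcons c X hX =>
    let T : (A ⊗[k] A) ⊗[k] A →ₗ[k] 𝒯 := TensorProduct.lift
      (((cons₂T k A).compr₂ (LinearMap.id)).compl₂ ((consT k A).flip X))
    have hT (z : A ⊗[k] A) (b : A) : T (z ⊗ₜ b) = cons₂T k A z (consT k A b X) := rfl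
    have h (z : A ⊗[k] A) : redB k A (cons₂T k A z X) =
        -T ((comul (R := k)).rTensor A z) +
          T ((TensorProduct.assoc k A A A).symm ((comul (R := k)).lTensor A z)) +
          cons₂T k A z (redB k A X) := by
      induction z with
      | zero => simp only [map_zero, LinearMap.zero_apply, neg_zero, add_zero]
      | add a b ha hb => simp only [map_add, LinearMap.add_apply, ha, hb]; abel
      | tmul a b =>
        rw [cons₂T_tmul, redB_consT, redB_consT, map_sub, map_neg, LinearMap.rTensor_tmul,
          LinearMap.lTensor_tmul, hT, cons₂T_tmul]
        have h2 (y : A ⊗[k] A) : consT k A a (cons₂T k A y X) =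
            T ((TensorProduct.assoc k A A A).symm (a ⊗ₜ y)) := by
          induction y with
          | zero => simp only [map_zero, LinearMap.zero_apply, tmul_zero]
          | add c d hc hd =>
            simp only [map_add, LinearMap.add_apply, tmul_add, hc, hd]
          | tmul c d => rw [TensorProduct.assoc_symm_tmul, hT]; rfl
        rw [h2]
        abel
    rw [redB_consT, map_sub, map_neg, h, coassoc_lift, redB_consT, hX, map_zero]
    abel

/-- The map `a ⊗ b ↦ (a ⊗ l) ⊗ (b, X)`. -/
def spread (l : 𝓔) (X : 𝒯) : A ⊗[k] A →ₗ[k] 𝓩 :=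
  TensorProduct.map ((TensorProduct.mk k A 𝓔).flip l) ((consT k A).flip X)

theorem spread_tmul (l : 𝓔) (X : 𝒯) (a b : A) :
    spread l X (a ⊗ₜ b) = (a ⊗ₜ l) ⊗ₜ consT k A b X := rfl

theorem double_ext {M : Type*} [AddCommGroup M] [Module k M] {f f' : 𝓩 →ₗ[k] M}
    (h : ∀ u l X, f ((u ⊗ₜ l) ⊗ₜ X) = f' ((u ⊗ₜ l) ⊗ₜ X)) : f = f' :=
  TensorProduct.ext_threefold h

variable (k A g) in
/-- The cobar differential with coefficients in the Koszul complex. -/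
def cobD : 𝓩 →ₗ[k] 𝓩 :=
  ((TensorProduct.lift (consT k A)).lTensor 𝓚 ∘ₗ (TensorProduct.assoc k 𝓚 A 𝒯).toLinearMap ∘ₗ
    ((TensorProduct.rightComm k A A 𝓔).toLinearMap ∘ₗ (comul (R := k)).rTensor 𝓔).rTensor 𝒯) +
  (redB k A).lTensor 𝓚

theorem cobD_tmul (u : A) (l : 𝓔) (X : 𝒯) : cobD k A g ((u ⊗ₜ l) ⊗ₜ X) =
    spread l X (comul (R := k) u) + (u ⊗ₜ l) ⊗ₜ redB k A X := by
  have h : ((TensorProduct.lift (consT k A)).lTensor 𝓚 ∘ₗ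
      (TensorProduct.assoc k 𝓚 A 𝒯).toLinearMap) ∘ₗ (TensorProduct.mk k (𝓚 ⊗[k] A) 𝒯).flip X ∘ₗ
      (TensorProduct.rightComm k A A 𝓔).toLinearMap ∘ₗ (TensorProduct.mk k (A ⊗[k] A) 𝓔).flip l =
      spread l X := TensorProduct.ext' fun a b => rfl
  rw [← h]
  rfl

theorem cobD_spread (l : 𝓔) (X : 𝒯) (z : A ⊗[k] A) : cobD k A g (spread l X z) =
    TensorProduct.map ((TensorProduct.mk k A 𝓔).flip l) ((cons₂T k A).flip X)
        (TensorProduct.assoc k A A A ((comul (R := k)).rTensor A z)) -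
      TensorProduct.map ((TensorProduct.mk k A 𝓔).flip l) ((cons₂T k A).flip X)
        ((comul (R := k)).lTensor A z) - spread l (redB k A X) z := by
  set T : A ⊗[k] (A ⊗[k] A) →ₗ[k] 𝓩 :=
    TensorProduct.map ((TensorProduct.mk k A 𝓔).flip l) ((cons₂T k A).flip X)
  suffices h : cobD k A g ∘ₗ spread l X = T ∘ₗ (TensorProduct.assoc k A A A).toLinearMap ∘ₗ
      (comul (R := k)).rTensor A - T ∘ₗ (comul (R := k)).lTensor A - spread l (redB k A X) from
    LinearMap.congr_fun h z
  refine TensorProduct.ext' fun a b => ?_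
  have h1 : spread l (consT k A b X) = T ∘ₗ (TensorProduct.assoc k A A A).toLinearMap ∘ₗ
      (TensorProduct.mk k (A ⊗[k] A) A).flip b := TensorProduct.ext' fun c d => rfl
  have h2 : T (a ⊗ₜ comul (R := k) b) = (a ⊗ₜ l) ⊗ₜ cons₂T k A (comul (R := k) b) X := rfl
  simp only [LinearMap.sub_apply, comp_apply, LinearMap.rTensor_tmul,
    LinearMap.lTensor_tmul, h2]
  rw [spread_tmul, cobD_tmul, h1, redB_consT, spread_tmul, TensorProduct.tmul_sub,
    TensorProduct.tmul_neg]
  simp only [comp_apply, LinearMap.flip_apply, TensorProduct.mk_apply]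
  abel

theorem cobD_cobD (z : 𝓩) : cobD k A g (cobD k A g z) = 0 := by
  suffices h : cobD k A g ∘ₗ cobD k A g = 0 from LinearMap.congr_fun h z
  refine double_ext fun u l X => ?_
  rw [comp_apply, LinearMap.zero_apply, cobD_tmul, map_add, cobD_spread, coassoc_apply,
    cobD_tmul, redB_redB, tmul_zero]
  abel

theorem cobD_coD (φ : A →ₗ[k] g) (z : 𝓩) :
    cobD k A g ((coD φ).rTensor 𝒯 z) = (coD φ).rTensor 𝒯 (cobD k A g z) := by
  suffices h : cobD k A g ∘ₗ (coD φ).rTensor 𝒯 = (coD φ).rTensor 𝒯 ∘ₗ cobD k A g from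
    LinearMap.congr_fun h z
  refine double_ext fun u l X => ?_
  set T : (A ⊗[k] A) ⊗[k] A →ₗ[k] 𝓩 :=
    TensorProduct.map (coM φ ∘ₗ (TensorProduct.mk k (A ⊗[k] A) 𝓔).flip l) ((consT k A).flip X)
  have h1 : (coD φ).rTensor 𝒯 ∘ₗ spread l X = T ∘ₗ (comul (R := k)).rTensor A :=
    TensorProduct.ext' fun a b => rfl
  have h2 : cobD k A g ∘ₗ (TensorProduct.mk k 𝓚 𝒯).flip X ∘ₗ coM φ ∘ₗ
      (TensorProduct.mk k (A ⊗[k] A) 𝓔).flip l = T ∘ₗ (TensorProduct.assoc k A A A).symm.toLinearMap ∘ₗ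
        (comul (R := k)).lTensor A + (TensorProduct.mk k 𝓚 𝒯).flip (redB k A X) ∘ₗ coM φ ∘ₗ
      (TensorProduct.mk k (A ⊗[k] A) 𝓔).flip l := by
    refine TensorProduct.ext' fun a b => ?_
    have h3 : spread (ExteriorAlgebra.ι k (φ a) * l) X = T ∘ₗ
        (TensorProduct.assoc k A A A).symm.toLinearMap ∘ₗ (TensorProduct.mk k A (A ⊗[k] A) a) :=
      TensorProduct.ext' fun c d => rfl
    have h4 := cobD_tmul (k := k) b (ExteriorAlgebra.ι k (φ a) * l) X
    rw [h3] at h4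
    exact h4
  have h5 := LinearMap.congr_fun h1 (comul (R := k) u)
  have h6 := LinearMap.congr_fun h2 (comul (R := k) u)
  simp only [comp_apply, LinearMap.add_apply, LinearEquiv.coe_coe] at h5 h6
  rw [coassoc_symm_apply] at h6
  rw [comp_apply, comp_apply, cobD_tmul, map_add, h5, LinearMap.rTensor_tmul,
    LinearMap.rTensor_tmul]
  exact h6

end Double

end LieFrame

end HopfCyclic

namespace HopfCyclic

universe u v w

namespace LieFrame

section Resolution

open Coalgebra Word

variable {k : Type u} {A : Type v} {g : Type w} [Field k] [CharZero k] [Ring A] [HopfAlgebra k A]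
  [PrimitivelyGenerated k A] [LieRing g] [LieAlgebra k g] (J : LieFrame k g A)

local notation "𝓔" => ExteriorAlgebra k g
local notation "𝓚" => A ⊗[k] ExteriorAlgebra k g
local notation "𝒯" => CocyclicOperators.Tot (CM k A)
local notation "𝓩" => (A ⊗[k] ExteriorAlgebra k g) ⊗[k] CocyclicOperators.Tot (CM k A)

variable (k A) in
/-- The cochains of degree `p`. -/
def deg (p : ℕ) : Submodule k 𝒯 := Submodule.span k {X | ∃ l : List A, l.length = p ∧ wd k A l = X}

variable (k A g) in
/-- The cochains of degree `p` with coefficients in the Koszul complex. -/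
def degK (p : ℕ) : Submodule k 𝓩 :=
  Submodule.span k {Z | ∃ (κ : 𝓚) (l : List A), l.length = p ∧ κ ⊗ₜ wd k A l = Z}

theorem consT_mem_deg {p : ℕ} (a : A) {X : 𝒯} (hX : X ∈ deg k A p) : consT k A a X ∈ deg k A (p + 1) := by
  refine (Submodule.span_le (p := (deg k A (p + 1)).comap (consT k A a))).2 ?_ hX
  rintro _ ⟨l, rfl, rfl⟩
  exact Submodule.subset_span ⟨a :: l, rfl, rfl⟩

theorem tmul_mem_degK {p : ℕ} (κ : 𝓚) {X : 𝒯} (hX : X ∈ deg k A p) : κ ⊗ₜ[k] X ∈ degK k A g p := by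
  refine (Submodule.span_le (p := (degK k A g p).comap (TensorProduct.mk k 𝓚 𝒯 κ))).2 ?_ hX
  rintro _ ⟨l, hl, rfl⟩
  exact Submodule.subset_span ⟨κ, l, hl, rfl⟩

theorem redB_wd_mem_deg (l : List A) : redB k A (wd k A l) ∈ deg k A (l.length + 1) := by
  induction l with
  | nil =>
    rw [redB_nil]
    exact neg_mem (Submodule.subset_span ⟨[1], rfl, rfl⟩)
  | cons a l ih =>
    rw [wd, redB_consT, List.length_cons]
    refine sub_mem (neg_mem ?_) (consT_mem_deg a ih)
    induction comul (R := k) a with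
    | zero => rw [map_zero]; exact zero_mem _
    | add x y hx hy => rw [map_add]; exact add_mem hx hy
    | tmul x y => exact Submodule.subset_span ⟨x :: y :: l, rfl, rfl⟩

theorem map_mem_degK {M : Type*} [AddCommGroup M] [Module k M] {T : 𝓩 →ₗ[k] M} {N : Submodule k M}
    {p : ℕ} (h : ∀ (u : A) (m : 𝓔) (l : List A), l.length = p → T ((u ⊗ₜ m) ⊗ₜ wd k A l) ∈ N) {z : 𝓩}
    (hz : z ∈ degK k A g p) : T z ∈ N := by
  refine (Submodule.span_le (p := N.comap T)).2 ?_ hz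
  rintro _ ⟨κ, l, hl, rfl⟩
  induction κ with
  | zero => rw [zero_tmul]; exact zero_mem _
  | add x y hx hy => rw [add_tmul]; exact add_mem hx hy
  | tmul u m => exact h u m l hl

theorem eq_of_mem_degK {M : Type*} [AddCommGroup M] [Module k M] {T T' : 𝓩 →ₗ[k] M} {p : ℕ}
    (h : ∀ (u : A) (m : 𝓔) (l : List A), l.length = p → T ((u ⊗ₜ m) ⊗ₜ wd k A l) = T' ((u ⊗ₜ m) ⊗ₜ wd k A l))
    {z : 𝓩} (hz : z ∈ degK k A g p) : T z = T' z := by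
  have := map_mem_degK (T := T - T') (N := ⊥) (fun u m l hl => by
    rw [LinearMap.sub_apply, h u m l hl, sub_self]; exact zero_mem _) hz
  exact sub_eq_zero.1 this

theorem rTensor_mem_degK (f : 𝓚 →ₗ[k] 𝓚) {p : ℕ} {z : 𝓩} (hz : z ∈ degK k A g p) :
    f.rTensor 𝒯 z ∈ degK k A g p :=
  map_mem_degK (fun u m l hl => tmul_mem_degK (f (u ⊗ₜ m)) (Submodule.subset_span ⟨l, hl, rfl⟩)) hz

theorem cobD_mem_degK {p : ℕ} {z : 𝓩} (hz : z ∈ degK k A g p) : cobD k A g z ∈ degK k A g (p + 1) := by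
  refine map_mem_degK (fun u m l hl => ?_) hz
  subst hl
  rw [cobD_tmul]
  refine add_mem ?_ (tmul_mem_degK _ (redB_wd_mem_deg l))
  induction comul (R := k) u with
  | zero => rw [map_zero]; exact zero_mem _
  | add x y hx hy => rw [map_add]; exact add_mem hx hy
  | tmul x y => exact Submodule.subset_span ⟨x ⊗ₜ m, y :: l, rfl, rfl⟩

variable (k A) in
/-- Separation of the first letter. -/
def splitT : 𝒯 →ₗ[k] A ⊗[k] 𝒯 :=
  DirectSum.toModule k ℕ _ fun n => match n with
    | 0 => 0
    | m + 1 => (lof k ℕ (CM k A).X m).lTensor A ∘ₗ splitFactor k A m 0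

theorem splitT_consT (a : A) (X : 𝒯) : splitT k A (consT k A a X) = a ⊗ₜ X := by
  suffices h : splitT k A ∘ₗ consT k A a = TensorProduct.mk k A 𝒯 a from LinearMap.congr_fun h X
  refine tot_ext fun l => ?_
  rw [comp_apply, wd_eq_lof, consT_lof, splitT, DirectSum.toModule_lof,
    comp_apply, splitFactor_insertFactor]
  rfl

variable (k A g) in
/-- The contraction of the cobar complex onto the exterior algebra. -/
def cobS : 𝓩 →ₗ[k] 𝓩 :=
  (TensorProduct.assoc k A 𝓔 𝒯).symm.toLinearMap ∘ₗ (TensorProduct.leftComm k 𝓔 A 𝒯).toLinearMap ∘ₗ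
    TensorProduct.map (counitExt LinearMap.id) (splitT k A)

theorem cobS_consT (u : A) (l : 𝓔) (a : A) (X : 𝒯) : cobS k A g ((u ⊗ₜ l) ⊗ₜ consT k A a X) =
    counit (R := k) u • ((a ⊗ₜ l) ⊗ₜ X) := by
  rw [cobS, comp_apply, comp_apply, map_tmul, splitT_consT,
    counitExt_tmul, ← TensorProduct.smul_tmul', map_smul, map_smul]
  rfl

theorem cobS_cons₂T (u : A) (l : 𝓔) (z : A ⊗[k] A) (X : 𝒯) :
    cobS k A g ((u ⊗ₜ l) ⊗ₜ cons₂T k A z X) = counit (R := k) u • spread l X z := by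
  induction z with
  | zero => simp only [map_zero, LinearMap.zero_apply, tmul_zero, smul_zero]
  | add a b ha hb => simp only [map_add, LinearMap.add_apply, tmul_add, smul_add, ha, hb]
  | tmul a b => rw [cons₂T_tmul, cobS_consT, spread_tmul]

theorem cobS_spread_comul (l : 𝓔) (X : 𝒯) (u : A) :
    cobS k A g (spread l X (comul (R := k) u)) = (u ⊗ₜ l) ⊗ₜ X := by
  have h : cobS k A g ∘ₗ spread l X = (TensorProduct.mk k 𝓚 𝒯).flip X ∘ₗ
      (TensorProduct.mk k A 𝓔).flip l ∘ₗ (TensorProduct.lid k A).toLinearMap ∘ₗ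
        (counit (R := k)).rTensor A := TensorProduct.ext' fun a b => by
    simp only [comp_apply, spread_tmul, cobS_consT, LinearMap.rTensor_tmul,
      LinearEquiv.coe_coe, TensorProduct.lid_tmul, map_smul]
    rfl
  have h2 := LinearMap.congr_fun h (comul (R := k) u)
  simp only [comp_apply, rTensor_counit_comul, LinearEquiv.coe_coe, TensorProduct.lid_tmul,
    one_smul] at h2
  exact h2

theorem cobS_homotopy {p : ℕ} {z : 𝓩} (hz : z ∈ degK k A g (p + 1)) :
    cobS k A g (cobD k A g z) + cobD k A g (cobS k A g z) = z := by
  refine eq_of_mem_degK (T := cobS k A g ∘ₗ cobD k A g + cobD k A g ∘ₗ cobS k A g) (T' := LinearMap.id)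
    (fun u m l hl => ?_) hz
  cases l with
  | nil => simp at hl
  | cons a l =>
    simp only [LinearMap.add_apply, comp_apply, LinearMap.id_apply]
    rw [cobD_tmul, map_add, cobS_spread_comul, wd, redB_consT, cobS_consT, map_smul, cobD_tmul,
      TensorProduct.tmul_sub, TensorProduct.tmul_neg, map_sub, map_neg, cobS_cons₂T, cobS_consT,
      smul_add]
    abel

variable (k A g) in
/-- The inclusion of the cochains with coefficients in the exterior algebra. -/
def unitK : 𝓔 ⊗[k] 𝒯 →ₗ[k] 𝓩 := (TensorProduct.mk k A 𝓔 1).rTensor 𝒯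

theorem unitK_tmul (l : 𝓔) (X : 𝒯) : unitK k A g (l ⊗ₜ X) = (1 ⊗ₜ l) ⊗ₜ X := rfl

theorem cobS_homotopy_zero {z : 𝓩} (hz : z ∈ degK k A g 0) :
    cobS k A g (cobD k A g z) = z - unitK k A g ((counitExt LinearMap.id).rTensor 𝒯 z) := by
  refine eq_of_mem_degK (T := cobS k A g ∘ₗ cobD k A g)
    (T' := LinearMap.id - unitK k A g ∘ₗ (counitExt LinearMap.id).rTensor 𝒯) (fun u m l hl => ?_) hz
  obtain rfl := List.length_eq_zero_iff.1 hl
  simp only [LinearMap.sub_apply, comp_apply, LinearMap.id_apply, LinearMap.rTensor_tmul]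
  rw [cobD_tmul, map_add, cobS_spread_comul, redB_nil, TensorProduct.tmul_neg, map_neg, cobS_consT,
    counitExt_tmul, ← TensorProduct.smul_tmul', map_smul, unitK_tmul, sub_eq_add_neg]
  rfl

theorem cobS_mem_degK {p : ℕ} {z : 𝓩} (hz : z ∈ degK k A g (p + 1)) : cobS k A g z ∈ degK k A g p := by
  refine map_mem_degK (fun u m l hl => ?_) hz
  cases l with
  | nil => simp at hl
  | cons a l =>
    rw [wd, cobS_consT]
    exact Submodule.smul_mem _ _ (Submodule.subset_span ⟨_, l, by simpa using hl, rfl⟩)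

end Resolution

end LieFrame

end HopfCyclic

namespace HopfCyclic

universe u v w

namespace LieFrame

section Hochschild

open Coalgebra Word

variable {k : Type u} {A : Type v} {g : Type w} [Field k] [CharZero k] [Ring A] [HopfAlgebra k A]
  [PrimitivelyGenerated k A] [LieRing g] [LieAlgebra k g] (J : LieFrame k g A)

local notation "𝓔" => ExteriorAlgebra k g
local notation "𝓚" => A ⊗[k] ExteriorAlgebra k g
local notation "𝒯" => CocyclicOperators.Tot (CM k A)
local notation "𝓩" => (A ⊗[k] ExteriorAlgebra k g) ⊗[k] CocyclicOperators.Tot (CM k A)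

/-- The wedge product of the letters in `l₂`, times the word of the letters in `l₁`. -/
def wedgeWd {n : ℕ} (l₁ l₂ : List (Fin n)) (u : Fin n → g) : 𝓔 ⊗[k] 𝒯 :=
  (l₂.map fun i => ExteriorAlgebra.ι k (u i)).prod ⊗ₜ wd k A (l₁.map fun i => J.j (u i))

/-- The cochains of degree `p` with coefficients in the exterior algebra which are alternating sums
of words in the Lie algebra. -/
def altCochains (p : ℕ) : Submodule k (𝓔 ⊗[k] 𝒯) :=
  Submodule.span k {Y | ∃ (n : ℕ) (v : Fin n → g) (l₁ l₂ : List (Fin n)), l₁.length = p ∧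
    (l₁ ++ l₂).Perm (List.finRange n) ∧ altS v (J.wedgeWd l₁ l₂) = Y}

variable (k A g) in
/-- The projection to the cochains with trivial coefficients. -/
def projE : 𝓔 ⊗[k] 𝒯 →ₗ[k] 𝒯 :=
  (TensorProduct.lid k 𝒯).toLinearMap ∘ₗ
    (ExteriorAlgebra.algebraMapInv (R := k) (M := g)).toLinearMap.rTensor 𝒯

theorem projE_tmul (l : 𝓔) (X : 𝒯) : projE k A g (l ⊗ₜ X) = ExteriorAlgebra.algebraMapInv l • X := rfl

variable (k A g) in
/-- The inclusion of the cochains with trivial coefficients. -/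
def unitT : 𝒯 →ₗ[k] 𝓩 := TensorProduct.mk k 𝓚 𝒯 1

variable (k A g) in
/-- The projection of the cochains with coefficients in the Koszul complex to those with trivial
coefficients. -/
def projT : 𝓩 →ₗ[k] 𝒯 := (TensorProduct.lid k 𝒯).toLinearMap ∘ₗ (proj0 (A := A) (g := g)).rTensor 𝒯

theorem projT_tmul (κ : 𝓚) (X : 𝒯) : projT k A g (κ ⊗ₜ X) = proj0 κ • X := rfl

theorem projT_unitT (X : 𝒯) : projT k A g (unitT k A g X) = X := by
  rw [unitT, TensorProduct.mk_apply, projT_tmul, proj0_one, one_smul]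

theorem projT_unitK (Y : 𝓔 ⊗[k] 𝒯) : projT k A g (unitK k A g Y) = projE k A g Y := by
  suffices h : projT k A g ∘ₗ unitK k A g = projE k A g from LinearMap.congr_fun h Y
  refine TensorProduct.ext' fun l X => ?_
  rw [comp_apply, unitK_tmul, projT_tmul, proj0_tmul, projE_tmul, Bialgebra.counit_one, one_mul]

theorem projT_coD (φ : A →ₗ[k] g) (z : 𝓩) : projT k A g ((coD φ).rTensor 𝒯 z) = 0 := by
  suffices h : projT k A g ∘ₗ (coD φ).rTensor 𝒯 = 0 from LinearMap.congr_fun h z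
  refine TensorProduct.ext' fun κ X => ?_
  rw [comp_apply, LinearMap.rTensor_tmul, projT_tmul, proj0_coD, zero_smul]
  rfl

theorem cobD_unitT (X : 𝒯) : cobD k A g (unitT k A g X) = unitT k A g (bT k A X) := by
  rw [unitT, TensorProduct.mk_apply, Algebra.TensorProduct.one_def, cobD_tmul, Bialgebra.comul_one,
    Algebra.TensorProduct.one_def, spread_tmul, ← tmul_add, redB_apply, add_sub_cancel]
  rfl

theorem projE_mem {p : ℕ} {Y : 𝓔 ⊗[k] 𝒯} (hY : Y ∈ J.altCochains p) :
    ∃ x : ⋀[k]^p g, projE k A g Y = antT J.j p x := by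
  suffices h : projE k A g Y ∈ LinearMap.range (antT J.j p) by
    obtain ⟨x, hx⟩ := h
    exact ⟨x, hx.symm⟩
  refine (Submodule.span_le (p := (LinearMap.range (antT J.j p)).comap (projE k A g))).2 ?_ hY
  rintro _ ⟨n, v, l₁, l₂, hl, hp, rfl⟩
  rw [SetLike.mem_coe, Submodule.mem_comap, map_altS]
  cases l₂ with
  | nil =>
    rw [List.append_nil] at hp
    obtain rfl : n = p := by rw [← hl, hp.length_eq, List.length_finRange]
    obtain ⟨τ, rfl⟩ := exists_perm_finRange hp
    have h (u : Fin n → g) : projE k A g (J.wedgeWd ((List.finRange n).map τ) [] u) = jwd J.j (u ∘ τ) := by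
      rw [wedgeWd, List.map_nil, List.prod_nil, projE_tmul, map_one, one_smul, jwd, List.ofFn_eq_map,
        List.map_map]
      rfl
    rw [altS_congr v h, altS_perm v τ (jwd J.j), ← factorial_smul_antT]
    exact (LinearMap.range (antT J.j n)).toAddSubgroup.zsmul_mem
      (Submodule.smul_mem _ _ (LinearMap.mem_range_self _ _)) _
  | cons a l₂ =>
    have h (u : Fin n → g) : projE k A g (J.wedgeWd l₁ (a :: l₂) u) = 0 := by
      rw [wedgeWd, List.map_cons, List.prod_cons, projE_tmul, algebraMapInv_ι_mul, zero_smul]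
    rw [altS_congr v h]
    simp [altS]

theorem tmul_nil_mem_altCochains (l : 𝓔) : l ⊗ₜ[k] wd k A [] ∈ J.altCochains 0 := by
  have hl : l ∈ Submodule.span k (Set.range fun x : Σ n, (Fin n → g) => ExteriorAlgebra.ιMulti k x.1 x.2) := by
    rw [ExteriorAlgebra.ιMulti_span]; trivial
  refine (Submodule.span_le (p := (J.altCochains 0).comap
    ((TensorProduct.mk k 𝓔 𝒯).flip (wd k A [])))).2 ?_ hl
  rintro _ ⟨⟨n, v⟩, rfl⟩
  have hn : (n.factorial : k) ≠ 0 := Nat.cast_ne_zero.2 n.factorial_ne_zero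
  rw [SetLike.mem_coe, ← Submodule.smul_mem_iff _ hn]
  refine Submodule.subset_span ⟨n, v, [], List.finRange n, rfl, by simp, ?_⟩
  rw [altS, LinearMap.flip_apply, TensorProduct.mk_apply, Nat.cast_smul_eq_nsmul]
  have h (σ : Equiv.Perm (Fin n)) : (Equiv.Perm.sign σ : ℤ) • J.wedgeWd [] (List.finRange n) (v ∘ σ) =
      ExteriorAlgebra.ιMulti k n v ⊗ₜ wd k A [] := by
    rw [wedgeWd, List.map_nil, ← List.ofFn_eq_map, ← ExteriorAlgebra.ιMulti_apply,
      AlternatingMap.map_perm]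
    rcases Int.units_eq_one_or (Equiv.Perm.sign σ) with h | h
    · rw [h, Units.val_one, one_smul, one_smul]
    · rw [h, Units.val_neg, Units.val_one, Units.neg_smul, one_smul, TensorProduct.neg_tmul,
        neg_one_zsmul, neg_neg]
  simp only [h]
  rw [Finset.sum_const, Finset.card_univ, Fintype.card_perm, Fintype.card_fin, TensorProduct.smul_tmul']

theorem exists_contraction_tensor : ∃ h : 𝓚 →ₗ[k] 𝓚, ∀ y : 𝓩, (coD J.p).rTensor 𝒯 y = 0 →
    (coD J.p).rTensor 𝒯 (h.rTensor 𝒯 y) = y - unitT k A g (projT k A g y) := by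
  obtain ⟨h, hh⟩ := J.exists_contraction_coD
  refine ⟨h, fun y hy => ?_⟩
  suffices h' : (coD J.p).rTensor 𝒯 ∘ₗ h.rTensor 𝒯 + h.rTensor 𝒯 ∘ₗ (coD J.p).rTensor 𝒯 =
      LinearMap.id - unitT k A g ∘ₗ projT k A g by
    have h2 := LinearMap.congr_fun h' y
    simp only [LinearMap.add_apply, comp_apply, hy] at h2
    rwa [map_zero, add_zero] at h2
  refine TensorProduct.ext' fun κ X => ?_
  simp only [LinearMap.add_apply, comp_apply, LinearMap.sub_apply, LinearMap.rTensor_tmul,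
    LinearMap.id_apply]
  rw [← add_tmul, hh, TensorProduct.sub_tmul, projT_tmul, map_smul]
  rfl

/-- The lift of an alternating cochain to the Koszul complex, by multiplication of the first letter. -/
theorem exists_lift_altCochains {p : ℕ} {Y : 𝓔 ⊗[k] 𝒯} (hY : Y ∈ J.altCochains p) :
    ∃ Z ∈ degK k A g p, ∃ Y' ∈ J.altCochains (p + 1),
      (coD J.p).rTensor 𝒯 Z = unitK k A g Y - unitT k A g (projE k A g Y) ∧
        cobD k A g Z = unitK k A g Y' := by
  induction hY using Submodule.span_induction with
  | zero => exact ⟨0, zero_mem _, 0, zero_mem _, by simp only [map_zero, sub_zero], by simp only [map_zero]⟩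
  | add X Y _ _ hX hY =>
    obtain ⟨Z, hZ, X', hX', h1, h2⟩ := hX
    obtain ⟨W, hW, Y', hY', h3, h4⟩ := hY
    exact ⟨Z + W, add_mem hZ hW, X' + Y', add_mem hX' hY', by simp only [map_add, h1, h3]; abel,
      by simp only [map_add, h2, h4]⟩
  | smul c X _ hX =>
    obtain ⟨Z, hZ, X', hX', h1, h2⟩ := hX
    exact ⟨c • Z, Submodule.smul_mem _ _ hZ, c • X', Submodule.smul_mem _ _ hX',
      by simp only [map_smul, h1, smul_sub], by simp only [map_smul, h2]⟩
  | mem Y h =>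
    obtain ⟨n, v, l₁, l₂, hl, hp, rfl⟩ := h
    cases l₂ with
    | nil =>
      refine ⟨0, zero_mem _, 0, zero_mem _, ?_, by simp only [map_zero]⟩
      rw [map_zero, map_altS, map_altS (projE k A g), map_altS]
      refine (sub_eq_zero.2 (altS_congr v fun u => ?_)).symm
      rw [wedgeWd, List.map_nil, List.prod_nil, projE_tmul, map_one, one_smul]
      rfl
    | cons a l₂ =>
      set m : (Fin n → g) → 𝓔 := fun u => (l₂.map fun i => ExteriorAlgebra.ι k (u i)).prod
      set X : (Fin n → g) → 𝒯 := fun u => wd k A (l₁.map fun i => J.j (u i))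
      refine ⟨altS v fun u => (J.j (u a) ⊗ₜ m u) ⊗ₜ X u, ?_, altS v (J.wedgeWd (a :: l₁) l₂), ?_, ?_, ?_⟩
      · exact altS_mem (degK k A g p).toAddSubgroup v fun u => Submodule.subset_span
          ⟨J.j (u a) ⊗ₜ m u, l₁.map fun i => J.j (u i), by rw [List.length_map, hl], rfl⟩
      · exact Submodule.subset_span ⟨n, v, a :: l₁, l₂, by rw [List.length_cons, hl],
          List.perm_middle.symm.trans hp, rfl⟩
      · have h0 (u : Fin n → g) : projE k A g (J.wedgeWd l₁ (a :: l₂) u) = 0 := by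
          rw [wedgeWd, List.map_cons, List.prod_cons, projE_tmul, algebraMapInv_ι_mul, zero_smul]
        have h1 : projE k A g (altS v (J.wedgeWd l₁ (a :: l₂))) = 0 := by
          rw [map_altS, altS_congr v h0]
          simp [altS]
        rw [h1, map_zero, sub_zero, map_altS, map_altS]
        refine altS_congr v fun u => ?_
        rw [LinearMap.rTensor_tmul, coD_tmul, J.comul_j, add_tmul, map_add, coM_tmul,
          coM_tmul, J.p_j, J.p_one, map_zero, zero_mul, tmul_zero]
        rw [wedgeWd, List.map_cons, List.prod_cons, unitK_tmul]
        simp only [add_zero]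
        rfl
      · rw [map_altS, map_altS]
        refine altS_congr v fun u => ?_
        have hb : bT k A (X u) = 0 := bT_wd_prim fun x hx => by
          obtain ⟨i, -, rfl⟩ := List.mem_map.1 hx
          exact J.comul_j _
        rw [cobD_tmul, J.comul_j, map_add, spread_tmul, spread_tmul, redB_apply, hb, zero_sub,
          TensorProduct.tmul_neg, add_neg_cancel_comm]
        rfl

/-- Cocycles of the double complex of degree `p` are alternating cochains up to boundaries. -/
theorem exists_eq_cobD_add {p : ℕ} {z : 𝓩} (hz : z ∈ degK k A g p) (hd : (coD J.p).rTensor 𝒯 z = 0)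
    (hD : cobD k A g z = 0) : ∃ y, (∀ q, p = q + 1 → y ∈ degK k A g q) ∧ (p = 0 → y = 0) ∧
      (coD J.p).rTensor 𝒯 y = 0 ∧ ∃ Y ∈ J.altCochains p, z = cobD k A g y + unitK k A g Y := by
  induction p generalizing z with
  | zero =>
    refine ⟨0, fun q hq => (Nat.succ_ne_zero q hq.symm).elim, fun _ => rfl, map_zero _,
      (counitExt LinearMap.id).rTensor 𝒯 z, ?_, ?_⟩
    · refine map_mem_degK (fun u m l hl => ?_) hz
      obtain rfl := List.length_eq_zero_iff.1 hl
      exact J.tmul_nil_mem_altCochains _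
    · have h := cobS_homotopy_zero hz
      rw [hD, map_zero, eq_comm, sub_eq_zero] at h
      rw [map_zero, zero_add]
      exact h
  | succ p ih =>
    have h1 : cobD k A g (cobS k A g z) = z := by
      have h := cobS_homotopy hz
      rwa [hD, map_zero, zero_add] at h
    have h2 := cobS_mem_degK hz
    obtain ⟨y, hy1, hy0, hdy, Y, hY, h3⟩ := ih (rTensor_mem_degK (coD J.p) h2)
      (by rw [← comp_apply, ← LinearMap.rTensor_comp,
            show coD J.p ∘ₗ coD J.p = 0 from LinearMap.ext (coD_coD J.p), LinearMap.rTensor_zero,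
            LinearMap.zero_apply])
      (by rw [cobD_coD, h1, hd])
    obtain ⟨Z, hZ, Y', hY', h4, h5⟩ := J.exists_lift_altCochains hY
    obtain ⟨h, hh⟩ := J.exists_contraction_tensor (A := A)
    have h6 := hh y hdy
    have hθ : cobD k A g (h.rTensor 𝒯 y) ∈ degK k A g p := by
      cases p with
      | zero => rw [hy0 rfl, map_zero, map_zero]; exact zero_mem _
      | succ q => exact cobD_mem_degK (rTensor_mem_degK h (hy1 q rfl))
    have h7 : (coD J.p).rTensor 𝒯 (cobS k A g z - Z - cobD k A g (h.rTensor 𝒯 y)) =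
        unitT k A g (projE k A g Y + bT k A (projT k A g y)) := by
      rw [map_sub, map_sub, ← cobD_coD, h6, map_sub, cobD_unitT, h3, h4, map_add]
      abel
    have h8 := congrArg (projT k A g) h7
    rw [projT_coD, projT_unitT] at h8
    refine ⟨cobS k A g z - Z - cobD k A g (h.rTensor 𝒯 y), fun q hq => ?_,
      fun hp => (Nat.succ_ne_zero p hp).elim, by rw [h7, ← h8, map_zero], Y', hY', ?_⟩
    · obtain rfl : p = q := by omega
      exact sub_mem (sub_mem h2 hZ) hθ
    · rw [map_sub, map_sub, cobD_cobD, h1, h5]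
      abel

theorem deg_le_projT {p : ℕ} {z : 𝓩} (hz : z ∈ degK k A g p) : projT k A g z ∈ deg k A p :=
  map_mem_degK (fun u m l hl => by
    rw [projT_tmul]
    exact Submodule.smul_mem _ _ (Submodule.subset_span ⟨l, hl, rfl⟩)) hz

/-- Hochschild cocycles are antisymmetric up to boundaries. -/
theorem exists_antT_add_bT {p : ℕ} {z : 𝒯} (hz : z ∈ deg k A p) (hb : bT k A z = 0) :
    ∃ x : ⋀[k]^p g, ∃ y, (∀ q, p = q + 1 → y ∈ deg k A q) ∧ (p = 0 → y = 0) ∧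
      z = antT J.j p x + bT k A y := by
  obtain ⟨y, hy, hy0, hdy, Y, hY, h⟩ := J.exists_eq_cobD_add (z := unitT k A g z) (tmul_mem_degK _ hz)
    (by
      change (coD J.p).rTensor 𝒯 ((1 : 𝓚) ⊗ₜ z) = 0
      rw [LinearMap.rTensor_tmul, Algebra.TensorProduct.one_def, coD_one J.p_one, zero_tmul])
    (by rw [cobD_unitT, hb, map_zero])
  obtain ⟨x, hx⟩ := J.projE_mem hY
  obtain ⟨h', hh⟩ := J.exists_contraction_tensor (A := A)
  refine ⟨x, projT k A g y, fun q hq => deg_le_projT (hy q hq), fun hp => by rw [hy0 hp, map_zero], ?_⟩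
  have h7 : y = (coD J.p).rTensor 𝒯 (h'.rTensor 𝒯 y) + unitT k A g (projT k A g y) := by
    rw [hh y hdy, sub_add_cancel]
  have h8 := congrArg (projT k A g) h
  rw [projT_unitT, map_add, projT_unitK, hx, h7, map_add, cobD_coD, map_add, projT_coD, cobD_unitT,
    projT_unitT, zero_add] at h8
  exact h8.trans (add_comm _ _)

end Hochschild

end LieFrame

end HopfCyclic

namespace HopfCyclic

universe u v w

namespace LieFrame

section Normalized

open Coalgebra Word

variable {k : Type u} {A : Type v} {g : Type w} [Field k] [CharZero k] [Ring A] [HopfAlgebra k A]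
  [PrimitivelyGenerated k A] [LieRing g] [LieAlgebra k g] (J : LieFrame k g A)

local notation "𝒯" => CocyclicOperators.Tot (CM k A)

variable (k A) in
/-- The normalized cochains of degree `p`. -/
def degN (p : ℕ) : Submodule k 𝒯 :=
  Submodule.span k {X | ∃ l : List A, l.length = p ∧ IsNorm k l ∧ wd k A l = X}

variable (k A) in
/-- The projection of all letters to the augmentation ideal. -/
def normT : Module.End k 𝒯 :=
  DirectSum.toModule k ℕ _ fun n => lof k ℕ (CM k A).X n ∘ₗ
    PiTensorProduct.map fun _ => augProj k A

theorem normT_wd (l : List A) : normT k A (wd k A l) = wd k A (l.map (augProj k A)) := by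
  conv_lhs => rw [← List.ofFn_getElem (xs := l), ← lof_tprod, normT, DirectSum.toModule_lof,
    comp_apply, PiTensorProduct.map_tprod, lof_tprod]
  congr 1
  exact List.ext_getElem (by simp) fun i h1 h2 => by simp

theorem normT_consT (a : A) (X : 𝒯) :
    normT k A (consT k A a X) = consT k A (augProj k A a) (normT k A X) := by
  suffices h : normT k A ∘ₗ consT k A a = consT k A (augProj k A a) ∘ₗ normT k A from
    LinearMap.congr_fun h X
  refine tot_ext fun l => ?_
  rw [comp_apply, comp_apply, normT_wd]
  exact normT_wd (a :: l)

theorem augProj_one : augProj k A 1 = 0 := by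
  rw [augProj, LinearMap.sub_apply, LinearMap.smulRight_apply, Bialgebra.counit_one, one_smul]
  exact sub_self _

theorem normT_cons₂T (a : A) (X : 𝒯) : normT k A (cons₂T k A (comul (R := k) a) X) =
    cons₂T k A (comul (R := k) (augProj k A a)) (normT k A X) -
      consT k A 1 (consT k A (augProj k A a) (normT k A X)) -
        consT k A (augProj k A a) (consT k A 1 (normT k A X)) := by
  set Y := normT k A X
  have h : normT k A ∘ₗ (cons₂T k A).flip X = (cons₂T k A).flip Y -
      (consT k A).flip (consT k A 1 Y) ∘ₗ (TensorProduct.rid k A).toLinearMap ∘ₗ counit.lTensor A -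
      consT k A 1 ∘ₗ (consT k A).flip Y ∘ₗ (TensorProduct.lid k A).toLinearMap ∘ₗ counit.rTensor A +
      (consT k A 1 (consT k A 1 Y) |> LinearMap.toSpanSingleton k 𝒯) ∘ₗ
        LinearMap.mul' k k ∘ₗ TensorProduct.map counit counit := TensorProduct.ext' fun b c => by
    simp only [comp_apply, LinearMap.flip_apply, LinearMap.sub_apply, LinearMap.add_apply,
      cons₂T_tmul, normT_consT, LinearMap.lTensor_tmul, LinearMap.rTensor_tmul, LinearEquiv.coe_coe,
      TensorProduct.lid_tmul, TensorProduct.rid_tmul, map_tmul, LinearMap.mul'_apply,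
      LinearMap.toSpanSingleton_apply]
    simp only [augProj, LinearMap.sub_apply, LinearMap.id_apply, LinearMap.smulRight_apply, map_sub,
      map_smul, LinearMap.smul_apply, mul_smul, smul_sub]
    rw [smul_comm (counit (R := k) b) (counit (R := k) c)]
    abel
  have h2 := LinearMap.congr_fun h (comul (R := k) a)
  have h3 : TensorProduct.map (counit (R := k)) (counit (R := k) (A := A)) (comul (R := k) a) =
      (1 : k) ⊗ₜ counit (R := k) a := by
    have : TensorProduct.map (counit (R := k)) (counit (R := k) (A := A)) =
        (counit (R := k) (A := A)).lTensor k ∘ₗ (counit (R := k) (A := A)).rTensor A := by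
      ext; rfl
    rw [this, comp_apply, rTensor_counit_comul, LinearMap.lTensor_tmul]
  simp only [comp_apply, LinearMap.flip_apply, LinearMap.sub_apply, LinearMap.add_apply,
    LinearEquiv.coe_coe, rTensor_counit_comul, lTensor_counit_comul, TensorProduct.lid_tmul,
    TensorProduct.rid_tmul, one_smul, h3, LinearMap.mul'_apply, one_mul,
    LinearMap.toSpanSingleton_apply] at h2
  rw [h2]
  simp only [augProj, LinearMap.sub_apply, LinearMap.id_apply, LinearMap.smulRight_apply, map_sub,
    map_smul, LinearMap.smul_apply, Bialgebra.comul_one, Algebra.TensorProduct.one_def, cons₂T_tmul]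
  abel

theorem normT_bT (X : 𝒯) : normT k A (bT k A X) = bT k A (normT k A X) := by
  induction X using tot_induction with
  | hnil => rw [bT_nil, map_zero, normT_wd, List.map_nil, bT_nil]
  | hadd X Y hX hY => simp only [map_add, hX, hY]
  | hsmul r X hX => simp only [map_smul, hX]
  | hcons c X hX =>
    rw [normT_consT, bT_consT, bT_consT]
    simp only [map_sub, map_add]
    rw [normT_cons₂T]
    simp only [normT_consT, augProj_one, map_zero, LinearMap.zero_apply, hX]
    abel

theorem normT_of_mem_part {i : ZMod 2} {X : 𝒯} (hX : X ∈ normPart k A i) : normT k A X = X := by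
  refine part_induction (P := fun X => normT k A X = X) (fun l _ hl => ?_) (map_zero _)
    (fun X Y h1 h2 => by rw [map_add, h1, h2]) (fun c X h => by rw [map_smul, h]) hX
  rw [normT_wd]
  congr 1
  refine (List.map_congr_left fun a ha => ?_).trans (List.map_id l)
  rw [augProj, LinearMap.sub_apply, LinearMap.smulRight_apply, hl a ha, zero_smul]
  exact sub_zero _

theorem normT_mem_degN {p : ℕ} {X : 𝒯} (hX : X ∈ deg k A p) : normT k A X ∈ degN k A p := by
  refine (Submodule.span_le (p := (degN k A p).comap (normT k A))).2 ?_ hX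
  rintro _ ⟨l, hl, rfl⟩
  rw [SetLike.mem_coe, Submodule.mem_comap, normT_wd]
  refine Submodule.subset_span ⟨_, by rw [List.length_map, hl], fun a ha => ?_, rfl⟩
  obtain ⟨b, -, rfl⟩ := List.mem_map.1 ha
  exact counit_augProj b

theorem degN_le_deg (p : ℕ) : degN k A p ≤ deg k A p :=
  Submodule.span_mono fun _ ⟨l, h1, _, h2⟩ => ⟨l, h1, h2⟩

theorem degN_le_part {p : ℕ} {i : ZMod 2} (h : (p : ZMod 2) = i) : degN k A p ≤ normPart k A i := by
  refine Submodule.span_le.2 ?_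
  rintro _ ⟨l, rfl, hl, rfl⟩
  exact wd_mem_part hl h

/-- Normalized Hochschild cocycles are antisymmetric up to boundaries of normalized cochains. -/
theorem exists_antT_add_bT_normalized {p : ℕ} {z : 𝒯} (hz : z ∈ degN k A p) (hb : bT k A z = 0) :
    ∃ x : ⋀[k]^p g, ∃ y, (∀ q, p = q + 1 → y ∈ degN k A q) ∧ (p = 0 → y = 0) ∧
      z = antT J.j p x + bT k A y := by
  obtain ⟨x, y, h1, h2, h3⟩ := J.exists_antT_add_bT (degN_le_deg p hz) hb
  refine ⟨x, normT k A y, fun q hq => normT_mem_degN (h1 q hq), fun hp => by rw [h2 hp, map_zero], ?_⟩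
  rw [← normT_of_mem_part (degN_le_part rfl hz), ← normT_bT,
    ← normT_of_mem_part (antT_mem_part J.comul_j x), ← map_add, ← h3]

variable (k) in
/-- The wedge product with an element, on the direct sum of all exterior powers. -/
def lieWedge : g →ₗ[k] LieTot k g →ₗ[k] LieTot k g :=
  LinearMap.flip (DirectSum.toModule k ℕ _ fun n =>
    ((TensorProduct.curry (wedge k g n)).compr₂ (lof k ℕ (fun n => ⋀[k]^n g) (n + 1))).flip)

theorem lieWedge_lof (x : g) {n : ℕ} (v : Fin n → g) :
    lieWedge k x (lof k ℕ (fun n => ⋀[k]^n g) n (exteriorPower.ιMulti k n v)) =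
      lof k ℕ (fun n => ⋀[k]^n g) (n + 1)
        (exteriorPower.ιMulti k (n + 1) (Matrix.vecCons x v)) := by
  rw [lieWedge, LinearMap.flip_apply, DirectSum.toModule_lof, LinearMap.flip_apply,
    LinearMap.compr₂_apply, TensorProduct.curry_apply, wedge, TensorProduct.lift.tmul,
    comp_apply, LinearEquiv.coe_coe, exteriorPower.alternatingMapLinearEquiv_apply_ιMulti]
  rfl

theorem lieWedge_self (x : g) (Y : LieTot k g) : lieWedge k x (lieWedge k x Y) = 0 := by
  refine lieTot_induction (P := fun Y => lieWedge k x (lieWedge k x Y) = 0) (fun n v => ?_)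
    (fun Y Z hY hZ => ?_) (fun c Y hY => ?_) Y
  · rw [lieWedge_lof, lieWedge_lof, (exteriorPower.ιMulti k (n + 2)).map_eq_zero_of_eq
      (Matrix.vecCons x (Matrix.vecCons x v)) (i := 0) (j := 1) rfl (by simp), map_zero]
  · rw [map_add, map_add, hY, hZ, add_zero]
  · rw [map_smul, map_smul, hY, smul_zero]

theorem extProj_consT (p : A →ₗ[k] g) (a : A) (X : 𝒯) :
    extProj p (consT k A a X) = lieWedge k (p a) (extProj p X) := by
  suffices h : extProj p ∘ₗ consT k A a = (lieWedge k (p a) : LieTot k g →ₗ[k] LieTot k g) ∘ₗ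
      extProj p from LinearMap.congr_fun h X
  refine tot_ext (M := LieTot k g) fun l => ?_
  have h (l : List A) : extProj p (wd k A l) = lof k ℕ (fun n => ⋀[k]^n g) l.length
      (exteriorPower.ιMulti k l.length fun i => p l[i]) := by
    conv_lhs => rw [← List.ofFn_getElem (xs := l), ← lof_tprod, extProj, DirectSum.toModule_lof,
      comp_apply, PiTensorProduct.lift.tprod]
    rfl
  rw [comp_apply, comp_apply, h, lieWedge_lof]
  exact (h (a :: l)).trans (congrArg (fun v : Fin (l.length + 1) → g =>
    lof k ℕ (fun n => ⋀[k]^n g) (l.length + 1) (exteriorPower.ιMulti k (l.length + 1) v))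
    (funext fun i => Fin.cases rfl (fun i => rfl) i))

theorem extProj_bT {p : A →ₗ[k] g} (hp : p 1 = 0) (X : 𝒯) : extProj p (bT k A X) = 0 := by
  induction X using tot_induction with
  | hnil => rw [bT_nil, map_zero]
  | hadd X Y hX hY => rw [map_add, map_add, hX, hY, add_zero]
  | hsmul r X hX => rw [map_smul, map_smul, hX, smul_zero]
  | hcons c X hX =>
    have h1 : extProj p (cons₂T k A (comul (R := k) c) X) = 0 := by
      set T : A ⊗[k] A →ₗ[k] LieTot k g := extProj p ∘ₗ (cons₂T k A).flip X
      have h2 : T + T ∘ₗ (Algebra.TensorProduct.comm k A A).toLinearMap = 0 :=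
        TensorProduct.ext' fun a b => by
          change extProj p (consT k A a (consT k A b X)) + extProj p (consT k A b (consT k A a X)) = 0
          simp only [extProj_consT]
          have h3 := lieWedge_self (k := k) (p a + p b) (extProj p X)
          simp only [map_add, LinearMap.add_apply, lieWedge_self] at h3
          rwa [zero_add, add_zero, add_comm] at h3
      have h5 := LinearMap.congr_fun h2 (comul (R := k) c)
      rw [LinearMap.add_apply, comp_apply T, AlgEquiv.toLinearMap_apply, comm_comul] at h5
      rw [← two_smul k] at h5
      exact (smul_eq_zero.1 h5).resolve_left two_ne_zero
    rw [bT_consT]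
    simp only [map_sub, map_add, h1, extProj_consT, hX, hp, map_zero, LinearMap.zero_apply]
    simp

end Normalized

end LieFrame

end HopfCyclic

namespace HopfCyclic

universe u v w

namespace LieFrame

section Periodic

open Coalgebra Word

variable {k : Type u} {A : Type v} {g : Type w} [Field k] [CharZero k] [Ring A] [HopfAlgebra k A]
  [PrimitivelyGenerated k A] [LieRing g] [LieAlgebra k g] (J : LieFrame k g A)

local notation "𝒯" => CocyclicOperators.Tot (CM k A)

theorem lof_mem_deg (n : ℕ) (x : Pow k A n) :
    lof k ℕ (CM k A).X n x ∈ deg k A n := by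
  have hx : x ∈ Submodule.span k (Set.range (PiTensorProduct.tprod k (s := fun _ : Fin n => A))) := by
    rw [PiTensorProduct.span_tprod_eq_top]; trivial
  refine (Submodule.span_le (p := (deg k A n).comap (lof k ℕ (CM k A).X n))).2 ?_ hx
  rintro _ ⟨h, rfl⟩
  exact Submodule.subset_span ⟨List.ofFn h, by simp, (lof_tprod n h).symm⟩

theorem FNT_wd_mem_deg (l : List A) : FNT k A (wd k A l) ∈ deg k A (l.length - 1) := by
  rw [FNT_wd]
  refine cyc_mem _ l fun v hv => ?_
  obtain ⟨x, hx⟩ := exists_lof_fT_wd (k := k) v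
  rw [hx, ← hv.length_eq]
  exact lof_mem_deg _ x

theorem FNT_mem_degN {p : ℕ} {X : 𝒯} (hX : X ∈ degN k A (p + 1)) : FNT k A X ∈ degN k A p := by
  have h1 : FNT k A X ∈ deg k A p := by
    refine (Submodule.span_le (p := (deg k A p).comap (FNT k A))).2 ?_ (degN_le_deg _ hX)
    rintro _ ⟨l, hl, rfl⟩
    have := FNT_wd_mem_deg (k := k) l
    rwa [hl] at this
  rw [← normT_of_mem_part (FNT_mem_part (degN_le_part (i := (p : ZMod 2) + 1) (by push_cast; rfl) hX))]
  exact normT_mem_degN h1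

theorem bT_wd_mem_deg (l : List A) : bT k A (wd k A l) ∈ deg k A (l.length + 1) := by
  have h := add_mem (redB_wd_mem_deg (k := k) l) (Submodule.subset_span ⟨1 :: l, rfl, rfl⟩ :
    consT k A 1 (wd k A l) ∈ deg k A (l.length + 1))
  rwa [redB_apply, sub_add_cancel] at h

variable (k A) in
/-- The projection to the cochains of degree `n`. -/
def degProj (n : ℕ) : Module.End k 𝒯 :=
  lof k ℕ (CM k A).X n ∘ₗ DirectSum.component k ℕ (CM k A).X n

theorem degProj_of_mem {n : ℕ} {X : 𝒯} (hX : X ∈ deg k A n) : degProj k A n X = X := by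
  have h : deg k A n ≤ LinearMap.eqLocus (degProj k A n) LinearMap.id := by
    refine Submodule.span_le.2 ?_
    rintro _ ⟨l, rfl, rfl⟩
    change degProj k A _ _ = wd k A l
    rw [wd_eq_lof, degProj, comp_apply, DirectSum.component.lof_self]
  exact h hX

theorem degProj_of_ne {m n : ℕ} (hmn : m ≠ n) {X : 𝒯} (hX : X ∈ deg k A m) : degProj k A n X = 0 := by
  have h : deg k A m ≤ LinearMap.ker (degProj k A n) := by
    refine Submodule.span_le.2 ?_
    rintro _ ⟨l, rfl, rfl⟩
    rw [SetLike.mem_coe, LinearMap.mem_ker, wd_eq_lof, degProj, comp_apply, DirectSum.component.of,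
      dif_neg hmn, map_zero]
  exact h hX

theorem degProj_antTot (n : ℕ) (x : LieTot k g) : degProj k A n (antTot J.j x) = antT J.j n (x n) := by
  suffices h : degProj k A n ∘ₗ antTot J.j = antT J.j n ∘ₗ DirectSum.component k ℕ (fun n => ⋀[k]^n g) n from
    LinearMap.congr_fun h x
  refine DirectSum.linearMap_ext _ fun m => LinearMap.ext fun y => ?_
  simp only [comp_apply]
  rw [antTot_lof, DirectSum.component.of]
  have hm : antT J.j m y ∈ deg k A m := lof_mem_deg m _
  by_cases h : m = n
  · subst h
    rw [dif_pos rfl, degProj_of_mem hm]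
  · rw [dif_neg h, map_zero, degProj_of_ne h hm]

variable (k A) in
/-- The normalized cochains of parity `i` and of degree less than `N`. -/
def fil (i : ZMod 2) (N : ℕ) : Submodule k 𝒯 :=
  Submodule.span k {X | ∃ l : List A, (l.length : ZMod 2) = i ∧ l.length < N ∧ IsNorm k l ∧ wd k A l = X}

theorem exists_mem_fil {i : ZMod 2} {X : 𝒯} (hX : X ∈ normPart k A i) : ∃ N, X ∈ fil k A i N := by
  have hmono {N N' : ℕ} (h : N ≤ N') : fil k A i N ≤ fil k A i N' :=
    Submodule.span_mono fun _ ⟨l, h1, h2, h3⟩ => ⟨l, h1, h2.trans_le h, h3⟩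
  refine part_induction (P := fun X => ∃ N, X ∈ fil k A i N) (fun l hl hn => ?_) ⟨0, zero_mem _⟩
    (fun X Y hX hY => ?_) (fun c X hX => ?_) hX
  · exact ⟨l.length + 1, Submodule.subset_span ⟨l, hl, Nat.lt_succ_self _, hn, rfl⟩⟩
  · obtain ⟨N, hN⟩ := hX
    obtain ⟨M, hM⟩ := hY
    exact ⟨max N M, add_mem (hmono (le_max_left _ _) hN) (hmono (le_max_right _ _) hM)⟩
  · obtain ⟨N, hN⟩ := hX
    exact ⟨N, Submodule.smul_mem _ _ hN⟩

theorem fil_le_part (i : ZMod 2) (N : ℕ) : fil k A i N ≤ normPart k A i := by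
  refine Submodule.span_le.2 ?_
  rintro _ ⟨l, h1, -, h3, rfl⟩
  exact wd_mem_part h3 h1

theorem degN_le_fil {p N : ℕ} {i : ZMod 2} (h : (p : ZMod 2) = i) (hp : p < N) :
    degN k A p ≤ fil k A i N :=
  Submodule.span_mono fun _ ⟨l, h1, h2, h3⟩ => ⟨l, by rw [h1, h], by rwa [h1], h2, h3⟩

theorem exists_of_mem_fil_succ {i : ZMod 2} {N : ℕ} {z : 𝒯} (hz : z ∈ fil k A i (N + 1)) :
    ∃ x ∈ degN k A N, ∃ y ∈ fil k A i N, z = x + y ∧ ((N : ZMod 2) ≠ i → x = 0) := by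
  by_cases h : (N : ZMod 2) = i
  · have hle : fil k A i (N + 1) ≤ degN k A N ⊔ fil k A i N := by
      refine Submodule.span_le.2 ?_
      rintro _ ⟨l, h1, h2, h3, rfl⟩
      rcases Nat.lt_succ_iff_lt_or_eq.1 h2 with h4 | h4
      · exact Submodule.mem_sup_right (Submodule.subset_span ⟨l, h1, h4, h3, rfl⟩)
      · exact Submodule.mem_sup_left (Submodule.subset_span ⟨l, h4, h3, rfl⟩)
    obtain ⟨x, hx, y, hy, hxy⟩ := Submodule.mem_sup.1 (hle hz)
    exact ⟨x, hx, y, hy, hxy.symm, fun h' => (h' h).elim⟩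
  · have hle : fil k A i (N + 1) ≤ fil k A i N :=
      Submodule.span_mono fun _ ⟨l, h1, h2, h3⟩ => ⟨l, h1, lt_of_le_of_ne (Nat.lt_succ_iff.1 h2)
        (fun h4 => h (by rw [← h4, h1])), h3⟩
    exact ⟨0, zero_mem _, z, hle hz, (zero_add z).symm, fun _ => rfl⟩

theorem degProj_dTot {i : ZMod 2} {N : ℕ} {x y : 𝒯} (hx : x ∈ degN k A N) (hy : y ∈ fil k A i N)
    (hz : x + y ∈ normPart k A i) :
    degProj k A (N + 1) ((CM k A).dTot (x + y)) = bT k A x := by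
  have hb (X : 𝒯) (n : ℕ) (hX : X ∈ deg k A n) : bT k A X ∈ deg k A (n + 1) := by
    refine (Submodule.span_le (p := (deg k A (n + 1)).comap (bT k A))).2 ?_ hX
    rintro _ ⟨l, rfl, rfl⟩
    exact bT_wd_mem_deg l
  have h1 : deg k A N ≤ LinearMap.ker (degProj k A (N + 1) ∘ₗ FNT k A) := by
    refine Submodule.span_le.2 ?_
    rintro _ ⟨l, rfl, rfl⟩
    exact degProj_of_ne (by omega) (FNT_wd_mem_deg l)
  have h2 : fil k A i N ≤ LinearMap.ker (degProj k A (N + 1) ∘ₗ (bT k A + FNT k A)) := by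
    refine Submodule.span_le.2 ?_
    rintro _ ⟨l, -, hl, -, rfl⟩
    rw [SetLike.mem_coe, LinearMap.mem_ker, comp_apply, LinearMap.add_apply, map_add,
      degProj_of_ne (by omega) (FNT_wd_mem_deg l), degProj_of_ne (by omega) (bT_wd_mem_deg l), add_zero]
  have h3 : degProj k A (N + 1) (FNT k A x) = 0 := h1 (degN_le_deg N hx)
  have h4 : degProj k A (N + 1) (bT k A y + FNT k A y) = 0 := h2 hy
  have h5 := degProj_of_mem (hb x N (degN_le_deg N hx))
  rw [dTot_eq_of_mem_part hz, map_add (bT k A), map_add (FNT k A), add_add_add_comm, map_add, map_add, h3, h4, h5,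
    add_zero, add_zero]

/-- The chains of parity `i`. -/
def liePart (k : Type u) (g : Type w) [Field k] [LieRing g] [LieAlgebra k g] (i : ZMod 2) :
    Submodule k (LieTot k g) where
  carrier := {x | ∀ n : ℕ, (n : ZMod 2) ≠ i → x n = 0}
  add_mem' hx hy n hn := by rw [DirectSum.add_apply, hx n hn, hy n hn, add_zero]
  zero_mem' n _ := DirectSum.zero_apply n
  smul_mem' c x hx n hn := by rw [DirectSum.smul_apply, hx n hn, smul_zero]

theorem lof_mem_liePart {i : ZMod 2} {n : ℕ} (hn : (n : ZMod 2) = i) (x : ⋀[k]^n g) :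
    lof k ℕ (fun n => ⋀[k]^n g) n x ∈ liePart k g i := fun m hm => by
  rw [DirectSum.lof_eq_of, DirectSum.of_eq_of_ne]
  rintro rfl
  exact hm hn

/-- Periodic cochains whose boundary is antisymmetric are antisymmetric up to boundaries. -/
theorem exists_antTot_add_dTot {i : ZMod 2} {z : 𝒯} (hz : z ∈ normPart k A i) {w : LieTot k g}
    (hw : (CM k A).dTot z = antTot J.j w) :
    ∃ x ∈ liePart k g i, ∃ y ∈ normPart k A (i + 1), z = antTot J.j x + (CM k A).dTot y := by
  obtain ⟨N, hN⟩ := exists_mem_fil hz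
  clear hz
  induction N generalizing z w with
  | zero =>
    have h : fil k A i 0 = ⊥ := by
      refine Submodule.span_eq_bot.2 ?_
      rintro _ ⟨l, -, h, -⟩
      exact (Nat.not_lt_zero _ h).elim
    rw [h, Submodule.mem_bot] at hN
    exact ⟨0, zero_mem _, 0, zero_mem _, by rw [hN, map_zero, map_zero, add_zero]⟩
  | succ N ih =>
    have hzp := fil_le_part i _ hN
    obtain ⟨x, hx, y, hy, rfl, h0⟩ := exists_of_mem_fil_succ hN
    by_cases hNi : (N : ZMod 2) = i
    swap
    · rw [h0 hNi, zero_add] at hw ⊢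
      exact ih hw hy
    have hbx : bT k A x = 0 := by
      have h1 := congrArg (degProj k A (N + 1)) hw
      rw [degProj_dTot hx hy hzp, J.degProj_antTot] at h1
      have h2 := congrArg (extProj J.p) h1
      rw [extProj_bT J.p_one, ← antTot_lof, extProj_antTot J.p_j] at h2
      rw [h1, ← antTot_lof, ← h2, map_zero]
    obtain ⟨a, c, hc, hc0, rfl⟩ := J.exists_antT_add_bT_normalized hx hbx
    have hcp : c ∈ normPart k A (i + 1) := by
      cases N with
      | zero => rw [hc0 rfl]; exact zero_mem _
      | succ q =>
        refine degN_le_part ?_ (hc q rfl)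
        have h2 : (1 : ZMod 2) + 1 = 0 := by decide
        rw [← hNi, Nat.cast_succ, add_assoc, h2, add_zero]
    have hFc : FNT k A c ∈ fil k A i N := by
      cases N with
      | zero => rw [hc0 rfl, map_zero]; exact zero_mem _
      | succ q =>
        cases q with
        | zero =>
          have : FNT k A c = 0 := by
            have h : degN k A 0 ≤ LinearMap.ker (FNT k A) := by
              refine Submodule.span_le.2 ?_
              rintro _ ⟨l, hl, -, rfl⟩
              obtain rfl := List.length_eq_zero_iff.1 hl
              rw [SetLike.mem_coe, LinearMap.mem_ker, FNT_wd, cyc, mark]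
            exact h (hc 0 rfl)
          rw [this]
          exact zero_mem _
        | succ r =>
          refine degN_le_fil ?_ (by omega) (FNT_mem_degN (hc (r + 1) rfl))
          have h2 : (1 : ZMod 2) + 1 = 0 := by decide
          rw [← hNi, Nat.cast_succ, Nat.cast_succ, add_assoc, h2, add_zero]
    have hdc := dTot_eq_of_mem_part hcp
    obtain ⟨a', ha', c', hc', h⟩ := ih (z := y - FNT k A c)
      (w := w + lieDTot k g (lof k ℕ (fun n => ⋀[k]^n g) N a)) (by
        have h1 : y - FNT k A c = (antT J.j N a + bT k A c + y) -
            antTot J.j (lof k ℕ (fun n => ⋀[k]^n g) N a) - (CM k A).dTot c := by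
          rw [hdc, antTot_lof]; abel
        rw [h1, map_sub, map_sub, hw, dTot_antTot J.comul_j J.j_lie, dTot_dTot hcp, map_add, sub_zero,
          sub_neg_eq_add]) (sub_mem hy hFc)
    refine ⟨_, add_mem (lof_mem_liePart hNi a) ha', _, add_mem hcp hc', ?_⟩
    rw [map_add, map_add, antTot_lof, hdc]
    rw [sub_eq_iff_eq_add] at h
    rw [h]
    abel

end Periodic

end LieFrame

end HopfCyclic

namespace HopfCyclic

universe u v w

section Induced

variable {k : Type u} [Field k]

theorem GradedComplex.exists_induces {ι κ : Type*} [Add ι] [One ι] [Add κ] [One κ]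
    {X : GradedComplex k ι} {Y : GradedComplex k κ} {f : X.V →ₗ[k] Y.V} {i : ι} {j : κ}
    (hc : ∀ x ∈ X.cycles i, f x ∈ Y.cycles j)
    (hb : ∀ x ∈ X.part (i + 1), ∃ y ∈ Y.part (j + 1), f (X.d x) = Y.d y) :
    ∃ φ : X.H i →ₗ[k] Y.H j, GradedComplex.Induces f φ := by
  refine ⟨Submodule.mapQ _ _ (f.restrict hc) ?_, fun z => ⟨hc z z.2, rfl⟩⟩
  rintro ⟨_, hz⟩ ⟨x, hx, rfl⟩
  obtain ⟨y, hy, hxy⟩ := hb x hx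
  exact ⟨y, hy, hxy.symm⟩

/-- The total map to the homology of a supercomplex. -/
def sumMapOf {X : GradedComplex k ℕ} {Y : GradedComplex k (ZMod 2)}
    (α : ∀ n : ℕ, X.H n →ₗ[k] Y.H (n : ZMod 2)) (i : ZMod 2) :
    (⨁ n : {n : ℕ // (n : ZMod 2) = i}, X.H n) →ₗ[k] Y.H i :=
  DirectSum.toModule k _ _ fun n => (Y.congrH n.2).toLinearMap ∘ₗ α n

/-- The map of sums of tensor products of homology groups. -/
def tensorMapOf {X : SignedComplex k ℕ} {Y : SignedComplex k (ZMod 2)}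
    (α : ∀ n : ℕ, X.H n →ₗ[k] Y.H (n : ZMod 2)) (n : ℕ) :
    X.HTensor X.toGradedComplex n →ₗ[k] Y.HTensor Y.toGradedComplex (n : ZMod 2) :=
  DirectSum.toModule k _ _ fun pq =>
    lof k _ (fun ij : {ij : ZMod 2 × ZMod 2 // ij.1 + ij.2 = (n : ZMod 2)} =>
        Y.H ij.1.1 ⊗[k] Y.H ij.1.2)
      ⟨((pq.1.1 : ZMod 2), (pq.1.2 : ZMod 2)), by rw [← Nat.cast_add, pq.2]⟩ ∘ₗ
    TensorProduct.map (α pq.1.1) (α pq.1.2)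

theorem sumMapOf_lof {X : GradedComplex k ℕ} {Y : GradedComplex k (ZMod 2)}
    {α : ∀ n : ℕ, X.H n →ₗ[k] Y.H (n : ZMod 2)} {f : X.V →ₗ[k] Y.V}
    (hα : ∀ n, GradedComplex.Induces f (α n)) {i : ZMod 2} (n : {n : ℕ // (n : ZMod 2) = i})
    (z : X.cycles n) : ∃ h : f z ∈ Y.cycles i, sumMapOf α i (lof k _
      (fun n : {n : ℕ // (n : ZMod 2) = i} => X.H n) n (X.cls n z)) = Y.cls i ⟨f z, h⟩ := by
  obtain ⟨n, rfl⟩ := n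
  obtain ⟨h, h'⟩ := hα n z
  refine ⟨h, ?_⟩
  rw [sumMapOf, DirectSum.toModule_lof]
  exact h'

theorem sumMapOf_bijective {X : GradedComplex k ℕ} {Y : GradedComplex k (ZMod 2)} (hY : Y.IsComplex)
    {π : ℕ → X.V →ₗ[k] X.V} (hπ : ∀ n x, π n x ∈ X.part n)
    (hπ1 : ∀ n, ∀ x ∈ X.part n, π n x = x) (hπ2 : ∀ m n, m ≠ n → ∀ x ∈ X.part m, π n x = 0)
    (hπd : ∀ n x, π n (X.d x) = X.d (π (n + 1) x)) (hd0 : ∀ x ∈ X.part 0, X.d x = 0)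
    (hsum : ∀ x, ∃ s : Finset ℕ, ∑ n ∈ s, π n x = x) {f : X.V →ₗ[k] Y.V} (hf : Function.Injective f)
    (hfp : ∀ n : ℕ, ∀ x ∈ X.part n, f x ∈ Y.part (n : ZMod 2)) (hfd : ∀ x, Y.d (f x) = -f (X.d x))
    (hfs : ∀ i, ∀ z ∈ Y.part i, ∀ w, Y.d z = f w →
      ∃ x, (∀ n : ℕ, (n : ZMod 2) ≠ i → π n x = 0) ∧ ∃ y ∈ Y.part (i + 1), z = f x + Y.d y)
    {α : ∀ n : ℕ, X.H n →ₗ[k] Y.H (n : ZMod 2)} (hα : ∀ n, GradedComplex.Induces f (α n)) (i : ZMod 2) :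
    Function.Bijective (sumMapOf α i) := by
  have hrel {z : Y.V} {i : ZMod 2} (hz : z ∈ Y.part i) {w : X.V} (h : Y.d z = f w) :
      ∃ x, (∀ n : ℕ, (n : ZMod 2) ≠ i → π n x = 0) ∧ w = -X.d x ∧
        ∃ y ∈ Y.part (i + 1), z = f x + Y.d y := by
    obtain ⟨x, hx, y, hy, rfl⟩ := hfs i z hz w h
    rw [map_add, hfd, hY.d_d hy, add_zero, ← map_neg] at h
    exact ⟨x, hx, (hf h).symm, y, hy, rfl⟩
  constructor
  · rw [injective_iff_map_eq_zero]
    intro ξ hξ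
    have hx : ∃ x : X.V, (∀ n : {n : ℕ // (n : ZMod 2) = i}, ∃ z : X.cycles n, z.1 = π n x ∧
        ξ n = X.cls n z) ∧ ∃ z : Y.cycles i, z.1 = f x ∧ sumMapOf α i ξ = Y.cls i z := by
      clear hξ
      induction ξ using DirectSum.induction_on with
      | zero => exact ⟨0, fun n => ⟨0, (map_zero _).symm, (map_zero _).symm⟩, 0, (map_zero _).symm,
          by rw [map_zero, map_zero]⟩
      | add ξ η h1 h2 =>
        obtain ⟨x, hx, z, hz, hz'⟩ := h1
        obtain ⟨y, hy, w, hw, hw'⟩ := h2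
        refine ⟨x + y, fun n => ?_, z + w, by rw [map_add, ← hz, ← hw]; rfl,
          by rw [map_add, map_add, hz', hw']⟩
        obtain ⟨a, ha, ha'⟩ := hx n
        obtain ⟨b, hb, hb'⟩ := hy n
        exact ⟨a + b, by rw [map_add, ← ha, ← hb]; rfl, by rw [DirectSum.add_apply, ha', hb', map_add]⟩
      | of n a =>
        obtain ⟨z, rfl⟩ := Submodule.mkQ_surjective _ a
        refine ⟨z, fun m => ?_, ?_⟩
        · by_cases hmn : m = n
          · subst hmn
            exact ⟨z, (hπ1 _ _ z.2.1).symm, DirectSum.of_eq_same _ _⟩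
          · refine ⟨0, (hπ2 n m (fun h => hmn (Subtype.ext h.symm)) z z.2.1).symm, ?_⟩
            rw [DirectSum.of_eq_of_ne _ _ _ hmn, map_zero]
        · obtain ⟨h, h'⟩ := sumMapOf_lof hα n z
          exact ⟨⟨f z, h⟩, rfl, h'⟩
    obtain ⟨x, hx, z, hz, hz'⟩ := hx
    rw [hz'] at hξ
    obtain ⟨y, hy, hyz⟩ := (Submodule.Quotient.mk_eq_zero _).1 hξ
    obtain ⟨x', -, h, -⟩ := hrel hy (hyz.trans hz)
    refine DFinsupp.ext fun n => ?_
    obtain ⟨a, ha, ha'⟩ := hx n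
    refine ha'.trans ((Submodule.Quotient.mk_eq_zero _).2 ⟨-π (n + 1) x', neg_mem (hπ _ _), ?_⟩)
    rw [map_neg, ← hπd, ← map_neg, ← h, ← ha]
    rfl
  · intro a
    obtain ⟨z, rfl⟩ := Submodule.mkQ_surjective _ a
    have hz : Y.d z = 0 := z.2.2
    obtain ⟨x, hx, hdx, y, hy, h⟩ := hrel z.2.1 (w := 0) (by rw [hz, map_zero])
    have hdn (n : ℕ) : X.d (π n x) = 0 := by
      cases n with
      | zero => exact hd0 _ (hπ 0 x)
      | succ n => rw [← hπd, ← neg_eq_zero, ← map_neg, ← hdx, map_zero]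
    have hm (n : ℕ) : f (π n x) ∈ Y.cycles i := by
      refine ⟨?_, ?_⟩
      · by_cases hn : (n : ZMod 2) = i
        · rw [← hn]; exact hfp n _ (hπ n x)
        · rw [hx n hn, map_zero]; exact zero_mem _
      · rw [SetLike.mem_coe, LinearMap.mem_ker, hfd, hdn, map_zero, neg_zero]
    obtain ⟨s, hs⟩ := hsum x
    have h1 : Y.cls i z = ∑ n ∈ s, Y.cls i ⟨f (π n x), hm n⟩ := by
      rw [← map_sum]
      refine (Submodule.Quotient.eq _).2 ⟨y, hy, ?_⟩
      change Y.d y = z - ((∑ n ∈ s, (⟨f (π n x), hm n⟩ : Y.cycles i) : Y.cycles i) : Y.V)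
      rw [Submodule.coe_sum, ← map_sum, hs, h, add_sub_cancel_left]
    change Y.cls i z ∈ LinearMap.range (sumMapOf α i)
    rw [h1]
    refine sum_mem fun n _ => ?_
    by_cases hn : (n : ZMod 2) = i
    · obtain ⟨h, h'⟩ := sumMapOf_lof hα ⟨n, hn⟩ ⟨π n x, hπ n x, hdn n⟩
      exact ⟨_, h'⟩
    · have h2 : (⟨f (π n x), hm n⟩ : Y.cycles i) = 0 := Subtype.ext ((congrArg f (hx n hn)).trans (map_zero f))
      rw [h2, map_zero]
      exact zero_mem _

variable {X : SignedComplex k ℕ} {Y : SignedComplex k (ZMod 2)} {f : X.V →ₗ[k] Y.V}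

theorem map_map_mem_part (hf : ∀ (n : ℕ), ∀ x ∈ X.part n, f x ∈ Y.part (n : ZMod 2)) (n : ℕ)
    {z : X.V ⊗[k] X.V} (hz : z ∈ (X.tensor X.toGradedComplex).part n) :
    TensorProduct.map f f z ∈ (Y.tensor Y.toGradedComplex).part (n : ZMod 2) := by
  refine SignedComplex.tensor_part_le (N := ((Y.tensor Y.toGradedComplex).part (n : ZMod 2)).comap
    (TensorProduct.map f f)) (fun i j hij x hx y hy => ?_) hz
  exact SignedComplex.tmul_mem_part (by rw [← Nat.cast_add, hij]) (hf i x hx) (hf j y hy)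

theorem tensor_d_map_map (hf : ∀ (n : ℕ), ∀ x ∈ X.part n, f x ∈ Y.part (n : ZMod 2))
    (hd : ∀ x, Y.d (f x) = -f (X.d x)) (hs : ∀ n : ℕ, Y.sgn (n : ZMod 2) = X.sgn n) (n : ℕ)
    {z : X.V ⊗[k] X.V} (hz : z ∈ (X.tensor X.toGradedComplex).part n) :
    (Y.tensor Y.toGradedComplex).d (TensorProduct.map f f z) =
      -TensorProduct.map f f ((X.tensor X.toGradedComplex).d z) := by
  refine SignedComplex.tensor_map_apply
    (f := (Y.tensor Y.toGradedComplex).d ∘ₗ TensorProduct.map f f)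
    (f' := -(TensorProduct.map f f ∘ₗ (X.tensor X.toGradedComplex).d)) (fun i j _ x hx y hy => ?_) hz
  rw [LinearMap.neg_apply, comp_apply, comp_apply, map_tmul,
    SignedComplex.tensor_d_tmul (hf i x hx), SignedComplex.tensor_d_tmul hx, map_add,
    map_tmul, map_tmul, hd, hd, hs, TensorProduct.neg_tmul,
    TensorProduct.tmul_neg, neg_add]
  congr 2
  rcases Int.units_eq_one_or (X.sgn i) with h | h
  · rw [h, one_smul, one_smul]
  · rw [h, Units.neg_smul, Units.neg_smul, one_smul, one_smul, map_neg]

/-- Induced maps of complexes with coproducts, where the coproducts correspond to each other up to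
boundaries. -/
theorem exists_induced_coproducts (hX : X.toGradedComplex.IsComplex) (hY : Y.toGradedComplex.IsComplex)
    (hsX : ∀ i, X.sgn (i + 1) = -X.sgn i) (hsY : ∀ i, Y.sgn (i + 1) = -Y.sgn i)
    (hs : ∀ n : ℕ, Y.sgn (n : ZMod 2) = X.sgn n)
    (hf : ∀ (n : ℕ), ∀ x ∈ X.part n, f x ∈ Y.part (n : ZMod 2)) (hd : ∀ x, Y.d (f x) = -f (X.d x))
    {c : X.V →ₗ[k] X.V ⊗[k] X.V} {c' : Y.V →ₗ[k] Y.V ⊗[k] Y.V}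
    (hc : ∀ n, ∀ x ∈ X.part n, c x ∈ (X.tensor X.toGradedComplex).part n)
    (hcd : ∀ n, ∀ x ∈ X.part n, c (X.d x) = (X.tensor X.toGradedComplex).d (c x))
    (hc' : ∀ n, ∀ x ∈ Y.part n, c' x ∈ (Y.tensor Y.toGradedComplex).part n)
    (hcd' : ∀ n, ∀ x ∈ Y.part n, c' (Y.d x) = (Y.tensor Y.toGradedComplex).d (c' x))
    (hcc : ∀ (n : ℕ), ∀ x ∈ X.part n, ∃ y ∈ (Y.tensor Y.toGradedComplex).part ((n : ZMod 2) + 1),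
      c' (f x) - TensorProduct.map f f (c x) = (Y.tensor Y.toGradedComplex).d y) :
    ∃ (α : ∀ n : ℕ, X.H n →ₗ[k] Y.H (n : ZMod 2))
      (γ : ∀ i, Y.H i →ₗ[k] Y.HTensor Y.toGradedComplex i)
      (δ : ∀ n, X.H n →ₗ[k] X.HTensor X.toGradedComplex n),
      (∀ n, GradedComplex.Induces (X := X.toGradedComplex) (Y := Y.toGradedComplex) f (α n)) ∧
      (∀ i, GradedComplex.Induces (X := Y.toGradedComplex) (Y := Y.tensor Y.toGradedComplex) c'
        (Y.kunneth Y.toGradedComplex i ∘ₗ γ i)) ∧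
      (∀ n, GradedComplex.Induces (X := X.toGradedComplex) (Y := X.tensor X.toGradedComplex) c
        (X.kunneth X.toGradedComplex n ∘ₗ δ n)) ∧
      ∀ n : ℕ, γ (n : ZMod 2) ∘ₗ α n = tensorMapOf α n ∘ₗ δ n := by
  have kX := SignedComplex.kunneth_bijective hX hX hsX
  have kY := SignedComplex.kunneth_bijective hY hY hsY
  have hα (n : ℕ) := GradedComplex.exists_induces (X := X.toGradedComplex) (Y := Y.toGradedComplex)
    (f := f) (i := n) (j := (n : ZMod 2)) (fun x hx => ⟨hf n x hx.1, by
      have h : X.d x = 0 := hx.2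
      rw [SetLike.mem_coe, LinearMap.mem_ker, hd, h, map_zero, neg_zero]⟩)
    (fun x hx => ⟨-f x, neg_mem (by simpa using hf _ x hx), by rw [map_neg, hd, neg_neg]⟩)
  have hγ (i : ZMod 2) := GradedComplex.exists_induces (X := Y.toGradedComplex)
    (Y := Y.tensor Y.toGradedComplex) (f := c') (i := i) (j := i) (fun x hx => ⟨hc' i x hx.1, by
      have h : Y.d x = 0 := hx.2
      rw [SetLike.mem_coe, LinearMap.mem_ker, ← hcd' i x hx.1, h, map_zero]⟩) (fun x hx => ⟨c' x, hc' _ x hx, hcd' _ x hx⟩)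
  have hδ (n : ℕ) := GradedComplex.exists_induces (X := X.toGradedComplex)
    (Y := X.tensor X.toGradedComplex) (f := c) (i := n) (j := n) (fun x hx => ⟨hc n x hx.1, by
      have h : X.d x = 0 := hx.2
      rw [SetLike.mem_coe, LinearMap.mem_ker, ← hcd n x hx.1, h, map_zero]⟩) (fun x hx => ⟨c x, hc _ x hx, hcd _ x hx⟩)
  have hψ (n : ℕ) := GradedComplex.exists_induces (X := X.tensor X.toGradedComplex)
    (Y := Y.tensor Y.toGradedComplex) (f := TensorProduct.map f f) (i := n) (j := (n : ZMod 2))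
    (fun x hx => ⟨map_map_mem_part hf n hx.1, by
      have h : (X.tensor X.toGradedComplex).d x = 0 := hx.2
      rw [SetLike.mem_coe, LinearMap.mem_ker, tensor_d_map_map hf hd hs n hx.1, h, map_zero, neg_zero]⟩)
    (fun x hx => ⟨-TensorProduct.map f f x, neg_mem (by simpa using map_map_mem_part hf _ hx), by
      rw [map_neg, tensor_d_map_map hf hd hs _ hx, neg_neg]⟩)
  choose α hα using hα
  choose γ hγ using hγ
  choose δ hδ using hδ
  choose ψ hψ using hψ
  let eX (n : ℕ) := LinearEquiv.ofBijective (X.kunneth X.toGradedComplex n) (kX n)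
  let eY (i : ZMod 2) := LinearEquiv.ofBijective (Y.kunneth Y.toGradedComplex i) (kY i)
  have heX (n : ℕ) : X.kunneth X.toGradedComplex n ∘ₗ (eX n).symm.toLinearMap ∘ₗ δ n = δ n :=
    LinearMap.ext fun x => (eX n).apply_symm_apply (δ n x)
  have heY (i : ZMod 2) : Y.kunneth Y.toGradedComplex i ∘ₗ (eY i).symm.toLinearMap ∘ₗ γ i = γ i :=
    LinearMap.ext fun x => (eY i).apply_symm_apply (γ i x)
  refine ⟨α, fun i => (eY i).symm.toLinearMap ∘ₗ γ i, fun n => (eX n).symm.toLinearMap ∘ₗ δ n, hα,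
    fun i => by rw [heY]; exact hγ i, fun n => by rw [heX]; exact hδ n, fun n => ?_⟩
  have hk : Y.kunneth Y.toGradedComplex (n : ZMod 2) ∘ₗ tensorMapOf α n =
      ψ n ∘ₗ X.kunneth X.toGradedComplex n := by
    refine DirectSum.linearMap_ext _ fun pq => TensorProduct.ext' fun a b => ?_
    obtain ⟨x, rfl⟩ := Submodule.mkQ_surjective _ a
    obtain ⟨y, rfl⟩ := Submodule.mkQ_surjective _ b
    obtain ⟨hx, hx'⟩ := hα pq.1.1 x
    obtain ⟨hy, hy'⟩ := hα pq.1.2 y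
    simp only [comp_apply]
    have h1 := SignedComplex.kunneth_lof (X := X) (Y := X.toGradedComplex) pq x y
    obtain ⟨h, h2⟩ := hψ n ⟨x.1 ⊗ₜ y.1, SignedComplex.tmul_mem_cycles pq.2 x.2 y.2⟩
    refine Eq.trans ?_ ((congrArg (ψ n) h1).trans h2).symm
    rw [tensorMapOf, DirectSum.toModule_lof, comp_apply, map_tmul]
    rw [show α pq.1.1 (Submodule.mkQ _ x) = _ from hx', show α pq.1.2 (Submodule.mkQ _ y) = _ from hy']
    exact SignedComplex.kunneth_lof (X := Y) (Y := Y.toGradedComplex)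
      ⟨((pq.1.1 : ZMod 2), (pq.1.2 : ZMod 2)), by rw [← Nat.cast_add, pq.2]⟩ ⟨f x, hx⟩ ⟨f y, hy⟩
  refine LinearMap.ext fun a => (kY (n : ZMod 2)).1 ?_
  have h1 := LinearMap.congr_fun (heY (n : ZMod 2)) (α n a)
  have h2 := LinearMap.congr_fun hk ((eX n).symm (δ n a))
  have h3 := LinearMap.congr_fun (heX n) a
  simp only [comp_apply, LinearEquiv.coe_coe] at h1 h2 h3 ⊢
  rw [h1, h2, h3]
  obtain ⟨z, rfl⟩ := Submodule.mkQ_surjective _ a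
  obtain ⟨hz1, hz2⟩ := hα n z
  obtain ⟨hz3, hz4⟩ := hδ n z
  obtain ⟨hz5, hz6⟩ := hγ (n : ZMod 2) ⟨f z, hz1⟩
  obtain ⟨hz7, hz8⟩ := hψ n ⟨c z, hz3⟩
  rw [show α n (Submodule.mkQ _ z) = _ from hz2, hz6, show δ n (Submodule.mkQ _ z) = _ from hz4, hz8]
  obtain ⟨y, hy, hy'⟩ := hcc n z z.2.1
  exact (Submodule.Quotient.eq _).2 ⟨y, hy, hy'.symm⟩

end Induced

end HopfCyclic

namespace HopfCyclic

universe u v w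

section Complexes

variable {k : Type u} [Field k]

theorem glue_normPart {A : Type v} [Ring A] [HopfAlgebra k A] {W : Type*} [AddCommGroup W] [Module k W]
    (f : ∀ i, normPart k A i →ₗ[k] W) : ∃ F : CocyclicOperators.Tot (CM k A) →ₗ[k] W,
      ∀ i (x : normPart k A i), F x = f i x := by
  have hm (n : ℕ) (x : (CM k A).normalized n) :
      lof k ℕ (CM k A).X n x ∈ normPart k A (n : ZMod 2) :=
    Submodule.mem_iSup_of_mem n (Submodule.mem_iSup_of_mem rfl (Submodule.mem_map_of_mem x.2))
  choose e he using fun n : ℕ => LinearMap.exists_extend (p := (CM k A).normalized n)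
    (f (n : ZMod 2) ∘ₗ LinearMap.codRestrict _
      (lof k ℕ (CM k A).X n ∘ₗ Submodule.subtype _) (hm n))
  refine ⟨DirectSum.toModule k ℕ _ e, fun i => ?_⟩
  rintro ⟨x, hx⟩
  change x ∈ (⨆ (n : ℕ) (_ : (n : ZMod 2) = i), ((CM k A).normalized n).map
    (lof k ℕ (CM k A).X n) :
      Submodule k (CocyclicOperators.Tot (CM k A))) at hx
  induction hx using Submodule.iSup_induction' with
  | zero => exact (map_zero _).trans (map_zero (f i)).symm
  | add x y hx hy hx' hy' =>
    exact (map_add _ x y).trans ((congrArg₂ _ hx' hy').trans (map_add (f i) ⟨x, hx⟩ ⟨y, hy⟩).symm)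
  | mem n x hx =>
    have hx' := hx
    by_cases h : (n : ZMod 2) = i
    · subst h
      rw [iSup_pos rfl] at hx'
      obtain ⟨y, hy, rfl⟩ := hx'
      exact (DirectSum.toModule_lof k n y).trans (LinearMap.congr_fun (he n) ⟨y, hy⟩)
    · rw [iSup_neg h, Submodule.mem_bot] at hx'
      subst hx'
      exact (map_zero _).trans (map_zero (f i)).symm

theorem glue_range_lof {M : ℕ → Type*} [∀ n, AddCommGroup (M n)] [∀ n, Module k (M n)]
    {W : Type*} [AddCommGroup W] [Module k W]
    (f : ∀ n, LinearMap.range (lof k ℕ M n) →ₗ[k] W) :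
    ∃ F : (⨁ n, M n) →ₗ[k] W, ∀ n (x : LinearMap.range (lof k ℕ M n)), F x = f n x := by
  refine ⟨DirectSum.toModule k ℕ W fun n => f n ∘ₗ LinearMap.rangeRestrict _, ?_⟩
  rintro n ⟨_, x, rfl⟩
  exact DirectSum.toModule_lof k n x

theorem isComplex_periodic {A : Type v} [CharZero k] [Ring A] [HopfAlgebra k A]
    [PrimitivelyGenerated k A] : (CM k A).periodic.toGradedComplex.IsComplex where
  glue f := glue_normPart f
  d_mem hx := dTot_mem_part hx
  d_d {i x} hx := dTot_dTot (i := i - 1) (by rwa [sub_add_cancel])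
  eq_succ_or i := Or.inl ⟨i - 1, (sub_add_cancel i 1).symm⟩

variable {g : Type w} [LieRing g] [LieAlgebra k g]

theorem lieDTot_lof_succ (n : ℕ) (x : ⋀[k]^(n + 1) g) :
    lieDTot k g (lof k ℕ (fun n => ⋀[k]^n g) (n + 1) x) =
      lof k ℕ (fun n => ⋀[k]^n g) n (lieD k g n x) := by
  rw [lieDTot, DirectSum.toModule_lof]; rfl

theorem lieDTot_lof_zero (x : ⋀[k]^0 g) :
    lieDTot k g (lof k ℕ (fun n => ⋀[k]^n g) 0 x) = 0 := by
  rw [lieDTot, DirectSum.toModule_lof]; rfl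

theorem lieDTot_apply (x : LieTot k g) (n : ℕ) : lieDTot k g x n = lieD k g n (x (n + 1)) := by
  suffices h : DirectSum.component k ℕ (fun n => ⋀[k]^n g) n ∘ₗ lieDTot k g =
      lieD k g n ∘ₗ DirectSum.component k ℕ (fun n => ⋀[k]^n g) (n + 1) from LinearMap.congr_fun h x
  refine DirectSum.linearMap_ext _ fun m => LinearMap.ext fun y => ?_
  simp only [comp_apply]
  cases m with
  | zero =>
    rw [lieDTot_lof_zero, map_zero, DirectSum.component.of, dif_neg (by omega), map_zero]
  | succ m =>
    rw [lieDTot_lof_succ, DirectSum.component.of, DirectSum.component.of]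
    by_cases h : m = n
    · subst h
      rw [dif_pos rfl, dif_pos rfl]
    · rw [dif_neg h, dif_neg (by omega), map_zero]

theorem cupLie_mem_part (n : ℕ) {x : LieTot k g}
    (hx : x ∈ LinearMap.range (lof k ℕ (fun n => ⋀[k]^n g) n)) :
    cupLie k g x ∈ ((lieComplex k g).tensor (lieComplex k g).toGradedComplex).part n := by
  obtain ⟨y, rfl⟩ := hx
  rw [cupLie, DirectSum.toModule_lof, LinearMap.sum_apply]
  refine sum_mem fun pq _ => ?_
  rw [comp_apply]
  induction cupLieComponent k g (Finset.HasAntidiagonal.mem_antidiagonal.1 pq.2) y using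
    TensorProduct.induction_on with
  | zero => rw [map_zero]; exact zero_mem _
  | add a b ha hb => rw [map_add]; exact add_mem ha hb
  | tmul a b =>
    exact SignedComplex.tmul_mem_part (Finset.HasAntidiagonal.mem_antidiagonal.1 pq.2) ⟨a, rfl⟩ ⟨b, rfl⟩

theorem sgn_periodic_succ {A : Type v} [Ring A] [HopfAlgebra k A] (i : ZMod 2) : (CM k A).periodic.sgn (i + 1) =
    -(CM k A).periodic.sgn i := by
  change (-1 : ℤˣ) ^ (i + 1).val = -(-1) ^ i.val
  revert i
  decide

theorem sgn_lieComplex_succ (n : ℕ) :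
    (lieComplex k g).sgn (n + 1) = -(lieComplex k g).sgn n := by
  change (-1 : ℤˣ) ^ (n + 1) = -(-1) ^ n
  rw [pow_succ, mul_neg, mul_one]

variable (k g) in
/-- The projection to the exterior power of degree `n`. -/
def lieProj (n : ℕ) : LieTot k g →ₗ[k] LieTot k g :=
  lof k ℕ (fun n => ⋀[k]^n g) n ∘ₗ DirectSum.component k ℕ (fun n => ⋀[k]^n g) n

theorem lieProj_apply (n : ℕ) (x : LieTot k g) :
    lieProj k g n x = lof k ℕ (fun n => ⋀[k]^n g) n (x n) := rfl

theorem lieProj_mem_range (n : ℕ) (x : LieTot k g) :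
    lieProj k g n x ∈ LinearMap.range (lof k ℕ (fun n => ⋀[k]^n g) n) :=
  ⟨x n, rfl⟩

theorem lieProj_lof_self (n : ℕ) (x : ⋀[k]^n g) :
    lieProj k g n (lof k ℕ (fun n => ⋀[k]^n g) n x) =
      lof k ℕ (fun n => ⋀[k]^n g) n x := by
  rw [lieProj, comp_apply, DirectSum.component.lof_self]

theorem lieProj_lof_of_ne {m n : ℕ} (h : m ≠ n) (x : ⋀[k]^m g) :
    lieProj k g n (lof k ℕ (fun n => ⋀[k]^n g) m x) = 0 := by
  rw [lieProj, comp_apply, DirectSum.component.of, dif_neg h, map_zero]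

theorem lieProj_lieDTot (n : ℕ) (x : LieTot k g) :
    lieProj k g n (lieDTot k g x) = lieDTot k g (lieProj k g (n + 1) x) := by
  rw [lieProj_apply, lieProj_apply, lieDTot_apply, lieDTot_lof_succ]

namespace LieFrame

variable {A : Type v} [CharZero k] [Ring A] [HopfAlgebra k A] [PrimitivelyGenerated k A]
  (J : LieFrame k g A)

include J

theorem isComplex_lieComplex : (lieComplex k g).toGradedComplex.IsComplex where
  glue f := glue_range_lof f
  d_mem {n x} hx := by
    obtain ⟨x, rfl⟩ := hx
    exact ⟨lieD k g n x, (lieDTot_lof_succ n x).symm⟩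
  d_d {n x} _ := lieDTot_lieDTot J.comul_j J.j_lie J.p_j x
  eq_succ_or n := by
    cases n with
    | zero =>
      refine Or.inr ?_
      rintro _ ⟨x, rfl⟩
      exact lieDTot_lof_zero x
    | succ n => exact Or.inl ⟨n, rfl⟩

theorem antTot_injective {x y : LieTot k g} (h : antTot J.j x = antTot J.j y) : x = y := by
  rw [← extProj_antTot J.p_j x, h, extProj_antTot J.p_j]

theorem antTot_mem_normPart (n : ℕ) {x : LieTot k g}
    (hx : x ∈ LinearMap.range (lof k ℕ (fun n => ⋀[k]^n g) n)) :
    antTot J.j x ∈ normPart k A (n : ZMod 2) := by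
  obtain ⟨y, rfl⟩ := hx
  rw [antTot_lof]
  exact antT_mem_part J.comul_j y

/-- Lie algebra homology is the periodic cyclic cohomology. -/
theorem sumMapOf_antTot_bijective
    {α : ∀ n : ℕ, LieH k g n →ₗ[k] (CM k A).HP (n : ZMod 2)}
    (hα : ∀ n : ℕ, GradedComplex.Induces (X := (lieComplex k g).toGradedComplex)
      (Y := (CM k A).periodic.toGradedComplex) (antTot J.j) (α n)) (i : ZMod 2) :
    Function.Bijective (sumMapOf α i) := by
  refine sumMapOf_bijective (X := (lieComplex k g).toGradedComplex)
    (isComplex_periodic (k := k) (A := A)) (π := lieProj k g)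
    lieProj_mem_range ?_ ?_ (fun n x => ?_) ?_ ?_ (f := antTot J.j)
    (fun x y h => J.antTot_injective h) (fun n x hx => J.antTot_mem_normPart n hx)
    (dTot_antTot J.comul_j J.j_lie) (fun i z hz w hw => ?_) hα i
  · rintro n _ ⟨x, rfl⟩
    exact lieProj_lof_self n x
  · rintro m n hmn _ ⟨x, rfl⟩
    exact lieProj_lof_of_ne hmn x
  · exact lieProj_lieDTot n x
  · rintro _ ⟨x, rfl⟩
    exact lieDTot_lof_zero x
  · intro x
    classical
    exact ⟨DFinsupp.support x, DirectSum.sum_support_of x⟩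
  · obtain ⟨x, hx, y, hy, h⟩ := J.exists_antTot_add_dTot hz hw
    exact ⟨x, fun n hn =>
      (congrArg (lof k ℕ (fun n => ⋀[k]^n g) n) (hx n hn)).trans (map_zero _), y, hy, h⟩

theorem exists_coproducts :
    ∃ (α : ∀ n : ℕ, LieH k g n →ₗ[k] (CM k A).HP (n : ZMod 2))
      (γ : ∀ i, (CM k A).HP i →ₗ[k]
        (CM k A).periodic.HTensor (CM k A).periodic.toGradedComplex i)
      (δ : ∀ n, LieH k g n →ₗ[k] (lieComplex k g).HTensor (lieComplex k g).toGradedComplex n),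
      (∀ n, GradedComplex.Induces (X := (lieComplex k g).toGradedComplex)
        (Y := (CM k A).periodic.toGradedComplex) (antTot J.j) (α n)) ∧
      (∀ i, GradedComplex.Induces (X := (CM k A).periodic.toGradedComplex)
        (Y := (CM k A).periodic.tensor (CM k A).periodic.toGradedComplex)
        (cup' k A) ((CM k A).periodic.kunneth
          (CM k A).periodic.toGradedComplex i ∘ₗ γ i)) ∧
      (∀ n, GradedComplex.Induces (X := (lieComplex k g).toGradedComplex)
        (Y := (lieComplex k g).tensor (lieComplex k g).toGradedComplex) (cupLie k g)
        ((lieComplex k g).kunneth (lieComplex k g).toGradedComplex n ∘ₗ δ n)) ∧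
      ∀ n : ℕ, γ (n : ZMod 2) ∘ₗ α n = tensorMapOf α n ∘ₗ δ n := by
  refine exists_induced_coproducts (X := lieComplex k g) (Y := (CM k A).periodic)
    (f := antTot J.j) J.isComplex_lieComplex
    (isComplex_periodic (k := k) (A := A)) sgn_lieComplex_succ sgn_periodic_succ (fun n => ?_)
    (fun n x hx => J.antTot_mem_normPart n hx) (dTot_antTot J.comul_j J.j_lie)
    (fun n x hx => cupLie_mem_part n hx)
    (fun n x _ => cupLie_lieDTot J.comul_j J.j_lie J.p_j x) (fun n x hx => cup'_mem_part hx)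
    (fun n x hx => cup'_dTot hx) ?_
  · change (-1 : ℤˣ) ^ (n : ZMod 2).val = (-1) ^ n
    rw [ZMod.val_natCast, ← Int.units_pow_eq_pow_mod_two]
  · rintro n _ ⟨x, rfl⟩
    exact cup'_antTot_sub J.comul_j J.j_lie J.p_j n x

end LieFrame

end Complexes

end HopfCyclic

namespace HopfCyclic

universe u v

variable (k : Type u) [Field k] [CharZero k] (g : Type v) [LieRing g] [LieAlgebra k g]

theorem exists_cup'_antisymTot_sub_eq (n : ℕ) (x : ⋀[k]^n g) :
    ∃ y ∈ ((CU k g).periodic.tensor (CU k g).periodic.toGradedComplex).part ((n : ZMod 2) + 1),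
      cup' k (UniversalEnvelopingAlgebra k g)
          (antisymTot k g (lof k ℕ (fun n => ⋀[k]^n g) n x)) -
        TensorProduct.map (antisymTot k g) (antisymTot k g)
          (cupLie k g (lof k ℕ (fun n => ⋀[k]^n g) n x)) =
      ((CU k g).periodic.tensor (CU k g).periodic.toGradedComplex).d y :=
  -- the order of the universes is that of the definition of `CU`
  cup'_antTot_sub.{u, max v u, v} (A := UniversalEnvelopingAlgebra k g) (lieFrame k g).comul_j
    (lieFrame k g).j_lie (lieFrame k g).p_j n x

theorem exists_coproducts_antisymTot :
    ∃ (α : ∀ n : ℕ, LieH k g n →ₗ[k] (CU k g).HP (n : ZMod 2))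
      (coprodHP : ∀ i : ZMod 2, (CU k g).HP i →ₗ[k]
        (CU k g).periodic.HTensor (CU k g).periodic.toGradedComplex i)
      (coprodLie : ∀ n : ℕ, LieH k g n →ₗ[k]
        (lieComplex k g).HTensor (lieComplex k g).toGradedComplex n),
      (∀ n : ℕ, GradedComplex.Induces (X := (lieComplex k g).toGradedComplex)
        (Y := (CU k g).periodic.toGradedComplex) (antisymTot k g) (α n)) ∧
      (∀ i : ZMod 2, Function.Bijective (sumMap α i)) ∧
      (∀ i : ZMod 2, GradedComplex.Induces (X := (CU k g).periodic.toGradedComplex)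
        (Y := (CU k g).periodic.tensor (CU k g).periodic.toGradedComplex)
        (cup' k (UniversalEnvelopingAlgebra k g))
        ((CU k g).periodic.kunneth (CU k g).periodic.toGradedComplex i ∘ₗ coprodHP i)) ∧
      (∀ n : ℕ, GradedComplex.Induces (X := (lieComplex k g).toGradedComplex)
        (Y := (lieComplex k g).tensor (lieComplex k g).toGradedComplex)
        (cupLie k g)
        ((lieComplex k g).kunneth (lieComplex k g).toGradedComplex n ∘ₗ coprodLie n)) ∧
      ∀ n : ℕ, coprodHP (n : ZMod 2) ∘ₗ α n = tensorMap α n ∘ₗ coprodLie n := by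
  obtain ⟨α, γ, δ, hα, hγ, hδ, h⟩ := LieFrame.exists_coproducts.{u, max v u, v} (lieFrame k g)
  exact ⟨α, γ, δ, hα, LieFrame.sumMapOf_antTot_bijective.{u, max v u, v} (lieFrame k g) hα, hγ, hδ, h⟩

end HopfCyclic

end

theorem mainTheorem4 (k : Type*) [Field k] [CharZero k]
    (g : Type*) [LieRing g] [LieAlgebra k g] :
    -- the two Künneth maps are isomorphisms
    (∀ i : ZMod 2, Function.Bijective
      ((CU k g).periodic.kunneth (CU k g).periodic.toGradedComplex i)) ∧
    (∀ n : ℕ, Function.Bijective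
      ((lieComplex k g).kunneth (lieComplex k g).toGradedComplex n)) ∧
    (∃ (α : ∀ n : ℕ, LieH k g n →ₗ[k] (CU k g).HP (n : ZMod 2))
      (coprodHP : ∀ i : ZMod 2, (CU k g).HP i →ₗ[k]
        (CU k g).periodic.HTensor (CU k g).periodic.toGradedComplex i)
      (coprodLie : ∀ n : ℕ, LieH k g n →ₗ[k]
        (lieComplex k g).HTensor (lieComplex k g).toGradedComplex n),
      -- antisymmetrization induces `α`, which is an isomorphism `⨁_{n ≡ i} H_n(g, k) ≅ HP^i`
      (∀ n : ℕ, GradedComplex.Induces (X := (lieComplex k g).toGradedComplex)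
        (Y := (CU k g).periodic.toGradedComplex) (antisymTot k g) (α n)) ∧
      (∀ i : ZMod 2, Function.Bijective (sumMap α i)) ∧
      -- the coproducts are induced by the maps of complexes, through the Künneth isomorphisms
      (∀ i : ZMod 2, GradedComplex.Induces (X := (CU k g).periodic.toGradedComplex)
        (Y := (CU k g).periodic.tensor (CU k g).periodic.toGradedComplex)
        (cup' k (UniversalEnvelopingAlgebra k g))
        ((CU k g).periodic.kunneth (CU k g).periodic.toGradedComplex i ∘ₗ coprodHP i)) ∧
      (∀ n : ℕ, GradedComplex.Induces (X := (lieComplex k g).toGradedComplex)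
        (Y := (lieComplex k g).tensor (lieComplex k g).toGradedComplex)
        (cupLie k g)
        ((lieComplex k g).kunneth (lieComplex k g).toGradedComplex n ∘ₗ coprodLie n)) ∧
      -- under `α`, the two coproducts coincide
      (∀ n : ℕ, coprodHP (n : ZMod 2) ∘ₗ α n = tensorMap α n ∘ₗ coprodLie n)) ∧
    -- the square of complexes commutes up to boundaries
    (∀ (n : ℕ) (x : ⋀[k]^n g),
      ∃ y ∈ ((CU k g).periodic.tensor (CU k g).periodic.toGradedComplex).part ((n : ZMod 2) + 1),
        cup' k (UniversalEnvelopingAlgebra k g)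
            (antisymTot k g (DirectSum.lof k ℕ (fun n => ⋀[k]^n g) n x)) -
          TensorProduct.map (antisymTot k g) (antisymTot k g)
            (cupLie k g (DirectSum.lof k ℕ (fun n => ⋀[k]^n g) n x)) =
        ((CU k g).periodic.tensor (CU k g).periodic.toGradedComplex).d y) := by
  have hX := (lieFrame k g).isComplex_lieComplex
  have hY := isComplex_periodic (k := k) (A := UniversalEnvelopingAlgebra k g)
  exact ⟨SignedComplex.kunneth_bijective hY hY sgn_periodic_succ,
    SignedComplex.kunneth_bijective hX hX sgn_lieComplex_succ,
    exists_coproducts_antisymTot k g, exists_cup'_antisymTot_sub_eq k g⟩
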